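/- A marked surface $(\mathcal S,\mathcal M)$ is a compact oriented surface $\mathcal S$ (not necessarily connected, every component having non-empty boundary) with a finite set $\mathcal M=\mathcal M_\circ\cup\mathcal M_\bullet\cup\mathcal P_\circ$ of marked points: $\mathcal M_\circ,\mathcal M_\bullet\subset\partial\mathcal S$ are disjoint, every boundary component carries at least one point of each colour and the colours alternate along it, and the points of $\mathcal P_\circ$ (punctures, also of colour $\circ$) lie in the interior. A $\circ$-arc (resp. $\bullet$-arc) is a non-contractible curve with end points in $\mathcal M_\circ\cup\mathcal P_\circ$ (resp. $\mathcal M_\bullet$); it is simple if it has no interior self-intersection. Curves are considered up to homotopy relative to their end points in the complement of the punctures, and intersections are transversal. A simple coordinate $\Delta^*$ is a collection of simple $\bullet$-arcs without interior intersections which cut $\mathcal S$ into polygons (discs), each containing exactly one $\circ$-point; these are the polygons of $\Delta^*$. An oriented intersection from $\ell$ to $\ell'$ ($\ell,\ell'\in\Delta^*$) is an anti-clockwise angle from $\ell$ to $\ell'$ inside the surface at a common end point (the two ends of a loop being regarded as different); it is minimal if it is not a composition of two oriented intersections of arcs of $\Delta^*$. The quiver $Q(\Delta^*)$ has the arcs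 of $\Delta^*$ as vertices and the minimal oriented intersections as arrows. The rank of $(\mathcal S,\mathcal M)$ is $|\mathcal M_\circ|-\chi$, where $\chi=\chi(\mathcal S)-|\mathcal P_\circ|$. A simple $\circ$-arc $\gamma$ is zigzag with respect to $\Delta^*$ if it crosses $\Delta^*$ at least once and each segment of $\gamma$ between two successive crossings with $\Delta^*$ cuts off a corner of the polygon in which it lies: one of the two parts into which it divides this polygon contains exactly one corner ($\bullet$-point) of the polygon and not its $\circ$-point. Let $(\mathcal S,\mathcal M)$ be a marked surface with a simple coordinate $\Delta^*$, and let $\gamma$ be a simple zigzag $\circ$-arc. Let $\mathcal S_\gamma$ be the surface obtained by cutting $\mathcal S$ along $\gamma$, so that $\gamma$ becomes two boundary segments $\gamma',\gamma''$. Let $\mathcal M_\gamma$ consist of the points over $\mathcal M$, with their colours (the end points of $\gamma$ being replaced by their copies, which are $\circ$-points), together with one new $\bullet$-point $q'$ in the interior of $\gamma'$ and one new $\bullet$-point $q''$ in the interior of $\gamma''$. The crossings with $\gamma$ divide each $\ell\in\Delta^*$ into segments; from each segment one obtains a $\bullet$-arc on $\mathcal S_\gamma$ by sliding those of its end points which lie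 on $\gamma'$ (resp. $\gamma''$) along $\gamma'$ (resp. $\gamma''$) to $q'$ (resp. $q''$). Let $\Delta^*_\gamma$ be the set of all these arcs up to homotopy (an arc of $\Delta^*$ that does not meet $\gamma$ is kept). Then: (1) $(\mathcal S_\gamma,\mathcal M_\gamma)$ is a marked surface and $\Delta^*_\gamma$ is a simple coordinate on it. (2) There is a bijection $\mathbf a\mapsto\widehat{\mathbf a}$ from the set of minimal oriented intersections of $\Delta^*$ to that of $\Delta^*_\gamma$ such that the source and the target of $\widehat{\mathbf a}$ arise from segments of the source and of the target of $\mathbf a$, respectively, and the polygon of $\Delta^*_\gamma$ containing $\widehat{\mathbf a}$ is induced by the polygon of $\Delta^*$ containing $\mathbf a$, that is, the $\circ$-point of the former lies over the $\circ$-point of the latter. (3) The rank of $(\mathcal S_\gamma,\mathcal M_\gamma)$ is the rank of $(\mathcal S,\mathcal M)$ plus one; moreover $|Q(\Delta^*_\gamma)_0|=|Q(\Delta^*)_0|+1$ and $|Q(\Delta^*_\gamma)_1|=|Q(\Delta^*)_1|$. -/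

import Mathlib

/-!
Compact oriented surfaces are presented as finite families of polygons whose sides are glued in
pairs. Marked points are vertices of the presentation, arcs are edge paths, and curves are considered
up to homotopy relative to their endpoints in the complement of the punctures.
-/

theorem exists_return {D : Type*} [Finite D] (f : Equiv.Perm D) (A : Set D) (x : A) :
    ∃ n : ℕ, (f ^ (n + 1)) (x : D) ∈ A :=
  ⟨orderOf f - 1, by
    rw [Nat.sub_add_cancel (orderOf_pos f), pow_orderOf_eq_one]; exact x.2⟩

open Classical in
/-- The first of the points `f x, f (f x), …` that lies in `A` again. -/
noncomputable def returnMap {D : Type*} [Finite D] (f : Equiv.Perm D) (A : Set D) (x : A) : A :=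
  ⟨(f ^ (Nat.find (exists_return f A x) + 1)) (x : D), Nat.find_spec (exists_return f A x)⟩

theorem returnMap_injective {D : Type*} [Finite D] (f : Equiv.Perm D) (A : Set D) :
    Function.Injective (returnMap f A) := by
  classical
  have key : ∀ x y : A, Nat.find (exists_return f A x) ≤ Nat.find (exists_return f A y) →
      returnMap f A x = returnMap f A y → x = y := by
    intro x y hle h
    have h' : (f ^ (Nat.find (exists_return f A x) + 1)) (x : D) =
        (f ^ (Nat.find (exists_return f A y) + 1)) (y : D) := by
      have := congrArg Subtype.val h
      simpa only [returnMap] using this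
    obtain ⟨k, hk⟩ := Nat.exists_eq_add_of_le hle
    have h2 : (x : D) = (f ^ k) (y : D) := by
      have e : Nat.find (exists_return f A y) + 1 =
          (Nat.find (exists_return f A x) + 1) + k := by omega
      apply (f ^ (Nat.find (exists_return f A x) + 1)).injective
      rw [h', e, pow_add, Equiv.Perm.mul_apply]
    cases k with
    | zero => exact Subtype.ext (by simpa using h2)
    | succ k => exact absurd (h2 ▸ x.2) (Nat.find_min (exists_return f A y) (m := k) (by omega))
  intro x y h
  rcases le_total (Nat.find (exists_return f A x)) (Nat.find (exists_return f A y)) with hle | hle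
  · exact key x y hle h
  · exact (key y x hle h.symm).symm

/-- The permutation which `f` induces on a subset `A` of a finite type. -/
noncomputable def firstReturn {D : Type*} [Finite D] (f : Equiv.Perm D) (A : Set D) :
    Equiv.Perm A :=
  Equiv.ofBijective (returnMap f A) (Finite.injective_iff_bijective.1 (returnMap_injective f A))

/-- A compact oriented surface glued from polygons. `D` is the set of all sides of the polygons.
Every side is directed so that its polygon lies on its left, `next d` is the side that follows `d`
on its polygon, and the side `d` is glued to the side `opp d`, reversing the direction. A side with
`opp d = d` is not glued to anything and lies on the boundary of the surface. -/
structure CellSurface (D : Type*) where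
  next : Equiv.Perm D
  opp : D → D
  opp_opp : ∀ d, opp (opp d) = d

namespace CellSurface

variable {D : Type*} (S : CellSurface D)

/-- A side `d` also names the corner of its polygon at the starting point of `d`. The corner which
follows `c` anti-clockwise around the same point of the surface is the one at the starting point
of `opp (next⁻¹ c)`, provided that the side `next⁻¹ c` is not on the boundary. -/
def Rot (c c' : D) : Prop :=
  S.opp (S.next.symm c) ≠ S.next.symm c ∧ c' = S.opp (S.next.symm c)

/-- The vertices of the surface: corners up to rotation. -/
def Vertex : Type _ := Quotient (Relation.EqvGen.setoid S.Rot)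

/-- The edges of the surface: sides up to gluing. -/
def Edge : Type _ := Quotient (Relation.EqvGen.setoid fun d d' : D => d' = S.opp d)

/-- The polygons out of which the surface is glued. -/
def Face : Type _ := Quotient (Equiv.Perm.SameCycle.setoid S.next)

/-- The starting point of a side. -/
def tail (d : D) : S.Vertex := Quotient.mk _ d

/-- The end point of a side. -/
def head (d : D) : S.Vertex := S.tail (S.next d)

def edge (d : D) : S.Edge := Quotient.mk _ d

def face (d : D) : S.Face := Quotient.mk _ d

/-- Two sides belong to the same connected component of the surface. -/
def SameComp : D → D → Prop := Relation.EqvGen fun d d' => d' = S.next d ∨ d' = S.opp d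

def IsBoundarySide (d : D) : Prop := S.opp d = d

def IsBoundaryVertex (v : S.Vertex) : Prop := ∃ d, S.IsBoundarySide d ∧ S.tail d = v

/-- The Euler characteristic of the part of the surface formed by the sides in `C`
(used for `C` the whole surface or one connected component). -/
noncomputable def euler (C : Set D) : ℤ :=
  ((S.tail '' C).ncard : ℤ) - (S.edge '' C).ncard + (S.face '' C).ncard

open Classical in
/-- Cutting the surface along the edges in `E`. -/
noncomputable def cut (E : Set D) : CellSurface D where
  next := S.next
  opp d := if d ∈ E ∨ S.opp d ∈ E then d else S.opp d
  opp_opp d := by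
    by_cases h : d ∈ E ∨ S.opp d ∈ E
    · simp [h]
    · have h' : ¬ (S.opp d ∈ E ∨ S.opp (S.opp d) ∈ E) := by
        rw [S.opp_opp]; tauto
      rw [if_neg h, if_neg h', S.opp_opp]

/-- Both directed versions of the edges of a path. -/
def sides (l : List D) : Set D := {d | d ∈ l ∨ S.opp d ∈ l}

/-- The vertices of an edge path other than its two end points. -/
def inner (l : List D) : Set S.Vertex := {v | ∃ d ∈ l.tail, S.tail d = v}

open Classical in
/-- The consecutive segments into which an edge path is divided by its inner vertices in `X`. -/
noncomputable def pieces (X : Set S.Vertex) (l : List D) : List (List D) :=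
  l.splitBy fun _ d => decide (S.tail d ∉ X)

/-- The edges of a collection of edge paths. -/
def arcSides (Δ : Set (List D)) : Set D := {d | ∃ l ∈ Δ, d ∈ S.sides l}

/-- The inner vertices of a collection of edge paths. -/
def arcInner (Δ : Set (List D)) : Set S.Vertex := {v | ∃ l ∈ Δ, v ∈ S.inner l}

end CellSurface

/-- A cell surface with two sets of marked vertices, `white` (`∘`) and `red` (`•`). -/
structure MarkedCells (D : Type*) extends CellSurface D where
  white : Set toCellSurface.Vertex
  red : Set toCellSurface.Vertex

/-- The corner at the start of a side, or the midpoint of a side, seen from the polygon of the side. -/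
inductive Station (D : Type*) where
  | corner (d : D)
  | mid (d : D)

namespace Station

def side {D : Type*} : Station D → D
  | corner d => d
  | mid d => d

end Station

namespace MarkedCells

variable {D : Type*} (S : MarkedCells D)

def IsMarked (v : S.Vertex) : Prop := v ∈ S.white ∨ v ∈ S.red

/-- The `∘`-points on the boundary. -/
def boundaryWhite : Set S.Vertex := {v | v ∈ S.white ∧ S.IsBoundaryVertex v}

/-- The punctures: the `∘`-points in the interior. -/
def punctures : Set S.Vertex := {v | v ∈ S.white ∧ ¬ S.IsBoundaryVertex v}

/-- `FirstMark d v`: following the boundary, starting with the boundary side `d`, the first marked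
point that is reached after the starting point of `d` is `v`. -/
inductive FirstMark : D → S.Vertex → Prop
  | here (d : D) : S.IsBoundarySide d → S.IsMarked (S.head d) → FirstMark d (S.head d)
  | step (d d' : D) (v : S.Vertex) : S.IsBoundarySide d → ¬ S.IsMarked (S.head d) →
      S.IsBoundarySide d' → S.tail d' = S.head d → FirstMark d' v → FirstMark d v

/-- Marked surfaces: every connected component has boundary, the `•`-points lie on the boundary, and
every boundary component carries marked points, whose two colours alternate (so that each colour
occurs on each boundary component). -/
structure IsMarkedSurface : Prop where
  boundary_nonempty : ∀ d, ∃ d', S.SameComp d d' ∧ S.IsBoundarySide d'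
  disjoint : Disjoint S.white S.red
  red_boundary : ∀ v ∈ S.red, S.IsBoundaryVertex v
  exists_mark : ∀ d, S.IsBoundarySide d → ∃ v, S.FirstMark d v
  white_red : ∀ d v, S.FirstMark d v → S.tail d ∈ S.white → v ∈ S.red
  red_white : ∀ d v, S.FirstMark d v → S.tail d ∈ S.red → v ∈ S.white

/-- The Euler characteristic of the marked surface, where punctures count as boundary components. -/
noncomputable def chi : ℤ := S.euler Set.univ - (S.punctures.ncard : ℤ)

/-- The rank of the marked surface. -/
noncomputable def rank : ℤ := (S.boundaryWhite.ncard : ℤ) - S.chi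

/-! ### Curves up to homotopy -/

/-- The point of the surface at which a station lies: a vertex, or the midpoint of an edge. -/
def point : Station D → S.Vertex ⊕ S.Edge
  | .corner d => Sum.inl (S.tail d)
  | .mid d => Sum.inr (S.edge d)

/-- A curve from `a` to `b`, whose interior avoids the punctures: a sequence of chords, each of which
joins two stations inside one polygon. -/
def IsCurve : S.Vertex ⊕ S.Edge → List (Station D × Station D) → S.Vertex ⊕ S.Edge → Prop
  | a, [], b => a = b
  | a, c :: cs, b =>
      S.point c.1 = a ∧ S.face c.1.side = S.face c.2.side ∧
        (cs = [] ∨ ∀ v ∈ S.punctures, S.point c.2 ≠ Sum.inl v) ∧ IsCurve (S.point c.2) cs b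

/-- The elementary homotopies: constant chords may be dropped, chords inside one polygon compose (a
polygon is contractible), and half of an interior edge is the same chord in both adjacent polygons. -/
inductive Move : List (Station D × Station D) → List (Station D × Station D) → Prop
  | const (x : Station D) : Move [(x, x)] []
  | comp (x y z : Station D) : S.face x.side = S.face y.side → S.face y.side = S.face z.side →
      Move [(x, y), (y, z)] [(x, z)]
  | out (d : D) : S.opp d ≠ d →
      Move [(.corner d, .mid d)] [(.corner (S.next (S.opp d)), .mid (S.opp d))]
  | back (d : D) : S.opp d ≠ d →
      Move [(.mid d, .corner d)] [(.mid (S.opp d), .corner (S.next (S.opp d)))]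

/-- Homotopy of curves from `a` to `b` relative to the endpoints, in the complement of the punctures. -/
def Homotopic (a b : S.Vertex ⊕ S.Edge) :
    List (Station D × Station D) → List (Station D × Station D) → Prop :=
  Relation.EqvGen fun l l' => S.IsCurve a l b ∧ S.IsCurve a l' b ∧
    ∃ p q u v, S.Move u v ∧ l = p ++ u ++ q ∧ l' = p ++ v ++ q

/-- The curve that runs along an edge path. -/
def curve (l : List D) : List (Station D × Station D) :=
  l.map fun d => (.corner d, .corner (S.next d))

/-- Two edge paths represent the same (undirected) arc: they are homotopic after a choice of the
directions. -/
def SameArc (l l' : List D) : Prop :=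
  ∃ a b, S.Homotopic a b (S.curve l) (S.curve l') ∨
    S.Homotopic a b (S.curve l) ((S.curve l').reverse.map Prod.swap)

/-! ### Arcs and simple coordinates -/

/-- A simple arc with end points in `ends`: a non-contractible edge path through the interior of the
surface, which passes through no edge and no inner vertex twice and through no marked point. -/
structure IsSimpleArc (ends : Set S.Vertex) (l : List D) : Prop where
  ne_nil : l ≠ []
  chain : l.IsChain fun d d' => S.head d = S.tail d'
  interior : ∀ d ∈ l, ¬ S.IsBoundarySide d
  no_edge_twice : ∀ d ∈ l, S.opp d ∉ l
  no_vertex_twice : (l.tail.map S.tail).Nodup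
  inner_interior : ∀ v ∈ S.inner l, ¬ S.IsMarked v ∧ ¬ S.IsBoundaryVertex v
  start_mem : ∀ d ∈ l.head?, S.tail d ∈ ends
  end_mem : ∀ d ∈ l.getLast?, S.head d ∈ ends
  not_contractible : ∀ a, ¬ S.Homotopic a a (S.curve l) []

/-- A simple coordinate: a collection of simple `•`-arcs without interior intersections which cut the
surface into polygons (connected pieces of Euler characteristic `1`, that is, discs), each of which
contains exactly one `∘`-point. -/
structure IsSimpleCoordinate (Δ : Set (List D)) : Prop where
  arc : ∀ l ∈ Δ, S.IsSimpleArc S.red l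
  disjoint_sides : ∀ l ∈ Δ, ∀ l' ∈ Δ, l ≠ l' → Disjoint (S.sides l) (S.sides l')
  disjoint_inner : ∀ l ∈ Δ, ∀ l' ∈ Δ, l ≠ l' → Disjoint (S.inner l) (S.inner l')
  polygon : ∀ d, (S.cut (S.arcSides Δ)).euler {c | (S.cut (S.arcSides Δ)).SameComp d c} = 1
  one_white : ∀ d, ((S.cut (S.arcSides Δ)).tail ''
    {c | (S.cut (S.arcSides Δ)).SameComp d c ∧ S.tail c ∈ S.white}).ncard = 1

/-- An oriented intersection of arcs of `Δ`: an anti-clockwise angle inside the surface, based at a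
`•`-point, from (the end that starts with the side `fst` of) the arc `src` to (the end that starts
with the side `snd` of) the arc `tgt`. -/
@[ext] structure OrientedIntersection (Δ : Set (List D)) where
  src : Δ
  tgt : Δ
  fst : D
  snd : D
  fst_mem : fst ∈ S.sides src.1
  snd_mem : snd ∈ S.sides tgt.1
  base : S.tail fst ∈ S.red
  angle : Relation.TransGen S.Rot fst snd

/-- Minimal oriented intersections (the arrows of the quiver of `Δ`, whose vertices are the elements
of `Δ`): those which are not a composition of two oriented intersections. -/
def MinimalIntersection (Δ : Set (List D)) : Type _ :=
  {a : S.OrientedIntersection Δ // ¬ ∃ x y : S.OrientedIntersection Δ,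
    x.fst = a.fst ∧ x.snd = y.fst ∧ y.snd = a.snd}

/-! ### Zigzag arcs -/

/-- `γ` meets the arcs of `Δ` only in isolated points, and at each of them it crosses: the two edges
of the arc at this point lie on different sides of `γ`. -/
def Transverse (Δ : Set (List D)) (γ : List D) : Prop :=
  ∀ l ∈ Δ, Disjoint (S.sides l) (S.sides γ) ∧
    ∀ a b, [a, b] <:+: l → S.tail b ∈ S.inner γ →
      (S.cut (S.sides γ)).tail b ≠ (S.cut (S.sides γ)).tail (S.opp a)

/-- The segment `ε` cuts off a corner of a polygon of `Δ`: one of the two parts into which it divides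
the polygon contains no `∘`-point and exactly one corner of the polygon. (So `ε` connects a side of
the polygon with its predecessor or successor, and the triangle which is formed by `ε` and these two
sides does not contain the `∘`-point.) -/
def CutsCorner (Δ : Set (List D)) (ε : List D) : Prop :=
  ∃ d ∈ S.sides ε,
    (∀ c, (S.cut (S.arcSides Δ ∪ S.sides ε)).SameComp d c → S.tail c ∉ S.white) ∧
    ((S.cut (S.arcSides Δ ∪ S.sides ε)).tail ''
      {c | (S.cut (S.arcSides Δ ∪ S.sides ε)).SameComp d c ∧ S.tail c ∈ S.red}).ncard = 1

/-- `γ` is a zigzag arc with respect to `Δ`: it crosses `Δ`, and each of the segments into which it is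
divided by `Δ`, apart from the first and the last one, cuts off a corner of a polygon of `Δ`. -/
def IsZigzag (Δ : Set (List D)) (γ : List D) : Prop :=
  S.Transverse Δ γ ∧ 2 ≤ (S.pieces (S.arcInner Δ) γ).length ∧
    ∀ ε ∈ (S.pieces (S.arcInner Δ) γ).tail.dropLast, S.CutsCorner Δ ε

/-! ### The cut surface -/

/-- The edges that remain on the cut surface: all but the inner edges of `γ`. -/
def kept (γ : List D) : Set D := (S.sides γ.tail.dropLast)ᶜ

/-- The surface cut along `γ`. Both copies of `γ` become boundary segments, on each of which all inner
vertices are moved together into one new `•`-point; that is, all edges of the two copies except for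
the first and the last one are contracted. This does not change the surface, and it slides the end
points of the cut `•`-arcs on each copy of `γ` along this copy to the new `•`-point. The `∘`-points
are those which lie over the old ones. -/
noncomputable def cutAlong [Finite D] (γ : List D) : MarkedCells (S.kept γ) :=
  let T : CellSurface (S.kept γ) :=
    { next := firstReturn S.next (S.kept γ)
      opp := fun d => ⟨(S.cut (S.sides γ)).opp d, by
        by_cases h : (d : D) ∈ S.sides γ ∨ S.opp (d : D) ∈ S.sides γ
        · simp only [CellSurface.cut, if_pos h, d.2]
        · have h' : ¬ ((d : D) ∈ γ.tail.dropLast ∨ S.opp (d : D) ∈ γ.tail.dropLast) := d.2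
          simp only [CellSurface.cut, if_neg h]
          change ¬ (S.opp (d : D) ∈ γ.tail.dropLast ∨ S.opp (S.opp (d : D)) ∈ γ.tail.dropLast)
          rw [S.opp_opp]
          tauto⟩
      opp_opp := fun d => Subtype.ext ((S.cut (S.sides γ)).opp_opp d) }
  { toCellSurface := T
    white := {v | ∃ d : S.kept γ, T.tail d = v ∧ S.tail d ∈ S.white}
    red := {v | ∃ d : S.kept γ, T.tail d = v ∧ (S.tail d ∈ S.red ∨ S.tail d ∈ S.inner γ)} }

/-- The arcs on the cut surface which arise from the segments of the arc `l` between its successive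
crossings with `γ` (from `l` itself if `l` does not cross `γ`). -/
def smoothedOf [Finite D] (γ l : List D) : Set (List (S.kept γ)) :=
  {s | s.map Subtype.val ∈ S.pieces (S.inner γ) l}

/-- `Δ'` represents the coordinate of the cut surface: it consists of the arcs which arise from the
segments of the arcs of `Δ`, taken up to homotopy, one for each homotopy class. -/
def IsCutCoordinate [Finite D] (Δ : Set (List D)) (γ : List D) (Δ' : Set (List (S.kept γ))) : Prop :=
  (∀ t ∈ Δ', ∃ l ∈ Δ, t ∈ S.smoothedOf γ l) ∧
    ∀ l ∈ Δ, ∀ s ∈ S.smoothedOf γ l, ∃! t, t ∈ Δ' ∧ (S.cutAlong γ).SameArc s t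

/-- The minimal oriented intersection `a'` of `Δ'` is induced by the minimal oriented intersection `a`
of `Δ`: its source and its target arise from segments of the source and of the target of `a`, and
the polygon that contains `a'` is induced by the polygon that contains `a`, that is, its `∘`-point
lies over the `∘`-point of the polygon that contains `a`. -/
def Induces [Finite D] (Δ : Set (List D)) (γ : List D) (Δ' : Set (List (S.kept γ)))
    (a : S.MinimalIntersection Δ) (a' : (S.cutAlong γ).MinimalIntersection Δ') : Prop :=
  (∃ s ∈ S.smoothedOf γ a.1.src.1, (S.cutAlong γ).SameArc s a'.1.src.1) ∧
  (∃ s ∈ S.smoothedOf γ a.1.tgt.1, (S.cutAlong γ).SameArc s a'.1.tgt.1) ∧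
  ∀ (c : D) (c' : S.kept γ),
    (S.cut (S.arcSides Δ)).SameComp a.1.fst c → S.tail c ∈ S.white →
    ((S.cutAlong γ).cut ((S.cutAlong γ).arcSides Δ')).SameComp a'.1.fst c' →
    (S.cutAlong γ).tail c' ∈ (S.cutAlong γ).white → S.tail (c' : D) = S.tail c

end MarkedCells

/-! Cutting along `γ` turns its two ends into two more `∘`-corners and adds one to the Euler
characteristic, both diminished by the number of punctures among the end points; the difference,
which is the rank, grows by one (`cutAlong_rank`).

The new coordinate is studied through the collection of all segments of arcs, before homotopic ones
are identified. If `γ` crosses `Δ` in `N` points, there are `|Δ| + N` segments (`card_segments`),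
which are disjoint `•`-paths on the cut surface. Cutting along them gives total Euler characteristic
`|∘| + N - 1` (`euler_segmentRegions`), whereas each component has boundary and hence Euler
characteristic at most one (`euler_le_one`, by a spanning tree). The zigzag condition enters here: a
region without `∘`-point lies on the inner side, that of the cut-off corner, of one of the at most
`N - 1` segments of `γ` between crossings (`exists_inner`). So the count is extremal
(`euler_eq_one_of_count`): all regions are discs with at most one `∘`-point, exactly `N - 1` have
none, and these correspond to the segments of `γ` (`regions_count`). Because a cut-off corner has
only one `•`-point, a region without `∘`-point has exactly two ends of arcs (`exists_other_end`): it
is a digon.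

The two sides of a digon are homotopic, since a disc without punctures is simply connected
(`homotopic_nil_of_euler_eq_one`). Deleting one of them merges the digon with its neighbour and
leaves a system of the same kind (`DigonRemoval.isDigonSystem`). Once every part has a `∘`-point,
different arcs are not homotopic: they would bound a set of parts modulo two, but each part contains
a puncture or a piece of boundary that forces the coefficient zero (`not_chainEquiv_of_white`).
Hence every set of representatives arises by such deletions and is a simple coordinate
(`IsDigonSystem.reduce`, `IsDigonSystem.isSimpleCoordinate`).

A minimal oriented intersection is a corner between two successive ends
(`exists_minimalIntersection_equiv`). On the cut surface each segment of `γ` between crossings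
creates two further corners, `o i` inside and `c i` outside. The digon of `o i` has a second corner
with the same source arc, target arc and polygon as `c i` (`exists_partner`). Exchanging these, by
comparing fibres, matches the corners of `Δ` with the corners in regions with a `∘`-point
(`exists_whiteCorners_equiv`), and deleting sides of digons carries the latter to parallel arcs
(`DigonRemoval.exists_equiv`). Finally, a simple coordinate has as many arcs as the rank
(`card_eq_rank`). -/

open Relation

/-! ### Equivalence closures and partial injections. -/

theorem Relation.EqvGen.iff_of_invariant {α : Type*} {r : α → α → Prop} {P : α → Prop}
    (h : ∀ x y, r x y → (P x ↔ P y)) {a b : α} (hab : EqvGen r a b) : P a ↔ P b := by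
  induction hab with
  | rel x y hxy => exact h x y hxy
  | refl x => exact Iff.rfl
  | symm x y _ ih => exact ih.symm
  | trans x y z _ _ h1 h2 => exact h1.trans h2

theorem Relation.EqvGen.eq_of_invariant {α β : Type*} {r : α → α → Prop} {f : α → β}
    (h : ∀ x y, r x y → f x = f y) {a b : α} (hab : EqvGen r a b) : f a = f b :=
  (Relation.EqvGen.iff_of_invariant (P := fun x => f a = f x)
    (fun x y hxy => by rw [h x y hxy]) hab).1 rfl

theorem Relation.EqvGen.lift_of {α β : Type*} {r : α → α → Prop} {s : β → β → Prop} {f : α → β}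
    (h : ∀ x y, r x y → EqvGen s (f x) (f y)) {a b : α} (hab : EqvGen r a b) :
    EqvGen s (f a) (f b) := by
  induction hab with
  | rel x y hxy => exact h x y hxy
  | refl x => exact EqvGen.refl _
  | symm x y _ ih => exact ih.symm
  | trans x y z _ _ h1 h2 => exact h1.trans _ _ _ h2

theorem Relation.ReflTransGen.to_eqvGen {α : Type*} {r : α → α → Prop} {a b : α}
    (h : ReflTransGen r a b) : EqvGen r a b := by
  induction h with
  | refl => exact EqvGen.refl _
  | tail _ h ih => exact ih.trans _ _ _ (EqvGen.rel _ _ h)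

/-- A partial injection of a finite type that is defined along a whole forward orbit reaches its
starting point again. -/
theorem exists_pred_of_total {α : Type*} [Finite α] {r : α → α → Prop}
    (hl : ∀ a b c, r a c → r b c → a = b) (a : α)
    (ht : ∀ x, ReflTransGen r a x → ∃ y, r x y) : ∃ x, ReflTransGen r a x ∧ r x a := by
  classical
  choose f hf using fun x : {x // ReflTransGen r a x} => ht x.1 x.2
  let g : {x // ReflTransGen r a x} → {x // ReflTransGen r a x} := fun x =>
    ⟨f x, x.2.tail (hf x)⟩
  have hg : Function.Injective g := fun x y hxy => by
    have h : f x = f y := congrArg Subtype.val hxy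
    exact Subtype.ext (hl _ _ _ (hf x) (h ▸ hf y))
  -- An injective self-map of the finite forward orbit is surjective, so the starting point itself
  -- has a predecessor in the orbit.
  obtain ⟨x, hx⟩ := (Finite.injective_iff_surjective.1 hg) ⟨a, .refl⟩
  refine ⟨x.1, x.2, ?_⟩
  have h : f x = a := congrArg Subtype.val hx
  have h' := hf x
  rwa [h] at h'

/-! ### Rotation about the vertices of a glued surface. -/

namespace CellSurface

variable {D : Type*} (S : CellSurface D)

theorem opp_injective : Function.Injective S.opp :=
  Function.LeftInverse.injective S.opp_opp

variable {S}

theorem Rot.right_unique {a b c : D} (h : S.Rot a b) (h' : S.Rot a c) : b = c := by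
  rw [h.2, h'.2]

theorem Rot.opp_eq {a b : D} (h : S.Rot a b) : S.opp b = S.next.symm a := by
  rw [h.2, S.opp_opp]

theorem Rot.eq_next {a b : D} (h : S.Rot a b) : a = S.next (S.opp b) := by
  rw [h.opp_eq, Equiv.apply_symm_apply]

theorem Rot.left_unique {a b c : D} (h : S.Rot a c) (h' : S.Rot b c) : a = b := by
  rw [h.eq_next, h'.eq_next]

/-- A rotation step into `b` passes across the edge of `b`, which is therefore glued to something.
This makes boundary sides the beginnings of fans. -/
theorem Rot.not_boundary {a b : D} (h : S.Rot a b) : ¬ S.IsBoundarySide b := by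
  intro hb
  have h1 := h.1
  rw [← h.opp_eq, S.opp_opp, hb] at h1
  exact h1 rfl

theorem rot_next_opp {d : D} (h : ¬ S.IsBoundarySide d) : S.Rot (S.next (S.opp d)) d := by
  refine ⟨?_, ?_⟩
  · rw [Equiv.symm_apply_apply, S.opp_opp]
    exact fun e => h e.symm
  · rw [Equiv.symm_apply_apply, S.opp_opp]

theorem not_rot_next {b c : D} (h : S.IsBoundarySide b) : ¬ S.Rot (S.next b) c := by
  intro hr
  apply hr.1
  rw [Equiv.symm_apply_apply]
  exact h

theorem exists_rot_of {c : D} (h : ¬ S.IsBoundarySide (S.next.symm c)) : ∃ c', S.Rot c c' :=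
  ⟨_, h, rfl⟩

theorem tail_eq_iff {a b : D} : S.tail a = S.tail b ↔ EqvGen S.Rot a b :=
  Quotient.eq (r := EqvGen.setoid S.Rot)

theorem Rot.tail_eq {a b : D} (h : S.Rot a b) : S.tail a = S.tail b :=
  tail_eq_iff.2 (EqvGen.rel _ _ h)

theorem tail_eq_of_reflTransGen {a b : D} (h : ReflTransGen S.Rot a b) : S.tail a = S.tail b :=
  tail_eq_iff.2 h.to_eqvGen

theorem head_opp {d : D} (h : ¬ S.IsBoundarySide d) : S.head (S.opp d) = S.tail d :=
  (rot_next_opp h).tail_eq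

theorem isBoundarySide_opp {d : D} : S.IsBoundarySide (S.opp d) ↔ S.IsBoundarySide d := by
  unfold IsBoundarySide
  rw [S.opp_opp]
  exact eq_comm

theorem tail_opp {d : D} (h : ¬ S.IsBoundarySide d) : S.tail (S.opp d) = S.head d := by
  rw [← head_opp (d := S.opp d) (by rwa [isBoundarySide_opp]), S.opp_opp]

theorem tail_surjective (v : S.Vertex) : ∃ d, S.tail d = v := Quotient.exists_rep v

/-! ### Fans at boundary vertices -/

/-- Rotation is a partial injection and nothing rotates into a boundary side, so the equivalence
class of `b` is just its forward orbit: a fan which begins with `b`. -/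
theorem reflTransGen_of_boundary_tail {b c : D} (hb : S.IsBoundarySide b)
    (h : S.tail b = S.tail c) : ReflTransGen S.Rot b c := by
  refine (EqvGen.iff_of_invariant (P := fun x => ReflTransGen S.Rot b x) ?_
    (tail_eq_iff.1 h)).1 .refl
  intro x y hxy
  refine ⟨fun hx => hx.tail hxy, fun hy => ?_⟩
  rcases ReflTransGen.cases_tail hy with e | ⟨z, hz, hzy⟩
  · exact absurd (e ▸ hb) hxy.not_boundary
  · rwa [hxy.left_unique hzy]

/-- Dually, nothing rotates out of the corner after a boundary side, so that this corner is the last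
one of its fan. -/
theorem reflTransGen_of_boundary_head {b c : D} (hb : S.IsBoundarySide b)
    (h : S.tail c = S.head b) : ReflTransGen S.Rot c (S.next b) := by
  refine (EqvGen.iff_of_invariant (P := fun x => ReflTransGen S.Rot x (S.next b)) ?_
    (tail_eq_iff.1 h)).2 .refl
  intro x y hxy
  refine ⟨fun hx => ?_, fun hy => hy.head hxy⟩
  rcases ReflTransGen.cases_head hx with e | ⟨z, hz, hzy⟩
  · exact absurd (e ▸ hxy) (not_rot_next hb)
  · rwa [hxy.right_unique hz]

theorem boundary_tail_injective {b b' : D} (hb : S.IsBoundarySide b) (hb' : S.IsBoundarySide b')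
    (h : S.tail b = S.tail b') : b = b' := by
  rcases ReflTransGen.cases_tail (reflTransGen_of_boundary_tail hb h) with e | ⟨z, _, hz⟩
  · exact e.symm
  · exact absurd hb' hz.not_boundary

theorem boundary_head_injective {b b' : D} (hb : S.IsBoundarySide b) (hb' : S.IsBoundarySide b')
    (h : S.head b = S.head b') : b = b' := by
  rcases ReflTransGen.cases_head (reflTransGen_of_boundary_head hb' h) with e | ⟨z, hz, _⟩
  · exact S.next.injective e
  · exact absurd hz (not_rot_next hb)

theorem exists_boundary_tail_eq_head [Finite D] {b : D} (hb : S.IsBoundarySide b) :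
    ∃ b', S.IsBoundarySide b' ∧ S.tail b' = S.head b := by
  by_contra! hcon
  obtain ⟨x, -, hx⟩ := exists_pred_of_total (r := Function.swap S.Rot)
    (fun a c x h h' => Rot.right_unique (S := S) h h') (S.next b) (by
      intro x hx
      by_cases hbx : S.IsBoundarySide x
      · exact absurd (tail_eq_of_reflTransGen (reflTransGen_swap.1 hx)) (hcon x hbx)
      · exact ⟨_, rot_next_opp hbx⟩)
  exact not_rot_next hb hx

theorem exists_boundary_head_eq_tail [Finite D] {b : D} (hb : S.IsBoundarySide b) :
    ∃ b', S.IsBoundarySide b' ∧ S.head b' = S.tail b := by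
  by_contra! hcon
  obtain ⟨x, -, hx⟩ := exists_pred_of_total (r := S.Rot)
    (fun a c x h h' => Rot.left_unique (S := S) h h') b (by
      intro x hx
      by_cases hbx : S.IsBoundarySide (S.next.symm x)
      · refine absurd ?_ (hcon _ hbx)
        rw [tail_eq_of_reflTransGen hx, head, Equiv.apply_symm_apply]
      · exact exists_rot_of hbx)
  exact hx.not_boundary hb

/-- Having a full turn is invariant under rotation, so it would pass to the first corner of the fan,
into which nothing rotates. -/
theorem not_transGen_self {c : D} (hc : S.IsBoundaryVertex (S.tail c)) :
    ¬ TransGen S.Rot c c := by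
  obtain ⟨b, hb, hbc⟩ := hc
  intro h
  have : TransGen S.Rot b b := by
    refine (EqvGen.iff_of_invariant (P := fun x => TransGen S.Rot x x) ?_
      (tail_eq_iff.1 hbc)).2 h
    intro x y hxy
    constructor
    · intro hx
      obtain ⟨z, hz, hzx⟩ := TransGen.head'_iff.1 hx
      rw [← hxy.right_unique hz] at hzx
      exact TransGen.tail' hzx hxy
    · intro hy
      obtain ⟨z, hz, hzy⟩ := TransGen.tail'_iff.1 hy
      rw [← hxy.left_unique hzy] at hz
      exact TransGen.head' hxy hz
  obtain ⟨z, _, hz⟩ := TransGen.tail'_iff.1 this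
  exact hz.not_boundary hb

/-! ### Components -/

variable (S) in
theorem sameComp_refl (a : D) : S.SameComp a a := EqvGen.refl a

theorem SameComp.symm {a b : D} (h : S.SameComp a b) : S.SameComp b a := EqvGen.symm _ _ h

theorem SameComp.trans {a b c : D} (h : S.SameComp a b) (h' : S.SameComp b c) : S.SameComp a c :=
  EqvGen.trans _ _ _ h h'

variable (S) in
theorem sameComp_next (a : D) : S.SameComp a (S.next a) := EqvGen.rel _ _ (Or.inl rfl)

variable (S) in
theorem sameComp_opp (a : D) : S.SameComp a (S.opp a) := EqvGen.rel _ _ (Or.inr rfl)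

theorem sameComp_of_tail_eq {a b : D} (h : S.tail a = S.tail b) : S.SameComp a b := by
  refine (EqvGen.iff_of_invariant (P := fun x => S.SameComp a x) ?_
    (tail_eq_iff.1 h)).1 (sameComp_refl S a)
  intro x y hxy
  have : S.SameComp x y := by
    rw [hxy.eq_next]
    exact ((S.sameComp_opp y).trans (S.sameComp_next _)).symm
  exact ⟨fun h => h.trans this, fun h => h.trans this.symm⟩

theorem sameComp_of_tail_eq_head {a b : D} (h : S.tail a = S.head b) : S.SameComp a b :=
  (sameComp_of_tail_eq h).trans (S.sameComp_next b).symm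

theorem SameComp.of_closed {P : D → Prop} (hn : ∀ d, P d ↔ P (S.next d))
    (ho : ∀ d, P d → P (S.opp d)) {a b : D} (h : S.SameComp a b) : P a ↔ P b := by
  refine EqvGen.iff_of_invariant ?_ h
  rintro x y (rfl | rfl)
  · exact hn x
  · exact ⟨ho x, fun h => S.opp_opp x ▸ ho _ h⟩

theorem face_eq_iff {a b : D} : S.face a = S.face b ↔ S.next.SameCycle a b :=
  Quotient.eq (r := Equiv.Perm.SameCycle.setoid S.next)

variable (S) in
theorem face_next (a : D) : S.face (S.next a) = S.face a :=
  face_eq_iff.2 (Equiv.Perm.sameCycle_apply_left.2 (Equiv.Perm.SameCycle.refl _ _))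

theorem sameComp_of_face_eq {a b : D} (h : S.face a = S.face b) : S.SameComp a b := by
  obtain ⟨n, rfl⟩ := face_eq_iff.1 h
  have hz : ∀ n : ℤ, S.SameComp a ((S.next ^ n) a) := by
    intro n
    induction n with
    | zero => exact sameComp_refl S a
    | succ n ih =>
      rw [add_comm, zpow_add, zpow_one, Equiv.Perm.mul_apply]
      exact ih.trans (S.sameComp_next _)
    | pred n ih =>
      refine ih.trans ?_
      have e : (S.next ^ (-(n : ℤ))) a = S.next ((S.next ^ (-(n : ℤ) - 1)) a) := by
        rw [← Equiv.Perm.mul_apply, ← zpow_one_add]; congr 2; ring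
      rw [e]
      exact (S.sameComp_next _).symm
  exact hz n

theorem edge_eq_iff {a b : D} : S.edge a = S.edge b ↔ a = b ∨ b = S.opp a := by
  constructor
  · intro h
    have h' : EqvGen (fun d d' : D => d' = S.opp d) a b :=
      (Quotient.eq (r := EqvGen.setoid fun d d' : D => d' = S.opp d)).1 h
    refine (EqvGen.iff_of_invariant (P := fun x => a = x ∨ x = S.opp a) ?_ h').1 (Or.inl rfl)
    rintro x y rfl
    constructor
    · rintro (rfl | rfl)
      · exact Or.inr rfl
      · exact Or.inl (S.opp_opp a).symm
    · rintro (rfl | h)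
      · exact Or.inr (S.opp_opp x).symm
      · exact Or.inl (S.opp_injective h).symm
  · rintro (rfl | rfl)
    · rfl
    · exact Quotient.sound (s := EqvGen.setoid fun d d' : D => d' = S.opp d) (EqvGen.rel _ _ rfl)

theorem sameComp_of_edge_eq {a b : D} (h : S.edge a = S.edge b) : S.SameComp a b := by
  rcases edge_eq_iff.1 h with rfl | rfl
  · exact S.sameComp_refl a
  · exact S.sameComp_opp a

/-! ### Cutting -/

variable (S) in
/-- A set of sides that contains with every side the side glued to it. -/
def OppClosed (E : Set D) : Prop := ∀ d ∈ E, S.opp d ∈ E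

theorem OppClosed.mem_iff {E : Set D} (hE : S.OppClosed E) {d : D} : S.opp d ∈ E ↔ d ∈ E :=
  ⟨fun h => S.opp_opp d ▸ hE _ h, hE d⟩

theorem OppClosed.union {E F : Set D} (hE : S.OppClosed E) (hF : S.OppClosed F) :
    S.OppClosed (E ∪ F) := by
  rintro d (h | h)
  · exact Or.inl (hE d h)
  · exact Or.inr (hF d h)

variable (S) in
theorem oppClosed_sides (l : List D) : S.OppClosed (S.sides l) := by
  rintro d (h | h)
  · exact Or.inr (by rwa [S.opp_opp])
  · exact Or.inl h

variable (S) in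
theorem oppClosed_arcSides (Δ : Set (List D)) : S.OppClosed (S.arcSides Δ) := by
  rintro d ⟨l, hl, h⟩
  exact ⟨l, hl, S.oppClosed_sides l d h⟩

theorem cut_opp_of_mem {E : Set D} {d : D} (h : d ∈ E) : (S.cut E).opp d = d := by
  simp [cut, h]

theorem cut_opp_of_notMem {E : Set D} (hE : S.OppClosed E) {d : D} (h : d ∉ E) :
    (S.cut E).opp d = S.opp d := by
  have : S.opp d ∉ E := fun h' => h (hE.mem_iff.1 h')
  simp [cut, h, this]

theorem cut_isBoundarySide {E : Set D} (hE : S.OppClosed E) {d : D} :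
    (S.cut E).IsBoundarySide d ↔ S.IsBoundarySide d ∨ d ∈ E := by
  by_cases h : d ∈ E
  · simp [IsBoundarySide, cut_opp_of_mem h, h]
  · simp [IsBoundarySide, cut_opp_of_notMem hE h, h]

/-- A rotation step crosses exactly one edge, that of its target; the cut destroys the steps across
`E` and no others. -/
theorem cut_rot_iff {E : Set D} (hE : S.OppClosed E) {a b : D} :
    (S.cut E).Rot a b ↔ S.Rot a b ∧ b ∉ E := by
  constructor
  · intro h
    have hb := h.not_boundary
    rw [cut_isBoundarySide hE] at hb
    push Not at hb
    refine ⟨?_, hb.2⟩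
    have := h.eq_next
    rw [cut_opp_of_notMem hE hb.2] at this
    rw [this]
    exact rot_next_opp hb.1
  · rintro ⟨h, hb⟩
    have : a = (S.cut E).next ((S.cut E).opp b) := by
      rw [cut_opp_of_notMem hE hb]; exact h.eq_next
    rw [this]
    apply rot_next_opp
    rw [cut_isBoundarySide hE]
    push Not
    exact ⟨h.not_boundary, hb⟩

theorem tail_eq_of_cut_tail_eq {E : Set D} (hE : S.OppClosed E) {a b : D}
    (h : (S.cut E).tail a = (S.cut E).tail b) : S.tail a = S.tail b :=
  EqvGen.eq_of_invariant (r := (S.cut E).Rot) (f := S.tail)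
    (fun _ _ h => ((cut_rot_iff hE).1 h).1.tail_eq) (tail_eq_iff.1 h)

theorem head_eq_of_cut_head_eq_tail {E : Set D} (hE : S.OppClosed E) {a b : D}
    (h : (S.cut E).head a = (S.cut E).tail b) : S.head a = S.tail b :=
  tail_eq_of_cut_tail_eq hE h

/-- Cutting does not separate corners at vertices which it does not touch. -/
theorem cut_tail_eq_of_forall {E : Set D} (hE : S.OppClosed E) {a b : D}
    (hn : ∀ g ∈ E, S.tail g ≠ S.tail a) (h : S.tail a = S.tail b) :
    (S.cut E).tail a = (S.cut E).tail b := by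
  have key : ∀ a b, EqvGen S.Rot a b → (∀ g ∈ E, S.tail g ≠ S.tail a) →
      (S.cut E).tail a = (S.cut E).tail b := by
    intro a b h
    induction h with
    | rel x y h =>
      intro hn
      exact ((cut_rot_iff hE).2 ⟨h, fun hy => hn y hy h.tail_eq.symm⟩).tail_eq
    | refl => intro _; rfl
    | symm x y h ih =>
      intro hn
      rw [ih (by rwa [tail_eq_iff.2 h])]
    | trans x y z h _ ih1 ih2 =>
      intro hn
      rw [ih1 hn, ih2 (by rwa [← tail_eq_iff.2 h])]
  exact key a b (tail_eq_iff.1 h) hn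

/-- A corner of the cut surface at a vertex which the cut touches belongs to a fan that starts with
a boundary side of the cut surface. -/
theorem exists_cut_boundary_of_tail_eq [Finite D] {E : Set D} (hE : S.OppClosed E) {a g : D}
    (hg : S.IsBoundarySide g ∨ g ∈ E) (h : S.tail g = S.tail a) :
    ∃ b, (S.IsBoundarySide b ∨ b ∈ E) ∧ (S.cut E).tail b = (S.cut E).tail a := by
  let Q : D → Prop := fun a => ∃ b, (S.cut E).IsBoundarySide b ∧ (S.cut E).tail b = (S.cut E).tail a
  have key : Q g ↔ Q a := by
    refine EqvGen.iff_of_invariant (P := Q) ?_ (tail_eq_iff.1 h)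
    intro x y hxy
    -- When the step crosses `E`, both corners qualify: `y` begins its own fan, and `x` is the last
    -- corner of the fan at the head of the new boundary side `opp y`.
    by_cases hy : y ∈ E
    · refine iff_of_true ?_ ⟨y, (cut_isBoundarySide hE).2 (Or.inr hy), rfl⟩
      have hx : x = S.next (S.opp y) := hxy.eq_next
      obtain ⟨b, hb, hbx⟩ := exists_boundary_tail_eq_head (S := S.cut E) (b := S.opp y)
        ((cut_isBoundarySide hE).2 (Or.inr (hE y hy)))
      exact ⟨b, hb, by rw [hbx, hx]; rfl⟩
    · have := ((cut_rot_iff hE).2 ⟨hxy, hy⟩).tail_eq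
      simp only [Q, this]
  obtain ⟨b, hb, hba⟩ := key.1 ⟨g, (cut_isBoundarySide hE).2 hg, rfl⟩
  exact ⟨b, (cut_isBoundarySide hE).1 hb, hba⟩

theorem SameComp.cut_mono {E F : Set D} (hE : S.OppClosed E) (hF : S.OppClosed F) (hEF : E ⊆ F)
    {a b : D} (h : (S.cut F).SameComp a b) : (S.cut E).SameComp a b := by
  refine EqvGen.lift_of (f := id) ?_ h
  rintro x y (rfl | rfl)
  · exact (S.cut E).sameComp_next x
  · by_cases hx : x ∈ F
    · rw [cut_opp_of_mem hx]; exact EqvGen.refl _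
    · rw [cut_opp_of_notMem hF hx, ← cut_opp_of_notMem hE (fun h => hx (hEF h))]
      exact (S.cut E).sameComp_opp x

theorem cut_sameComp_opp {E : Set D} (hE : S.OppClosed E) {d : D} (h : d ∉ E) :
    (S.cut E).SameComp d (S.opp d) := by
  rw [← cut_opp_of_notMem hE h]; exact (S.cut E).sameComp_opp d

end CellSurface

/-! ### Distance functions and recursion along trees. -/

/-- The rank is the distance from `A`. A reachable point at positive distance has a predecessor one
step closer. The value at unreachable points is irrelevant. -/
theorem exists_rank {α : Type*} (r : α → α → Prop) (A : Set α) :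
    ∃ ρ : α → ℕ, ∀ x, x ∉ A → (∃ a ∈ A, ReflTransGen r a x) →
      ∃ y, r y x ∧ ρ y < ρ x ∧ ∃ a ∈ A, ReflTransGen r a y := by
  classical
  let R : ℕ → α → Prop := fun n => Nat.rec (fun x => x ∈ A) (fun _ ih x => ∃ y, ih y ∧ r y x) n
  have hR : ∀ n x, R n x → ∃ a ∈ A, ReflTransGen r a x := by
    intro n
    induction n with
    | zero => intro x hx; exact ⟨x, hx, .refl⟩
    | succ n ih =>
      rintro x ⟨y, hy, hyx⟩
      obtain ⟨a, ha, hay⟩ := ih y hy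
      exact ⟨a, ha, hay.tail hyx⟩
  have hR' : ∀ x, (∃ a ∈ A, ReflTransGen r a x) → ∃ n, R n x := by
    rintro x ⟨a, ha, hax⟩
    induction hax with
    | refl => exact ⟨0, ha⟩
    | tail _ h ih =>
      obtain ⟨n, hn⟩ := ih
      exact ⟨n + 1, _, hn, h⟩
  refine ⟨fun x => sInf {n | R n x}, fun x hxA hx => ?_⟩
  have hne : {n | R n x}.Nonempty := hR' x hx
  have hmem : R (sInf {n | R n x}) x := Nat.sInf_mem hne
  obtain ⟨m, hm⟩ : ∃ m, sInf {n | R n x} = m + 1 := by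
    cases hk : sInf {n | R n x} with
    | zero => rw [hk] at hmem; exact absurd hmem hxA
    | succ m => exact ⟨m, rfl⟩
  rw [hm] at hmem
  obtain ⟨y, hy, hyx⟩ := hmem
  refine ⟨y, hyx, ?_, hR m y hy⟩
  have : sInf {n | R n y} ≤ m := Nat.sInf_le hy
  show sInf {n | R n y} < sInf {n | R n x}
  omega

theorem exists_rec_of_rank {α X : Type*} (rank : α → ℕ) (par : α → α) (good : Set α)
    (h : ∀ n ∈ good, rank (par n) < rank n) (step : α → X → X) (x₀ : X) :
    ∃ P : α → X, (∀ n ∈ good, P n = step n (P (par n))) ∧ ∀ n ∉ good, P n = x₀ := by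
  classical
  let F : ∀ n, (∀ m, rank m < rank n → X) → X := fun n ih =>
    if hn : n ∈ good then step n (ih (par n) (h n hn)) else x₀
  refine ⟨(measure rank).wf.fix F, fun n hn => ?_, fun n hn => ?_⟩
  · rw [WellFounded.fix_eq]; simp only [F, dif_pos hn]
  · rw [WellFounded.fix_eq]; simp only [F, dif_neg hn]

/-! ### Peeling, spanning trees and the bound for the Euler characteristic. -/

namespace CellSurface

variable {D : Type*} {S : CellSurface D}

/-- An interior edge has two sides; a boundary edge has one, which the second summand counts again.
-/
theorem two_mul_ncard_edge [Finite D] {C : Set D} (hC : S.OppClosed C) :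
    2 * (S.edge '' C).ncard = C.ncard + {d ∈ C | S.IsBoundarySide d}.ncard := by
  classical
  have := Fintype.ofFinite D
  rw [Set.ncard_eq_toFinset_card' C, Set.ncard_eq_toFinset_card' (S.edge '' C),
    Set.ncard_eq_toFinset_card' {d ∈ C | S.IsBoundarySide d}]
  rw [Finset.card_eq_sum_card_fiberwise (f := S.edge) (s := C.toFinset)
      (t := (S.edge '' C).toFinset) (by intro x hx; simpa using ⟨x, by simpa using hx, rfl⟩),
    Finset.card_eq_sum_card_fiberwise (f := S.edge) (s := {d ∈ C | S.IsBoundarySide d}.toFinset)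
      (t := (S.edge '' C).toFinset) (by
        intro x hx
        simp only [Set.coe_toFinset, Set.mem_ofPred_eq] at hx
        simpa using ⟨x, hx.1, rfl⟩),
    ← Finset.sum_add_distrib, mul_comm, ← smul_eq_mul, ← Finset.sum_const]
  refine Finset.sum_congr rfl fun e he => ?_
  simp only [Set.mem_toFinset, Set.mem_image] at he
  obtain ⟨d, hd, rfl⟩ := he
  have h1 : C.toFinset.filter (fun x => S.edge x = S.edge d) = {d, S.opp d} := by
    ext x
    simp only [Finset.mem_filter, Set.mem_toFinset, Finset.mem_insert, Finset.mem_singleton]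
    constructor
    · rintro ⟨_, hx⟩
      rcases edge_eq_iff.1 hx.symm with h | h
      · exact Or.inl h.symm
      · exact Or.inr h
    · rintro (rfl | rfl)
      · exact ⟨hd, rfl⟩
      · exact ⟨hC _ hd, (edge_eq_iff.2 (Or.inr rfl)).symm⟩
  have h2 : {d ∈ C | S.IsBoundarySide d}.toFinset.filter (fun x => S.edge x = S.edge d) =
      if S.IsBoundarySide d then {d} else ∅ := by
    ext x
    simp only [Finset.mem_filter, Set.mem_toFinset, Set.mem_ofPred_eq]
    constructor
    · rintro ⟨⟨_, hx⟩, he⟩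
      have hxd : d = x := by
        rcases edge_eq_iff.1 he with h | h
        · exact h.symm
        · rw [h]; exact hx
      subst hxd
      simp [hx]
    · intro hx
      split_ifs at hx with hb
      · simp only [Finset.mem_singleton] at hx
        subst hx
        exact ⟨⟨hd, hb⟩, rfl⟩
      · simp at hx
  rw [h1, h2]
  split_ifs with hb
  · have : S.opp d = d := hb
    simp [this]
  · have : d ≠ S.opp d := fun h => hb h.symm
    simp [Finset.card_pair this]

/-- In a component with boundary, all interior edges can be removed one after the other, each together
with one corner next to it that is free by then. The remaining corners are as many as the edges, and
a property of corners which spreads from three corners of every interior edge to the fourth one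
spreads from them to the whole component. -/
theorem exists_peeling [Finite D] {b₀ : D} (hb₀ : S.IsBoundarySide b₀) :
    ∃ K ⊆ {c | S.SameComp b₀ c}, K.ncard = (S.edge '' {c | S.SameComp b₀ c}).ncard ∧
      ∀ Good : D → Prop, (∀ c ∈ K, Good c) →
        (∀ d, S.SameComp b₀ d → ¬ S.IsBoundarySide d → Good (S.next d) → Good (S.opp d) →
          Good (S.next (S.opp d)) → Good d) →
        (∀ d, S.SameComp b₀ d → ¬ S.IsBoundarySide d → Good d → Good (S.next d) →
          Good (S.opp d) → Good (S.next (S.opp d))) →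
        ∀ c, S.SameComp b₀ c → Good c := by
  classical
  set C : Set D := {c | S.SameComp b₀ c} with hCdef
  have hCopp : S.OppClosed C := fun d hd => SameComp.trans hd (S.sameComp_opp d)
  -- Two edges are adjacent if they meet in a corner of a polygon; `ρ` measures the distance from
  -- the boundary edge of `b₀`.
  let r : S.Edge → S.Edge → Prop := fun e e' =>
    ∃ d, (e = S.edge d ∧ e' = S.edge (S.next d)) ∨ (e = S.edge (S.next d) ∧ e' = S.edge d)
  obtain ⟨ρ, hρ⟩ := exists_rank r {S.edge b₀}
  have hreach : ∀ c ∈ C, ReflTransGen r (S.edge b₀) (S.edge c) := by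
    intro c hc
    refine (SameComp.of_closed (P := fun x => ReflTransGen r (S.edge b₀) (S.edge x)) ?_ ?_ hc).1
      .refl
    · intro d
      exact ⟨fun h => h.tail ⟨d, Or.inl ⟨rfl, rfl⟩⟩, fun h => h.tail ⟨d, Or.inr ⟨rfl, rfl⟩⟩⟩
    · intro d h
      have : S.edge (S.opp d) = S.edge d := (edge_eq_iff.2 (Or.inr rfl)).symm
      rwa [this]
  -- A corner lies between two edges and may be selected by the one that is farther away. Hence it
  -- is selected at most once, and each interior edge finds such a corner on its way towards `b₀`.
  let Sel : D → S.Edge → Prop := fun c q =>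
    (S.edge c = q ∧ ρ (S.edge (S.next.symm c)) < ρ q) ∨
      (S.edge (S.next.symm c) = q ∧ ρ (S.edge c) < ρ q)
  let C₁ : Set D := {d ∈ C | ¬ S.IsBoundarySide d}
  have hC₁opp : S.OppClosed C₁ := fun d hd =>
    ⟨hCopp d hd.1, by rw [isBoundarySide_opp]; exact hd.2⟩
  have hmemC₁ : ∀ c, S.edge c ∈ S.edge '' C₁ → c ∈ C₁ := by
    rintro c ⟨d, hd, h⟩
    rcases edge_eq_iff.1 h with rfl | rfl
    · exact hd
    · exact hC₁opp d hd
  have hsel : ∀ q ∈ S.edge '' C₁, ∃ c ∈ C, Sel c q := by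
    rintro q ⟨d, hd, rfl⟩
    obtain ⟨y, ⟨x, hx⟩, hlt, -⟩ := hρ (S.edge d) (by
      intro h
      rcases edge_eq_iff.1 h with rfl | h
      · exact hd.2 hb₀
      · apply hd.2; rw [← isBoundarySide_opp, ← h]; exact hb₀) ⟨_, rfl, hreach d hd.1⟩
    have aux : ∀ x, S.edge x = S.edge d → x ∈ C := fun x h => (hmemC₁ x (h ▸ ⟨d, hd, rfl⟩)).1
    rcases hx with ⟨rfl, hx⟩ | ⟨rfl, hx⟩
    · refine ⟨S.next x, aux _ hx.symm, Or.inl ⟨hx.symm, ?_⟩⟩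
      rwa [Equiv.symm_apply_apply]
    · refine ⟨S.next x, (aux x hx.symm).trans (S.sameComp_next x), Or.inr ⟨?_, hlt⟩⟩
      rw [Equiv.symm_apply_apply, hx]
  have hSel : ∀ c q q', Sel c q → Sel c q' → q = q' := by
    rintro c q q' (⟨rfl, h⟩ | ⟨rfl, h⟩) (⟨h1, h'⟩ | ⟨h1, h'⟩)
    · exact h1
    · subst h1; omega
    · subst h1; omega
    · exact h1
  have : Nonempty D := ⟨b₀⟩
  choose! sel hselC hselS using hsel
  have hinj : Set.InjOn sel (S.edge '' C₁) := fun q hq q' hq' h =>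
    hSel _ _ _ (hselS q hq) (h ▸ hselS q' hq')
  -- One corner is given up for each interior edge. There are as many corners as sides, namely two
  -- per interior edge and one per boundary edge, so one corner per edge remains.
  refine ⟨C \ sel '' (S.edge '' C₁), Set.sdiff_subset, ?_, ?_⟩
  · have h1 : sel '' (S.edge '' C₁) ⊆ C := by
      rintro _ ⟨q, hq, rfl⟩; exact hselC q hq
    have h2 := Set.ncard_sdiff_add_ncard_of_subset h1
    rw [hinj.ncard_image] at h2
    have h3 := two_mul_ncard_edge hCopp
    have h4 := two_mul_ncard_edge hC₁opp
    have h5 : {d ∈ C₁ | S.IsBoundarySide d} = ∅ := by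
      ext d; simp only [C₁, Set.mem_ofPred_eq, Set.mem_empty_iff_false, iff_false]; tauto
    rw [h5, Set.ncard_empty] at h4
    have h6 : C.ncard = C₁.ncard + {d ∈ C | S.IsBoundarySide d}.ncard := by
      rw [← Set.ncard_union_eq]
      · congr 1; ext d; simp only [C₁, Set.mem_union, Set.mem_ofPred_eq]; tauto
      · rw [Set.disjoint_left]; intro d h h'; exact h.2 h'.2
    omega
  · intro Good hK hq1 hq2
    obtain ⟨M, hM⟩ : ∃ M, ∀ q : S.Edge, ρ q ≤ M := by
      have : Finite S.Edge := Quotient.finite _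
      obtain ⟨M, hM⟩ := (Set.finite_range ρ).bddAbove
      exact ⟨M, fun q => hM ⟨q, rfl⟩⟩
    -- Start with the farthest edges: any other corner at `q` is unselected or selected by an edge
    -- farther away than `q`, hence is already known to be good.
    have hgood : ∀ m, ∀ q ∈ S.edge '' C₁, M - ρ q = m → Good (sel q) := by
      intro m
      induction m using Nat.strong_induction_on with
      | _ m ih =>
      intro q hq hqm
      have key : ∀ c' ∈ C, c' ≠ sel q → (S.edge c' = q ∨ S.edge (S.next.symm c') = q) →
          Good c' := by
        intro c' hc' hne ht
        by_cases hc : c' ∈ sel '' (S.edge '' C₁)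
        · obtain ⟨q', hq', rfl⟩ := hc
          have hqq : q' ≠ q := fun h => hne (h ▸ rfl)
          have hlt : ρ q < ρ q' := by
            rcases hselS q' hq' with ⟨h1, h2⟩ | ⟨h1, h2⟩ <;> rcases ht with h | h
            · exact absurd (h1.symm.trans h) hqq
            · rwa [h] at h2
            · rwa [h] at h2
            · exact absurd (h1.symm.trans h) hqq
          exact ih _ (by have := hM q'; omega) q' hq' rfl
        · exact hK c' ⟨hc', hc⟩
      rcases hselS q hq with ⟨h1, h2⟩ | ⟨h1, h2⟩
      · set c := sel q
        have hc : c ∈ C₁ := hmemC₁ c (h1 ▸ hq)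
        have hno : S.edge (S.next.symm c) ≠ q := fun h => by rw [h] at h2; omega
        have ho : S.edge (S.opp c) = q := by rw [← h1]; exact (edge_eq_iff.2 (Or.inr rfl)).symm
        refine hq1 c hc.1 hc.2 (key _ (SameComp.trans hc.1 (S.sameComp_next _)) ?_ (Or.inr ?_))
          (key _ (hCopp c hc.1) hc.2 (Or.inl ho))
          (key _ (SameComp.trans (hCopp c hc.1) (S.sameComp_next _)) ?_ (Or.inr ?_))
        · intro h; apply hno; rw [(Equiv.symm_apply_eq _).2 h.symm, h1]
        · rw [Equiv.symm_apply_apply, h1]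
        · intro h; apply hno; rw [(Equiv.symm_apply_eq _).2 h.symm, ho]
        · rw [Equiv.symm_apply_apply, ho]
      · set c := sel q
        set d' := S.next.symm c with hd'
        have hcd : c = S.next d' := by rw [hd', Equiv.apply_symm_apply]
        have hc : d' ∈ C₁ := hmemC₁ d' (h1 ▸ hq)
        have hno : S.edge c ≠ q := fun h => by rw [h] at h2; omega
        have ho : S.edge (S.opp d') = q := by rw [← h1]; exact (edge_eq_iff.2 (Or.inr rfl)).symm
        have h := hq2 (S.opp d') (hCopp _ hc.1) (by rw [isBoundarySide_opp]; exact hc.2)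
          (key _ (hCopp _ hc.1) (fun h => hno (h ▸ ho)) (Or.inl ho))
          (key _ (SameComp.trans (hCopp _ hc.1) (S.sameComp_next _)) ?_
            (Or.inr (by rw [Equiv.symm_apply_apply, ho])))
          (by rw [S.opp_opp]; exact key _ hc.1 (fun h => hno (h ▸ h1)) (Or.inl h1))
        · rwa [S.opp_opp, ← hcd] at h
        · rw [hcd]; intro h; exact hc.2 (S.next.injective h)
    intro c hc
    by_cases h : c ∈ sel '' (S.edge '' C₁)
    · obtain ⟨q, hq, rfl⟩ := h; exact hgood _ q hq rfl
    · exact hK c ⟨hc, h⟩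

/-- Consider the bipartite graph of polygons and vertices whose edges are the corners in `K`. It is
connected because the four corners at an interior edge form a cycle through its two polygons and its
two ends, so three of them connect what the fourth does. Distances from the vertex of `b₀` give a
spanning tree, with `par n` the parent of `n` and `k n` the corner leading there. -/
theorem exists_tree {b₀ : D} {C : Set D}
    (hC : C = {c | S.SameComp b₀ c}) {K : Set D}
    (hK : ∀ Good : D → Prop, (∀ c ∈ K, Good c) →
        (∀ d, S.SameComp b₀ d → ¬ S.IsBoundarySide d → Good (S.next d) → Good (S.opp d) →
          Good (S.next (S.opp d)) → Good d) →
        (∀ d, S.SameComp b₀ d → ¬ S.IsBoundarySide d → Good d → Good (S.next d) →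
          Good (S.opp d) → Good (S.next (S.opp d))) →
        ∀ c, S.SameComp b₀ c → Good c) :
    ∃ (rank : S.Face ⊕ S.Vertex → ℕ) (par : S.Face ⊕ S.Vertex → S.Face ⊕ S.Vertex)
      (k : S.Face ⊕ S.Vertex → D),
      ∀ n ∈ (Sum.inl '' (S.face '' C) ∪ Sum.inr '' (S.tail '' C)) \ {Sum.inr (S.tail b₀)},
        rank (par n) < rank n ∧ k n ∈ K ∧
        ((n = Sum.inr (S.tail (k n)) ∧ par n = Sum.inl (S.face (k n))) ∨
          (n = Sum.inl (S.face (k n)) ∧ par n = Sum.inr (S.tail (k n)))) := by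
  classical
  let r : S.Face ⊕ S.Vertex → S.Face ⊕ S.Vertex → Prop := fun n' n => ∃ c ∈ K,
    ((n = Sum.inr (S.tail c) ∧ n' = Sum.inl (S.face c)) ∨
          (n = Sum.inl (S.face c) ∧ n' = Sum.inr (S.tail c)))
  have hsymm : ∀ a b, EqvGen r a b → ReflTransGen r a b := by
    intro a b h
    induction h with
    | rel x y h => exact .single h
    | refl x => exact .refl
    | trans x y z _ _ h h' => exact h.trans h'
    | symm x y _ ih =>
      rw [← reflTransGen_swap]
      refine ReflTransGen.lift id ?_ _ _ ih
      rintro a b ⟨c, hc, h⟩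
      exact ⟨c, hc, by tauto⟩
  have hconn : ∀ c, S.SameComp b₀ c → EqvGen r (Sum.inl (S.face c)) (Sum.inr (S.tail c)) := by
    apply hK (fun c => EqvGen r (Sum.inl (S.face c)) (Sum.inr (S.tail c)))
    · intro c hc; exact EqvGen.rel _ _ ⟨c, hc, Or.inl ⟨rfl, rfl⟩⟩
    · intro d _ hd h1 h2 h3
      rw [face_next] at h1 h3
      rw [show S.tail (S.next (S.opp d)) = S.tail d from head_opp hd] at h3
      rw [tail_opp hd] at h2
      exact (h1.trans _ _ _ h2.symm).trans _ _ _ h3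
    · intro d _ hd h1 h2 h3
      rw [face_next] at h2 ⊢
      rw [show S.tail (S.next (S.opp d)) = S.tail d from head_opp hd]
      rw [tail_opp hd] at h3
      exact (h3.trans _ _ _ h2.symm).trans _ _ _ h1
  have hreach : ∀ c, S.SameComp b₀ c → EqvGen r (Sum.inr (S.tail b₀)) (Sum.inl (S.face c)) := by
    intro c hc
    refine ((SameComp.of_closed (P := fun x => S.SameComp b₀ x ∧
      EqvGen r (Sum.inr (S.tail b₀)) (Sum.inl (S.face x))) ?_ ?_ hc).1
      ⟨S.sameComp_refl _, (hconn b₀ (S.sameComp_refl _)).symm⟩).2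
    · intro d
      rw [face_next]
      exact and_congr_left fun _ => ⟨fun h => h.trans (S.sameComp_next d),
        fun h => h.trans (S.sameComp_next d).symm⟩
    · rintro d ⟨h, h'⟩
      refine ⟨h.trans (S.sameComp_opp d), ?_⟩
      by_cases hd : S.IsBoundarySide d
      · rwa [show S.opp d = d from hd]
      · have h2 := hconn (S.next (S.opp d)) ((h.trans (S.sameComp_opp d)).trans (S.sameComp_next _))
        rw [face_next, show S.tail (S.next (S.opp d)) = S.tail d from head_opp hd] at h2
        exact (h'.trans _ _ _ (hconn d h)).trans _ _ _ h2.symm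
  obtain ⟨rank, hrank⟩ := exists_rank r {Sum.inr (S.tail b₀)}
  have hex : ∀ n ∈ (Sum.inl '' (S.face '' C) ∪ Sum.inr '' (S.tail '' C)) \ {Sum.inr (S.tail b₀)},
      ∃ n' c, rank n' < rank n ∧ c ∈ K ∧ ((n = Sum.inr (S.tail c) ∧ n' = Sum.inl (S.face c)) ∨
          (n = Sum.inl (S.face c) ∧ n' = Sum.inr (S.tail c))) := by
    rintro n ⟨hn, hne⟩
    have hre : EqvGen r (Sum.inr (S.tail b₀)) n := by
      rcases hn with ⟨_, ⟨c, hc, rfl⟩, rfl⟩ | ⟨_, ⟨c, hc, rfl⟩, rfl⟩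
      · rw [hC] at hc; exact hreach c hc
      · rw [hC] at hc; exact (hreach c hc).trans _ _ _ (hconn c hc)
    obtain ⟨y, ⟨c, hc, h⟩, hlt, -⟩ := hrank n hne ⟨_, rfl, hsymm _ _ hre⟩
    exact ⟨y, c, hlt, hc, h⟩
  have : Nonempty D := ⟨b₀⟩
  have : Nonempty (S.Face ⊕ S.Vertex) := ⟨Sum.inl (S.face b₀)⟩
  choose! par k h using hex
  exact ⟨rank, par, k, h⟩

section EulerCount

/-- If one corner led from two different nodes to their parents, each of them would be the parent of
the other, against the decrease of the rank. -/
theorem injOn_parent {N : Set (S.Face ⊕ S.Vertex)} {rank : S.Face ⊕ S.Vertex → ℕ}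
    {par : S.Face ⊕ S.Vertex → S.Face ⊕ S.Vertex} {k : S.Face ⊕ S.Vertex → D}
    (h : ∀ n ∈ N, rank (par n) < rank n ∧
        ((n = Sum.inr (S.tail (k n)) ∧ par n = Sum.inl (S.face (k n))) ∨
          (n = Sum.inl (S.face (k n)) ∧ par n = Sum.inr (S.tail (k n))))) : Set.InjOn k N := by
  intro n hn n' hn' e
  obtain ⟨l1, h1⟩ := h n hn
  obtain ⟨l2, h2⟩ := h n' hn'
  rw [← e] at h2
  rcases h1 with ⟨a1, b1⟩ | ⟨a1, b1⟩ <;> rcases h2 with ⟨a2, b2⟩ | ⟨a2, b2⟩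
  · exact a1.trans a2.symm
  · rw [b1, ← a2] at l1; rw [b2, ← a1] at l2; omega
  · rw [b1, ← a2] at l1; rw [b2, ← a1] at l2; omega
  · exact a1.trans a2.symm

variable [Finite D]

instance : Finite S.Vertex := Quotient.finite _

theorem ncard_nodes {C : Set D} {b₀ : D} (hb : b₀ ∈ C) :
    (((Sum.inl '' (S.face '' C) ∪ Sum.inr '' (S.tail '' C)) \ {Sum.inr (S.tail b₀)} :
      Set (S.Face ⊕ S.Vertex)).ncard : ℤ) = (S.face '' C).ncard + (S.tail '' C).ncard - 1 := by
  have h1 : (Sum.inr (S.tail b₀) : S.Face ⊕ S.Vertex) ∈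
      Sum.inl '' (S.face '' C) ∪ Sum.inr '' (S.tail '' C) := Or.inr ⟨_, ⟨b₀, hb, rfl⟩, rfl⟩
  have h2 := Set.ncard_sdiff_singleton_add_one h1
  rw [Set.ncard_union_eq (by
    rw [Set.disjoint_left]; rintro _ ⟨_, _, rfl⟩ ⟨_, _, h⟩; cases h),
    Set.ncard_image_of_injective _ Sum.inl_injective,
    Set.ncard_image_of_injective _ Sum.inr_injective] at h2
  omega

/-- The spanning tree uses `|V| + |F| - 1` different corners, all of them among the `|E|` corners
that are left after peeling. -/
theorem euler_le_one {b₀ : D} (hb₀ : S.IsBoundarySide b₀) :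
    S.euler {c | S.SameComp b₀ c} ≤ 1 := by
  obtain ⟨K, hKC, hcard, hK⟩ := exists_peeling hb₀
  obtain ⟨rank, par, k, h⟩ := exists_tree rfl hK
  have hle := Set.ncard_le_ncard_of_injOn k (fun n hn => (h n hn).2.1)
    (injOn_parent fun n hn => ⟨(h n hn).1, (h n hn).2.2⟩) (Set.toFinite K)
  have hn := ncard_nodes (S := S) (C := {c | S.SameComp b₀ c}) (S.sameComp_refl b₀)
  rw [hcard] at hle
  unfold euler
  omega

/-- A transport system along the corners of a component of Euler characteristic one can be
integrated. -/
theorem exists_potential {b₀ : D} (hb₀ : S.IsBoundarySide b₀)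
    (hχ : S.euler {c | S.SameComp b₀ c} = 1) {X : Type*} (x₀ : X) (fv vf : D → X → X)
    (Val : S.Face ⊕ S.Vertex → X → Prop) (h₀ : Val (Sum.inr (S.tail b₀)) x₀)
    (hfv : ∀ c x, S.SameComp b₀ c → Val (Sum.inl (S.face c)) x →
      Val (Sum.inr (S.tail c)) (fv c x))
    (hvf : ∀ c x, S.SameComp b₀ c → Val (Sum.inr (S.tail c)) x →
      Val (Sum.inl (S.face c)) (vf c x)) :
    ∃ P : S.Face ⊕ S.Vertex → X, P (Sum.inr (S.tail b₀)) = x₀ ∧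
      (∀ c, S.SameComp b₀ c → Val (Sum.inl (S.face c)) (P (Sum.inl (S.face c))) ∧
        Val (Sum.inr (S.tail c)) (P (Sum.inr (S.tail c)))) ∧
      ∀ Good : D → Prop, (∀ c, S.SameComp b₀ c →
          (P (Sum.inr (S.tail c)) = fv c (P (Sum.inl (S.face c))) ∨
            P (Sum.inl (S.face c)) = vf c (P (Sum.inr (S.tail c)))) → Good c) →
        (∀ d, S.SameComp b₀ d → ¬ S.IsBoundarySide d → Good (S.next d) → Good (S.opp d) →
          Good (S.next (S.opp d)) → Good d) →
        (∀ d, S.SameComp b₀ d → ¬ S.IsBoundarySide d → Good d → Good (S.next d) →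
          Good (S.opp d) → Good (S.next (S.opp d))) →
        ∀ c, S.SameComp b₀ c → Good c := by
  classical
  obtain ⟨K, hKC, hcard, hK⟩ := exists_peeling hb₀
  obtain ⟨rank, par, k, h⟩ := exists_tree rfl hK
  set C : Set D := {c | S.SameComp b₀ c} with hC
  set N : Set (S.Face ⊕ S.Vertex) :=
    (Sum.inl '' (S.face '' C) ∪ Sum.inr '' (S.tail '' C)) \ {Sum.inr (S.tail b₀)} with hN
  have hn := ncard_nodes (S := S) (C := C) (S.sameComp_refl b₀)
  rw [← hN] at hn
  have hle : K.ncard ≤ N.ncard := by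
    unfold euler at hχ
    rw [hcard]
    omega
  -- Equality in the count: every remaining corner belongs to the tree. There the transport holds by
  -- construction, and it spreads to the other corners by peeling.
  have hsurj : ∀ c ∈ K, ∃ n ∈ N, k n = c := by
    intro c hc
    have hinj := injOn_parent (S := S) fun n hn => ⟨(h n hn).1, (h n hn).2.2⟩
    have hsub : k '' N ⊆ K := by rintro _ ⟨n, hn, rfl⟩; exact (h n hn).2.1
    have heq : k '' N = K := Set.eq_of_subset_of_ncard_le hsub
      (by rw [hinj.ncard_image]; exact hle) (Set.toFinite K)
    rw [← heq] at hc
    exact hc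
  -- The potential is defined by transport along the tree, starting with `x₀` at the root.
  obtain ⟨P, hP, hP0⟩ := exists_rec_of_rank rank par N (fun n hn => (h n hn).1)
    (fun n x => Sum.elim (fun _ => vf (k n) x) (fun _ => fv (k n) x) n) x₀
  have hinl : ∀ n x v, n = Sum.inl v →
      Sum.elim (fun _ => vf (k n) x) (fun _ => fv (k n) x) n = vf (k n) x := by
    rintro _ x v rfl; rfl
  have hinr : ∀ n x v, n = Sum.inr v →
      Sum.elim (fun _ => vf (k n) x) (fun _ => fv (k n) x) n = fv (k n) x := by
    rintro _ x v rfl; rfl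
  have hroot : P (Sum.inr (S.tail b₀)) = x₀ := hP0 _ (fun hmem => hmem.2 rfl)
  have hmemN : ∀ c, S.SameComp b₀ c → (Sum.inl (S.face c) : S.Face ⊕ S.Vertex) ∈ N := by
    intro c hc
    exact ⟨Or.inl ⟨_, ⟨c, hc, rfl⟩, rfl⟩, fun h => by cases h⟩
  have hVal : ∀ m, ∀ n, rank n = m → (n ∈ N ∨ n = Sum.inr (S.tail b₀)) → Val n (P n) := by
    intro m
    induction m using Nat.strong_induction_on with
    | _ m ih =>
    intro n hnm hn
    rcases hn with hn | rfl
    · obtain ⟨hlt, hkK, hk⟩ := h n hn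
      have hkC : S.SameComp b₀ (k n) := hKC hkK
      have hpar : Val (par n) (P (par n)) := by
        refine ih _ (hnm ▸ hlt) _ rfl ?_
        by_cases hp : par n = Sum.inr (S.tail b₀)
        · exact Or.inr hp
        · refine Or.inl ⟨?_, hp⟩
          rcases hk with ⟨-, e⟩ | ⟨-, e⟩
          · rw [e]; exact Or.inl ⟨_, ⟨_, hkC, rfl⟩, rfl⟩
          · rw [e]; exact Or.inr ⟨_, ⟨_, hkC, rfl⟩, rfl⟩
      rw [hP n hn]
      rcases hk with ⟨e1, e2⟩ | ⟨e1, e2⟩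
      · rw [e2] at hpar ⊢
        have := hfv _ _ hkC hpar
        rw [← e1] at this
        rw [hinr n _ _ e1]; exact this
      · rw [e2] at hpar ⊢
        have := hvf _ _ hkC hpar
        rw [← e1] at this
        rw [hinl n _ _ e1]; exact this
    · rwa [hroot]
  refine ⟨P, hroot, fun c hc => ⟨hVal _ _ rfl (Or.inl (hmemN c hc)), hVal _ _ rfl ?_⟩, ?_⟩
  · by_cases hp : (Sum.inr (S.tail c) : S.Face ⊕ S.Vertex) = Sum.inr (S.tail b₀)
    · exact Or.inr hp
    · exact Or.inl ⟨Or.inr ⟨_, ⟨c, hc, rfl⟩, rfl⟩, hp⟩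
  · intro Good hg
    refine hK Good fun c hc => hg c (hKC hc) ?_
    obtain ⟨n, hn, rfl⟩ := hsurj c hc
    obtain ⟨-, -, ⟨e1, e2⟩ | ⟨e1, e2⟩⟩ := h n hn
    · left
      have hPn := hP n hn
      rw [e2] at hPn
      rw [hinr n _ _ e1] at hPn
      rw [← e1]; exact hPn
    · right
      have hPn := hP n hn
      rw [e2] at hPn
      rw [hinl n _ _ e1] at hPn
      rw [← e1]; exact hPn

end EulerCount

end CellSurface

/-! ### Calculus of curves and homotopies. -/

namespace MarkedCells

variable {D : Type*} {S : MarkedCells D}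

variable (S) in
/-- The point is not a puncture. -/
def Avoids (x : S.Vertex ⊕ S.Edge) : Prop := ∀ v ∈ S.punctures, x ≠ Sum.inl v

/-- The curve traversed backwards. -/
def rev (l : List (Station D × Station D)) : List (Station D × Station D) :=
  l.reverse.map Prod.swap

@[simp] theorem rev_rev (l : List (Station D × Station D)) : rev (rev l) = l := by
  simp [rev]

theorem rev_append (l m : List (Station D × Station D)) : rev (l ++ m) = rev m ++ rev l := by
  simp [rev]

/-- The junction is an interior point of the curve, and so has to avoid the punctures, only when
both parts are non-empty. -/
theorem isCurve_append {a c : S.Vertex ⊕ S.Edge} {l m : List (Station D × Station D)} :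
    S.IsCurve a (l ++ m) c ↔ ∃ b, S.IsCurve a l b ∧ S.IsCurve b m c ∧
      (l = [] ∨ m = [] ∨ S.Avoids b) := by
  induction l generalizing a with
  | nil => simp [IsCurve]
  | cons x l ih =>
    simp only [List.cons_append, IsCurve, ih]
    constructor
    · rintro ⟨h1, h2, h3, b, h4, h5, h6⟩
      refine ⟨b, ⟨h1, h2, ?_, h4⟩, h5, ?_⟩
      · rcases h3 with h3 | h3
        · left; exact (List.append_eq_nil_iff.1 h3).1
        · exact Or.inr h3
      · rcases h3 with h3 | h3
        · right; left; exact (List.append_eq_nil_iff.1 h3).2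
        · rcases h6 with rfl | h6
          · right; right
            have : S.point x.2 = b := h4
            rw [← this]; exact h3
          · exact Or.inr h6
    · rintro ⟨b, ⟨h1, h2, h3, h4⟩, h5, h6⟩
      refine ⟨h1, h2, ?_, b, h4, h5, ?_⟩
      · rcases h3 with rfl | h3
        · have : S.point x.2 = b := h4
          rcases h6 with h | rfl | h
          · cases h
          · exact Or.inl rfl
          · right; rw [this]; exact h
        · exact Or.inr h3
      · rcases h6 with h | h
        · cases h
        · exact Or.inr h

theorem IsCurve.append {a b c : S.Vertex ⊕ S.Edge} {l m : List (Station D × Station D)}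
    (hl : S.IsCurve a l b) (hm : S.IsCurve b m c) (hb : S.Avoids b) : S.IsCurve a (l ++ m) c :=
  isCurve_append.2 ⟨b, hl, hm, Or.inr (Or.inr hb)⟩

theorem isCurve_single {x y : Station D} (h : S.face x.side = S.face y.side) :
    S.IsCurve (S.point x) [(x, y)] (S.point y) := ⟨rfl, h, Or.inl rfl, rfl⟩

theorem isCurve_pair {x y z w : Station D} (h : S.face x.side = S.face y.side)
    (h' : S.face z.side = S.face w.side) (hyz : S.point y = S.point z) (hy : S.Avoids (S.point y)) :
    S.IsCurve (S.point x) [(x, y), (z, w)] (S.point w) :=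
  ⟨rfl, h, Or.inr hy, hyz.symm, h', Or.inl rfl, rfl⟩

theorem IsCurve.unique {a b a' b' : S.Vertex ⊕ S.Edge} {l : List (Station D × Station D)}
    (h : S.IsCurve a l b) (h' : S.IsCurve a' l b') (hl : l ≠ []) : a = a' ∧ b = b' := by
  induction l generalizing a a' with
  | nil => exact absurd rfl hl
  | cons x l ih =>
    obtain ⟨h1, -, -, h4⟩ := h
    obtain ⟨h1', -, -, h4'⟩ := h'
    refine ⟨h1.symm.trans h1', ?_⟩
    by_cases hn : l = []
    · subst hn; exact h4.symm.trans h4'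
    · exact (ih h4 h4' hn).2

theorem IsCurve.rev {a b : S.Vertex ⊕ S.Edge} {l : List (Station D × Station D)}
    (h : S.IsCurve a l b) : S.IsCurve b (rev l) a := by
  induction l generalizing a with
  | nil => exact h.symm
  | cons x l ih =>
    obtain ⟨h1, h2, h3, h4⟩ := h
    have : MarkedCells.rev (x :: l) = MarkedCells.rev l ++ [x.swap] := by simp [MarkedCells.rev]
    rw [this, isCurve_append]
    refine ⟨S.point x.2, ih h4, ⟨rfl, h2.symm, Or.inl rfl, h1⟩, ?_⟩
    rcases h3 with rfl | h3
    · left; rfl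
    · right; right; exact h3

theorem Move.rev {u v : List (Station D × Station D)} (h : S.Move u v) :
    S.Move (rev u) (rev v) := by
  cases h with
  | const x => exact Move.const x
  | comp x y z h h' => exact Move.comp z y x h'.symm h.symm
  | out d h => exact Move.back d h
  | back d h => exact Move.out d h

namespace Homotopic

theorem refl (a b : S.Vertex ⊕ S.Edge) (l : List (Station D × Station D)) :
    S.Homotopic a b l l := EqvGen.refl l

theorem symm {a b : S.Vertex ⊕ S.Edge} {l m : List (Station D × Station D)}
    (h : S.Homotopic a b l m) : S.Homotopic a b m l := EqvGen.symm _ _ h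

theorem trans {a b : S.Vertex ⊕ S.Edge} {l m n : List (Station D × Station D)}
    (h : S.Homotopic a b l m) (h' : S.Homotopic a b m n) : S.Homotopic a b l n :=
  EqvGen.trans _ _ _ h h'

theorem isCurve_iff {a b : S.Vertex ⊕ S.Edge} {l m : List (Station D × Station D)}
    (h : S.Homotopic a b l m) : S.IsCurve a l b ↔ S.IsCurve a m b :=
  EqvGen.iff_of_invariant (fun _ _ h => iff_of_true h.1 h.2.1) h

/-- The generated equivalence relation also relates each list, curve or not, to itself; this
separates the trivial case from the genuine one. -/
theorem eq_or_isCurve {a b : S.Vertex ⊕ S.Edge} {l m : List (Station D × Station D)}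
    (h : S.Homotopic a b l m) : l = m ∨ (S.IsCurve a l b ∧ S.IsCurve a m b) := by
  induction h with
  | rel x y h => exact Or.inr ⟨h.1, h.2.1⟩
  | refl => exact Or.inl rfl
  | symm x y _ ih => rcases ih with rfl | ⟨h, h'⟩; exacts [Or.inl rfl, Or.inr ⟨h', h⟩]
  | trans x y z _ _ ih ih' =>
    rcases ih with rfl | ⟨h, h'⟩
    · exact ih'
    · rcases ih' with rfl | ⟨_, h''⟩
      · exact Or.inr ⟨h, h'⟩
      · exact Or.inr ⟨h, h''⟩

theorem of_move {a b : S.Vertex ⊕ S.Edge} {u v : List (Station D × Station D)}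
    (h : S.Move u v) (hu : S.IsCurve a u b) (hv : S.IsCurve a v b) : S.Homotopic a b u v :=
  EqvGen.rel _ _ ⟨hu, hv, [], [], u, v, h, by simp, by simp⟩

theorem append_right {a b c : S.Vertex ⊕ S.Edge} {l l' m : List (Station D × Station D)}
    (h : S.Homotopic a b l l') (hm : S.IsCurve b m c) (hb : S.Avoids b) :
    S.Homotopic a c (l ++ m) (l' ++ m) := by
  refine EqvGen.lift_of (f := fun x => x ++ m) ?_ h
  rintro x y ⟨hx, hy, p, q, u, v, huv, rfl, rfl⟩
  exact EqvGen.rel _ _ ⟨hx.append hm hb, hy.append hm hb, p, q ++ m, u, v, huv,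
    by simp, by simp⟩

theorem append_left {a b c : S.Vertex ⊕ S.Edge} {p l l' : List (Station D × Station D)}
    (hp : S.IsCurve a p b) (hb : S.Avoids b) (h : S.Homotopic b c l l') :
    S.Homotopic a c (p ++ l) (p ++ l') := by
  refine EqvGen.lift_of (f := fun x => p ++ x) ?_ h
  rintro x y ⟨hx, hy, p', q, u, v, huv, rfl, rfl⟩
  exact EqvGen.rel _ _ ⟨hp.append hx hb, hp.append hy hb, p ++ p', q, u, v, huv,
    by simp, by simp⟩

theorem rev {a b : S.Vertex ⊕ S.Edge} {l m : List (Station D × Station D)}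
    (h : S.Homotopic a b l m) : S.Homotopic b a (rev l) (rev m) := by
  refine EqvGen.lift_of (f := MarkedCells.rev) ?_ h
  rintro x y ⟨hx, hy, p, q, u, v, huv, rfl, rfl⟩
  refine EqvGen.rel _ _ ⟨hx.rev, hy.rev, MarkedCells.rev q, MarkedCells.rev p, MarkedCells.rev u,
    MarkedCells.rev v, huv.rev, ?_, ?_⟩ <;> simp [rev_append]

theorem comp {x y z : Station D} (h : S.face x.side = S.face y.side)
    (h' : S.face y.side = S.face z.side) (hy : S.Avoids (S.point y)) :
    S.Homotopic (S.point x) (S.point z) [(x, y), (y, z)] [(x, z)] :=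
  of_move (Move.comp x y z h h') (isCurve_pair h h' rfl hy) (isCurve_single (h.trans h'))

theorem cancel {x y : Station D} (h : S.face x.side = S.face y.side)
    (hy : S.Avoids (S.point y)) :
    S.Homotopic (S.point x) (S.point x) [(x, y), (y, x)] [] :=
  (comp h h.symm hy).trans (of_move (Move.const x) (isCurve_single rfl) rfl)

theorem avoids_mid (d : D) : S.Avoids (S.point (.mid d)) := fun _ _ h => by cases h

/-- An interior edge is the same chord in both adjacent polygons. -/
theorem flip {d : D} (hd : ¬ S.IsBoundarySide d) :
    S.Homotopic (Sum.inl (S.tail d)) (Sum.inl (S.head d))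
      [(.corner d, .corner (S.next d))]
      [(.corner (S.next (S.opp d)), .corner (S.opp d))] := by
  have e1 : S.point (.corner (S.next (S.opp d))) = S.point (.corner d) :=
    congrArg Sum.inl (CellSurface.head_opp hd)
  have e2 : S.point (.corner (S.opp d)) = S.point (.corner (S.next d)) :=
    congrArg Sum.inl (CellSurface.tail_opp hd)
  have e3 : S.point (.mid (S.opp d)) = S.point (.mid d) :=
    congrArg Sum.inr (CellSurface.edge_eq_iff.2 (Or.inr rfl)).symm
  have f1 : S.face (S.next d) = S.face d := S.face_next d
  have f2 : S.face (S.next (S.opp d)) = S.face (S.opp d) := S.face_next _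
  -- The elementary moves concern half edges: split the edge at its midpoint, carry each half to the
  -- other polygon and compose again there.
  have h1 : S.Homotopic (S.point (.corner d)) (S.point (.corner (S.next d)))
      [(.corner d, .corner (S.next d))] [(.corner d, .mid d), (.mid d, .corner (S.next d))] :=
    (comp (x := .corner d) (y := .mid d) (z := .corner (S.next d)) rfl f1.symm
      (avoids_mid d)).symm
  have h2 : S.Homotopic (S.point (.corner d)) (S.point (.mid d)) [(.corner d, .mid d)]
      [(.corner (S.next (S.opp d)), .mid (S.opp d))] :=
    of_move (Move.out d hd) (isCurve_single rfl) ⟨e1, f2, Or.inl rfl, e3⟩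
  have h3 : S.Homotopic (S.point (.mid d)) (S.point (.corner (S.next d)))
      [(.mid d, .corner (S.next d))] [(.mid (S.opp d), .corner (S.opp d))] := by
    have hm := Move.back (S := S) (S.opp d) (by rw [S.opp_opp]; exact fun h => hd h.symm)
    rw [S.opp_opp] at hm
    exact (of_move hm ⟨e3, rfl, Or.inl rfl, e2⟩ (isCurve_single f1.symm)).symm
  have h4 : S.Homotopic (S.point (.corner d)) (S.point (.corner (S.next d)))
      [(.corner (S.next (S.opp d)), .mid (S.opp d)), (.mid (S.opp d), .corner (S.opp d))]
      [(.corner (S.next (S.opp d)), .corner (S.opp d))] := by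
    rw [← e1, ← e2]
    exact comp f2 rfl (avoids_mid _)
  refine h1.trans (.trans ?_ h4)
  refine (append_right (m := [(.mid d, .corner (S.next d))]) h2 (isCurve_single f1.symm)
    (avoids_mid d)).trans ?_
  exact append_left (p := [(.corner (S.next (S.opp d)), .mid (S.opp d))])
    ⟨e1, f2, Or.inl rfl, e3⟩ (avoids_mid d) h3

theorem append_rev {a b : S.Vertex ⊕ S.Edge} {l : List (Station D × Station D)}
    (h : S.IsCurve a l b) (hb : S.Avoids b) : S.Homotopic a a (l ++ MarkedCells.rev l) [] := by
  induction l generalizing a with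
  | nil => exact refl _ _ _
  | cons x l ih =>
    obtain ⟨h1, h2, h3, h4⟩ := h
    subst h1
    have e : x :: l ++ MarkedCells.rev (x :: l) =
        [x] ++ (l ++ MarkedCells.rev l) ++ [x.swap] := by simp [MarkedCells.rev]
    have hx : S.Avoids (S.point x.2) := by
      rcases h3 with rfl | h3
      · rwa [show S.point x.2 = b from h4]
      · exact h3
    rw [e]
    refine (append_right (b := S.point x.2) (append_left (isCurve_single h2) hx (ih h4))
      (m := [x.swap]) (isCurve_single h2.symm) hx).trans ?_
    exact cancel h2 hx

theorem of_append_null {a b : S.Vertex ⊕ S.Edge} {l m : List (Station D × Station D)}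
    (hl : S.IsCurve a l b) (hm : S.IsCurve b m a) (ha : S.Avoids a) (hb : S.Avoids b)
    (h : S.Homotopic a a (l ++ m) []) : S.Homotopic a b l (MarkedCells.rev m) := by
  have h1 : S.Homotopic a b (l ++ (m ++ MarkedCells.rev m)) (l ++ []) :=
    append_left hl hb (append_rev hm ha)
  have h2 : S.Homotopic a b (l ++ m ++ MarkedCells.rev m) ([] ++ MarkedCells.rev m) :=
    append_right h hm.rev ha
  rw [List.append_nil] at h1
  rw [← List.append_assoc] at h1
  exact h1.symm.trans h2

end Homotopic

/-! ### Edge paths -/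

variable (S) in
/-- The edge path traversed backwards. -/
def revPath (l : List D) : List D := (l.map S.opp).reverse

theorem curve_append (l m : List D) : S.curve (l ++ m) = S.curve l ++ S.curve m := by
  simp [curve]

theorem curve_ne_nil {l : List D} (h : l ≠ []) : S.curve l ≠ [] := by
  simpa [curve] using h

/-- The curve run backwards uses the same sides in the same polygons, while the reversed path uses
the sides glued to them; `Homotopic.flip` passes from one to the other edge by edge. -/
theorem homotopic_curve_revPath {l : List D} {a b : S.Vertex ⊕ S.Edge}
    (hi : ∀ d ∈ l, ¬ S.IsBoundarySide d) (h : S.IsCurve a (S.curve l) b) :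
    S.Homotopic b a (rev (S.curve l)) (S.curve (S.revPath l)) := by
  induction l generalizing a with
  | nil => exact Homotopic.refl _ _ _
  | cons d l ih =>
    have hd := hi d List.mem_cons_self
    obtain ⟨h1, -, h3, h4⟩ := h
    have hih := ih (fun x hx => hi x (List.mem_cons_of_mem _ hx)) h4
    have e1 : rev (S.curve (d :: l)) =
        rev (S.curve l) ++ [(.corner (S.next d), .corner d)] := by simp [rev, curve]
    have e2 : S.curve (S.revPath (d :: l)) =
        S.curve (S.revPath l) ++ [(.corner (S.opp d), .corner (S.next (S.opp d)))] := by
      simp [revPath, curve]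
    have hf : S.Homotopic (Sum.inl (S.head d)) (Sum.inl (S.tail d))
        [(.corner (S.next d), .corner d)] [(.corner (S.opp d), .corner (S.next (S.opp d)))] :=
      (Homotopic.flip hd).rev
    have hs : S.IsCurve (Sum.inl (S.head d)) [(.corner (S.next d), .corner d)] a :=
      h1 ▸ isCurve_single (x := .corner (S.next d)) (y := .corner d) (S.face_next d)
    have hs' : S.IsCurve (Sum.inl (S.head d))
        [(.corner (S.opp d), .corner (S.next (S.opp d)))] a := by
      have e : a = Sum.inl (S.tail d) := h1.symm
      subst e
      exact hf.isCurve_iff.1 hs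
    rw [e1, e2]
    rcases h3 with h3 | h3
    · have hl : l = [] := by simpa [curve] using h3
      subst hl
      have e : a = Sum.inl (S.tail d) := h1.symm
      have e' : b = Sum.inl (S.head d) := h4.symm
      subst e e'
      exact hf
    · have e : a = Sum.inl (S.tail d) := h1.symm
      subst e
      exact (hih.append_right hs h3).trans
        (Homotopic.append_left (hih.isCurve_iff.1 h4.rev) h3 hf)

theorem isCurve_curve {l : List D} (hl : l ≠ [])
    (hc : l.IsChain fun d d' => S.head d = S.tail d')
    (hp : ∀ d ∈ l.tail, S.tail d ∉ S.punctures) :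
    S.IsCurve (Sum.inl (S.tail (l.head hl))) (S.curve l) (Sum.inl (S.head (l.getLast hl))) := by
  induction l with
  | nil => exact absurd rfl hl
  | cons d l ih =>
    refine ⟨rfl, (S.face_next d).symm, ?_, ?_⟩
    · cases l with
      | nil => exact Or.inl rfl
      | cons d' l =>
        right
        intro v hv h
        rw [List.isChain_cons_cons] at hc
        apply hp d' (by simp)
        rw [← hc.1]
        have : S.head d = v := Sum.inl_injective h
        rwa [this]
    · cases l with
      | nil => rfl
      | cons d' l =>
        rw [List.isChain_cons_cons] at hc
        have := ih (by simp) hc.2 (fun x hx => hp x (by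
          simp only [List.tail_cons] at hx ⊢; exact List.mem_cons_of_mem _ hx))
        simp only [List.head_cons] at this
        have e : S.point (Station.corner (S.next d)) = Sum.inl (S.tail d') := congrArg Sum.inl hc.1
        show S.IsCurve (S.point (Station.corner (S.next d))) _ _
        rw [e, List.getLast_cons (by simp)]
        exact this

theorem SameArc.symm {l m : List D} (h : S.SameArc l m) : S.SameArc m l := by
  obtain ⟨a, b, h | h⟩ := h
  · exact ⟨a, b, Or.inl h.symm⟩
  · refine ⟨b, a, Or.inr ?_⟩
    have := h.rev.symm
    rwa [show List.map Prod.swap (S.curve m).reverse = rev (S.curve m) from rfl, rev_rev] at this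

theorem sameArc_refl (d : D) (l : List D) : S.SameArc l l :=
  ⟨Sum.inl (S.tail d), Sum.inl (S.tail d), Or.inl (Homotopic.refl _ _ _)⟩

/-- A non-empty middle path determines the end points of both homotopies, up to the choice of its
direction, so that they can be composed. -/
theorem SameArc.trans {l m n : List D} (hm : m ≠ []) (h : S.SameArc l m) (h' : S.SameArc m n) :
    S.SameArc l n := by
  obtain ⟨a, b, h⟩ := h
  obtain ⟨a', b', h'⟩ := h'
  change S.Homotopic a b (S.curve l) (S.curve m) ∨
    S.Homotopic a b (S.curve l) (rev (S.curve m)) at h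
  change S.Homotopic a' b' (S.curve m) (S.curve n) ∨
    S.Homotopic a' b' (S.curve m) (rev (S.curve n)) at h'
  have hmc := curve_ne_nil (S := S) hm
  have hmr : rev (S.curve m) ≠ [] := by simpa [rev] using hmc
  have key : ∀ {a b : S.Vertex ⊕ S.Edge}, S.Homotopic a b (S.curve m) (S.curve n) →
      S.Homotopic b a (rev (S.curve m)) (rev (S.curve n)) := fun h => h.rev
  have key' : ∀ {a b : S.Vertex ⊕ S.Edge}, S.Homotopic a b (S.curve m) (rev (S.curve n)) →
      S.Homotopic b a (rev (S.curve m)) (S.curve n) := fun h => by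
    have := h.rev; rwa [rev_rev] at this
  have glue : ∀ {a b a' b' : S.Vertex ⊕ S.Edge} {x y z : List (Station D × Station D)},
      y ≠ [] → S.Homotopic a b x y → S.Homotopic a' b' y z →
      ∃ a b, S.Homotopic a b x z := by
    intro a b a' b' x y z hy h h'
    rcases h.eq_or_isCurve with rfl | ⟨_, h1⟩
    · exact ⟨_, _, h'⟩
    · rcases h'.eq_or_isCurve with rfl | ⟨h2, _⟩
      · exact ⟨_, _, h⟩
      · obtain ⟨rfl, rfl⟩ := h1.unique h2 hy
        exact ⟨_, _, h.trans h'⟩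
  rcases h with h | h <;> rcases h' with h' | h'
  · obtain ⟨a, b, h⟩ := glue hmc h h'; exact ⟨a, b, Or.inl h⟩
  · obtain ⟨a, b, h⟩ := glue hmc h h'; exact ⟨a, b, Or.inr h⟩
  · obtain ⟨a, b, h⟩ := glue hmr h (key h'); exact ⟨a, b, Or.inr h⟩
  · obtain ⟨a, b, h⟩ := glue hmr h (key' h'); exact ⟨a, b, Or.inl h⟩

/-! ### Discs are simply connected -/

section Disc

variable [Finite D]

/-- The potential assigns to every vertex a curve from the base point, transport being the appending
of chords. A corner is good if going through its polygon gives, up to homotopy, the curve of its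
vertex. Since an interior edge is the same chord on both sides, goodness of three corners at it
implies that of the fourth. -/
theorem exists_homotopy_potential (hp : S.punctures = ∅) {b₀ : D} (hb₀ : S.IsBoundarySide b₀)
    (hχ : S.euler {c | S.SameComp b₀ c} = 1) :
    ∃ P : S.Vertex → List (Station D × Station D), P (S.tail b₀) = [] ∧
      (∀ c, S.SameComp b₀ c →
        S.IsCurve (Sum.inl (S.tail b₀)) (P (S.tail c)) (Sum.inl (S.tail c))) ∧
      ∀ d, S.SameComp b₀ d → S.Homotopic (Sum.inl (S.tail b₀)) (Sum.inl (S.head d))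
        (P (S.tail d) ++ [(.corner d, .corner (S.next d))]) (P (S.head d)) := by
  have hav : ∀ x, S.Avoids x := fun x v hv => by rw [hp] at hv; exact hv.elim
  set a : S.Vertex ⊕ S.Edge := Sum.inl (S.tail b₀) with ha
  -- A polygon is represented by one chosen corner.
  let o : D → Station D := fun d => .corner (Quotient.out (S.face d))
  have ho : ∀ d, S.face (o d).side = S.face d := fun d => Quotient.out_eq (S.face d)
  have hoe : ∀ d e, S.face d = S.face e → o d = o e := fun d e h => by
    show Station.corner (Quotient.out (S.face d)) = _
    rw [h]
  obtain ⟨P, hP0, hPv, hP⟩ := CellSurface.exists_potential hb₀ hχ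
    (X := List (Station D × Station D)) []
    (fun c x => x ++ [(o c, .corner c)]) (fun c x => x ++ [(.corner c, o c)])
    (fun n x => Sum.elim (fun F => S.IsCurve a x (Sum.inl (S.tail (Quotient.out F))))
      (fun v => S.IsCurve a x (Sum.inl v)) n) rfl
    (fun c x _ hx => by
      have h : S.IsCurve a x (S.point (o c)) := hx
      exact h.append (isCurve_single (x := o c) (y := .corner c) (ho c)) (hav _))
    (fun c x _ hx => by
      have h : S.IsCurve a x (S.point (.corner c)) := hx
      exact h.append (isCurve_single (x := .corner c) (y := o c) (ho c).symm) (hav _))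
  let PF : D → List (Station D × Station D) := fun d => P (Sum.inl (S.face d))
  have hPF : ∀ d, S.SameComp b₀ d → S.IsCurve a (PF d) (S.point (o d)) := fun d hd => (hPv d hd).1
  have hPV : ∀ d, S.SameComp b₀ d →
      S.IsCurve a (P (Sum.inr (S.tail d))) (S.point (.corner d)) := fun d hd => (hPv d hd).2
  let Good : D → Prop := fun c => S.Homotopic a (S.point (.corner c))
    (PF c ++ [(o c, .corner c)]) (P (Sum.inr (S.tail c)))
  have hshift : ∀ c c', S.SameComp b₀ c → S.face c = S.face c' → Good c →
      S.Homotopic a (S.point (.corner c')) (P (Sum.inr (S.tail c)) ++ [(.corner c, .corner c')])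
        (PF c' ++ [(o c', .corner c')]) := by
    intro c c' hc hcc hg
    have e1 : PF c' = PF c := by simp only [PF, hcc]
    rw [e1, ← hoe c c' hcc]
    refine (Homotopic.append_right hg (m := [(.corner c, .corner c')])
      (isCurve_single (x := .corner c) (y := .corner c') hcc) (hav _)).symm.trans ?_
    rw [List.append_assoc]
    exact Homotopic.append_left (hPF c hc) (hav _)
      (Homotopic.comp (x := o c) (y := .corner c) (z := .corner c') (ho c) hcc (hav _))
  have hcross : ∀ d, S.SameComp b₀ d → ¬ S.IsBoundarySide d →
      S.Homotopic a (S.point (.corner d))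
        (P (Sum.inr (S.head d)) ++ [(.corner (S.next d), .corner d)])
        (P (Sum.inr (S.head d)) ++ [(.corner (S.opp d), .corner (S.next (S.opp d)))]) := by
    intro d hd hbd
    exact Homotopic.append_left (hPV (S.next d) (hd.trans (S.sameComp_next d))) (hav _)
      (Homotopic.flip hbd).rev
  have hgood : ∀ c, S.SameComp b₀ c → Good c := by
    refine hP Good ?_ ?_ ?_
    · rintro c hc (h | h)
      · show S.Homotopic _ _ _ _
        rw [h]; exact Homotopic.refl _ _ _
      · show S.Homotopic a _ (P (Sum.inl (S.face c)) ++ _) _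
        rw [h, List.append_assoc]
        have := Homotopic.append_left (hPV c hc) (hav _)
          (Homotopic.cancel (x := .corner c) (y := o c) (ho c).symm (hav _))
        rwa [List.append_nil] at this
    · intro d hd hbd g1 g2 g3
      have hd1 := hd.trans (S.sameComp_next d)
      have hd2 := hd.trans (S.sameComp_opp d)
      have s1 := hshift (S.next d) d hd1 (S.face_next d) g1
      have s2 := hshift (S.opp d) (S.next (S.opp d)) hd2 (S.face_next _).symm g2
      have e1 : S.tail (S.opp d) = S.head d := CellSurface.tail_opp hbd
      have e2 : S.tail (S.next (S.opp d)) = S.tail d := CellSurface.head_opp hbd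
      have g3' : S.Homotopic a (Sum.inl (S.tail (S.next (S.opp d)))) _ _ := g3
      have s2' : S.Homotopic a (Sum.inl (S.tail (S.next (S.opp d)))) _ _ := s2
      rw [e2] at g3' s2'
      rw [e1] at s2'
      exact s1.symm.trans ((hcross d hd hbd).trans (s2'.trans g3'))
    · intro d hd hbd g1 g2 g3
      have hd1 := hd.trans (S.sameComp_next d)
      have hd2 := hd.trans (S.sameComp_opp d)
      have s1 := hshift (S.next d) d hd1 (S.face_next d) g2
      have s2 := hshift (S.opp d) (S.next (S.opp d)) hd2 (S.face_next _).symm g3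
      have e1 : S.tail (S.opp d) = S.head d := CellSurface.tail_opp hbd
      have e2 : S.tail (S.next (S.opp d)) = S.tail d := CellSurface.head_opp hbd
      have s2' : S.Homotopic a (Sum.inl (S.tail (S.next (S.opp d)))) _ _ := s2
      show S.Homotopic a (Sum.inl (S.tail (S.next (S.opp d)))) _ _
      rw [e2] at s2' ⊢
      rw [e1] at s2'
      exact s2'.symm.trans ((hcross d hd hbd).symm.trans (s1.trans g1))
  refine ⟨fun v => P (Sum.inr v), hP0, fun c hc => (hPv c hc).2, fun d hd => ?_⟩
  exact (hshift d (S.next d) hd (S.face_next d).symm (hgood d hd)).trans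
    (hgood (S.next d) (hd.trans (S.sameComp_next d)))

/-- Appending an edge to the curve of its start gives the curve of its end. Along a closed path this
telescopes, and the curve of the base point is trivial. -/
theorem homotopic_nil_of_euler_eq_one (hp : S.punctures = ∅) {b₀ : D}
    (hb₀ : S.IsBoundarySide b₀) (hχ : S.euler {c | S.SameComp b₀ c} = 1) {l : List D} (hl : l ≠ [])
    (hc : l.IsChain fun d d' => S.head d = S.tail d') (h₁ : S.tail (l.head hl) = S.tail b₀)
    (h₂ : S.head (l.getLast hl) = S.tail b₀) :
    S.Homotopic (Sum.inl (S.tail b₀)) (Sum.inl (S.tail b₀)) (S.curve l) [] := by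
  have hav : ∀ x, S.Avoids x := fun x v hv => by rw [hp] at hv; exact hv.elim
  obtain ⟨P, hP0, hPv, hP⟩ := exists_homotopy_potential hp hb₀ hχ
  have key : ∀ (l : List D) (hl : l ≠ []), l.IsChain (fun d d' => S.head d = S.tail d') →
      S.SameComp b₀ (l.head hl) → S.Homotopic (Sum.inl (S.tail b₀))
        (Sum.inl (S.head (l.getLast hl))) (P (S.tail (l.head hl)) ++ S.curve l)
        (P (S.head (l.getLast hl))) := by
    intro l
    induction l with
    | nil => intro hl; exact absurd rfl hl
    | cons d l ih =>
      intro _ hc hd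
      cases l with
      | nil => exact hP d hd
      | cons d' l =>
        rw [List.isChain_cons_cons] at hc
        have hd' : S.SameComp b₀ d' :=
          hd.trans (CellSurface.sameComp_of_tail_eq_head hc.1.symm).symm
        have h1 := ih (by simp) hc.2 hd'
        have h2 := hP d hd
        simp only [List.head_cons] at h1 ⊢
        rw [List.getLast_cons (by simp)]
        refine Homotopic.trans ?_ h1
        have e : S.curve (d :: d' :: l) = [(.corner d, .corner (S.next d))] ++ S.curve (d' :: l) :=
          rfl
        rw [e, ← List.append_assoc]
        rw [hc.1] at h2
        refine Homotopic.append_right h2 ?_ (hav _)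
        have := isCurve_curve (S := S) (l := d' :: l) (by simp) hc.2 (by simp [hp])
        exact this
  have h := key l hl hc (CellSurface.sameComp_of_tail_eq h₁.symm)
  rw [h₁, h₂, hP0] at h
  exact h

end Disc

end MarkedCells

/-- A cell surface without marked points. -/
def CellSurface.bare {D : Type*} (S : CellSurface D) : MarkedCells D where
  toCellSurface := S
  white := ∅
  red := ∅

theorem CellSurface.bare_punctures {D : Type*} (S : CellSurface D) : S.bare.punctures = ∅ := by
  ext v
  exact iff_of_false (fun h => h.1) (fun h => h)

namespace MarkedCells

variable {D : Type*} {S : MarkedCells D}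

/-! ### Homotopies in a part of a cut surface -/

theorem point_eq_of_cut {E : Set D} (hE : S.OppClosed E) {x y : Station D}
    (h : (S.cut E).bare.point x = (S.cut E).bare.point y) : S.point x = S.point y := by
  cases x with
  | corner d =>
    cases y with
    | corner d' =>
      exact congrArg Sum.inl (CellSurface.tail_eq_of_cut_tail_eq hE (Sum.inl_injective h))
    | mid d' => cases h
  | mid d =>
    cases y with
    | corner d' => cases h
    | mid d' =>
      refine congrArg Sum.inr (CellSurface.edge_eq_iff.2 ?_)
      rcases CellSurface.edge_eq_iff.1 (Sum.inr_injective h) with h | h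
      · exact Or.inl h
      · by_cases hd : d ∈ E
        · left; rw [h]; exact (CellSurface.cut_opp_of_mem hd).symm
        · right; rw [h]; exact CellSurface.cut_opp_of_notMem hE hd

theorem sameComp_of_point_eq {x y : Station D} (h : S.point x = S.point y) :
    S.SameComp x.side y.side := by
  cases x with
  | corner d =>
    cases y with
    | corner d' => exact CellSurface.sameComp_of_tail_eq (Sum.inl_injective h)
    | mid d' => cases h
  | mid d =>
    cases y with
    | corner d' => cases h
    | mid d' => exact CellSurface.sameComp_of_edge_eq (Sum.inr_injective h)

theorem isCurve_of_cut {E : Set D} (hE : S.OppClosed E) {b₀ : D}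
    (hC : ∀ c, (S.cut E).SameComp b₀ c → S.tail c ∉ S.punctures) {x y : Station D}
    (hx : (S.cut E).SameComp b₀ x.side) {l : List (Station D × Station D)}
    (h : (S.cut E).bare.IsCurve ((S.cut E).bare.point x) l ((S.cut E).bare.point y)) :
    S.IsCurve (S.point x) l (S.point y) := by
  induction l generalizing x with
  | nil => exact point_eq_of_cut hE h
  | cons c l ih =>
    obtain ⟨h1, h2, -, h4⟩ := h
    have hc1 : (S.cut E).SameComp b₀ c.1.side := hx.trans (sameComp_of_point_eq h1).symm
    have hc2 : (S.cut E).SameComp b₀ c.2.side :=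
      hc1.trans (CellSurface.sameComp_of_face_eq h2)
    refine ⟨point_eq_of_cut hE h1, h2, Or.inr ?_, ih hc2 h4⟩
    intro v hv hv'
    obtain ⟨c1, c2⟩ := c
    cases c2 with
    | corner d => exact hC d hc2 (by rw [Sum.inl_injective hv']; exact hv)
    | mid d => cases hv'

/-- Regluing only identifies more points and chords, so the moves survive; the hypothesis on
punctures is what makes curves of the unmarked cut surface admissible in `S`. -/
theorem homotopic_of_cut {E : Set D} (hE : S.OppClosed E) {b₀ : D}
    (hC : ∀ c, (S.cut E).SameComp b₀ c → S.tail c ∉ S.punctures) {x y : Station D}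
    (hx : (S.cut E).SameComp b₀ x.side) {l m : List (Station D × Station D)}
    (h : (S.cut E).bare.Homotopic ((S.cut E).bare.point x) ((S.cut E).bare.point y) l m) :
    S.Homotopic (S.point x) (S.point y) l m := by
  refine EqvGen.lift_of (f := id) ?_ h
  rintro l m ⟨hl, hm, p, q, u, v, huv, rfl, rfl⟩
  refine EqvGen.rel _ _ ⟨isCurve_of_cut hE hC hx hl, isCurve_of_cut hE hC hx hm, p, q, u, v, ?_,
    rfl, rfl⟩
  have hopp : ∀ d, (S.cut E).opp d ≠ d → (S.cut E).opp d = S.opp d := by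
    intro d hd
    by_cases hdE : d ∈ E
    · exact absurd (CellSurface.cut_opp_of_mem hdE) hd
    · exact CellSurface.cut_opp_of_notMem hE hdE
  cases huv with
  | const x => exact Move.const x
  | comp x y z h h' => exact Move.comp x y z h h'
  | out d h =>
    have e := hopp d h
    have := Move.out (S := S) d (e ▸ h)
    change S.Move _ [(.corner (S.next ((S.cut E).opp d)), .mid ((S.cut E).opp d))]
    rwa [e]
  | back d h =>
    have e := hopp d h
    have := Move.back (S := S) d (e ▸ h)
    change S.Move _ [(.mid ((S.cut E).opp d), .corner (S.next ((S.cut E).opp d)))]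
    rwa [e]

/-! ### The class of a curve modulo two -/

open Classical in
/-- The boundary of a chain of chords, before the identification of the sides, modulo two. -/
noncomputable def chain (l : List (Station D × Station D)) (s : Station D) : ZMod 2 :=
  (l.map fun c => (if s = c.1 then 1 else 0) + (if s = c.2 then 1 else 0)).sum

variable (S) in
/-- The effect on `chain` of moving the halves of the edges selected by `β` to the other side. -/
noncomputable def shift (β : D → ZMod 2) : Station D → ZMod 2
  | .corner d => β d + β (S.opp (S.next.symm d))
  | .mid d => β d + β (S.opp d)

theorem chain_append (l m : List (Station D × Station D)) (s : Station D) :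
    chain (l ++ m) s = chain l s + chain m s := by
  simp [chain]

theorem chain_rev (l : List (Station D × Station D)) (s : Station D) :
    chain (rev l) s = chain l s := by
  induction l with
  | nil => rfl
  | cons c l ih =>
    have e : rev (c :: l) = rev l ++ [c.swap] := by simp [rev]
    rw [e, chain_append, ih]
    simp only [chain, List.map_cons, List.map_nil, List.sum_cons, List.sum_nil, Prod.fst_swap,
      Prod.snd_swap]
    ring

open Classical in
-- The four stations are the ends of the two chords, on either side of the edge, which represent one
-- and the same half edge.
theorem shift_single {d : D} (s : Station D) :
    S.shift (Pi.single d 1) s = (if s = .corner d then 1 else 0) + (if s = .mid d then 1 else 0) +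
      ((if s = .corner (S.next (S.opp d)) then 1 else 0) +
        (if s = .mid (S.opp d) then 1 else 0)) := by
  cases s with
  | corner c =>
    have h : (S.opp (S.next.symm c) = d) ↔ (c = S.next (S.opp d)) := by
      constructor
      · rintro rfl; rw [S.opp_opp, Equiv.apply_symm_apply]
      · rintro rfl; rw [Equiv.symm_apply_apply, S.opp_opp]
    simp only [shift, Pi.single_apply, h, Station.corner.injEq, reduceCtorEq, if_false, add_zero]
  | mid c =>
    have h : (S.opp c = d) ↔ (c = S.opp d) := by
      constructor
      · rintro rfl; rw [S.opp_opp]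
      · rintro rfl; rw [S.opp_opp]
    simp only [shift, Pi.single_apply, h, Station.mid.injEq, reduceCtorEq, if_false, zero_add]

theorem shift_add (β β' : D → ZMod 2) (s : Station D) :
    S.shift (β + β') s = S.shift β s + S.shift β' s := by
  cases s <;> simp only [shift, Pi.add_apply] <;> ring

theorem zmod_two_add_self (x : ZMod 2) : x + x = 0 := CharTwo.add_self_eq_zero x

variable (S) in
/-- The chains of the two curves differ by moving half edges, none of which ends in a puncture. -/
def ChainEquiv (l m : List (Station D × Station D)) : Prop :=
  ∃ β : D → ZMod 2, (∀ d, S.IsBoundarySide d ∨ S.tail d ∈ S.punctures → β d = 0) ∧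
    ∀ s, chain l s + chain m s = S.shift β s

theorem ChainEquiv.refl (l : List (Station D × Station D)) : S.ChainEquiv l l := by
  refine ⟨0, fun _ _ => rfl, fun s => ?_⟩
  rw [zmod_two_add_self]
  cases s <;> simp [shift]

theorem ChainEquiv.symm {l m : List (Station D × Station D)} (h : S.ChainEquiv l m) :
    S.ChainEquiv m l := by
  obtain ⟨β, h1, h2⟩ := h
  exact ⟨β, h1, fun s => by rw [add_comm, h2]⟩

theorem ChainEquiv.trans {l m n : List (Station D × Station D)} (h : S.ChainEquiv l m)
    (h' : S.ChainEquiv m n) : S.ChainEquiv l n := by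
  obtain ⟨β, h1, h2⟩ := h
  obtain ⟨β', h1', h2'⟩ := h'
  refine ⟨β + β', fun d hd => ?_, fun s => ?_⟩
  · rw [Pi.add_apply, h1 d hd, h1' d hd, add_zero]
  · rw [shift_add, ← h2, ← h2']
    have := zmod_two_add_self (chain m s)
    linear_combination -this

theorem chainEquiv_rev (l : List (Station D × Station D)) : S.ChainEquiv (rev l) l := by
  obtain ⟨β, h1, h2⟩ := ChainEquiv.refl (S := S) l
  exact ⟨β, h1, fun s => by rw [chain_rev, h2]⟩

/-- Dropping or composing chords does not change the boundary modulo two, and moving a half edge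
changes it by the `shift` of this half. The vertex of the half is a point of the curve, so it is no
puncture. -/
theorem Homotopic.chainEquiv {a b : S.Vertex ⊕ S.Edge} (ha : S.Avoids a) (hb : S.Avoids b)
    {l m : List (Station D × Station D)} (h : S.Homotopic a b l m) : S.ChainEquiv l m := by
  classical
  induction h with
  | refl x => exact ChainEquiv.refl x
  | symm x y _ ih => exact ih.symm
  | trans x y z _ _ h h' => exact h.trans h'
  | rel x y h =>
    obtain ⟨hx, hy, p, q, u, v, huv, rfl, rfl⟩ := h
    obtain ⟨e, h1, h2, h3⟩ := isCurve_append.1 hx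
    obtain ⟨f, h4, h5, h6⟩ := isCurve_append.1 h1
    have hred : ∀ s, chain (p ++ u ++ q) s + chain (p ++ v ++ q) s = chain u s + chain v s := by
      intro s
      simp only [chain_append]
      have h1 := zmod_two_add_self (chain p s)
      have h2 := zmod_two_add_self (chain q s)
      linear_combination h1 + h2
    -- The junctions before and after the replaced part are either interior points of the curve or
    -- its end points, which avoid the punctures by assumption.
    have hf : u ≠ [] → S.Avoids f := by
      intro hu
      rcases h6 with rfl | h6 | h6
      · rwa [← (show a = f from h4)]
      · exact absurd h6 hu
      · exact h6
    have he : u ≠ [] → S.Avoids e := by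
      intro hu
      rcases h3 with h3 | rfl | h3
      · exact absurd (List.append_eq_nil_iff.1 h3).2 hu
      · rwa [(show e = b from h2)]
      · exact h3
    cases huv with
    | const x =>
      refine ⟨0, fun _ _ => rfl, fun s => ?_⟩
      rw [hred]
      have hz := zmod_two_add_self (if s = x then (1 : ZMod 2) else 0)
      cases s <;> simpa [chain, shift] using hz
    | comp x y z _ _ =>
      refine ⟨0, fun _ _ => rfl, fun s => ?_⟩
      rw [hred]
      have hx := zmod_two_add_self (if s = x then (1 : ZMod 2) else 0)
      have hy := zmod_two_add_self (if s = y then (1 : ZMod 2) else 0)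
      have hz := zmod_two_add_self (if s = z then (1 : ZMod 2) else 0)
      have h0 : S.shift 0 s = 0 := by cases s <;> simp [shift]
      rw [h0]
      simp only [chain, List.map_cons, List.map_nil, List.sum_cons, List.sum_nil]
      linear_combination hx + hy + hz
    | out d hd =>
      have hav := hf (by simp)
      refine ⟨Pi.single d 1, fun d' hd' => ?_, fun s => ?_⟩
      · rw [Pi.single_apply, if_neg]
        rintro rfl
        rcases hd' with h | h
        · exact hd h
        · exact hav _ h h5.1.symm
      · rw [hred, shift_single]
        simp only [chain, List.map_cons, List.map_nil, List.sum_cons, List.sum_nil, add_zero]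
    | back d hd =>
      have hav := he (by simp)
      refine ⟨Pi.single d 1, fun d' hd' => ?_, fun s => ?_⟩
      · rw [Pi.single_apply, if_neg]
        rintro rfl
        rcases hd' with h | h
        · exact hd h
        · exact hav _ h h5.2.2.2.symm
      · rw [hred, shift_single]
        simp only [chain, List.map_cons, List.map_nil, List.sum_cons, List.sum_nil, add_zero]
        ring

theorem Homotopic.chainEquiv' {a b : S.Vertex ⊕ S.Edge} {l m : List (Station D × Station D)}
    (h : S.Homotopic a b l m) (hl : ∀ a b, S.IsCurve a l b → S.Avoids a ∧ S.Avoids b) :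
    S.ChainEquiv l m := by
  rcases h.eq_or_isCurve with rfl | ⟨h1, -⟩
  · exact ChainEquiv.refl _
  · exact h.chainEquiv (hl a b h1).1 (hl a b h1).2

open Classical in
theorem chain_curve_mid (l : List D) (d : D) : chain (S.curve l) (.mid d) = 0 := by
  induction l with
  | nil => rfl
  | cons e l ih =>
    have : chain (S.curve (e :: l)) (.mid d) = 0 + chain (S.curve l) (.mid d) := by
      simp [curve, chain]
    rw [this, ih, add_zero]

open Classical in
theorem chain_curve_corner (l : List D) (d : D) :
    chain (S.curve l) (.corner d) = (l.count d : ZMod 2) + (l.count (S.next.symm d) : ZMod 2) := by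
  induction l with
  | nil => simp [curve, chain]
  | cons e l ih =>
    have h : chain (S.curve (e :: l)) (.corner d) = ((if d = e then 1 else 0) +
        (if d = S.next e then 1 else 0)) + chain (S.curve l) (.corner d) := by
      simp [curve, chain]
    have h' : (d = S.next e) ↔ (e = S.next.symm d) := by
      rw [Equiv.eq_symm_apply]; exact eq_comm
    rw [h, ih, List.count_cons, List.count_cons]
    simp only [beq_iff_eq, h', eq_comm (a := d)]
    push_cast
    ring

open Classical in
/-- If two edge paths have equivalent chains, then they bound a set of polygons modulo two. -/
theorem ChainEquiv.exists_faces {l m : List D} (h : S.ChainEquiv (S.curve l) (S.curve m)) :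
    ∃ x : D → ZMod 2, (∀ d, x (S.next d) = x d) ∧
      (∀ d, x (S.opp d) = x d + ((l.count d : ZMod 2) + l.count (S.opp d) + m.count d +
        m.count (S.opp d))) ∧
      ∀ d, S.IsBoundarySide d ∨ S.tail d ∈ S.punctures →
        x d = (l.count d : ZMod 2) + m.count d := by
  obtain ⟨β, h1, h2⟩ := h
  have hopp : ∀ d, β (S.opp d) = β d := by
    intro d
    have := h2 (.mid d)
    rw [chain_curve_mid, chain_curve_mid, add_zero] at this
    simp only [shift] at this
    have h' := zmod_two_add_self (β d)
    linear_combination -this - h'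
  -- The coefficient of a polygon, read off at one of its sides. The equation at corners says that
  -- it is the same for successive sides; the equation at midpoints makes `β` symmetric, which gives
  -- the jump across an edge.
  refine ⟨fun d => β d + l.count d + m.count d, fun d => ?_, fun d => ?_, fun d hd => ?_⟩
  · have := h2 (.corner (S.next d))
    rw [chain_curve_corner, chain_curve_corner] at this
    simp only [shift, Equiv.symm_apply_apply, hopp] at this
    have a1 := zmod_two_add_self (β d)
    have a2 := zmod_two_add_self (l.count d : ZMod 2)
    have a3 := zmod_two_add_self (m.count d : ZMod 2)
    have a4 := zmod_two_add_self (β (S.next d))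
    show β (S.next d) + l.count (S.next d) + m.count (S.next d) = β d + l.count d + m.count d
    linear_combination this - a2 - a3 + a4
  · show β (S.opp d) + l.count (S.opp d) + m.count (S.opp d) = _
    rw [hopp]
    have a2 := zmod_two_add_self (l.count d : ZMod 2)
    have a3 := zmod_two_add_self (m.count d : ZMod 2)
    linear_combination -a2 - a3
  · show β d + l.count d + m.count d = _
    rw [h1 d hd, zero_add]

/-- Disjoint edge paths, along which the surface falls into parts each of which has a `∘`-point, have
inequivalent chains. -/
theorem not_chainEquiv_of_white {A : Set D} (hA : S.OppClosed A)
    (hAb : ∀ d ∈ A, ¬ S.IsBoundarySide d) (hAw : ∀ d ∈ A, S.tail d ∉ S.white)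
    (hw : ∀ d, ∃ c, (S.cut A).SameComp d c ∧ S.tail c ∈ S.white)
    {l m : List D} (hl : l ≠ []) (hlA : ∀ d ∈ l, d ∈ A) (hmA : ∀ d ∈ m, d ∈ A)
    (hln : l.Nodup) (hlo : ∀ d ∈ l, S.opp d ∉ l) (hlm : ∀ d ∈ l, d ∉ m ∧ S.opp d ∉ m) :
    ¬ S.ChainEquiv (S.curve l) (S.curve m) := by
  classical
  intro h
  obtain ⟨x, hx1, hx2, hx3⟩ := h.exists_faces
  have hcl : ∀ d ∉ A, (l.count d : ZMod 2) = 0 := fun d hd => by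
    rw [List.count_eq_zero_of_not_mem fun h => hd (hlA d h), Nat.cast_zero]
  have hcm : ∀ d ∉ A, (m.count d : ZMod 2) = 0 := fun d hd => by
    rw [List.count_eq_zero_of_not_mem fun h => hd (hmA d h), Nat.cast_zero]
  -- The coefficient jumps only across edges of the two paths, all of which have been cut.
  have hconst : ∀ d c, (S.cut A).SameComp d c → x d = x c := by
    intro d c h
    refine EqvGen.eq_of_invariant (f := x) ?_ h
    rintro y z (rfl | rfl)
    · exact (hx1 y).symm
    · by_cases hy : y ∈ A
      · rw [CellSurface.cut_opp_of_mem hy]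
      · have hy' : S.opp y ∉ A := fun h => hy (hA.mem_iff.1 h)
        rw [CellSurface.cut_opp_of_notMem hA hy, hx2, hcl y hy, hcl _ hy', hcm y hy, hcm _ hy']
        simp
  -- At a `∘`-point the coefficient vanishes: a boundary point has a boundary side, which is in
  -- neither path, and at a puncture no half edge may be moved.
  have hzero : ∀ d, x d = 0 := by
    intro d
    obtain ⟨c, hdc, hc⟩ := hw d
    rw [hconst d c hdc]
    by_cases hb : S.IsBoundaryVertex (S.tail c)
    · obtain ⟨b, hb, hbc⟩ := hb
      have hsame : (S.cut A).tail b = (S.cut A).tail c :=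
        CellSurface.cut_tail_eq_of_forall hA (fun g hg h => hAw g hg (by rw [h, hbc]; exact hc)) hbc
      rw [← hconst b c (CellSurface.sameComp_of_tail_eq hsame), hx3 b (Or.inl hb)]
      have hbA : b ∉ A := fun h => hAb b h hb
      rw [hcl b hbA, hcm b hbA, add_zero]
    · rw [hx3 c (Or.inr ⟨hc, hb⟩)]
      have hcA : c ∉ A := fun h => hAw c h hc
      rw [hcl c hcA, hcm c hcA, add_zero]
  -- Across an edge of `l` the coefficient would have to jump by one.
  obtain ⟨d, hd⟩ := List.exists_mem_of_ne_nil l hl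
  have := hx2 d
  rw [hzero, hzero, List.count_eq_one_of_mem hln hd, List.count_eq_zero_of_not_mem (hlo d hd),
    List.count_eq_zero_of_not_mem (hlm d hd).1, List.count_eq_zero_of_not_mem (hlm d hd).2] at this
  simp at this

end MarkedCells

namespace CellSurface

variable {D : Type*} {S : CellSurface D}

/-! ### Counting vertices -/

variable (S) in
/-- A set of corners that is a union of vertices. -/
def Saturated (w : Set D) : Prop := ∀ c c', S.tail c = S.tail c' → c ∈ w → c' ∈ w

theorem Saturated.cut {w E : Set D} (hw : S.Saturated w) (hE : S.OppClosed E) :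
    (S.cut E).Saturated w :=
  fun c c' h => hw c c' (tail_eq_of_cut_tail_eq hE h)

variable (S) in
theorem saturated_preimage (V : Set S.Vertex) : S.Saturated {c | S.tail c ∈ V} := by
  intro c c' h hc
  show S.tail c' ∈ V
  rw [← h]; exact hc

/-- The fan at a boundary vertex begins with exactly one boundary side, so boundary sides enumerate
boundary vertices. -/
theorem ncard_tail_image [Finite D] {w : Set D} (hw : S.Saturated w) :
    (S.tail '' w).ncard = {b ∈ w | S.IsBoundarySide b}.ncard +
      {v ∈ S.tail '' w | ¬ S.IsBoundaryVertex v}.ncard := by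
  have h1 : (S.tail '' {b ∈ w | S.IsBoundarySide b}).ncard = {b ∈ w | S.IsBoundarySide b}.ncard :=
    Set.InjOn.ncard_image fun b hb b' hb' h => boundary_tail_injective hb.2 hb'.2 h
  rw [← h1, ← Set.ncard_union_eq]
  · congr 1
    ext v
    constructor
    · rintro ⟨c, hc, rfl⟩
      by_cases hb : S.IsBoundaryVertex (S.tail c)
      · obtain ⟨b, hb, hbc⟩ := hb
        exact Or.inl ⟨b, ⟨hw c b hbc.symm hc, hb⟩, hbc⟩
      · exact Or.inr ⟨⟨c, hc, rfl⟩, hb⟩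
    · rintro (⟨b, hb, rfl⟩ | h)
      · exact ⟨b, hb.1, rfl⟩
      · exact h.1
  · rw [Set.disjoint_left]
    rintro v ⟨b, hb, rfl⟩ h
    exact h.2 ⟨b, hb.2, rfl⟩

/-- The vertex of the original surface over which a vertex of the cut surface lies. -/
def cutVertex {E : Set D} (hE : S.OppClosed E) : (S.cut E).Vertex → S.Vertex :=
  Quotient.lift S.tail fun _ _ h => tail_eq_of_cut_tail_eq hE (tail_eq_iff.2 h)

/-- At a vertex on the boundary or on the cut every corner gets into a fan that begins with a
boundary side; all other vertices are left as they are. -/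
theorem ncard_cut_interior [Finite D] {w E : Set D} (hE : S.OppClosed E) :
    {v ∈ (S.cut E).tail '' w | ¬ (S.cut E).IsBoundaryVertex v}.ncard =
      {v ∈ S.tail '' w | ¬ S.IsBoundaryVertex v ∧ v ∉ S.tail '' E}.ncard := by
  have hno : ∀ c, ¬ (S.cut E).IsBoundaryVertex ((S.cut E).tail c) →
      ∀ g, (S.IsBoundarySide g ∨ g ∈ E) → S.tail g ≠ S.tail c := by
    intro c hc g hg h
    obtain ⟨b, hb, hbc⟩ := exists_cut_boundary_of_tail_eq hE hg h
    exact hc ⟨b, (cut_isBoundarySide hE).2 hb, hbc⟩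
  have hinj : Set.InjOn (cutVertex hE)
      {v ∈ (S.cut E).tail '' w | ¬ (S.cut E).IsBoundaryVertex v} := by
    rintro _ ⟨⟨c, hc, rfl⟩, hv⟩ _ ⟨⟨c', hc', rfl⟩, hv'⟩ h
    exact cut_tail_eq_of_forall hE (fun g hg => hno c hv g (Or.inr hg)) h
  rw [← hinj.ncard_image]
  congr 1
  ext v
  constructor
  · rintro ⟨_, ⟨⟨c, hc, rfl⟩, hv⟩, rfl⟩
    refine ⟨⟨c, hc, rfl⟩, ?_, ?_⟩
    · rintro ⟨b, hb, hbc⟩; exact hno c hv b (Or.inl hb) hbc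
    · rintro ⟨g, hg, hgc⟩; exact hno c hv g (Or.inr hg) hgc
  · rintro ⟨⟨c, hc, rfl⟩, h1, h2⟩
    refine ⟨(S.cut E).tail c, ⟨⟨c, hc, rfl⟩, ?_⟩, rfl⟩
    rintro ⟨b, hb, hbc⟩
    have hbc' := tail_eq_of_cut_tail_eq hE hbc
    rcases (cut_isBoundarySide hE).1 hb with hb | hb
    · exact h1 ⟨b, hb, hbc'⟩
    · exact h2 ⟨b, hb, hbc'⟩

/-- Each side of `E` becomes a boundary side and so begins a fan, that is, a boundary vertex of its
own; in exchange the interior vertices touched by the cut disappear. -/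
theorem ncard_cut_tail [Finite D] {w E : Set D} (hE : S.OppClosed E)
    (hEb : ∀ d ∈ E, ¬ S.IsBoundarySide d) (hw : S.Saturated w) :
    ((S.cut E).tail '' w).ncard + {v ∈ S.tail '' (E ∩ w) | ¬ S.IsBoundaryVertex v}.ncard =
      (S.tail '' w).ncard + (E ∩ w).ncard := by
  rw [ncard_tail_image (hw.cut hE), ncard_tail_image hw, ncard_cut_interior hE]
  have h1 : {b ∈ w | (S.cut E).IsBoundarySide b}.ncard =
      {b ∈ w | S.IsBoundarySide b}.ncard + (E ∩ w).ncard := by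
    rw [← Set.ncard_union_eq]
    · congr 1
      ext b
      simp only [Set.mem_ofPred_eq, cut_isBoundarySide hE, Set.mem_union, Set.mem_inter_iff]
      tauto
    · rw [Set.disjoint_left]
      intro b hb hb'
      exact hEb b hb'.1 hb.2
  have h2 : {v ∈ S.tail '' w | ¬ S.IsBoundaryVertex v}.ncard =
      {v ∈ S.tail '' w | ¬ S.IsBoundaryVertex v ∧ v ∉ S.tail '' E}.ncard +
      {v ∈ S.tail '' (E ∩ w) | ¬ S.IsBoundaryVertex v}.ncard := by
    rw [← Set.ncard_union_eq]
    · congr 1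
      ext v
      constructor
      · rintro ⟨⟨c, hc, rfl⟩, h⟩
        by_cases hg : S.tail c ∈ S.tail '' E
        · obtain ⟨g, hg, hgc⟩ := hg
          exact Or.inr ⟨⟨g, ⟨hg, hw c g hgc.symm hc⟩, hgc⟩, h⟩
        · exact Or.inl ⟨⟨c, hc, rfl⟩, h, hg⟩
      · rintro (⟨h1, h2, -⟩ | ⟨⟨g, hg, rfl⟩, h2⟩)
        · exact ⟨h1, h2⟩
        · exact ⟨⟨g, hg.2, rfl⟩, h2⟩
    · rw [Set.disjoint_left]
      rintro v ⟨_, _, h⟩ ⟨⟨g, hg, rfl⟩, -⟩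
      exact h ⟨g, hg.1, rfl⟩
  omega

theorem two_mul_ncard_cut_edge [Finite D] {E : Set D} (hE : S.OppClosed E)
    (hEb : ∀ d ∈ E, ¬ S.IsBoundarySide d) :
    2 * ((S.cut E).edge '' Set.univ).ncard = 2 * (S.edge '' Set.univ).ncard + E.ncard := by
  rw [two_mul_ncard_edge (fun _ _ => Set.mem_univ _), two_mul_ncard_edge (fun _ _ => Set.mem_univ _)]
  have h1 : {b ∈ (Set.univ : Set D) | (S.cut E).IsBoundarySide b}.ncard =
      {b ∈ (Set.univ : Set D) | S.IsBoundarySide b}.ncard + E.ncard := by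
    rw [← Set.ncard_union_eq]
    · congr 1
      ext b
      simp only [Set.mem_ofPred_eq, cut_isBoundarySide hE, Set.mem_union, Set.mem_univ, true_and]
    · rw [Set.disjoint_left]
      intro b hb hb'
      exact hEb b hb' hb.2
  omega

/-! ### Counting over components -/

variable (S) in
/-- The connected components. -/
def Comp : Type _ := Quotient (EqvGen.setoid fun d d' => d' = S.next d ∨ d' = S.opp d)

variable (S) in
/-- The component of a side. -/
def comp (d : D) : S.Comp := Quotient.mk _ d

theorem comp_eq_iff {a b : D} : S.comp a = S.comp b ↔ S.SameComp a b :=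
  Quotient.eq (r := EqvGen.setoid fun d d' => d' = S.next d ∨ d' = S.opp d)

theorem comp_surjective (q : S.Comp) : ∃ d, S.comp d = q := Quotient.exists_rep q

instance [Finite D] : Finite S.Comp := Quotient.finite _

/-- Different components have disjoint images under `g`. This is applied to vertices, edges and
polygons. -/
theorem sum_ncard_image_comp [Finite D] [Fintype S.Comp] {V : Type*} {g : D → V} (w : Set D)
    (hg : ∀ c c', g c = g c' → S.SameComp c c') :
    ∑ q : S.Comp, (g '' {c | S.comp c = q ∧ c ∈ w}).ncard = (g '' w).ncard := by
  classical
  have := Fintype.ofFinite D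
  have hcard : ∀ X : Set D, (g '' X).ncard = (X.toFinset.image g).card := by
    intro X
    rw [← Set.ncard_coe_finset]
    simp
  simp only [hcard]
  rw [← Finset.card_biUnion]
  · congr 1
    ext v
    simp only [Finset.mem_biUnion, Finset.mem_univ, true_and, Finset.mem_image, Set.mem_toFinset,
      Set.mem_ofPred_eq]
    constructor
    · rintro ⟨q, c, ⟨-, hc⟩, rfl⟩; exact ⟨c, hc, rfl⟩
    · rintro ⟨c, hc, rfl⟩; exact ⟨_, c, ⟨rfl, hc⟩, rfl⟩
  · intro q _ q' _ hne
    rw [Function.onFun, Finset.disjoint_left]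
    simp only [Finset.mem_image, Set.mem_toFinset, Set.mem_ofPred_eq]
    rintro v ⟨c, ⟨rfl, -⟩, rfl⟩ ⟨c', ⟨rfl, -⟩, h⟩
    exact hne (comp_eq_iff.2 (hg c c' h.symm))

theorem sum_euler_comp [Finite D] [Fintype S.Comp] :
    ∑ q : S.Comp, S.euler {c | S.comp c = q} = S.euler Set.univ := by
  have h : ∀ q : S.Comp, {c | S.comp c = q} = {c | S.comp c = q ∧ c ∈ (Set.univ : Set D)} := by
    intro q; ext c; simp
  unfold euler
  rw [Finset.sum_add_distrib, Finset.sum_sub_distrib]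
  simp only [h]
  rw [← sum_ncard_image_comp Set.univ fun c c' h => sameComp_of_tail_eq h,
    ← sum_ncard_image_comp Set.univ fun c c' h => sameComp_of_edge_eq h,
    ← sum_ncard_image_comp Set.univ fun c c' h => sameComp_of_face_eq h]
  push_cast
  rfl

/-- Since no component with boundary has Euler characteristic greater than one, a surface of
sufficiently large Euler characteristic consists of discs, which share the vertices in `w` among
them. -/
theorem euler_eq_one_of_count [Finite D] (hb : ∀ d, ∃ d', S.SameComp d d' ∧ S.IsBoundarySide d')
    (w : Set D) (k : ℕ) (hk : {q : S.Comp | ∀ c ∈ w, S.comp c ≠ q}.ncard ≤ k)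
    (hχ : ((S.tail '' w).ncard : ℤ) + k ≤ S.euler Set.univ) :
    (∀ d, S.euler {c | S.SameComp d c} = 1) ∧
      (∀ d, (S.tail '' {c | S.SameComp d c ∧ c ∈ w}).ncard ≤ 1) ∧
      {q : S.Comp | ∀ c ∈ w, S.comp c ≠ q}.ncard = k := by
  classical
  have := Fintype.ofFinite S.Comp
  have hset : ∀ d, {c | S.comp c = S.comp d} = {c | S.SameComp d c} := by
    intro d; ext c; exact comp_eq_iff.trans ⟨SameComp.symm, SameComp.symm⟩
  have hset' : ∀ d, {c | S.comp c = S.comp d ∧ c ∈ w} = {c | S.SameComp d c ∧ c ∈ w} := by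
    intro d; ext c
    exact and_congr_left fun _ => comp_eq_iff.trans ⟨SameComp.symm, SameComp.symm⟩
  have h1 : ∀ q : S.Comp, S.euler {c | S.comp c = q} ≤ 1 := by
    intro q
    obtain ⟨d, rfl⟩ := comp_surjective q
    obtain ⟨b, hdb, hb⟩ := hb d
    rw [hset]
    have : {c | S.SameComp d c} = {c | S.SameComp b c} := by
      ext c; exact ⟨fun h => hdb.symm.trans h, fun h => hdb.trans h⟩
    rw [this]
    exact euler_le_one hb
  have hr0 : ({q : S.Comp | ∀ c ∈ w, S.comp c ≠ q}.ncard : ℤ) =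
      ∑ q : S.Comp, if ∀ c ∈ w, S.comp c ≠ q then 1 else 0 := by
    rw [Finset.sum_boole, Set.ncard_eq_toFinset_card']
    congr 2
    ext q
    simp
  have hW := sum_ncard_image_comp (S := S) (g := S.tail) w fun c c' h => sameComp_of_tail_eq h
  -- A component contains a vertex in `w` or is counted among those that avoid `w`.
  have h2 : ∀ q : S.Comp, (1 : ℤ) ≤ (S.tail '' {c | S.comp c = q ∧ c ∈ w}).ncard +
      if ∀ c ∈ w, S.comp c ≠ q then 1 else 0 := by
    intro q
    split_ifs with h
    · have : (0 : ℤ) ≤ (S.tail '' {c | S.comp c = q ∧ c ∈ w}).ncard := by positivity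
      omega
    · push Not at h
      obtain ⟨c, hc, hq⟩ := h
      have : 0 < (S.tail '' {c | S.comp c = q ∧ c ∈ w}).ncard :=
        (Set.ncard_pos (Set.toFinite _)).2 ⟨_, c, ⟨hq, hc⟩, rfl⟩
      omega
  have hχs := sum_euler_comp (S := S)
  set χ : S.Comp → ℤ := fun q => S.euler {c | S.comp c = q} with hχdef
  set W : S.Comp → ℤ := fun q => (S.tail '' {c | S.comp c = q ∧ c ∈ w}).ncard with hWdef
  set z : S.Comp → ℤ := fun q => if ∀ c ∈ w, S.comp c ≠ q then 1 else 0 with hz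
  have hW' : ∑ q, W q = ((S.tail '' w).ncard : ℤ) := by rw [← hW]; push_cast; rfl
  -- Both summands of each term are non-negative, while the hypotheses make the total at most zero;
  -- hence all of them vanish.
  have hsum : ∑ q : S.Comp, ((1 - χ q) + (W q + z q - 1)) =
      (S.tail '' w).ncard + {q : S.Comp | ∀ c ∈ w, S.comp c ≠ q}.ncard - S.euler Set.univ := by
    rw [hr0, ← hW', ← hχs, ← Finset.sum_add_distrib, ← Finset.sum_sub_distrib]
    refine Finset.sum_congr rfl fun q _ => ?_
    ring
  have hnn : ∀ q ∈ Finset.univ, 0 ≤ (1 - χ q) + (W q + z q - 1) := by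
    intro q _
    have a := h1 q
    have b := h2 q
    show 0 ≤ (1 - S.euler {c | S.comp c = q}) + (W q + z q - 1)
    change 1 ≤ W q + z q at b
    linarith
  have hle : ∑ q : S.Comp, ((1 - χ q) + (W q + z q - 1)) ≤ 0 := by
    rw [hsum]; have : ({q : S.Comp | ∀ c ∈ w, S.comp c ≠ q}.ncard : ℤ) ≤ k := by exact_mod_cast hk
    linarith
  have hzero : ∑ q : S.Comp, ((1 - χ q) + (W q + z q - 1)) = 0 :=
    le_antisymm hle (Finset.sum_nonneg hnn)
  have hall := (Finset.sum_eq_zero_iff_of_nonneg hnn).1 hzero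
  have hboth : ∀ q, χ q = 1 ∧ W q + z q = 1 := by
    intro q
    have a := hall q (Finset.mem_univ q)
    have b : χ q ≤ 1 := h1 q
    have c : 1 ≤ W q + z q := h2 q
    constructor <;> linarith
  refine ⟨fun d => ?_, fun d => ?_, ?_⟩
  · rw [← hset]; exact (hboth (S.comp d)).1
  · rw [← hset']
    have a := (hboth (S.comp d)).2
    have b : 0 ≤ z (S.comp d) := by simp only [hz]; split_ifs <;> norm_num
    have c : ((S.tail '' {c | S.comp c = S.comp d ∧ c ∈ w}).ncard : ℤ) ≤ 1 := by
      change W (S.comp d) ≤ 1; linarith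
    exact_mod_cast c
  · rw [hsum] at hzero
    have : (k : ℤ) ≤ {q : S.Comp | ∀ c ∈ w, S.comp c ≠ q}.ncard := by linarith
    exact le_antisymm hk (by exact_mod_cast this)

end CellSurface

/-! ### Consecutive entries of lists without repetition. -/

theorem List.exists_pair_of_mem_tail {α : Type*} {l : List α} {b : α} (h : b ∈ l.tail) :
    ∃ a, [a, b] <:+: l := by
  cases l with
  | nil => simp at h
  | cons x l =>
    obtain ⟨p, q, rfl⟩ := List.append_of_mem (show b ∈ l from h)
    induction p using List.reverseRecOn with
    | nil => exact ⟨x, [], q, by simp⟩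
    | append_singleton p y _ => exact ⟨y, x :: p, q, by simp⟩

theorem List.exists_pair_of_mem_dropLast {α : Type*} {l : List α} {a : α} (h : a ∈ l.dropLast) :
    ∃ b, [a, b] <:+: l := by
  have h' : a ∈ l.reverse.tail := by
    rw [List.tail_reverse]; simpa using h
  obtain ⟨b, hb⟩ := List.exists_pair_of_mem_tail h'
  refine ⟨b, ?_⟩
  have := List.reverse_infix.2 hb
  simpa using this

theorem List.mem_tail_of_pair {α : Type*} {l : List α} {a b : α} (h : [a, b] <:+: l) :
    b ∈ l.tail := by
  obtain ⟨p, q, rfl⟩ := h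
  cases p <;> simp

theorem List.mem_dropLast_of_pair {α : Type*} {l : List α} {a b : α} (h : [a, b] <:+: l) :
    a ∈ l.dropLast := by
  obtain ⟨p, q, rfl⟩ := h
  rw [List.append_assoc, List.dropLast_append_of_ne_nil (by simp)]
  simp

theorem List.Nodup.pair_left_unique {α : Type*} {l : List α} (hl : l.Nodup) {a a' b : α}
    (h : [a, b] <:+: l) (h' : [a', b] <:+: l) : a = a' := by
  obtain ⟨p, q, rfl⟩ := h
  obtain ⟨p', q', e⟩ := h'
  simp only [List.append_assoc, List.cons_append, List.nil_append] at hl e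
  have e1 : (p' ++ [a']) ++ b :: q' = (p ++ [a]) ++ b :: q := by simpa using e
  have hl' : ((p ++ [a]) ++ b :: q).Nodup := by simpa using hl
  have h1 : b ∉ p ++ [a] := fun hb => (List.nodup_append.1 hl').2.2 _ hb _ (by simp) rfl
  have h2 : b ∉ p' ++ [a'] := fun hb => by
    rw [← e1] at hl'
    exact (List.nodup_append.1 hl').2.2 _ hb _ (by simp) rfl
  -- The part of the list before `b` is found by reading up to the first `b`, so both decompositions
  -- have the same one.
  have h3 := List.append_inj_left e1 (by
    classical
    have key : ∀ (u v : List α), b ∉ u → (u ++ b :: v).takeWhile (fun x => decide (x ≠ b)) = u := by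
      intro u v hu
      rw [List.takeWhile_append_of_pos]
      · simp
      · intro x hx; simp; rintro rfl; exact hu hx
    have := congrArg (List.takeWhile fun x => decide (x ≠ b)) e1
    rw [key _ _ h1, key _ _ h2] at this
    rw [this])
  have h4 := List.append_inj_right' h3 rfl
  simpa using h4.symm

theorem List.Nodup.pair_right_unique {α : Type*} {l : List α} (hl : l.Nodup) {a b b' : α}
    (h : [a, b] <:+: l) (h' : [a, b'] <:+: l) : b = b' := by
  refine List.Nodup.pair_left_unique (l := l.reverse) (List.nodup_reverse.2 hl) (b := a) ?_ ?_
  · simpa using List.reverse_infix.2 h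
  · simpa using List.reverse_infix.2 h'

theorem List.eq_head_or_mem_tail {α : Type*} {l : List α} {a : α} (h : a ∈ l) (hl : l ≠ []) :
    a = l.head hl ∨ a ∈ l.tail := by
  cases l with
  | nil => simp at h
  | cons x l => simpa using h

theorem List.eq_getLast_or_mem_dropLast {α : Type*} {l : List α} {a : α} (h : a ∈ l)
    (hl : l ≠ []) : a = l.getLast hl ∨ a ∈ l.dropLast := by
  conv at h => rw [← List.dropLast_concat_getLast hl]
  simp only [List.mem_append, List.mem_singleton] at h
  tauto

/-! ### Systems of disjoint paths and the effect of cutting along them. -/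

namespace MarkedCells

variable {D : Type*} {S : MarkedCells D}

theorem red_marked (v : S.Vertex) (hv : v ∈ S.red) : S.IsMarked v := Or.inr hv

theorem white_marked (v : S.Vertex) (hv : v ∈ S.white) : S.IsMarked v := Or.inl hv

variable (S) in
/-- A simple edge path through the interior with end points in `ends`. -/
structure IsPath (ends : Set S.Vertex) (l : List D) : Prop where
  ne_nil : l ≠ []
  chain : l.IsChain fun d d' => S.head d = S.tail d'
  interior : ∀ d ∈ l, ¬ S.IsBoundarySide d
  no_edge_twice : ∀ d ∈ l, S.opp d ∉ l
  no_vertex_twice : (l.tail.map S.tail).Nodup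
  inner_interior : ∀ v ∈ S.inner l, ¬ S.IsMarked v ∧ ¬ S.IsBoundaryVertex v
  start_mem : ∀ d ∈ l.head?, S.tail d ∈ ends
  end_mem : ∀ d ∈ l.getLast?, S.head d ∈ ends

theorem IsSimpleArc.isPath {ends : Set S.Vertex} {l : List D} (h : S.IsSimpleArc ends l) :
    S.IsPath ends l where
  ne_nil := h.ne_nil
  chain := h.chain
  interior := h.interior
  no_edge_twice := h.no_edge_twice
  no_vertex_twice := h.no_vertex_twice
  inner_interior := h.inner_interior
  start_mem := h.start_mem
  end_mem := h.end_mem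

namespace IsPath

variable {ends : Set S.Vertex} {l : List D}

theorem head_mem (h : S.IsPath ends l) : S.tail (l.head h.ne_nil) ∈ ends :=
  h.start_mem _ (by rw [List.head?_eq_some_head h.ne_nil]; rfl)

theorem last_mem (h : S.IsPath ends l) : S.head (l.getLast h.ne_nil) ∈ ends :=
  h.end_mem _ (by rw [List.getLast?_eq_some_getLast h.ne_nil]; rfl)

theorem pair_head (h : S.IsPath ends l) {a b : D} (hab : [a, b] <:+: l) : S.head a = S.tail b :=
  by simpa using h.chain.infix hab

theorem inner_not_ends (hm : ∀ v ∈ ends, S.IsMarked v) (h : S.IsPath ends l) {v : S.Vertex}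
    (hv : v ∈ S.inner l) : v ∉ ends := fun h' => (h.inner_interior v hv).1 (hm v h')

theorem nodup (hm : ∀ v ∈ ends, S.IsMarked v) (h : S.IsPath ends l) : l.Nodup := by
  have h1 := List.Nodup.of_map _ h.no_vertex_twice
  have h2 := h.head_mem
  have h3 := fun v hv => h.inner_not_ends hm (v := v) hv
  have hne := h.ne_nil
  cases l with
  | nil => exact absurd rfl hne
  | cons d l =>
    refine List.nodup_cons.2 ⟨fun hd => h3 (S.tail d) ⟨d, hd, rfl⟩ h2, h1⟩

theorem tail_unique (h : S.IsPath ends l) {b b' : D} (hb : b ∈ l.tail) (hb' : b' ∈ l.tail)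
    (e : S.tail b = S.tail b') : b = b' :=
  List.inj_on_of_nodup_map h.no_vertex_twice hb hb' e

theorem opp_ne (h : S.IsPath ends l) {a b : D} (ha : a ∈ l) (hb : b ∈ l) : S.opp a ≠ b :=
  fun e => h.no_edge_twice a ha (e ▸ hb)

/-- The sides of a path at an end point are the first one and the reverse of the last one. -/
theorem side_ends_iff (hm : ∀ v ∈ ends, S.IsMarked v) (h : S.IsPath ends l) {d : D}
    (hd : d ∈ S.sides l) :
    S.tail d ∈ ends ↔ d = l.head h.ne_nil ∨ d = S.opp (l.getLast h.ne_nil) := by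
  constructor
  · intro he
    rcases hd with hd | hd
    · rcases List.eq_head_or_mem_tail hd h.ne_nil with e | hd'
      · exact Or.inl e
      · exact absurd he (h.inner_not_ends hm ⟨d, hd', rfl⟩)
    · rcases List.eq_getLast_or_mem_dropLast hd h.ne_nil with e | hd'
      · right; rw [← e, S.opp_opp]
      · obtain ⟨b, hb⟩ := List.exists_pair_of_mem_dropLast hd'
        have hb' := h.pair_head hb
        have : S.head (S.opp d) = S.tail d := CellSurface.head_opp (by
          rw [← CellSurface.isBoundarySide_opp]; exact h.interior _ hd)
        rw [this] at hb'
        exact absurd he (h.inner_not_ends hm ⟨b, List.mem_tail_of_pair hb, hb'.symm⟩)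
  · rintro (rfl | rfl)
    · exact h.head_mem
    · rw [CellSurface.tail_opp (h.interior _ (List.getLast_mem _))]
      exact h.last_mem

theorem side_mem (h : S.IsPath ends l) {d : D}
    (hd : d ∈ S.sides l) : S.tail d ∈ ends ∨ S.tail d ∈ S.inner l := by
  by_contra! hcon
  rcases hd with hd' | hd'
  · rcases List.eq_head_or_mem_tail hd' h.ne_nil with e | h'
    · exact hcon.1 (e ▸ h.head_mem)
    · exact hcon.2 ⟨d, h', rfl⟩
  · have hh : S.head (S.opp d) = S.tail d := CellSurface.head_opp (by
      rw [← CellSurface.isBoundarySide_opp]; exact h.interior _ hd')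
    rcases List.eq_getLast_or_mem_dropLast hd' h.ne_nil with e | h'
    · exact hcon.1 (by rw [← hh, e]; exact h.last_mem)
    · obtain ⟨b, hb⟩ := List.exists_pair_of_mem_dropLast h'
      exact hcon.2 ⟨b, List.mem_tail_of_pair hb, by rw [← h.pair_head hb, hh]⟩

/-- At an inner vertex a path has two sides. -/
theorem side_inner_iff (hm : ∀ v ∈ ends, S.IsMarked v) (h : S.IsPath ends l) {a b : D}
    (hab : [a, b] <:+: l) {d : D} (hd : d ∈ S.sides l) :
    S.tail d = S.tail b ↔ d = b ∨ d = S.opp a := by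
  have hbt := List.mem_tail_of_pair hab
  have had := List.mem_dropLast_of_pair hab
  have hal : a ∈ l := List.mem_of_mem_dropLast had
  constructor
  · intro e
    have hne : S.tail d ∉ ends := e ▸ h.inner_not_ends hm ⟨b, hbt, rfl⟩
    rcases hd with hd' | hd'
    · rcases List.eq_head_or_mem_tail hd' h.ne_nil with e' | h'
      · exact absurd (e' ▸ h.head_mem) hne
      · exact Or.inl (h.tail_unique h' hbt e)
    · have hh : S.head (S.opp d) = S.tail d := CellSurface.head_opp (by
        rw [← CellSurface.isBoundarySide_opp]; exact h.interior _ hd')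
      rcases List.eq_getLast_or_mem_dropLast hd' h.ne_nil with e' | h'
      · exact absurd (by rw [← hh, e']; exact h.last_mem) hne
      · obtain ⟨b', hb'⟩ := List.exists_pair_of_mem_dropLast h'
        have e2 : S.tail b' = S.tail b := by rw [← h.pair_head hb', hh, e]
        have e3 := h.tail_unique (List.mem_tail_of_pair hb') hbt e2
        subst e3
        right
        rw [← (h.nodup hm).pair_left_unique hb' hab, S.opp_opp]
  · rintro (rfl | rfl)
    · rfl
    · rw [CellSurface.tail_opp (h.interior a hal), h.pair_head hab]

theorem revPath_ne_nil (h : S.IsPath ends l) : S.revPath l ≠ [] := by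
  simpa [revPath] using h.ne_nil

end IsPath

theorem mem_sides_of_mem {l : List D} {d : D} (h : d ∈ l) : d ∈ S.sides l := Or.inl h

theorem opp_mem_sides_of_mem {l : List D} {d : D} (h : d ∈ l) : S.opp d ∈ S.sides l :=
  Or.inr (by rwa [S.opp_opp])

variable (S) in
/-- A collection of simple edge paths without interior intersections. -/
structure PathSystem (ends : Set S.Vertex) (Δ : Set (List D)) : Prop where
  path : ∀ l ∈ Δ, S.IsPath ends l
  disjoint_sides : ∀ l ∈ Δ, ∀ l' ∈ Δ, l ≠ l' → Disjoint (S.sides l) (S.sides l')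
  disjoint_inner : ∀ l ∈ Δ, ∀ l' ∈ Δ, l ≠ l' → Disjoint (S.inner l) (S.inner l')

theorem IsSimpleCoordinate.pathSystem {Δ : Set (List D)} (h : S.IsSimpleCoordinate Δ) :
    S.PathSystem S.red Δ where
  path l hl := (h.arc l hl).isPath
  disjoint_sides := h.disjoint_sides
  disjoint_inner := h.disjoint_inner

theorem IsPath.pathSystem {ends : Set S.Vertex} {l : List D} (h : S.IsPath ends l) :
    S.PathSystem ends {l} where
  path := by rintro _ rfl; exact h
  disjoint_sides := by rintro _ rfl _ rfl h; exact absurd rfl h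
  disjoint_inner := by rintro _ rfl _ rfl h; exact absurd rfl h

theorem arcSides_singleton (l : List D) : S.arcSides {l} = S.sides l := by
  ext d; simp [CellSurface.arcSides]

namespace PathSystem

variable {ends : Set S.Vertex} {Δ : Set (List D)}

theorem eq_of_mem_sides (h : S.PathSystem ends Δ) {l l' : List D} (hl : l ∈ Δ) (hl' : l' ∈ Δ)
    {d : D} (hd : d ∈ S.sides l) (hd' : d ∈ S.sides l') : l = l' := by
  by_contra hne
  exact Set.disjoint_left.1 (h.disjoint_sides l hl l' hl' hne) hd hd'

theorem eq_of_mem_inner (h : S.PathSystem ends Δ) {l l' : List D} (hl : l ∈ Δ) (hl' : l' ∈ Δ)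
    {v : S.Vertex} (hv : v ∈ S.inner l) (hv' : v ∈ S.inner l') : l = l' := by
  by_contra hne
  exact Set.disjoint_left.1 (h.disjoint_inner l hl l' hl' hne) hv hv'

theorem mono (h : S.PathSystem ends Δ) {Δ' : Set (List D)} (hs : Δ' ⊆ Δ) :
    S.PathSystem ends Δ' where
  path l hl := h.path l (hs hl)
  disjoint_sides l hl l' hl' := h.disjoint_sides l (hs hl) l' (hs hl')
  disjoint_inner l hl l' hl' := h.disjoint_inner l (hs hl) l' (hs hl')

theorem not_boundary (h : S.PathSystem ends Δ) : ∀ d ∈ S.arcSides Δ, ¬ S.IsBoundarySide d := by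
  rintro d ⟨l, hl, hd | hd⟩
  · exact (h.path l hl).interior d hd
  · rw [← CellSurface.isBoundarySide_opp]; exact (h.path l hl).interior _ hd

theorem tail_mem (h : S.PathSystem ends Δ) {d : D}
    (hd : d ∈ S.arcSides Δ) : S.tail d ∈ ends ∨ S.tail d ∈ S.arcInner Δ := by
  obtain ⟨l, hl, hd⟩ := hd
  exact ((h.path l hl).side_mem hd).imp_right fun h => ⟨l, hl, h⟩

theorem inner_interior (h : S.PathSystem ends Δ) {v : S.Vertex} (hv : v ∈ S.arcInner Δ) :
    ¬ S.IsMarked v ∧ ¬ S.IsBoundaryVertex v := by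
  obtain ⟨l, hl, hv⟩ := hv
  exact (h.path l hl).inner_interior v hv

theorem side_inner_iff (hm : ∀ v ∈ ends, S.IsMarked v) (h : S.PathSystem ends Δ) {l : List D}
    (hl : l ∈ Δ) {a b : D} (hab : [a, b] <:+: l) {d : D} (hd : d ∈ S.arcSides Δ) :
    S.tail d = S.tail b ↔ d = b ∨ d = S.opp a := by
  have hbt := List.mem_tail_of_pair hab
  have hal : a ∈ l := List.mem_of_mem_dropLast (List.mem_dropLast_of_pair hab)
  have hP := h.path l hl
  constructor
  · intro e
    obtain ⟨l', hl', hd'⟩ := hd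
    have hin : S.tail b ∈ S.inner l := ⟨b, hbt, rfl⟩
    rcases (h.path l' hl').side_mem hd' with h' | h'
    · exact absurd (e ▸ h') (hP.inner_not_ends hm hin)
    · have : l' = l := h.eq_of_mem_inner hl' hl h' (e ▸ hin)
      subst this
      exact (hP.side_inner_iff hm hab hd').1 e
  · rintro (rfl | rfl)
    · rfl
    · rw [CellSurface.tail_opp (hP.interior a hal), hP.pair_head hab]

theorem exists_pair (_h : S.PathSystem ends Δ) {v : S.Vertex} (hv : v ∈ S.arcInner Δ) :
    ∃ l ∈ Δ, ∃ a b, [a, b] <:+: l ∧ S.tail b = v := by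
  obtain ⟨l, hl, b, hb, rfl⟩ := hv
  obtain ⟨a, ha⟩ := List.exists_pair_of_mem_tail hb
  exact ⟨l, hl, a, b, ha, rfl⟩

theorem pair_opp_ne (h : S.PathSystem ends Δ) {l : List D} (hl : l ∈ Δ) {a b : D}
    (hab : [a, b] <:+: l) : b ≠ S.opp a := fun e =>
  (h.path l hl).opp_ne (List.mem_of_mem_dropLast (List.mem_dropLast_of_pair hab))
    (List.mem_of_mem_tail (List.mem_tail_of_pair hab)) e.symm

/-- Every path has two ends. -/
theorem ncard_ends [Finite D] (hm : ∀ v ∈ ends, S.IsMarked v) (h : S.PathSystem ends Δ) :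
    {d ∈ S.arcSides Δ | S.tail d ∈ ends}.ncard = 2 * Nat.card Δ := by
  let f : Δ ⊕ Δ → D := Sum.elim (fun l => l.1.head (h.path l.1 l.2).ne_nil)
    (fun l => S.opp (l.1.getLast (h.path l.1 l.2).ne_nil))
  have hhead : ∀ l : Δ, l.1.head (h.path l.1 l.2).ne_nil ∈ S.sides l.1 := fun l =>
    mem_sides_of_mem (List.head_mem _)
  have hlast : ∀ l : Δ, S.opp (l.1.getLast (h.path l.1 l.2).ne_nil) ∈ S.sides l.1 := fun l =>
    opp_mem_sides_of_mem (List.getLast_mem _)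
  have hf : Function.Injective f := by
    rintro (l | l) (l' | l') e
    · exact congrArg Sum.inl (Subtype.ext (h.eq_of_mem_sides l.2 l'.2 (hhead l)
        (show f (Sum.inl l) ∈ S.sides l'.1 from e ▸ hhead l')))
    · have : l = l' := Subtype.ext (h.eq_of_mem_sides l.2 l'.2 (hhead l)
        (show f (Sum.inl l) ∈ S.sides l'.1 from e ▸ hlast l'))
      subst this
      exact absurd e.symm ((h.path l.1 l.2).opp_ne (List.getLast_mem _) (List.head_mem _))
    · have : l = l' := Subtype.ext (h.eq_of_mem_sides l.2 l'.2 (hlast l)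
        (show f (Sum.inr l) ∈ S.sides l'.1 from e ▸ hhead l'))
      subst this
      exact absurd e ((h.path l.1 l.2).opp_ne (List.getLast_mem _) (List.head_mem _))
    · exact congrArg Sum.inr (Subtype.ext (h.eq_of_mem_sides l.2 l'.2 (hlast l)
        (show f (Sum.inr l) ∈ S.sides l'.1 from e ▸ hlast l')))
  have hr : Set.range f = {d ∈ S.arcSides Δ | S.tail d ∈ ends} := by
    ext d
    constructor
    · rintro ⟨l | l, rfl⟩
      · exact ⟨⟨l.1, l.2, hhead l⟩, ((h.path l.1 l.2).side_ends_iff hm (hhead l)).2 (Or.inl rfl)⟩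
      · exact ⟨⟨l.1, l.2, hlast l⟩, ((h.path l.1 l.2).side_ends_iff hm (hlast l)).2 (Or.inr rfl)⟩
    · rintro ⟨⟨l, hl, hd⟩, he⟩
      rcases ((h.path l hl).side_ends_iff hm hd).1 he with e | e
      · exact ⟨Sum.inl ⟨l, hl⟩, e.symm⟩
      · exact ⟨Sum.inr ⟨l, hl⟩, e.symm⟩
  have : Finite (Δ ⊕ Δ) := Finite.of_injective f hf
  have : Finite Δ := Finite.of_injective (Sum.inl : Δ → Δ ⊕ Δ) Sum.inl_injective
  rw [← hr, ← Nat.card_coe_set_eq, Nat.card_range_of_injective hf, Nat.card_sum]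
  ring

theorem finite [Finite D] (h : S.PathSystem ends Δ) : Finite Δ := by
  refine Finite.of_injective (fun l : Δ => l.1.head (h.path l.1 l.2).ne_nil) fun l l' e => ?_
  refine Subtype.ext (h.eq_of_mem_sides l.2 l'.2 (mem_sides_of_mem (List.head_mem _))
    (d := l.1.head (h.path l.1 l.2).ne_nil) ?_)
  have e' : l.1.head (h.path l.1 l.2).ne_nil = l'.1.head (h.path l'.1 l'.2).ne_nil := e
  rw [e']
  exact mem_sides_of_mem (List.head_mem _)

/-- At each vertex of a set of inner vertices there are two sides. -/
theorem ncard_inner [Finite D] (hm : ∀ v ∈ ends, S.IsMarked v) (h : S.PathSystem ends Δ)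
    {X : Set S.Vertex} (hX : X ⊆ S.arcInner Δ) :
    {d ∈ S.arcSides Δ | S.tail d ∈ X}.ncard = 2 * X.ncard := by
  choose p hp a b hab hv using fun v : X => h.exists_pair (hX v.2)
  have hbA : ∀ v, b v ∈ S.arcSides Δ := fun v =>
    ⟨p v, hp v, mem_sides_of_mem (List.mem_of_mem_tail (List.mem_tail_of_pair (hab v)))⟩
  have haA : ∀ v, S.opp (a v) ∈ S.arcSides Δ := fun v =>
    ⟨p v, hp v, opp_mem_sides_of_mem
      (List.mem_of_mem_dropLast (List.mem_dropLast_of_pair (hab v)))⟩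
  have hva : ∀ v, S.tail (S.opp (a v)) = v := fun v => by
    rw [← hv v]; exact (h.side_inner_iff hm (hp v) (hab v) (haA v)).2 (Or.inr rfl)
  let f : X ⊕ X → D := Sum.elim b (fun v => S.opp (a v))
  have hf : Function.Injective f := by
    rintro (v | v) (v' | v') e
    · refine congrArg Sum.inl (Subtype.ext ?_)
      rw [← hv v, ← hv v']; exact congrArg S.tail e
    · have : v = v' := Subtype.ext (by rw [← hv v, ← hva v']; exact congrArg S.tail e)
      subst this
      exact absurd e (h.pair_opp_ne (hp v) (hab v))
    · have : v = v' := Subtype.ext (by rw [← hva v, ← hv v']; exact congrArg S.tail e)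
      subst this
      exact absurd e.symm (h.pair_opp_ne (hp v) (hab v))
    · refine congrArg Sum.inr (Subtype.ext ?_)
      rw [← hva v, ← hva v']; exact congrArg S.tail e
  have hr : Set.range f = {d ∈ S.arcSides Δ | S.tail d ∈ X} := by
    ext d
    constructor
    · rintro ⟨v | v, rfl⟩
      · exact ⟨hbA v, by rw [show f (Sum.inl v) = b v from rfl, hv v]; exact v.2⟩
      · exact ⟨haA v, by rw [show f (Sum.inr v) = S.opp (a v) from rfl, hva v]; exact v.2⟩
    · rintro ⟨hd, hX⟩
      rcases (h.side_inner_iff hm (hp ⟨_, hX⟩) (hab ⟨_, hX⟩) hd).1 (hv ⟨_, hX⟩).symm with e | e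
      · exact ⟨Sum.inl ⟨_, hX⟩, e.symm⟩
      · exact ⟨Sum.inr ⟨_, hX⟩, e.symm⟩
  rw [← hr, ← Nat.card_coe_set_eq, Nat.card_range_of_injective hf, Nat.card_sum,
    Nat.card_coe_set_eq]
  ring

/-- Each side is counted at its starting point: two for the ends of every path, and two at each
inner vertex, since no other path passes through it. -/
theorem ncard_arcSides [Finite D] (hm : ∀ v ∈ ends, S.IsMarked v) (h : S.PathSystem ends Δ) :
    (S.arcSides Δ).ncard = 2 * Nat.card Δ + 2 * (S.arcInner Δ).ncard := by
  rw [← h.ncard_ends hm, ← h.ncard_inner hm subset_rfl, ← Set.ncard_union_eq]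
  · congr 1
    ext d
    constructor
    · intro hd
      rcases h.tail_mem hd with h' | h'
      · exact Or.inl ⟨hd, h'⟩
      · exact Or.inr ⟨hd, h'⟩
    · rintro (h | h) <;> exact h.1
  · rw [Set.disjoint_left]
    intro d hd hd'
    exact (h.inner_interior hd'.2).1 (hm _ hd.2)

/-- Cutting along a path system raises the Euler characteristic by one for every path, and lowers it
by one for every interior end point. -/
theorem euler_cut [Finite D] (hm : ∀ v ∈ ends, S.IsMarked v) (h : S.PathSystem ends Δ) :
    (S.cut (S.arcSides Δ)).euler Set.univ +
        {v ∈ ends | ¬ S.IsBoundaryVertex v ∧ v ∈ S.tail '' S.arcSides Δ}.ncard =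
      S.euler Set.univ + Nat.card Δ := by
  have hE := S.oppClosed_arcSides Δ
  have h1 := CellSurface.ncard_cut_tail (w := Set.univ) hE h.not_boundary
    (fun _ _ _ _ => Set.mem_univ _)
  have h2 := CellSurface.two_mul_ncard_cut_edge hE h.not_boundary
  have h3 := h.ncard_arcSides hm
  rw [Set.inter_univ] at h1
  have h4 : {v ∈ S.tail '' S.arcSides Δ | ¬ S.IsBoundaryVertex v}.ncard =
      {v ∈ ends | ¬ S.IsBoundaryVertex v ∧ v ∈ S.tail '' S.arcSides Δ}.ncard +
        (S.arcInner Δ).ncard := by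
    rw [← Set.ncard_union_eq]
    · congr 1
      ext v
      constructor
      · rintro ⟨⟨d, hd, rfl⟩, hb⟩
        rcases h.tail_mem hd with h' | h'
        · exact Or.inl ⟨h', hb, d, hd, rfl⟩
        · exact Or.inr h'
      · rintro (⟨_, hb, hd⟩ | hv)
        · exact ⟨hd, hb⟩
        · refine ⟨?_, (h.inner_interior hv).2⟩
          obtain ⟨l, hl, b, hb, rfl⟩ := hv
          exact ⟨b, ⟨l, hl, mem_sides_of_mem (List.mem_of_mem_tail hb)⟩, rfl⟩
    · rw [Set.disjoint_left]
      intro v hv hv'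
      exact (h.inner_interior hv').1 (hm _ hv.1)
  have h5 : (S.cut (S.arcSides Δ)).face '' Set.univ = S.face '' Set.univ := rfl
  have h6 : ((S.cut (S.arcSides Δ)).face '' Set.univ).ncard = (S.face '' Set.univ).ncard := by
    rw [h5]; rfl
  -- With `A` the set of sides of the paths, the number of vertices grows by `|A|` less the interior
  -- vertices on the paths, that of edges by `|A| / 2`, and the polygons stay the same. Half of
  -- `|A|` is the number of paths plus that of inner vertices.
  unfold CellSurface.euler
  omega

theorem euler_cut_of_boundary [Finite D] (hm : ∀ v ∈ ends, S.IsMarked v)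
    (hb : ∀ v ∈ ends, S.IsBoundaryVertex v) (h : S.PathSystem ends Δ) :
    (S.cut (S.arcSides Δ)).euler Set.univ = S.euler Set.univ + Nat.card Δ := by
  have := h.euler_cut hm
  have h0 : {v ∈ ends | ¬ S.IsBoundaryVertex v ∧ v ∈ S.tail '' S.arcSides Δ} = ∅ := by
    ext v
    exact iff_of_false (fun h => h.2.1 (hb v h.1)) (fun h => h)
  rw [h0, Set.ncard_empty] at this
  omega

end PathSystem

end MarkedCells

/-! ### The side that follows anti-clockwise at a vertex. -/

namespace CellSurface

variable {D : Type*} {S : CellSurface D}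

theorem isBoundaryVertex_head [Finite D] {b : D} (hb : S.IsBoundarySide b) :
    S.IsBoundaryVertex (S.head b) := by
  obtain ⟨b', h, h'⟩ := exists_boundary_tail_eq_head hb
  exact ⟨b', h, h'⟩

/-- At an interior vertex one can rotate from every corner to every other one. -/
theorem reflTransGen_of_interior [Finite D] {c c' : D} (hc : ¬ S.IsBoundaryVertex (S.tail c))
    (h : S.tail c = S.tail c') : ReflTransGen S.Rot c c' := by
  -- At an interior vertex rotation never stops, so the orbit of `a` returns to `a`; a step back is
  -- the rest of the full turn.
  have back : ∀ a b, ¬ S.IsBoundaryVertex (S.tail a) → S.Rot a b → ReflTransGen S.Rot b a := by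
    intro a b ha hab
    obtain ⟨x, hx, hxa⟩ := exists_pred_of_total (r := S.Rot)
      (fun _ _ _ h h' => h.left_unique h') a (fun x hx => exists_rot_of fun hb => ha (by
        have h1 := isBoundaryVertex_head hb
        have h2 : S.head (S.next.symm x) = S.tail x := by
          unfold head; rw [Equiv.apply_symm_apply]
        rw [h2, ← tail_eq_of_reflTransGen hx] at h1
        exact h1))
    rcases ReflTransGen.cases_head hx with rfl | ⟨y, hy, hyx⟩
    · rw [hab.right_unique hxa]
    · rw [hab.right_unique hy]
      exact hyx.tail hxa
  have key : ∀ x y, EqvGen S.Rot x y → ¬ S.IsBoundaryVertex (S.tail x) →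
      ReflTransGen S.Rot x y ∧ ReflTransGen S.Rot y x := by
    intro x y hxy
    induction hxy with
    | rel a b h => exact fun ha => ⟨.single h, back a b ha h⟩
    | refl a => exact fun _ => ⟨.refl, .refl⟩
    | symm a b hab ih =>
      intro hb
      have := ih (by rw [tail_eq_iff.2 hab]; exact hb)
      exact ⟨this.2, this.1⟩
    | trans a b c hab _ ih1 ih2 =>
      intro ha
      have h1 := ih1 ha
      have h2 := ih2 (by rw [← tail_eq_iff.2 hab]; exact ha)
      exact ⟨h1.1.trans h2.1, h2.2.trans h1.2⟩
  exact (key c c' (tail_eq_iff.1 h) hc).1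

variable (S) in
/-- `e` is the first side in `E` that is met when rotating anti-clockwise from `d`. -/
def NextSide (E : Set D) (d e : D) : Prop :=
  e ∈ E ∧ (S.cut E).head (S.opp e) = (S.cut E).tail d

section NextSide

variable {E : Set D}

theorem cut_boundary_of_mem {d : D} (hd : d ∈ E) : (S.cut E).IsBoundarySide d := cut_opp_of_mem hd

theorem cut_boundary_opp_of_mem (hE : S.OppClosed E) {d : D} (hd : d ∈ E) :
    (S.cut E).IsBoundarySide (S.opp d) := cut_opp_of_mem (hE d hd)

/-- A fan of the cut surface ends at the head of only one boundary side. -/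
theorem NextSide.right_unique (hE : S.OppClosed E) {d e e' : D} (h : S.NextSide E d e)
    (h' : S.NextSide E d e') : e = e' :=
  S.opp_injective (boundary_head_injective (cut_boundary_opp_of_mem hE h.1)
    (cut_boundary_opp_of_mem hE h'.1) (h.2.trans h'.2.symm))

theorem NextSide.left_unique {d d' e : D} (hd : d ∈ E) (hd' : d' ∈ E)
    (h : S.NextSide E d e) (h' : S.NextSide E d' e) : d = d' :=
  boundary_tail_injective (cut_boundary_of_mem hd) (cut_boundary_of_mem hd')
    (h.2.symm.trans h'.2)

theorem NextSide.sameComp {d e : D} (h : S.NextSide E d e) :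
    (S.cut E).SameComp d (S.opp e) := sameComp_of_tail_eq_head h.2.symm

theorem NextSide.tail_eq (hE : S.OppClosed E) (hEb : ∀ d ∈ E, ¬ S.IsBoundarySide d) {d e : D}
    (h : S.NextSide E d e) : S.tail e = S.tail d := by
  rw [← head_eq_of_cut_head_eq_tail hE h.2, head_opp (hEb e h.1)]

/-- The fan of the cut surface that begins with `d` ends at a boundary side: either the reverse of a
side in `E`, which is then the next one, or a boundary side of `S`, where the rotation stops. -/
theorem exists_nextSide_or [Finite D] (hE : S.OppClosed E) {d : D} (hd : d ∈ E) :
    (∃ e, S.NextSide E d e) ∨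
      ∃ b, S.IsBoundarySide b ∧ b ∉ E ∧ (S.cut E).head b = (S.cut E).tail d := by
  obtain ⟨b, hb, hbd⟩ := exists_boundary_head_eq_tail (cut_boundary_of_mem (S := S) hd)
  by_cases h : b ∈ E
  · exact Or.inl ⟨S.opp b, hE b h, by rwa [S.opp_opp]⟩
  · exact Or.inr ⟨b, ((cut_isBoundarySide hE).1 hb).resolve_right h, h, hbd⟩

theorem exists_nextSide [Finite D] (hE : S.OppClosed E) {d : D} (hd : d ∈ E)
    (hi : ¬ S.IsBoundaryVertex (S.tail d)) : ∃ e, S.NextSide E d e := by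
  rcases exists_nextSide_or hE hd with h | ⟨b, hb, _, hbd⟩
  · exact h
  · refine absurd ?_ hi
    rw [← head_eq_of_cut_head_eq_tail hE hbd]
    exact isBoundaryVertex_head hb

/-- The sides in `E` at an interior vertex are permuted cyclically by `NextSide`. -/
theorem mem_of_nextSide_closed [Finite D] (hE : S.OppClosed E) {P : Set D} (hPE : P ⊆ E)
    (hP : ∀ d ∈ P, ∀ e, S.NextSide E d e → e ∈ P) {d e : D} (hd : d ∈ P)
    (hi : ¬ S.IsBoundaryVertex (S.tail d)) (he : e ∈ E) (hde : S.tail d = S.tail e) : e ∈ P := by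
  have key : ∀ c, ReflTransGen S.Rot d c → ∃ x ∈ P, (S.cut E).tail x = (S.cut E).tail c := by
    intro c hc
    induction hc with
    | refl => exact ⟨d, hd, rfl⟩
    | @tail b c _ hbc ih =>
      obtain ⟨x, hx, hxb⟩ := ih
      by_cases hcE : c ∈ E
      · refine ⟨c, hP x hx c ⟨hcE, ?_⟩, rfl⟩
        have : (S.cut E).head (S.opp c) = (S.cut E).tail b := by
          rw [hbc.eq_next]; rfl
        rw [this, hxb]
      · exact ⟨x, hx, hxb.trans ((cut_rot_iff hE).2 ⟨hbc, hcE⟩).tail_eq⟩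
  obtain ⟨x, hx, hxe⟩ := key e (reflTransGen_of_interior hi hde)
  rwa [← boundary_tail_injective (cut_boundary_of_mem (hPE hx)) (cut_boundary_of_mem he) hxe]

/-- If `E` has exactly the two sides `x` and `y` at an interior vertex, then they follow each
other. -/
theorem nextSide_of_pair [Finite D] (hE : S.OppClosed E) {x y : D} (hx : x ∈ E)
    (hy : y ∈ E) (hxy : x ≠ y) (ht : S.tail x = S.tail y)
    (hi : ¬ S.IsBoundaryVertex (S.tail x)) (hEb : ∀ d ∈ E, ¬ S.IsBoundarySide d)
    (ho : ∀ d ∈ E, S.tail d = S.tail x → d = x ∨ d = y) : S.NextSide E x y := by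
  obtain ⟨e, he⟩ := exists_nextSide hE hx hi
  rcases ho e he.1 (he.tail_eq hE hEb) with rfl | rfl
  -- A side that followed itself would be the only side of `E` at the vertex.
  · have := mem_of_nextSide_closed hE (P := {e}) (by simpa using hx)
      (by rintro _ rfl e' he'; exact he'.right_unique hE he) (Set.mem_singleton _) hi hy ht
    exact absurd this.symm hxy
  · exact he

end NextSide

end CellSurface

/-! ### Minimal oriented intersections as corners between successive ends. -/

namespace MarkedCells

variable {D : Type*} {S : MarkedCells D}

open CellSurface

/-- The ends of the arcs of `Δ` that are followed by another end in the anti-clockwise direction. -/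
def corners (S : MarkedCells D) (Δ : Set (List D)) : Set D :=
  {d | d ∈ S.arcSides Δ ∧ S.tail d ∈ S.red ∧ ∃ e, S.NextSide (S.arcSides Δ) d e}

theorem transGen_of_nextSide {E : Set D} (hE : S.OppClosed E)
    (hEb : ∀ d ∈ E, ¬ S.IsBoundarySide d) {d e : D} (hd : d ∈ E) (h : S.NextSide E d e) :
    TransGen S.Rot d e := by
  have h1 : ReflTransGen (S.cut E).Rot d (S.next (S.opp e)) :=
    reflTransGen_of_boundary_tail (cut_boundary_of_mem hd) h.2.symm
  have h2 : ReflTransGen S.Rot d (S.next (S.opp e)) :=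
    ReflTransGen.lift id (fun a b hab => ((cut_rot_iff hE).1 hab).1) _ _ h1
  exact TransGen.tail' h2 (rot_next_opp (hEb e h.1))

/-- If no side of `E` is met strictly between `d` and `e`, the turn stays within one fan of the cut
surface until its last step, which crosses `e`. -/
theorem exists_nextSide_of_transGen {E : Set D} (hE : S.OppClosed E) {d e : D}
    (he : e ∈ E) (h : TransGen S.Rot d e) :
    S.NextSide E d e ∨ ∃ y ∈ E, TransGen S.Rot d y ∧ TransGen S.Rot y e := by
  by_contra! hcon
  obtain ⟨h1, h2⟩ := hcon
  obtain ⟨c, hdc, hce⟩ := TransGen.tail'_iff.1 h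
  refine h1 ⟨he, ?_⟩
  have key : ∀ x, ReflTransGen S.Rot d x → ReflTransGen S.Rot x c →
      (S.cut E).tail d = (S.cut E).tail x := by
    intro x hx
    induction hx with
    | refl => exact fun _ => rfl
    | @tail b x hb hbx ih =>
      intro hxc
      rw [ih (ReflTransGen.head hbx hxc)]
      refine ((cut_rot_iff hE).2 ⟨hbx, fun hxE => ?_⟩).tail_eq
      exact h2 x hxE (TransGen.tail' hb hbx) (TransGen.tail' hxc hce)
  rw [key c hdc .refl, hce.eq_next]
  rfl

/-- The fan from `d` to the corner just before `e` crosses no side of `E`, so `y` can only be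
reached at or after `e`. Turning on from `y` to `e` would then complete a full turn at a boundary
vertex. -/
theorem not_between_nextSide {E : Set D} (hE : S.OppClosed E)
    (hEb : ∀ d ∈ E, ¬ S.IsBoundarySide d) {d e y : D} (hd : d ∈ E) (h : S.NextSide E d e)
    (hb : S.IsBoundaryVertex (S.tail d)) (hy : y ∈ E) (h1 : TransGen S.Rot d y)
    (h2 : TransGen S.Rot y e) : False := by
  have h3 : ReflTransGen (S.cut E).Rot d (S.next (S.opp e)) :=
    reflTransGen_of_boundary_tail (cut_boundary_of_mem hd) h.2.symm
  have key : TransGen S.Rot (S.next (S.opp e)) y := by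
    clear hd h hb h2
    induction h3 using ReflTransGen.head_induction_on with
    | refl => exact h1
    | @head a c hac _ ih =>
      have hac' := (cut_rot_iff hE).1 hac
      refine ih ?_
      obtain ⟨c', hc, hcy⟩ := TransGen.head'_iff.1 h1
      rw [← hac'.1.right_unique hc] at hcy
      rcases ReflTransGen.cases_head hcy with rfl | ⟨z, hz, hzy⟩
      · exact absurd hy hac'.2
      · exact TransGen.head' hz hzy
  obtain ⟨c', hc, hcy⟩ := TransGen.head'_iff.1 key
  rw [← (rot_next_opp (hEb e h.1)).right_unique hc] at hcy
  refine not_transGen_self (S := S.toCellSurface) (c := e) ?_ (TransGen.trans_right hcy h2)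
  rw [h.tail_eq hE hEb]
  exact hb

/-- A minimal oriented intersection is a corner between two successive ends. -/
theorem exists_minimalIntersection_equiv {Δ : Set (List D)} (h : S.PathSystem S.red Δ)
    (hr : ∀ v ∈ S.red, S.IsBoundaryVertex v) :
    ∃ f : S.MinimalIntersection Δ ≃ S.corners Δ,
      ∀ a, (f a : D) = a.1.fst ∧ S.NextSide (S.arcSides Δ) a.1.fst a.1.snd := by
  have hE := S.oppClosed_arcSides Δ
  have hEb := h.not_boundary
  have mem : ∀ (l : Δ) {d : D}, d ∈ S.sides l.1 → d ∈ S.arcSides Δ := fun l d hd => ⟨l.1, l.2, hd⟩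
  -- A side of an arc strictly inside the angle would decompose the intersection.
  have hn : ∀ a : S.MinimalIntersection Δ, S.NextSide (S.arcSides Δ) a.1.fst a.1.snd := by
    intro a
    rcases exists_nextSide_of_transGen hE (mem _ a.1.snd_mem) a.1.angle with h' | ⟨y, hy, h1, h2⟩
    · exact h'
    · obtain ⟨l, hl, hyl⟩ := hy
      refine absurd ⟨⟨a.1.src, ⟨l, hl⟩, a.1.fst, y, a.1.fst_mem, hyl, a.1.base, h1⟩,
        ⟨⟨l, hl⟩, a.1.tgt, y, a.1.snd, hyl, a.1.snd_mem, ?_, h2⟩, rfl, rfl, rfl⟩ a.2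
      rw [← tail_eq_of_reflTransGen h1.to_reflTransGen]
      exact a.1.base
  let f : S.MinimalIntersection Δ → S.corners Δ := fun a =>
    ⟨a.1.fst, mem _ a.1.fst_mem, a.1.base, a.1.snd, hn a⟩
  have hf : Function.Bijective f := by
    constructor
    · intro a b hab
      have e1 : a.1.fst = b.1.fst := congrArg Subtype.val hab
      have e2 : a.1.snd = b.1.snd := (hn a).right_unique hE (e1 ▸ hn b)
      refine Subtype.ext (OrientedIntersection.ext ?_ ?_ e1 e2)
      · exact Subtype.ext (h.eq_of_mem_sides a.1.src.2 b.1.src.2 a.1.fst_mem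
          (e1 ▸ b.1.fst_mem))
      · exact Subtype.ext (h.eq_of_mem_sides a.1.tgt.2 b.1.tgt.2 a.1.snd_mem
          (e2 ▸ b.1.snd_mem))
    · rintro ⟨d, hd, hdr, e, he⟩
      obtain ⟨l, hl, hdl⟩ := id hd
      obtain ⟨m, hm, hem⟩ := id he.1
      refine ⟨⟨⟨⟨l, hl⟩, ⟨m, hm⟩, d, e, hdl, hem, hdr, transGen_of_nextSide hE hEb hd he⟩, ?_⟩, rfl⟩
      rintro ⟨x, y, e1, e2, e3⟩
      refine not_between_nextSide hE hEb hd he (hr _ hdr) (mem _ x.snd_mem) ?_ ?_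
      · have := x.angle
        rwa [e1] at this
      · have := y.angle
        rw [← e2, e3] at this
        exact this
  exact ⟨Equiv.ofBijective f hf, fun a => ⟨rfl, hn a⟩⟩

end MarkedCells

/-! ### Contraction of boundary sides. -/

theorem Set.ncard_image_eq_of_iff {α β β' : Type*} {g : α → β} {g' : α → β'} {s : Set α}
    (h : ∀ a ∈ s, ∀ b ∈ s, g a = g b ↔ g' a = g' b) : (g '' s).ncard = (g' '' s).ncard := by
  classical
  rcases s.eq_empty_or_nonempty with rfl | ⟨a₀, ha₀⟩
  · simp
  have hrep : ∀ x, ∃ a, x ∈ g '' s → a ∈ s ∧ g a = x := by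
    intro x
    by_cases hx : x ∈ g '' s
    · obtain ⟨a, ha, e⟩ := hx
      exact ⟨a, fun _ => ⟨ha, e⟩⟩
    · exact ⟨a₀, fun h => absurd h hx⟩
  choose r hr using hrep
  have e : g' '' s = (fun x => g' (r x)) '' (g '' s) := by
    ext y
    constructor
    · rintro ⟨a, ha, rfl⟩
      refine ⟨g a, ⟨a, ha, rfl⟩, ?_⟩
      have h1 := hr (g a) ⟨a, ha, rfl⟩
      exact (h _ h1.1 _ ha).1 h1.2
    · rintro ⟨x, hx, rfl⟩
      exact ⟨r x, (hr x hx).1, rfl⟩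
  rw [e]
  refine (Set.InjOn.ncard_image ?_).symm
  intro x hx y hy hxy
  have h1 := hr x hx
  have h2 := hr y hy
  rw [← h1.2, ← h2.2]
  exact (h _ h1.1 _ h2.1).2 hxy

namespace CellSurface

variable {D : Type*}

theorem eq_of_face_eq {S : CellSurface D} {Z : Type*} {g : D → Z}
    (hg : ∀ d, g (S.next d) = g d) {a b : D} (h : S.face a = S.face b) : g a = g b := by
  obtain ⟨i, rfl⟩ := face_eq_iff.1 h
  induction i using Int.induction_on with
  | zero => rfl
  | succ i ih => rw [ih (by rw [face_eq_iff]; exact ⟨_, rfl⟩), add_comm, zpow_add, zpow_one,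
      Equiv.Perm.mul_apply, hg]
  | pred i ih =>
    rw [ih (by rw [face_eq_iff]; exact ⟨_, rfl⟩), ← hg ((S.next ^ (-(i : ℤ) - 1)) a)]
    congr 1
    rw [← Equiv.Perm.mul_apply, ← zpow_one_add]
    congr 2
    ring

/-- `T` arises from `R` by contracting the boundary sides outside of `K`, no boundary component
being contracted completely. -/
structure IsContraction [Finite D] {K : Set D} (R : CellSurface D) (T : CellSurface K) : Prop where
  next_eq : T.next = firstReturn R.next K
  opp_eq : ∀ d, (T.opp d : D) = R.opp d
  boundary : ∀ d ∉ K, R.IsBoundarySide d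
  rank : ∃ ρ : D → ℕ, ∀ d ∉ K, ∀ b ∉ K, R.tail b = R.head d → ρ d < ρ b

namespace IsContraction

variable [Finite D] {K : Set D} {R : CellSurface D} {T : CellSurface K}

-- The function `ρ` is bounded and increases along a chain of contracted boundary sides, so each
-- chain ends at a kept side, and induction can run backwards from there.
@[elab_as_elim]
theorem induction (h : IsContraction R T) {P : D → Prop} (hK : ∀ d ∈ K, P d)
    (hs : ∀ d ∉ K, (∀ b, R.tail b = R.head d → P b) → P d) (d : D) : P d := by
  obtain ⟨ρ, hρ⟩ := h.rank
  obtain ⟨M, hM⟩ := (Set.finite_range ρ).bddAbove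
  have hM' : ∀ d, ρ d ≤ M := fun d => hM ⟨d, rfl⟩
  induction hn : M - ρ d using Nat.strong_induction_on generalizing d with
  | _ n ih =>
    by_cases hd : d ∈ K
    · exact hK d hd
    · refine hs d hd fun b hb => ?_
      by_cases hbK : b ∈ K
      · exact hK b hbK
      · have := hρ d hd b hbK hb
        exact ih (M - ρ b) (by have := hM' b; have := hM' d; omega) b rfl

theorem exists_kept (h : IsContraction R T) (d : D) : ∃ n : ℕ, (R.next ^ n) d ∈ K := by
  refine h.induction (fun d hd => ⟨0, by simpa using hd⟩) (fun d _ ih => ?_) d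
  obtain ⟨n, hn⟩ := ih (R.next d) rfl
  exact ⟨n + 1, by rw [pow_succ, Equiv.Perm.mul_apply]; exact hn⟩

open Classical in
/-- The first side among `d`, `next d`, … which is not contracted. -/
noncomputable def land (h : IsContraction R T) (d : D) : K :=
  ⟨(R.next ^ Nat.find (h.exists_kept d)) d, Nat.find_spec (h.exists_kept d)⟩

theorem land_of_mem (h : IsContraction R T) (d : K) : h.land d = d := by
  classical
  apply Subtype.ext
  have : Nat.find (h.exists_kept d) = 0 := by
    rw [Nat.find_eq_zero]; simp
  simp [land, this]

theorem land_next (h : IsContraction R T) {d : D} (hd : d ∉ K) : h.land (R.next d) = h.land d := by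
  classical
  apply Subtype.ext
  have h1 : Nat.find (h.exists_kept d) = Nat.find (h.exists_kept (R.next d)) + 1 := by
    rw [Nat.find_eq_iff]
    refine ⟨?_, ?_⟩
    · rw [pow_succ, Equiv.Perm.mul_apply]
      exact Nat.find_spec (h.exists_kept (R.next d))
    · intro n hn
      cases n with
      | zero => simpa using hd
      | succ n =>
        rw [pow_succ, Equiv.Perm.mul_apply]
        exact Nat.find_min (h.exists_kept (R.next d)) (by omega)
  simp only [land, h1, pow_succ, Equiv.Perm.mul_apply]

theorem next_eq_land (h : IsContraction R T) (d : K) : T.next d = h.land (R.next d) := by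
  classical
  rw [h.next_eq]
  apply Subtype.ext
  have h1 : Nat.find (exists_return R.next K d) = Nat.find (h.exists_kept (R.next d)) := by
    rw [Nat.find_eq_iff]
    refine ⟨?_, ?_⟩
    · rw [pow_succ, Equiv.Perm.mul_apply]
      exact Nat.find_spec (h.exists_kept (R.next d))
    · intro n hn
      rw [pow_succ, Equiv.Perm.mul_apply]
      exact Nat.find_min (h.exists_kept (R.next d)) hn
  change (R.next ^ (Nat.find (exists_return R.next K d) + 1)) (d : D) = _
  rw [h1, pow_succ, Equiv.Perm.mul_apply]
  rfl

/-- A function that is constant along contracted sides has the same value before and after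
`land`. -/
theorem apply_land (h : IsContraction R T) {Z : Type*} {g : D → Z}
    (hc : ∀ d ∉ K, g (R.next d) = g d) (d : D) : g (h.land d) = g d := by
  refine h.induction (fun d hd => ?_) (fun d hd ih => ?_) d
  · rw [h.land_of_mem ⟨d, hd⟩]
  · rw [← h.land_next hd, ih _ rfl, hc d hd]

/-- The vertex of the contracted surface onto which the starting point of a side is mapped. -/
noncomputable def vtx (h : IsContraction R T) (d : D) : T.Vertex := T.tail (h.land d)

theorem vtx_of_mem (h : IsContraction R T) (d : K) : h.vtx d = T.tail d := by
  rw [vtx, h.land_of_mem]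

theorem vtx_next (h : IsContraction R T) {d : D} (hd : d ∉ K) : h.vtx (R.next d) = h.vtx d := by
  rw [vtx, h.land_next hd, vtx]

theorem head_eq_vtx (h : IsContraction R T) (d : K) : T.head d = h.vtx (R.next d) := by
  rw [head, h.next_eq_land, vtx]

theorem isBoundarySide_iff (h : IsContraction R T) {d : K} :
    T.IsBoundarySide d ↔ R.IsBoundarySide d := by
  unfold IsBoundarySide
  rw [← h.opp_eq, Subtype.ext_iff]

theorem mem_of_not_boundary (h : IsContraction R T) {d : D} (hd : ¬ R.IsBoundarySide d) : d ∈ K :=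
  not_imp_comm.1 (h.boundary d) hd

/-- Contracted sides lie on the boundary and are never crossed by a rotation step; both sides of the
crossed edge are therefore kept, and the corner `c` is represented by the first kept side after it.
-/
theorem rot_land (h : IsContraction R T) {c c' : D} (hr : R.Rot c c') :
    ∃ hc' : c' ∈ K, T.Rot (h.land c) ⟨c', hc'⟩ := by
  have hc' : c' ∈ K := h.mem_of_not_boundary hr.not_boundary
  have hp : R.opp c' ∈ K := h.mem_of_not_boundary (by
    rw [isBoundarySide_opp]; exact hr.not_boundary)
  have hn : T.next ⟨R.opp c', hp⟩ = h.land c := by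
    rw [h.next_eq_land, hr.eq_next]
  have ho : T.opp ⟨R.opp c', hp⟩ = ⟨c', hc'⟩ := Subtype.ext (by rw [h.opp_eq, R.opp_opp])
  refine ⟨hc', ?_⟩
  have hs : T.next.symm (h.land c) = ⟨R.opp c', hp⟩ := by rw [← hn, Equiv.symm_apply_apply]
  refine ⟨?_, ?_⟩
  · rw [hs, ho]
    intro e
    exact hr.not_boundary (congrArg Subtype.val e).symm
  · rw [hs, ho]

theorem vtx_eq_of_tail_eq (h : IsContraction R T) {a b : D} (hab : R.tail a = R.tail b) :
    h.vtx a = h.vtx b := by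
  refine EqvGen.eq_of_invariant (fun x y hxy => ?_) (tail_eq_iff.1 hab)
  obtain ⟨hy, hr⟩ := h.rot_land hxy
  rw [vtx, hr.tail_eq, ← h.vtx_of_mem]

/-- The vertices of the contracted surface are those of the original one up to contracted sides. -/
theorem eq_of_vtx_eq (h : IsContraction R T) {Z : Type*} {g : D → Z}
    (hr : ∀ a b, R.tail a = R.tail b → g a = g b) (hc : ∀ d ∉ K, g (R.next d) = g d)
    {a b : D} (hab : h.vtx a = h.vtx b) : g a = g b := by
  -- A rotation step after the contraction is the walk along contracted sides done by `land`,
  -- together with a rotation step before the contraction.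
  have key : ∀ x y : K, T.Rot x y → g x = g y := by
    intro x y hxy
    have e1 : x = h.land (R.next (T.opp y)) := by rw [← h.next_eq_land]; exact hxy.eq_next
    have hb : ¬ R.IsBoundarySide (y : D) := fun hb =>
      hxy.not_boundary (h.isBoundarySide_iff.2 hb)
    rw [e1, h.apply_land hc, h.opp_eq]
    exact hr _ _ (rot_next_opp hb).tail_eq
  have := EqvGen.eq_of_invariant (f := fun x : K => g x) key (tail_eq_iff.1 hab)
  simpa only [h.apply_land hc] using this

theorem eq_of_tail_eq (h : IsContraction R T) {Z : Type*} {g : D → Z}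
    (hr : ∀ a b, R.tail a = R.tail b → g a = g b) (hc : ∀ d ∉ K, g (R.next d) = g d)
    {a b : K} (hab : T.tail a = T.tail b) : g a = g b :=
  h.eq_of_vtx_eq hr hc (by rwa [h.vtx_of_mem, h.vtx_of_mem])

theorem sameComp_land (h : IsContraction R T) (d : D) : R.SameComp d (h.land d) := by
  refine h.induction (fun d hd => ?_) (fun d hd ih => ?_) d
  · rw [h.land_of_mem ⟨d, hd⟩]; exact R.sameComp_refl d
  · rw [← h.land_next hd]
    exact (R.sameComp_next d).trans (ih _ rfl)

/-- The map `land` does not leave a component and is a left inverse of the inclusion of the kept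
sides. -/
theorem sameComp_iff (h : IsContraction R T) {a b : K} :
    T.SameComp a b ↔ R.SameComp a b := by
  constructor
  · refine EqvGen.lift_of (f := Subtype.val) ?_
    rintro x y (rfl | rfl)
    · rw [h.next_eq_land]
      exact (R.sameComp_next x).trans (h.sameComp_land _)
    · rw [h.opp_eq]; exact R.sameComp_opp _
  · intro hab
    have := EqvGen.lift_of (f := h.land) (s := fun d d' => d' = T.next d ∨ d' = T.opp d) ?_ hab
    · rwa [h.land_of_mem, h.land_of_mem] at this
    · rintro x y (rfl | rfl)
      · by_cases hx : x ∈ K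
        · have e : h.land x = ⟨x, hx⟩ := h.land_of_mem ⟨x, hx⟩
          have e' := h.next_eq_land ⟨x, hx⟩
          rw [e, ← e']
          exact T.sameComp_next _
        · rw [h.land_next hx]; exact EqvGen.refl _
      · by_cases hx : R.IsBoundarySide x
        · rw [hx]; exact EqvGen.refl _
        · have hx' := h.mem_of_not_boundary hx
          have hy' : R.opp x ∈ K := h.mem_of_not_boundary (by rwa [isBoundarySide_opp])
          have e : h.land x = ⟨x, hx'⟩ := h.land_of_mem ⟨x, hx'⟩
          have e' : h.land (R.opp x) = ⟨R.opp x, hy'⟩ := h.land_of_mem ⟨_, hy'⟩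
          have e2 : (⟨R.opp x, hy'⟩ : K) = T.opp ⟨x, hx'⟩ := Subtype.ext (h.opp_eq ⟨x, hx'⟩).symm
          rw [e, e', e2]
          exact T.sameComp_opp _

theorem ncard_face (h : IsContraction R T) :
    (T.face '' Set.univ).ncard = (R.face '' Set.univ).ncard := by
  have e : T.face '' Set.univ = (fun d => T.face (h.land d)) '' Set.univ := by
    ext x
    constructor
    · rintro ⟨d, _, rfl⟩
      exact ⟨d, trivial, congrArg T.face (h.land_of_mem d)⟩
    · rintro ⟨d, _, rfl⟩
      exact ⟨_, trivial, rfl⟩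
  rw [e]
  refine Set.ncard_image_eq_of_iff fun a _ b _ => ⟨fun hab => ?_, fun hab => ?_⟩
  · have h1 := eq_of_face_eq (g := fun d : K => R.face d) (fun d => by
      rw [h.next_eq_land, h.apply_land (g := R.face) (fun d _ => R.face_next d), R.face_next]) hab
    simpa only [h.apply_land (g := R.face) (fun d _ => R.face_next d)] using h1
  · refine eq_of_face_eq (g := fun d => T.face (h.land d)) (fun d => ?_) hab
    by_cases hd : d ∈ K
    · have e : h.land d = ⟨d, hd⟩ := h.land_of_mem ⟨d, hd⟩
      have e' := h.next_eq_land ⟨d, hd⟩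
      simp only [e, ← e', T.face_next]
    · simp only [h.land_next hd]

theorem isBoundaryVertex_next_iff (h : IsContraction R T) (d : D) (hd : d ∉ K) :
    R.IsBoundaryVertex (R.tail (R.next d)) = R.IsBoundaryVertex (R.tail d) :=
  propext (iff_of_true (isBoundaryVertex_head (h.boundary d hd)) ⟨d, h.boundary d hd, rfl⟩)

/-- A boundary vertex of the original surface is mapped to one which starts a kept boundary side. -/
theorem isBoundaryVertex_vtx (h : IsContraction R T) {c : D} :
    T.IsBoundaryVertex (h.vtx c) ↔ R.IsBoundaryVertex (R.tail c) := by
  constructor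
  · rintro ⟨b, hb, hbc⟩
    have := h.eq_of_vtx_eq (g := fun c => R.IsBoundaryVertex (R.tail c))
      (fun a b e => by rw [e]) (h.isBoundaryVertex_next_iff) (a := b) (b := c)
      (by rw [h.vtx_of_mem, hbc])
    rw [← this]
    exact ⟨b, h.isBoundarySide_iff.1 hb, rfl⟩
  · rintro ⟨b, hb, hbc⟩
    rw [← h.vtx_eq_of_tail_eq hbc]
    clear hbc
    revert hb
    refine h.induction (fun d hd hb => ?_) (fun d hd ih hb => ?_) b
    · exact ⟨⟨d, hd⟩, h.isBoundarySide_iff.2 hb, (h.vtx_of_mem ⟨d, hd⟩).symm⟩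
    · obtain ⟨b', hb', he⟩ := exists_boundary_tail_eq_head hb
      have := ih b' he hb'
      rwa [h.vtx_eq_of_tail_eq he, h.vtx_next hd] at this

/-- Vertices that no contracted side touches are not merged with anything. -/
theorem ncard_tail_of_disjoint (h : IsContraction R T) {w : Set D} (hw : R.Saturated w)
    (hd : ∀ d ∉ K, d ∉ w ∧ R.next d ∉ w) :
    (T.tail '' {d | (d : D) ∈ w}).ncard = (R.tail '' w).ncard := by
  classical
  have hwK : ∀ d ∈ w, d ∈ K := fun d hdw => by_contra fun hn => (hd d hn).1 hdw
  have e : T.tail '' {d | (d : D) ∈ w} = h.vtx '' w := by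
    ext x
    constructor
    · rintro ⟨d, hd, rfl⟩
      exact ⟨d, hd, h.vtx_of_mem d⟩
    · rintro ⟨d, hd, rfl⟩
      exact ⟨⟨d, hwK d hd⟩, hd, (h.vtx_of_mem ⟨d, hwK d hd⟩).symm⟩
  rw [e]
  refine Set.ncard_image_eq_of_iff fun a ha b hb => ⟨fun hab => ?_, h.vtx_eq_of_tail_eq⟩
  -- The value `none` outside of `w` makes the function constant along contracted sides, while
  -- inside of `w` it still tells the vertices apart.
  have := h.eq_of_vtx_eq (g := fun c => if c ∈ w then some (R.tail c) else none)
    (fun a b e => by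
      have : a ∈ w ↔ b ∈ w := ⟨hw a b e, hw b a e.symm⟩
      by_cases ha : a ∈ w
      · simp [ha, this.1 ha, e]
      · have hb : b ∉ w := fun hb => ha (this.2 hb)
        simp [ha, hb]) (fun d hdK => by simp [hd d hdK]) hab
  simpa [ha, hb] using this

theorem ncard_interior (h : IsContraction R T) :
    {v ∈ T.tail '' Set.univ | ¬ T.IsBoundaryVertex v}.ncard =
      {v ∈ R.tail '' Set.univ | ¬ R.IsBoundaryVertex v}.ncard := by
  have h1 := h.ncard_tail_of_disjoint (w := {c | ¬ R.IsBoundaryVertex (R.tail c)})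
    (fun a b e ha => by simpa only [Set.mem_ofPred_eq, ← e] using ha)
    (fun d hd => ⟨fun hn => hn ⟨d, h.boundary d hd, rfl⟩,
      fun hn => hn (isBoundaryVertex_head (h.boundary d hd))⟩)
  convert h1 using 2
  · ext v
    constructor
    · rintro ⟨⟨d, _, rfl⟩, hv⟩
      rw [← h.vtx_of_mem, h.isBoundaryVertex_vtx] at hv
      exact ⟨d, hv, rfl⟩
    · rintro ⟨d, hd, rfl⟩
      refine ⟨⟨d, trivial, rfl⟩, ?_⟩
      rw [← h.vtx_of_mem, h.isBoundaryVertex_vtx]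
      exact hd
  · ext v
    constructor
    · rintro ⟨⟨d, _, rfl⟩, hv⟩
      exact ⟨d, hv, rfl⟩
    · rintro ⟨d, hd, rfl⟩
      exact ⟨⟨d, trivial, rfl⟩, hd⟩

/-- Each contracted boundary side takes away one edge and, since boundary vertices correspond to
boundary sides, one vertex; interior vertices and polygons keep their numbers. -/
theorem euler_eq (h : IsContraction R T) : T.euler Set.univ = R.euler Set.univ := by
  have v1 := ncard_tail_image (S := T) (w := Set.univ) (fun _ _ _ _ => trivial)
  have v2 := ncard_tail_image (S := R) (w := Set.univ) (fun _ _ _ _ => trivial)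
  have e1 := two_mul_ncard_edge (S := T) (C := Set.univ) (fun _ _ => trivial)
  have e2 := two_mul_ncard_edge (S := R) (C := Set.univ) (fun _ _ => trivial)
  have hi := h.ncard_interior
  have hf := h.ncard_face
  have c1 : (Set.univ : Set D).ncard = (Set.univ : Set K).ncard + Kᶜ.ncard := by
    rw [Set.ncard_univ, Set.ncard_univ, Nat.card_coe_set_eq, Set.ncard_add_ncard_compl]
  have c2 : {b ∈ (Set.univ : Set D) | R.IsBoundarySide b}.ncard =
      {b ∈ (Set.univ : Set K) | T.IsBoundarySide b}.ncard + Kᶜ.ncard := by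
    rw [← Set.ncard_image_of_injective _ Subtype.val_injective, ← Set.ncard_union_eq]
    · congr 1
      ext d
      constructor
      · rintro ⟨_, hd⟩
        by_cases hK : d ∈ K
        · exact Or.inl ⟨⟨d, hK⟩, ⟨trivial, h.isBoundarySide_iff.2 hd⟩, rfl⟩
        · exact Or.inr hK
      · rintro (⟨x, ⟨_, hx⟩, rfl⟩ | hd)
        · exact ⟨trivial, h.isBoundarySide_iff.1 hx⟩
        · exact ⟨trivial, h.boundary d hd⟩
    · rw [Set.disjoint_left]
      rintro _ ⟨x, _, rfl⟩ hx
      exact hx x.2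
  unfold euler
  omega

/-- Contraction commutes with cutting along kept sides. -/
theorem cut (h : IsContraction R T) {E : Set D} (hE : R.OppClosed E) :
    IsContraction (R.cut E) (T.cut {d | (d : D) ∈ E}) where
  next_eq := h.next_eq
  opp_eq d := by
    have hE' : T.OppClosed {d | (d : D) ∈ E} := fun x hx => by
      change (T.opp x : D) ∈ E
      rw [h.opp_eq]; exact hE _ hx
    by_cases hd : (d : D) ∈ E
    · rw [cut_opp_of_mem (S := T) (E := {d | (d : D) ∈ E}) hd, cut_opp_of_mem hd]
    · rw [cut_opp_of_notMem hE' (d := d) hd, cut_opp_of_notMem hE hd, h.opp_eq]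
  boundary d hd := (cut_isBoundarySide hE).2 (Or.inl (h.boundary d hd))
  rank := by
    obtain ⟨ρ, hρ⟩ := h.rank
    exact ⟨ρ, fun d hd b hb e => hρ d hd b hb (tail_eq_of_cut_tail_eq hE e)⟩

end IsContraction

end CellSurface

/-! ### The surface cut along the `∘`-arc. -/

theorem List.Nodup.idxOf_pair {α : Type*} [DecidableEq α] {l : List α} (hl : l.Nodup) {a b : α}
    (h : [a, b] <:+: l) : l.idxOf b = l.idxOf a + 1 := by
  obtain ⟨p, q, rfl⟩ := h
  simp only [List.append_assoc, List.cons_append, List.nil_append] at hl ⊢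
  have h1 := List.nodup_append.1 hl
  have ha : a ∉ p := fun h => h1.2.2 _ h _ (by simp) rfl
  have hb : b ∉ p := fun h => h1.2.2 _ h _ (by simp) rfl
  have hab : a ≠ b := by
    have := h1.2.1
    simp only [List.nodup_cons, List.mem_cons, not_or] at this
    exact this.1.1
  rw [List.idxOf_append_of_notMem ha, List.idxOf_append_of_notMem hb, List.idxOf_cons_self,
    List.idxOf_cons_ne _ hab, List.idxOf_cons_self]

namespace CellSurface

variable {D : Type*} {S : CellSurface D}

/-- A component of the cut surface without boundary would contain no side of `E`, hence be a whole
component of `S`, which has boundary. -/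
theorem exists_boundary_cut (hb : ∀ d, ∃ d', S.SameComp d d' ∧ S.IsBoundarySide d') {E : Set D}
    (hE : S.OppClosed E) (d : D) :
    ∃ d', (S.cut E).SameComp d d' ∧ (S.cut E).IsBoundarySide d' := by
  by_contra! hcon
  obtain ⟨b, hdb, hbb⟩ := hb d
  have key : ∀ c, (S.cut E).SameComp d c → (S.cut E).SameComp d (S.opp c) := by
    intro c hc
    have hcE : c ∉ E := fun h => hcon c hc (cut_boundary_of_mem h)
    exact hc.trans (cut_sameComp_opp hE hcE)
  have := (SameComp.of_closed (S := S) (P := fun c => (S.cut E).SameComp d c)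
    (fun c => ⟨fun h => h.trans ((S.cut E).sameComp_next c),
      fun h => h.trans ((S.cut E).sameComp_next c).symm⟩) key hdb).1 ((S.cut E).sameComp_refl d)
  exact hcon b this ((cut_isBoundarySide hE).2 (Or.inl hbb))

theorem IsContraction.exists_boundary [Finite D] {K : Set D} {R : CellSurface D}
    {T : CellSurface K} (h : IsContraction R T)
    (hb : ∀ d, ∃ d', R.SameComp d d' ∧ R.IsBoundarySide d') (d : K) :
    ∃ d', T.SameComp d d' ∧ T.IsBoundarySide d' := by
  obtain ⟨b, hdb, hbb⟩ := hb d
  obtain ⟨b', hb', e⟩ := h.isBoundaryVertex_vtx.2 ⟨b, hbb, rfl⟩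
  refine ⟨b', ?_, hb'⟩
  rw [h.sameComp_iff]
  have h1 : T.SameComp b' (h.land b) := sameComp_of_tail_eq e
  exact (hdb.trans (h.sameComp_land b)).trans (h.sameComp_iff.1 h1).symm

end CellSurface

namespace MarkedCells

open CellSurface

variable {D : Type*} {S : MarkedCells D}

/-- At an inner vertex `b` and `opp a` are the only sides of the system, so each follows the other.
-/
theorem PathSystem.nextSide_pair [Finite D] {ends : Set S.Vertex}
    (hm : ∀ v ∈ ends, S.IsMarked v) {Δ : Set (List D)} (h : S.PathSystem ends Δ) {l : List D}
    (hl : l ∈ Δ) {a b : D} (hab : [a, b] <:+: l) :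
    S.NextSide (S.arcSides Δ) b (S.opp a) ∧ S.NextSide (S.arcSides Δ) (S.opp a) b := by
  have hb : b ∈ S.arcSides Δ :=
    ⟨l, hl, mem_sides_of_mem (List.mem_of_mem_tail (List.mem_tail_of_pair hab))⟩
  have ha : S.opp a ∈ S.arcSides Δ :=
    ⟨l, hl, opp_mem_sides_of_mem (List.mem_of_mem_dropLast (List.mem_dropLast_of_pair hab))⟩
  have ht : S.tail (S.opp a) = S.tail b := (h.side_inner_iff hm hl hab ha).2 (Or.inr rfl)
  have hi : ¬ S.IsBoundaryVertex (S.tail b) :=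
    (h.inner_interior ⟨l, hl, b, List.mem_tail_of_pair hab, rfl⟩).2
  have hne := h.pair_opp_ne hl hab
  constructor
  · exact nextSide_of_pair (S.oppClosed_arcSides Δ) hb ha hne ht.symm hi h.not_boundary
      (fun d hd e => (h.side_inner_iff hm hl hab hd).1 e)
  · exact nextSide_of_pair (S.oppClosed_arcSides Δ) ha hb hne.symm ht (by rwa [ht])
      h.not_boundary (fun d hd e => ((h.side_inner_iff hm hl hab hd).1 (e.trans ht)).symm)

/-- On the surface cut along a path, consecutive sides of either copy of the path meet. -/
theorem IsPath.cut_pair [Finite D] {ends : Set S.Vertex} (hm : ∀ v ∈ ends, S.IsMarked v)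
    {l : List D} (h : S.IsPath ends l) {a b : D} (hab : [a, b] <:+: l) :
    (S.cut (S.sides l)).head a = (S.cut (S.sides l)).tail b ∧
      (S.cut (S.sides l)).head (S.opp b) = (S.cut (S.sides l)).tail (S.opp a) := by
  have := h.pathSystem.nextSide_pair hm rfl hab
  rw [arcSides_singleton] at this
  refine ⟨?_, this.2.2⟩
  have h1 := this.1.2
  rwa [S.opp_opp] at h1

theorem sides_tail_dropLast_subset {γ : List D} : S.sides γ.tail.dropLast ⊆ S.sides γ := by
  rintro d (h | h)
  · exact Or.inl (List.mem_of_mem_tail (List.mem_of_mem_dropLast h))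
  · exact Or.inr (List.mem_of_mem_tail (List.mem_of_mem_dropLast h))

theorem mem_kept_of_notMem {γ : List D} {d : D} (h : d ∉ S.sides γ) : d ∈ S.kept γ :=
  fun h' => h (sides_tail_dropLast_subset h')

theorem List.exists_pairs_of_mem_tail_dropLast {l : List D} {d : D} (h : d ∈ l.tail.dropLast) :
    (∃ a, [a, d] <:+: l) ∧ ∃ b, [d, b] <:+: l := by
  refine ⟨List.exists_pair_of_mem_tail (List.mem_of_mem_dropLast h), ?_⟩
  refine List.exists_pair_of_mem_dropLast ?_
  rw [← List.tail_dropLast] at h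
  exact List.mem_of_mem_tail h

/-- The contracted sides form the inner parts of the two copies of the path. Neither copy is
contracted completely, because its first and last edges are kept. -/
theorem cutAlong_isContraction [Finite D] {γ : List D} (h : S.IsPath S.white γ) :
    IsContraction (S.cut (S.sides γ)) (S.cutAlong γ).toCellSurface where
  next_eq := rfl
  opp_eq _ := rfl
  boundary d hd := cut_boundary_of_mem (sides_tail_dropLast_subset (not_not.1 hd))
  rank := by
    classical
    have hm : ∀ v ∈ S.white, S.IsMarked v := fun v hv => Or.inl hv
    have hn := h.nodup hm
    -- The position on the respective copy: one copy is directed like `γ`, the other one runs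
    -- backwards. Positions are smaller than the length, so nothing is lost by truncated
    -- subtraction.
    refine ⟨fun d => if d ∈ γ then γ.idxOf d else γ.length - γ.idxOf (S.opp d), ?_⟩
    intro d hd b hb e
    have hb' : (S.cut (S.sides γ)).IsBoundarySide b :=
      cut_boundary_of_mem (sides_tail_dropLast_subset (not_not.1 hb))
    rcases not_not.1 hd with hd' | hd'
    · obtain ⟨-, x, hx⟩ := List.exists_pairs_of_mem_tail_dropLast hd'
      have hxγ : x ∈ γ := List.mem_of_mem_tail (List.mem_tail_of_pair hx)
      have hdγ : d ∈ γ := List.mem_of_mem_tail (List.mem_of_mem_dropLast hd')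
      have : b = x := boundary_tail_injective hb'
        (cut_boundary_of_mem (mem_sides_of_mem hxγ)) (e.trans (h.cut_pair hm hx).1)
      subst this
      simp only [hxγ, hdγ, if_true]
      rw [hn.idxOf_pair hx]
      exact Nat.lt_succ_self _
    · obtain ⟨⟨x, hx⟩, -⟩ := List.exists_pairs_of_mem_tail_dropLast hd'
      have hxγ : x ∈ γ := List.mem_of_mem_dropLast (List.mem_dropLast_of_pair hx)
      have hdγ : S.opp d ∈ γ := List.mem_of_mem_tail (List.mem_of_mem_dropLast hd')
      have h1 := (h.cut_pair hm hx).2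
      rw [S.opp_opp] at h1
      have : b = S.opp x := boundary_tail_injective hb'
        (cut_boundary_of_mem (opp_mem_sides_of_mem hxγ)) (e.trans h1)
      subst this
      have h2 : S.opp x ∉ γ := h.no_edge_twice x hxγ
      have h3 : d ∉ γ := fun h' => h.no_edge_twice d h' hdγ
      simp only [h2, h3, if_false, S.opp_opp]
      have h4 := hn.idxOf_pair hx
      have h5 : γ.idxOf (S.opp d) < γ.length := List.idxOf_lt_length_of_mem hdγ
      omega

section CutAlong

variable {γ : List D}

theorem tail_contracted (h : S.IsPath S.white γ) {d : D} (hd : d ∉ S.kept γ) :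
    S.tail d ∈ S.inner γ ∧ S.tail (S.next d) ∈ S.inner γ := by
  change S.tail d ∈ S.inner γ ∧ S.head d ∈ S.inner γ
  rcases not_not.1 hd with hd' | hd'
  · obtain ⟨-, x, hx⟩ := List.exists_pairs_of_mem_tail_dropLast hd'
    exact ⟨⟨d, List.mem_of_mem_dropLast hd', rfl⟩, x, List.mem_tail_of_pair hx,
      (h.pair_head hx).symm⟩
  · obtain ⟨-, x, hx⟩ := List.exists_pairs_of_mem_tail_dropLast hd'
    have hb : ¬ S.IsBoundarySide d := by
      rw [← isBoundarySide_opp]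
      exact h.interior _ (List.mem_of_mem_tail (List.mem_of_mem_dropLast hd'))
    refine ⟨⟨x, List.mem_tail_of_pair hx, ?_⟩, S.opp d, List.mem_of_mem_dropLast hd', tail_opp hb⟩
    rw [← h.pair_head hx, head_opp hb]

/-- Properties of the vertices that do not distinguish the inner vertices of `γ` are seen on the cut
surface. -/
theorem tail_mem_iff_of_cutAlong [Finite D] (h : S.IsPath S.white γ) {V : Set S.Vertex}
    (hV : S.inner γ ⊆ V ∨ Disjoint (S.inner γ) V) {a b : S.kept γ}
    (hab : (S.cutAlong γ).tail a = (S.cutAlong γ).tail b) : S.tail a ∈ V ↔ S.tail b ∈ V := by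
  have := (cutAlong_isContraction h).eq_of_tail_eq (g := fun d => S.tail d ∈ V) (fun a b e => by
    rw [tail_eq_of_cut_tail_eq (S.oppClosed_sides γ) e]) (fun d hd => propext (by
      obtain ⟨h1, h2⟩ := tail_contracted h hd
      rcases hV with hV | hV
      · exact iff_of_true (hV h2) (hV h1)
      · exact iff_of_false (Set.disjoint_left.1 hV h2) (Set.disjoint_left.1 hV h1))) hab
  exact iff_of_eq this

theorem disjoint_inner_white (h : S.IsPath S.white γ) : Disjoint (S.inner γ) S.white :=
  Set.disjoint_left.2 fun v hv hw => (h.inner_interior v hv).1 (Or.inl hw)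

theorem tail_mem_white_iff [Finite D] (h : S.IsPath S.white γ) {d : S.kept γ} :
    (S.cutAlong γ).tail d ∈ (S.cutAlong γ).white ↔ S.tail d ∈ S.white := by
  constructor
  · rintro ⟨d', e, hd'⟩
    exact (tail_mem_iff_of_cutAlong h (Or.inr (disjoint_inner_white h)) e).1 hd'
  · exact fun hd => ⟨d, rfl, hd⟩

theorem tail_mem_red_iff [Finite D] (h : S.IsPath S.white γ) {d : S.kept γ} :
    (S.cutAlong γ).tail d ∈ (S.cutAlong γ).red ↔ S.tail d ∈ S.red ∨ S.tail d ∈ S.inner γ := by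
  constructor
  · rintro ⟨d', e, hd'⟩
    exact (tail_mem_iff_of_cutAlong h (V := {v | v ∈ S.red ∨ v ∈ S.inner γ})
      (Or.inl fun v hv => Or.inr hv) e).1 hd'
  · exact fun hd => ⟨d, rfl, hd⟩

theorem vtx_mem_white_iff [Finite D] (h : S.IsPath S.white γ) {d : D} :
    (cutAlong_isContraction h).vtx d ∈ (S.cutAlong γ).white ↔ S.tail d ∈ S.white := by
  rw [IsContraction.vtx, tail_mem_white_iff h]
  exact iff_of_eq ((cutAlong_isContraction h).apply_land (g := fun d => S.tail d ∈ S.white)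
    (fun d hd => propext (by
      obtain ⟨h1, h2⟩ := tail_contracted h hd
      have hV := disjoint_inner_white h
      exact iff_of_false (Set.disjoint_left.1 hV h2) (Set.disjoint_left.1 hV h1))) d)

theorem vtx_mem_red_iff [Finite D] (h : S.IsPath S.white γ) {d : D} :
    (cutAlong_isContraction h).vtx d ∈ (S.cutAlong γ).red ↔
      S.tail d ∈ S.red ∨ S.tail d ∈ S.inner γ := by
  rw [IsContraction.vtx, tail_mem_red_iff h]
  exact iff_of_eq ((cutAlong_isContraction h).apply_land
    (g := fun d => S.tail d ∈ S.red ∨ S.tail d ∈ S.inner γ)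
    (fun d hd => propext (by
      obtain ⟨h1, h2⟩ := tail_contracted h hd
      exact iff_of_true (Or.inr h2) (Or.inr h1))) d)

theorem FirstMark.unique {d : D} {v v' : S.Vertex} (h : S.FirstMark d v) (h' : S.FirstMark d v') :
    v = v' := by
  induction h with
  | here d hb hm =>
    cases h' with
    | here => rfl
    | step _ _ _ _ hn => exact absurd hm hn
  | step d d' v hb hn hb' ht _ ih =>
    cases h' with
    | here _ _ hm => exact absurd hm hn
    | step _ d'' _ _ _ hb'' ht' hv =>
      have := boundary_tail_injective hb' hb'' (ht.trans ht'.symm)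
      subst this
      exact ih hv

/-- The boundary sides of `S` away from `γ`, with their first marks, are kept on the cut surface. -/
theorem FirstMark.cutAlong [Finite D] (h : S.IsPath S.white γ) {d : D} {v : S.Vertex}
    (hv : S.FirstMark d v) : ∀ hd : d ∈ S.kept γ, ∃ v', (S.cutAlong γ).FirstMark ⟨d, hd⟩ v' ∧
      (v ∈ S.white → v' ∈ (S.cutAlong γ).white) ∧ (v ∈ S.red → v' ∈ (S.cutAlong γ).red) := by
  have hc := cutAlong_isContraction h
  have hbd : ∀ (d : D) (hd : d ∈ S.kept γ), S.IsBoundarySide d →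
      (S.cutAlong γ).IsBoundarySide ⟨d, hd⟩ := fun d hd hb =>
    hc.isBoundarySide_iff.2 ((cut_isBoundarySide (S.oppClosed_sides γ)).2 (Or.inl hb))
  induction hv with
  | here d hb hm =>
    intro hd
    have e : (S.cutAlong γ).head ⟨d, hd⟩ = hc.vtx (S.next d) := hc.head_eq_vtx ⟨d, hd⟩
    have hw := vtx_mem_white_iff h (d := S.next d)
    have hr := vtx_mem_red_iff h (d := S.next d)
    refine ⟨_, FirstMark.here _ (hbd d hd hb) ?_, ?_, ?_⟩
    · rw [e]
      exact hm.imp (fun h' => hw.2 h') fun h' => hr.2 (Or.inl h')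
    · rw [e]; exact fun h' => hw.2 h'
    · rw [e]; exact fun h' => hr.2 (Or.inl h')
  | step d d' v hb hn hb' ht _ ih =>
    intro hd
    have e : (S.cutAlong γ).head ⟨d, hd⟩ = hc.vtx (S.next d) := hc.head_eq_vtx ⟨d, hd⟩
    have hw := vtx_mem_white_iff h (d := S.next d)
    have hr := vtx_mem_red_iff h (d := S.next d)
    have hin : S.head d ∉ S.inner γ := fun h' =>
      (h.inner_interior _ h').2 (isBoundaryVertex_head hb)
    have hd' : d' ∈ S.kept γ := mem_kept_of_notMem fun h' => by
      rcases h' with h' | h'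
      · exact h.interior _ h' hb'
      · exact h.interior _ h' (isBoundarySide_opp.2 hb')
    obtain ⟨v', hv', h1, h2⟩ := ih hd'
    refine ⟨v', FirstMark.step _ ⟨d', hd'⟩ _ (hbd d hd hb) ?_ (hbd d' hd' hb') ?_ hv', h1, h2⟩
    · rw [e]
      rintro (h' | h')
      · exact hn (Or.inl (hw.1 h'))
      · rcases hr.1 h' with h' | h'
        · exact hn (Or.inr h')
        · exact hin h'
    -- An unmarked boundary vertex is neither an end point nor an inner vertex of `γ`, so the cut
    -- does not separate its corners.
    · rw [e, ← hc.vtx_of_mem ⟨d', hd'⟩]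
      refine hc.vtx_eq_of_tail_eq (cut_tail_eq_of_forall (S.oppClosed_sides γ) ?_ ht)
      intro g hg e'
      rcases h.side_mem hg with h' | h'
      · exact hn (Or.inl (by rw [← ht, ← e']; exact h'))
      · exact hin (by rw [← ht, ← e']; exact h')

theorem eq_head_or_getLast_of_kept {d : D} (h : S.IsPath S.white γ) (hd : d ∈ S.kept γ)
    (hdγ : d ∈ γ) : d = γ.head h.ne_nil ∨ d = γ.getLast h.ne_nil := by
  by_contra! hcon
  have h1 := (List.eq_head_or_mem_tail hdγ h.ne_nil).resolve_left hcon.1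
  have hne : γ.tail ≠ [] := fun e => by simp [e] at h1
  rcases List.eq_getLast_or_mem_dropLast h1 hne with h2 | h2
  · exact hcon.2 (by rw [h2, List.getLast_tail])
  · exact hd (Or.inl h2)

theorem opp_mem_kept {d : D} (hd : d ∈ S.kept γ) : S.opp d ∈ S.kept γ := fun h =>
  hd ((S.oppClosed_sides _).mem_iff.1 h)

/-- The kept sides of `γ` connect a white end of `γ` with an inner vertex. -/
theorem kept_side_ends (h : S.IsPath S.white γ) (hl : 2 ≤ γ.length) {d : D} (hd : d ∈ S.kept γ)
    (hdγ : d ∈ S.sides γ) : (S.tail d ∈ S.white ∧ S.head d ∈ S.inner γ) ∨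
      (S.tail d ∈ S.inner γ ∧ S.head d ∈ S.white) := by
  have key : ∀ d ∈ S.kept γ, d ∈ γ → (S.tail d ∈ S.white ∧ S.head d ∈ S.inner γ) ∨
      (S.tail d ∈ S.inner γ ∧ S.head d ∈ S.white) := by
    intro d hd hdγ
    have hm : ∀ v ∈ S.white, S.IsMarked v := fun v hv => Or.inl hv
    rcases eq_head_or_getLast_of_kept h hd hdγ with e | e
    · left
      refine ⟨e ▸ h.head_mem, ?_⟩
      have h1 : d ∈ γ.dropLast := by
        rcases List.eq_getLast_or_mem_dropLast hdγ h.ne_nil with e' | h'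
        · exfalso
          have h2 := e.symm.trans e'
          have hn := h.nodup hm
          rw [List.head_eq_getElem, List.getLast_eq_getElem, hn.getElem_inj_iff] at h2
          omega
        · exact h'
      obtain ⟨x, hx⟩ := List.exists_pair_of_mem_dropLast h1
      exact ⟨x, List.mem_tail_of_pair hx, (h.pair_head hx).symm⟩
    · right
      refine ⟨⟨d, ?_, rfl⟩, e ▸ h.last_mem⟩
      rcases List.eq_head_or_mem_tail hdγ h.ne_nil with e' | h'
      · exfalso
        have h2 := e'.symm.trans e
        have hn := h.nodup hm
        rw [List.head_eq_getElem, List.getLast_eq_getElem, hn.getElem_inj_iff] at h2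
        omega
      · exact h'
  rcases hdγ with h' | h'
  · exact key d hd h'
  · have hb : ¬ S.IsBoundarySide d := by rw [← isBoundarySide_opp]; exact h.interior _ h'
    have := key _ (opp_mem_kept hd) h'
    rw [tail_opp hb, head_opp hb] at this
    tauto

/-- A kept side of `γ` joins a copy of an end point directly with one of the new `•`-points, so the
colours alternate along both copies; the length at least two guarantees that these new points exist.
From any other boundary side the first mark is the old one. -/
theorem cutAlong_isMarkedSurface [Finite D] (hS : S.IsMarkedSurface) (h : S.IsPath S.white γ)
    (hl : 2 ≤ γ.length) : (S.cutAlong γ).IsMarkedSurface := by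
  have hc := cutAlong_isContraction h
  have hG := S.oppClosed_sides γ
  have hdis : ∀ v ∈ S.white, ¬ (v ∈ S.red ∨ v ∈ S.inner γ) := by
    rintro v hw (hr | hi)
    · exact Set.disjoint_left.1 hS.disjoint hw hr
    · exact (h.inner_interior v hi).1 (Or.inl hw)
  -- a boundary side on `γ` and its end points
  have hγm : ∀ d : S.kept γ, (d : D) ∈ S.sides γ →
      ((S.tail d ∈ S.white ∧ (S.cutAlong γ).head d ∈ (S.cutAlong γ).red) ∨
        (S.tail d ∈ S.inner γ ∧ (S.cutAlong γ).head d ∈ (S.cutAlong γ).white)) := by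
    intro d hd
    have e : (S.cutAlong γ).head d = hc.vtx (S.next d) := hc.head_eq_vtx d
    rw [e, vtx_mem_white_iff h, vtx_mem_red_iff h]
    rcases kept_side_ends h hl d.2 hd with ⟨h1, h2⟩ | ⟨h1, h2⟩
    · exact Or.inl ⟨h1, Or.inr h2⟩
    · exact Or.inr ⟨h1, h2⟩
  have hγf : ∀ (d : S.kept γ) v, (d : D) ∈ S.sides γ → (S.cutAlong γ).FirstMark d v →
      v = (S.cutAlong γ).head d := by
    intro d v hd hv
    cases hv with
    | here => rfl
    | step _ _ _ _ hn =>
      refine absurd ?_ hn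
      rcases hγm d hd with h' | h'
      · exact Or.inr h'.2
      · exact Or.inl h'.2
  have hbs : ∀ d : S.kept γ, (S.cutAlong γ).IsBoundarySide d → (d : D) ∉ S.sides γ →
      S.IsBoundarySide (d : D) := fun d hd hn =>
    ((cut_isBoundarySide hG).1 (hc.isBoundarySide_iff.1 hd)).resolve_right hn
  have hfb : ∀ (d : S.kept γ) v, (S.cutAlong γ).FirstMark d v →
      (S.cutAlong γ).IsBoundarySide d := by
    intro d v hv
    cases hv <;> assumption
  refine ⟨?_, ?_, ?_, ?_, ?_, ?_⟩
  · exact hc.exists_boundary (exists_boundary_cut hS.boundary_nonempty hG)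
  · rw [Set.disjoint_left]
    intro v hv hv'
    obtain ⟨d, rfl⟩ := tail_surjective v
    exact hdis _ ((tail_mem_white_iff h).1 hv) ((tail_mem_red_iff h).1 hv')
  · intro v hv
    obtain ⟨d, rfl⟩ := tail_surjective v
    rw [← hc.vtx_of_mem d, hc.isBoundaryVertex_vtx]
    have : ∃ g, (S.IsBoundarySide g ∨ g ∈ S.sides γ) ∧ S.tail g = S.tail d := by
      rcases (tail_mem_red_iff h).1 hv with h' | ⟨g, hg, e⟩
      · obtain ⟨b, hb, e⟩ := hS.red_boundary _ h'
        exact ⟨b, Or.inl hb, e⟩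
      · exact ⟨g, Or.inr (mem_sides_of_mem (List.mem_of_mem_tail hg)), e⟩
    obtain ⟨g, hg, e⟩ := this
    obtain ⟨b, hb, e'⟩ := exists_cut_boundary_of_tail_eq hG hg e
    exact ⟨b, (cut_isBoundarySide hG).2 hb, e'⟩
  · intro d hd
    by_cases hdγ : (d : D) ∈ S.sides γ
    · exact ⟨_, FirstMark.here d hd ((hγm d hdγ).elim (fun h' => Or.inr h'.2)
        (fun h' => Or.inl h'.2))⟩
    · obtain ⟨v, hv⟩ := hS.exists_mark d (hbs d hd hdγ)
      obtain ⟨v', hv', _⟩ := hv.cutAlong h d.2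
      exact ⟨v', hv'⟩
  · intro d v hv hw
    rw [tail_mem_white_iff h] at hw
    by_cases hdγ : (d : D) ∈ S.sides γ
    · rw [hγf d v hdγ hv]
      rcases hγm d hdγ with h' | h'
      · exact h'.2
      · exact absurd (Or.inr h'.1) (hdis _ hw)
    · obtain ⟨u, hu⟩ := hS.exists_mark d (hbs d (hfb d v hv) hdγ)
      obtain ⟨v', hv', _, h2⟩ := hu.cutAlong h d.2
      rw [hv.unique hv']
      exact h2 (hS.white_red _ _ hu hw)
  · intro d v hv hr
    rw [tail_mem_red_iff h] at hr
    by_cases hdγ : (d : D) ∈ S.sides γ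
    · rw [hγf d v hdγ hv]
      rcases hγm d hdγ with h' | h'
      · exact absurd hr (hdis _ h'.1)
      · exact h'.2
    · have hb := hbs d (hfb d v hv) hdγ
      obtain ⟨u, hu⟩ := hS.exists_mark d hb
      obtain ⟨v', hv', h1, _⟩ := hu.cutAlong h d.2
      rw [hv.unique hv']
      refine h1 (hS.red_white _ _ hu (hr.resolve_right fun h' => ?_))
      exact (h.inner_interior _ h').2 ⟨d, hb, rfl⟩

/-- Punctures enter the rank through `chi`, so that all `∘`-points count alike. -/
theorem rank_eq [Finite D] (S : MarkedCells D) : S.rank = (S.white.ncard : ℤ) - S.euler Set.univ := by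
  have : S.white.ncard = S.boundaryWhite.ncard + S.punctures.ncard := by
    rw [← Set.ncard_union_eq]
    · congr 1
      ext v
      simp only [boundaryWhite, punctures, Set.mem_union, Set.mem_ofPred_eq]
      tauto
    · rw [Set.disjoint_left]
      exact fun v h h' => h'.2 h.2
  rw [rank, chi, this]
  push_cast
  ring

theorem tail_image_white (S : MarkedCells D) : S.tail '' {c | S.tail c ∈ S.white} = S.white := by
  ext v
  constructor
  · rintro ⟨c, hc, rfl⟩; exact hc
  · intro hv
    obtain ⟨c, rfl⟩ := tail_surjective v
    exact ⟨c, hv, rfl⟩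

/-- Two sides of `γ` start at `∘`-points, so there are two more `∘`-points, less the interior end
points. The Euler characteristic increases by one, less the same number. -/
theorem cutAlong_rank [Finite D] (h : S.IsPath S.white γ) : (S.cutAlong γ).rank = S.rank + 1 := by
  have hm : ∀ v ∈ S.white, S.IsMarked v := fun v hv => Or.inl hv
  have hc := cutAlong_isContraction h
  have hG := S.oppClosed_sides γ
  have hP := h.pathSystem
  have hGb := hP.not_boundary
  rw [arcSides_singleton] at hGb
  have h1 := ncard_cut_tail (S := S.toCellSurface) (w := {c | S.tail c ∈ S.white}) hG hGb
    (S.saturated_preimage _)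
  have h2 := hP.euler_cut hm
  have h3 := hP.ncard_ends hm
  have h4 := hc.ncard_tail_of_disjoint (w := {c | S.tail c ∈ S.white})
    ((S.saturated_preimage _).cut hG) (fun d hd => by
      obtain ⟨h1, h2⟩ := tail_contracted h hd
      exact ⟨Set.disjoint_left.1 (disjoint_inner_white h) h1,
        Set.disjoint_left.1 (disjoint_inner_white h) h2⟩)
  have h5 := hc.euler_eq
  have h6 : (S.cutAlong γ).tail '' {d | (d : D) ∈ {c | S.tail c ∈ S.white}} =
      (S.cutAlong γ).white := by
    rw [← tail_image_white (S.cutAlong γ)]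
    congr 1
    ext d
    exact (tail_mem_white_iff h).symm
  rw [arcSides_singleton] at h2 h3
  have h7 : {v ∈ S.tail '' (S.sides γ ∩ {c | S.tail c ∈ S.white}) | ¬ S.IsBoundaryVertex v} =
      {v ∈ S.white | ¬ S.IsBoundaryVertex v ∧ v ∈ S.tail '' S.sides γ} := by
    ext v
    constructor
    · rintro ⟨⟨d, ⟨hd, hw⟩, rfl⟩, hb⟩
      exact ⟨hw, hb, d, hd, rfl⟩
    · rintro ⟨hw, hb, d, hd, rfl⟩
      exact ⟨⟨d, ⟨hd, hw⟩, rfl⟩, hb⟩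
  have h8 : S.sides γ ∩ {c | S.tail c ∈ S.white} = {d ∈ S.sides γ | S.tail d ∈ S.white} := rfl
  rw [h6] at h4
  rw [h7, h8, h3, tail_image_white] at h1
  have h9 : Nat.card ({γ} : Set (List D)) = 1 := by simp
  rw [h9] at h1 h2
  rw [rank_eq, rank_eq, h5, h4]
  omega

end CutAlong

end MarkedCells

/-! ### The pieces into which a path is divided. -/

namespace CellSurface

variable {D : Type*} {S : CellSurface D}

theorem exists_of_mem_pieces {X : Set S.Vertex} {l m : List D} (h : m ∈ S.pieces X l) :
    m ≠ [] ∧ (∀ d ∈ m.tail, S.tail d ∉ X) ∧ ∃ p q, l = p ++ m ++ q ∧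
      (p = [] ∨ ∀ d ∈ m.head?, S.tail d ∈ X) ∧ ∀ d ∈ q.head?, S.tail d ∈ X := by
  classical
  have hc := List.isChain_getLast_head_splitBy (fun _ d => decide (S.tail d ∉ X)) l
  have hf := List.flatten_splitBy (fun _ d => decide (S.tail d ∉ X)) l
  have hmc := List.isChain_of_mem_splitBy h
  have hne := List.ne_nil_of_mem_splitBy h
  have e : l.splitBy (fun _ d => decide (S.tail d ∉ X)) = S.pieces X l := by
    unfold pieces; congr
  rw [e] at hc hf
  refine ⟨hne, ?_, ?_⟩
  · intro d hd
    obtain ⟨a, ha⟩ := List.exists_pair_of_mem_tail hd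
    have := hmc.infix ha
    simpa using this
  obtain ⟨L₁, L₂, hL⟩ := List.append_of_mem h
  rw [hL] at hc hf
  refine ⟨L₁.flatten, L₂.flatten, by simp [← hf], ?_, ?_⟩
  · rcases L₁.eq_nil_or_concat with rfl | ⟨L, a, rfl⟩
    · simp
    · right
      intro d hd
      have h1 : [a, m] <:+: (L.concat a) ++ m :: L₂ := ⟨L, L₂, by simp⟩
      have := hc.infix h1
      simp only [List.isChain_cons_cons] at this
      obtain ⟨⟨_, hb, h2⟩, -⟩ := this
      rw [List.head_of_mem_head? hd] at h2
      simpa using h2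
  · cases L₂ with
    | nil => simp
    | cons b L =>
      intro d hd
      have h1 : [m, b] <:+: L₁ ++ m :: b :: L := ⟨L₁, L, by simp⟩
      have := hc.infix h1
      simp only [List.isChain_cons_cons] at this
      obtain ⟨⟨_, hb, h2⟩, -⟩ := this
      rw [List.flatten_cons, List.head?_append_of_ne_nil _ hb] at hd
      rw [List.head_of_mem_head? hd] at h2
      simpa using h2

theorem flatten_pieces (X : Set S.Vertex) (l : List D) : (S.pieces X l).flatten = l := by
  classical
  have hf := List.flatten_splitBy (fun _ d => decide (S.tail d ∉ X)) l
  have e : l.splitBy (fun _ d => decide (S.tail d ∉ X)) = S.pieces X l := by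
    unfold pieces; congr
  rwa [e] at hf

theorem exists_piece_of_mem {X : Set S.Vertex} {l : List D} {d : D} (h : d ∈ l) :
    ∃ m ∈ S.pieces X l, d ∈ m := by
  rwa [← flatten_pieces X l, List.mem_flatten] at h

theorem pieces_eq_of_mem {X : Set S.Vertex} {l : List D} (hl : l.Nodup) {m m' : List D}
    (hm : m ∈ S.pieces X l) (hm' : m' ∈ S.pieces X l) {d : D} (hd : d ∈ m) (hd' : d ∈ m') :
    m = m' := by
  rw [← flatten_pieces X l, List.nodup_flatten] at hl
  by_contra hne
  have : Std.Symm (List.Disjoint (α := D)) := ⟨fun _ _ hab => List.Disjoint.symm hab⟩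
  exact hl.2.forall hm hm' hne hd hd'

end CellSurface

/-! ### Segments of the arcs on the cut surface. -/

namespace MarkedCells

open CellSurface

variable {D : Type*} {S : MarkedCells D} {γ : List D} {Δ : Set (List D)}

/-- A corner away from the inner vertices of `γ` has the same vertex before the contraction. -/
theorem cut_tail_eq_of_cutAlong [Finite D] (h : S.IsPath S.white γ) {a b : S.kept γ}
    (ha : S.tail a ∉ S.inner γ) (hab : (S.cutAlong γ).tail a = (S.cutAlong γ).tail b) :
    (S.cut (S.sides γ)).tail (a : D) = (S.cut (S.sides γ)).tail b := by
  classical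
  have hb : S.tail b ∉ S.inner γ := fun hb => ha
    ((tail_mem_iff_of_cutAlong h (Or.inl subset_rfl) hab).2 hb)
  have := (cutAlong_isContraction h).eq_of_tail_eq
    (g := fun c => if S.tail c ∈ S.inner γ then none else some ((S.cut (S.sides γ)).tail c))
    (fun x y e => by
      rw [tail_eq_of_cut_tail_eq (S.oppClosed_sides γ) e, e])
    (fun d hd => by
      obtain ⟨h1, h2⟩ := tail_contracted h hd
      change (if S.tail (S.next d) ∈ S.inner γ then none else _) = _
      rw [if_pos h1, if_pos h2]) hab
  simpa [ha, hb] using this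

theorem tail_eq_of_cutAlong [Finite D] (h : S.IsPath S.white γ) {a b : S.kept γ}
    (ha : S.tail a ∉ S.inner γ) (hab : (S.cutAlong γ).tail a = (S.cutAlong γ).tail b) :
    S.tail (a : D) = S.tail (b : D) :=
  tail_eq_of_cut_tail_eq (S.oppClosed_sides γ) (cut_tail_eq_of_cutAlong h ha hab)

/-- A collection of `•`-arcs and a `∘`-arc which crosses it transversally. -/
structure CrossingData (S : MarkedCells D) (Δ : Set (List D)) (γ : List D) : Prop where
  sys : S.PathSystem S.red Δ
  path : S.IsPath S.white γ
  transverse : S.Transverse Δ γ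
  white_red : Disjoint S.white S.red

/-- The segments into which `γ` divides the arcs of `Δ`. -/
def segments [Finite D] (S : MarkedCells D) (Δ : Set (List D)) (γ : List D) : Set (List (S.kept γ)) :=
  {t | ∃ l ∈ Δ, t ∈ S.smoothedOf γ l}

namespace CrossingData

theorem disjoint (h : CrossingData S Δ γ) {d : D} (hd : d ∈ S.arcSides Δ) : d ∉ S.sides γ := by
  obtain ⟨l, hl, hd⟩ := hd
  exact Set.disjoint_left.1 (h.transverse l hl).1 hd

theorem mem_kept (h : CrossingData S Δ γ) {d : D} (hd : d ∈ S.arcSides Δ) : d ∈ S.kept γ :=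
  mem_kept_of_notMem (h.disjoint hd)

theorem opp_val [Finite D] (h : CrossingData S Δ γ) {d : S.kept γ} (hd : (d : D) ∈ S.arcSides Δ) :
    (((S.cutAlong γ).opp d : S.kept γ) : D) = S.opp d :=
  cut_opp_of_notMem (S.oppClosed_sides γ) (h.disjoint hd)

theorem oppClosed_val [Finite D] (h : CrossingData S Δ γ) :
    (S.cutAlong γ).OppClosed {d | (d : D) ∈ S.arcSides Δ} := fun d hd => by
  change (((S.cutAlong γ).opp d : S.kept γ) : D) ∈ S.arcSides Δ
  rw [h.opp_val hd]
  exact S.oppClosed_arcSides Δ _ hd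

/-- The inner vertices of the arcs which do not lie on `γ` are not touched by `γ`. -/
theorem tail_ne_of_inner (h : CrossingData S Δ γ) {v : S.Vertex} (hv : v ∈ S.arcInner Δ)
    (hv' : v ∉ S.inner γ) {g : D} (hg : g ∈ S.sides γ) : S.tail g ≠ v := by
  rintro rfl
  rcases h.path.side_mem hg with h' | h'
  · exact (h.sys.inner_interior hv).1 (Or.inl h')
  · exact hv' h'

/-- A segment of an arc, as a part of this arc. -/
theorem exists_of_mem_segments [Finite D] {t : List (S.kept γ)} (ht : t ∈ S.segments Δ γ) :
    ∃ l ∈ Δ, t.map Subtype.val ∈ S.pieces (S.inner γ) l ∧ t ≠ [] ∧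
      (∀ d ∈ t.tail, S.tail (d : D) ∉ S.inner γ) ∧ t.map Subtype.val <:+: l := by
  obtain ⟨l, hl, hm⟩ := ht
  obtain ⟨h1, h2, p, q, e, -⟩ := exists_of_mem_pieces hm
  refine ⟨l, hl, hm, fun e => h1 (by simp [e]), fun d hd => h2 d ?_, p, q, e.symm⟩
  rw [← List.map_tail]
  exact List.mem_map_of_mem hd

/-- Arcs are divided wherever they meet `γ`, so the inner vertices of a segment are untouched by cut
and contraction. Its end points are end points of the arc or lie over inner vertices of `γ`, and
both kinds are `•`-points of the cut surface. -/
theorem segment_path [Finite D] (h : CrossingData S Δ γ) {t : List (S.kept γ)} (ht : t ∈ S.segments Δ γ) :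
    (S.cutAlong γ).IsPath (S.cutAlong γ).red t := by
  have hc := cutAlong_isContraction h.path
  have hG := S.oppClosed_sides γ
  obtain ⟨l, hl, hm, hne, hinn, hinf⟩ := exists_of_mem_segments ht
  have hP := h.sys.path l hl
  have hmem : ∀ d ∈ t, (d : D) ∈ l := fun d hd => hinf.subset (List.mem_map_of_mem hd)
  have hA : ∀ d ∈ t, (d : D) ∈ S.arcSides Δ := fun d hd =>
    ⟨l, hl, mem_sides_of_mem (hmem d hd)⟩
  have hpair : ∀ a b : S.kept γ, [a, b] <:+: t → [(a : D), (b : D)] <:+: l := fun a b hab =>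
    (List.IsInfix.map Subtype.val hab).trans hinf
  have hltail : ∀ d ∈ t.tail, (d : D) ∈ l.tail := by
    intro d hd
    obtain ⟨a, ha⟩ := List.exists_pair_of_mem_tail hd
    exact List.mem_tail_of_pair (hpair a d ha)
  have hlin : ∀ d ∈ t.tail, S.tail (d : D) ∈ S.arcInner Δ := fun d hd =>
    ⟨l, hl, d, hltail d hd, rfl⟩
  refine ⟨hne, ?_, ?_, ?_, ?_, ?_, ?_, ?_⟩
  · rw [List.isChain_iff_forall_rel_of_append_cons_cons]
    intro a b p q e
    have hab : [a, b] <:+: t := ⟨p, q, by rw [e]; simp⟩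
    have hb := List.mem_tail_of_pair hab
    rw [hc.head_eq_vtx, ← hc.vtx_of_mem b]
    refine hc.vtx_eq_of_tail_eq (cut_tail_eq_of_forall hG (fun g hg e => ?_)
      (hP.pair_head (hpair a b hab)).symm).symm
    exact h.tail_ne_of_inner (hlin b hb) (hinn b hb) hg e
  · intro d hd hb
    rcases (cut_isBoundarySide hG).1 (hc.isBoundarySide_iff.1 hb) with h' | h'
    · exact hP.interior _ (hmem d hd) h'
    · exact h.disjoint (hA d hd) h'
  · intro d hd hd'
    have := hmem _ hd'
    rw [h.opp_val (hA d hd)] at this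
    exact hP.no_edge_twice _ (hmem d hd) this
  · refine List.Nodup.map_on (fun a ha b hb e => ?_) ?_
    · exact Subtype.ext (hP.tail_unique (hltail a ha) (hltail b hb)
        (tail_eq_of_cutAlong h.path (hinn a ha) e))
    · have h1 : (t.map Subtype.val).Nodup := (hP.nodup red_marked).sublist hinf.sublist
      exact (List.Nodup.of_map _ h1).sublist (List.tail_sublist t)
  · rintro _ ⟨d, hd, rfl⟩
    have hi := h.sys.inner_interior (hlin d hd)
    refine ⟨?_, ?_⟩
    · rintro (h' | h')
      · exact hi.1 (Or.inl ((tail_mem_white_iff h.path).1 h'))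
      · rcases (tail_mem_red_iff h.path).1 h' with h' | h'
        · exact hi.1 (Or.inr h')
        · exact hinn d hd h'
    · rw [← hc.vtx_of_mem d, hc.isBoundaryVertex_vtx]
      rintro ⟨b, hb, e⟩
      have e' := tail_eq_of_cut_tail_eq hG e
      rcases (cut_isBoundarySide hG).1 hb with h' | h'
      · exact hi.2 ⟨b, h', e'⟩
      · exact h.tail_ne_of_inner (hlin d hd) (hinn d hd) h' e'
  · intro d hd
    rw [tail_mem_red_iff h.path]
    obtain ⟨-, -, p, q, e, hp, -⟩ := exists_of_mem_pieces hm
    have hd' : (d : D) ∈ (t.map Subtype.val).head? := by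
      rw [List.head?_map]; exact Option.mem_map_of_mem _ hd
    rcases hp with rfl | hp
    · left
      refine hP.start_mem _ ?_
      rw [e, List.nil_append]
      exact List.mem_head?_append_of_mem_head? hd'
    · exact Or.inr (hp _ hd')
  · intro d hd
    rw [hc.head_eq_vtx, vtx_mem_red_iff h.path]
    obtain ⟨-, -, p, q, e, -, hq⟩ := exists_of_mem_pieces hm
    have hd' : (d : D) ∈ (t.map Subtype.val).getLast? := by
      rw [List.getLast?_map]; exact Option.mem_map_of_mem _ hd
    cases q with
    | nil =>
      left
      refine hP.end_mem _ ?_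
      rw [e, List.append_nil]
      exact List.mem_getLast?_append_of_mem_getLast? hd'
    | cons y q =>
      right
      have h1 : S.tail y ∈ S.inner γ := hq y rfl
      have h2 : [(d : D), y] <:+: l := by
        obtain ⟨u, hu⟩ := List.mem_getLast?_eq_getLast hd'
        have h3 := List.dropLast_append_getLast u
        refine ⟨p ++ (t.map Subtype.val).dropLast, q, ?_⟩
        rw [e]
        conv_rhs => rw [← h3, ← hu]
        simp
      have h3 := hP.pair_head h2
      exact (show S.head (d : D) ∈ S.inner γ by rw [h3]; exact h1)

/-- A side determines its arc, an arc does not use an edge in both directions, and within the arc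
the pieces are disjoint. -/
theorem eq_of_mem_segments [Finite D] (h : CrossingData S Δ γ) {t t' : List (S.kept γ)}
    (ht : t ∈ S.segments Δ γ) (ht' : t' ∈ S.segments Δ γ) {d : S.kept γ} (hd : d ∈ t)
    (hd' : d ∈ t' ∨ (S.cutAlong γ).opp d ∈ t') : t = t' := by
  obtain ⟨l, hl, hm, -, -, hinf⟩ := exists_of_mem_segments ht
  obtain ⟨l', hl', hm', -, -, hinf'⟩ := exists_of_mem_segments ht'
  have h1 : (d : D) ∈ l := hinf.subset (List.mem_map_of_mem hd)
  have hA : (d : D) ∈ S.arcSides Δ := ⟨l, hl, mem_sides_of_mem h1⟩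
  have h2 : (d : D) ∈ S.sides l' := by
    rcases hd' with hd' | hd'
    · exact mem_sides_of_mem (hinf'.subset (List.mem_map_of_mem hd'))
    · right
      rw [← h.opp_val hA]
      exact hinf'.subset (List.mem_map_of_mem hd')
  have := h.sys.eq_of_mem_sides hl hl' (mem_sides_of_mem h1) h2
  subst this
  have h3 : d ∈ t' := by
    refine hd'.resolve_right fun hd' => (h.sys.path l hl).no_edge_twice _ h1 ?_
    rw [← h.opp_val hA]
    exact hinf'.subset (List.mem_map_of_mem hd')
  have := pieces_eq_of_mem ((h.sys.path l hl).nodup red_marked) hm hm'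
    (List.mem_map_of_mem hd) (List.mem_map_of_mem h3)
  exact List.map_injective_iff.2 Subtype.val_injective this

theorem segments_pathSystem [Finite D] (h : CrossingData S Δ γ) :
    (S.cutAlong γ).PathSystem (S.cutAlong γ).red (S.segments Δ γ) where
  path _ ht := h.segment_path ht
  disjoint_sides t ht t' ht' hne := by
    rw [Set.disjoint_left]
    rintro d (hd | hd) hd'
    · exact hne (h.eq_of_mem_segments ht ht' hd hd')
    · refine hne (h.eq_of_mem_segments ht ht' hd ?_)
      rw [(S.cutAlong γ).opp_opp]
      exact Or.symm hd'
  disjoint_inner t ht t' ht' hne := by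
    rw [Set.disjoint_left]
    rintro _ ⟨a, ha, rfl⟩ ⟨b, hb, e⟩
    obtain ⟨l, hl, hm, -, hinn, hinf⟩ := exists_of_mem_segments ht
    obtain ⟨l', hl', hm', -, hinn', hinf'⟩ := exists_of_mem_segments ht'
    have tl : ∀ {t : List (S.kept γ)} {l : List D} {d : S.kept γ}, t.map Subtype.val <:+: l →
        d ∈ t.tail → (d : D) ∈ l.tail := by
      intro t l d hinf hd
      obtain ⟨a, ha⟩ := List.exists_pair_of_mem_tail hd
      exact List.mem_tail_of_pair ((List.IsInfix.map Subtype.val ha).trans hinf)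
    have e' := tail_eq_of_cutAlong h.path (hinn' b hb) e
    have := h.sys.eq_of_mem_inner hl' hl ⟨b, tl hinf' hb, rfl⟩ ⟨a, tl hinf ha, e'.symm⟩
    subst this
    have h1 : b = a := Subtype.ext ((h.sys.path l' hl).tail_unique (tl hinf' hb) (tl hinf ha) e')
    subst h1
    exact hne (h.eq_of_mem_segments ht ht' (List.mem_of_mem_tail ha)
      (Or.inl (List.mem_of_mem_tail hb)))

theorem exists_segment [Finite D] (h : CrossingData S Δ γ) {l : List D} (hl : l ∈ Δ) {d : D} (hd : d ∈ l) :
    ∃ t ∈ S.smoothedOf γ l, ∃ hd : d ∈ S.kept γ, ⟨d, hd⟩ ∈ t := by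
  obtain ⟨m, hm, hdm⟩ := exists_piece_of_mem (X := S.inner γ) hd
  obtain ⟨-, -, p, q, e, -⟩ := exists_of_mem_pieces hm
  have hk : ∀ x ∈ m, x ∈ S.kept γ := fun x hx =>
    h.mem_kept ⟨l, hl, mem_sides_of_mem (by rw [e]; simp [hx])⟩
  lift m to List (S.kept γ) using hk
  obtain ⟨x, hx, rfl⟩ := List.mem_map.1 hdm
  exact ⟨m, hm, x.2, hx⟩

theorem arcSides_segments [Finite D] (h : CrossingData S Δ γ) :
    (S.cutAlong γ).arcSides (S.segments Δ γ) = {d : S.kept γ | (d : D) ∈ S.arcSides Δ} := by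
  ext d
  constructor
  · rintro ⟨t, ht, hd⟩
    obtain ⟨l, hl, -, -, -, hinf⟩ := exists_of_mem_segments ht
    have key : ∀ x ∈ t, (x : D) ∈ S.arcSides Δ := fun x hx =>
      ⟨l, hl, mem_sides_of_mem (hinf.subset (List.mem_map_of_mem hx))⟩
    rcases hd with hd | hd
    · exact key d hd
    · have := h.oppClosed_val _ (key _ hd)
      rwa [(S.cutAlong γ).opp_opp] at this
  · rintro ⟨l, hl, hd⟩
    rcases hd with hd' | hd'
    · obtain ⟨t, ht, hk, hdt⟩ := h.exists_segment hl hd'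
      exact ⟨t, ⟨l, hl, ht⟩, Or.inl hdt⟩
    · obtain ⟨t, ht, hk, hdt⟩ := h.exists_segment hl hd'
      refine ⟨t, ⟨l, hl, ht⟩, Or.inr ?_⟩
      have e : (S.cutAlong γ).opp d = ⟨S.opp d, hk⟩ := Subtype.ext (h.opp_val ⟨l, hl, Or.inr hd'⟩)
      rwa [e]

/-- Every crossing increases the number of arcs by one. -/
theorem card_segments [Finite D] (h : CrossingData S Δ γ) :
    Nat.card (S.segments Δ γ) = Nat.card Δ + (S.inner γ ∩ S.arcInner Δ).ncard := by
  have h1 := h.segments_pathSystem.ncard_ends red_marked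
  have h2 := h.sys.ncard_ends red_marked
  have h3 := h.sys.ncard_inner red_marked (X := S.inner γ ∩ S.arcInner Δ) Set.inter_subset_right
  have h4 : {d ∈ (S.cutAlong γ).arcSides (S.segments Δ γ) |
      (S.cutAlong γ).tail d ∈ (S.cutAlong γ).red}.ncard =
      {d ∈ S.arcSides Δ | S.tail d ∈ S.red}.ncard +
        {d ∈ S.arcSides Δ | S.tail d ∈ S.inner γ ∩ S.arcInner Δ}.ncard := by
    rw [← Set.ncard_union_eq, ← Set.ncard_image_of_injective _ Subtype.val_injective]
    · congr 1
      ext d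
      constructor
      · rintro ⟨x, ⟨hx, hr⟩, rfl⟩
        rw [h.arcSides_segments] at hx
        rcases (tail_mem_red_iff h.path).1 hr with hr | hr
        · exact Or.inl ⟨hx, hr⟩
        · refine Or.inr ⟨hx, hr, (h.sys.tail_mem hx).resolve_left fun h' => ?_⟩
          exact (h.path.inner_interior _ hr).1 (Or.inr h')
      · rintro (⟨hd, hr⟩ | ⟨hd, hr, -⟩)
        · refine ⟨⟨d, h.mem_kept hd⟩, ⟨?_, (tail_mem_red_iff h.path).2 (Or.inl hr)⟩, rfl⟩
          rw [h.arcSides_segments]; exact hd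
        · refine ⟨⟨d, h.mem_kept hd⟩, ⟨?_, (tail_mem_red_iff h.path).2 (Or.inr hr)⟩, rfl⟩
          rw [h.arcSides_segments]; exact hd
    · rw [Set.disjoint_left]
      rintro d ⟨_, hd⟩ ⟨_, hd', -⟩
      exact (h.path.inner_interior _ hd').1 (Or.inr hd)
  omega

end CrossingData

end MarkedCells

/-! ### Parts that meet the boundary, and paths in both directions. -/

theorem List.IsChain.forall_of_equivalence {α : Type*} {r : α → α → Prop} (hr : Equivalence r)
    {l : List α} (h : l.IsChain r) {a b : α} (ha : a ∈ l) (hb : b ∈ l) : r a b := by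
  have : IsTrans α r := ⟨fun _ _ _ => hr.trans⟩
  have h1 := List.isChain_iff_pairwise.1 h
  have : Std.Symm r := ⟨fun _ _ => hr.symm⟩
  by_cases e : a = b
  · rw [e]; exact hr.refl b
  · exact h1.forall ha hb e

namespace MarkedCells

open CellSurface

variable {D : Type*} {S : MarkedCells D} {Δ : Set (List D)}

/-- Every boundary side lies in a part of the cut surface that contains a `∘`-point. -/
theorem exists_white_of_boundary [Finite D] (hS : S.IsMarkedSurface) {E : Set D}
    (hE : S.OppClosed E)
    (hEm : ∀ g ∈ E, S.IsMarked (S.tail g) ∨ ¬ S.IsBoundaryVertex (S.tail g)) {b : D}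
    (hb : S.IsBoundarySide b) : ∃ c, (S.cut E).SameComp b c ∧ S.tail c ∈ S.white := by
  by_contra! hcon
  -- the boundary sides without a white point in their component and with a red first mark
  let P : Set D := {b | S.IsBoundarySide b ∧
    (∀ c, (S.cut E).SameComp b c → S.tail c ∉ S.white) ∧ ∀ v, S.FirstMark b v → v ∈ S.red}
  have conn : ∀ b b', S.IsBoundarySide b → S.head b = S.tail b' → ¬ S.IsMarked (S.tail b') →
      (S.cut E).SameComp b' b := by
    intro b b' hb e hm
    refine sameComp_of_tail_eq_head (cut_tail_eq_of_forall hE (fun g hg e' => ?_) e.symm)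
    rcases hEm g hg with h | h
    · exact hm (e' ▸ h)
    · exact h (by rw [e', ← e]; exact isBoundaryVertex_head hb)
  -- The start of a side in `P` is no `∘`-point of its part, and no `•`-point either, since the
  -- first mark after a `•`-point is a `∘`-point. So it is unmarked, and the preceding boundary side
  -- lies in the same part and in `P` again.
  have hprev : ∀ b ∈ P, ∃ b' ∈ P, S.head b' = S.tail b ∧ ¬ S.IsMarked (S.tail b) := by
    rintro b ⟨hb, hw, hr⟩
    obtain ⟨v, hv⟩ := hS.exists_mark b hb
    have hm : ¬ S.IsMarked (S.tail b) := by
      rintro (h | h)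
      · exact hw b ((S.cut E).sameComp_refl b) h
      · exact Set.disjoint_left.1 hS.disjoint (hS.red_white b v hv h) (hr v hv)
    obtain ⟨b', hb', e⟩ := exists_boundary_head_eq_tail hb
    have hc := conn b' b hb' e hm
    refine ⟨b', ⟨hb', fun c hbc => hw c (hc.trans hbc), fun v' hv' => ?_⟩, e, hm⟩
    have := FirstMark.step b' b v hb' (by rw [e]; exact hm) hb e.symm hv
    rw [hv'.unique this]
    exact hr v hv
  choose f hf hfe hfm using fun x : P => hprev x.1 x.2
  have hinj : Function.Injective (fun x : P => (⟨f x, hf x⟩ : P)) := by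
    intro x y e
    have e' : f x = f y := congrArg Subtype.val e
    exact Subtype.ext (boundary_tail_injective x.2.1 y.2.1 (by rw [← hfe x, ← hfe y, e']))
  have hsurj := Finite.injective_iff_surjective.1 hinj
  -- By finiteness the injective predecessor map on `P` is surjective. Hence `P` is also closed
  -- under successors, all of which start at unmarked points, and no mark is ever reached.
  have hnext : ∀ b ∈ P, ∃ b' ∈ P, S.head b = S.tail b' ∧ ¬ S.IsMarked (S.tail b') := by
    intro b hb
    obtain ⟨x, hx⟩ := hsurj ⟨b, hb⟩
    have e : f x = b := congrArg Subtype.val hx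
    exact ⟨x, x.2, by rw [← e]; exact hfe x, hfm x⟩
  have hno : ∀ b v, S.FirstMark b v → b ∉ P := by
    intro b v hv
    induction hv with
    | here d _ hm =>
      intro hd
      obtain ⟨b', _, e, h⟩ := hnext d hd
      exact h (e ▸ hm)
    | step d d' v hd _ hd' ht _ ih =>
      intro hP
      obtain ⟨b', hb', e, _⟩ := hnext d hP
      rw [boundary_tail_injective hd' hb'.1 (ht.trans e)] at ih
      exact ih hb'
  -- Until the first mark is reached one stays in the same part, so without `∘`-points there this
  -- mark is a `•`-point.
  have key : ∀ b v, S.FirstMark b v → (∀ c, (S.cut E).SameComp b c → S.tail c ∉ S.white) →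
      v ∈ S.red := by
    intro b v hv
    induction hv with
    | here d _ hm => exact fun hw => hm.resolve_left (hw _ ((S.cut E).sameComp_next d))
    | step d d' v hd hm hd' ht _ ih =>
      exact fun hw => ih fun c hc => hw c
        ((conn d d' hd ht.symm (by rw [ht]; exact hm)).symm.trans hc)
  obtain ⟨v, hv⟩ := hS.exists_mark b hb
  exact hno b v hv ⟨hb, hcon, fun v' hv' => key b v' hv' hcon⟩

theorem revPath_revPath (l : List D) : S.revPath (S.revPath l) = l := by
  simp [revPath, List.map_reverse, Function.comp_def, S.opp_opp]

theorem mem_revPath {l : List D} {d : D} : d ∈ S.revPath l ↔ S.opp d ∈ l := by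
  simp only [revPath, List.mem_reverse, List.mem_map]
  constructor
  · rintro ⟨x, hx, rfl⟩; rwa [S.opp_opp]
  · exact fun h => ⟨_, h, S.opp_opp d⟩

theorem sides_revPath (l : List D) : S.sides (S.revPath l) = S.sides l := by
  ext d
  simp only [CellSurface.sides, Set.mem_ofPred_eq, mem_revPath, S.opp_opp]
  exact Or.comm

theorem pair_of_pair_revPath {l : List D} {a b : D} (h : [a, b] <:+: S.revPath l) :
    [S.opp b, S.opp a] <:+: l := by
  have h1 := List.IsInfix.map S.opp (List.reverse_infix.2 h)
  simpa [revPath, Function.comp_def, S.opp_opp] using h1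

theorem head_revPath {l : List D} (h : l ≠ []) (h' : S.revPath l ≠ []) :
    (S.revPath l).head h' = S.opp (l.getLast h) := by
  simp [revPath]

theorem getLast_revPath {l : List D} (h : l ≠ []) (h' : S.revPath l ≠ []) :
    (S.revPath l).getLast h' = S.opp (l.head h) := by
  simp [revPath]

theorem inner_revPath {l : List D} (hc : l.IsChain fun d d' => S.head d = S.tail d')
    (hi : ∀ d ∈ l, ¬ S.IsBoundarySide d) : S.inner (S.revPath l) = S.inner l := by
  have pair : ∀ a b, [a, b] <:+: l → S.tail b = S.tail (S.opp a) := by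
    intro a b hab
    have h1 : S.head a = S.tail b := by simpa using hc.infix hab
    rw [tail_opp (hi a (List.mem_of_mem_dropLast (List.mem_dropLast_of_pair hab))), h1]
  ext v
  constructor
  · rintro ⟨d, hd, rfl⟩
    obtain ⟨a, ha⟩ := List.exists_pair_of_mem_tail hd
    have h1 := pair_of_pair_revPath ha
    refine ⟨S.opp a, List.mem_tail_of_pair h1, ?_⟩
    rw [pair _ _ h1, S.opp_opp]
  · rintro ⟨d, hd, rfl⟩
    obtain ⟨a, ha⟩ := List.exists_pair_of_mem_tail hd
    have h1 : [S.opp d, S.opp a] <:+: S.revPath l :=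
      pair_of_pair_revPath (by rwa [revPath_revPath, ] )
    exact ⟨S.opp a, List.mem_tail_of_pair h1, (pair _ _ ha).symm⟩

theorem IsPath.revPath {ends : Set S.Vertex} {l : List D} (h : S.IsPath ends l) :
    S.IsPath ends (S.revPath l) where
  ne_nil := h.revPath_ne_nil
  chain := by
    rw [List.isChain_iff_forall_rel_of_append_cons_cons]
    intro a b p q e
    have hab : [a, b] <:+: S.revPath l := ⟨p, q, by rw [e]; simp⟩
    have h1 := h.pair_head (pair_of_pair_revPath hab)
    have ha : ¬ S.IsBoundarySide a := by
      rw [← isBoundarySide_opp]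
      exact h.interior _ (List.mem_of_mem_tail (List.mem_tail_of_pair (pair_of_pair_revPath hab)))
    have hb : ¬ S.IsBoundarySide b := by
      rw [← isBoundarySide_opp]
      exact h.interior _ (List.mem_of_mem_dropLast (List.mem_dropLast_of_pair (pair_of_pair_revPath hab)))
    rw [head_opp hb, tail_opp ha] at h1
    exact h1.symm
  interior d hd := by
    rw [← isBoundarySide_opp]; exact h.interior _ (mem_revPath.1 hd)
  no_edge_twice d hd hd' := by
    rw [mem_revPath, S.opp_opp] at hd'
    exact h.no_edge_twice d hd' (mem_revPath.1 hd)
  no_vertex_twice := by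
    have e : (S.revPath l).tail.map S.tail = (l.tail.map S.tail).reverse := by
      have h1 : (S.revPath l).tail.map S.tail = (l.dropLast.map S.head).reverse := by
        rw [MarkedCells.revPath, List.tail_reverse, ← List.map_dropLast, ← List.map_reverse,
          ← List.map_reverse, List.map_map]
        refine List.map_congr_left fun d hd => ?_
        exact tail_opp (h.interior d (List.mem_of_mem_dropLast (List.mem_reverse.1 hd)))
      rw [h1]
      congr 1
      have hc := h.chain
      clear h h1
      induction l with
      | nil => rfl
      | cons a l ih =>
        cases l with
        | nil => rfl
        | cons b l =>
          rw [List.isChain_cons_cons] at hc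
          have := ih hc.2
          simp only [List.tail_cons, List.dropLast_cons_cons, List.map_cons] at this ⊢
          rw [this, hc.1]
    rw [e, List.nodup_reverse]
    exact h.no_vertex_twice
  inner_interior v hv := by
    rw [inner_revPath h.chain h.interior] at hv
    exact h.inner_interior v hv
  start_mem d hd := by
    rw [← List.head_of_mem_head? hd, head_revPath h.ne_nil,
      tail_opp (h.interior _ (List.getLast_mem _))]
    exact h.last_mem
  end_mem d hd := by
    rw [← List.getLast_of_mem_getLast? hd, getLast_revPath h.ne_nil,
      head_opp (h.interior _ (List.head_mem _))]
    exact h.head_mem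

/-- The paths of a collection, in both directions. -/
def Oriented (S : MarkedCells D) (Δ : Set (List D)) (p : List D) : Prop :=
  p ∈ Δ ∨ S.revPath p ∈ Δ

theorem Oriented.revPath {p : List D} (hp : S.Oriented Δ p) : S.Oriented Δ (S.revPath p) := by
  rcases hp with h | h
  · exact Or.inr (by rwa [revPath_revPath])
  · exact Or.inl h

theorem Oriented.exists_arc {p : List D} (hp : S.Oriented Δ p) :
    ∃ l ∈ Δ, (p = l ∨ p = S.revPath l) ∧ S.sides p = S.sides l := by
  rcases hp with h | h
  · exact ⟨p, h, Or.inl rfl, rfl⟩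
  · exact ⟨_, h, Or.inr (revPath_revPath p).symm, (sides_revPath p).symm⟩

theorem exists_oriented {d : D} (hd : d ∈ S.arcSides Δ) : ∃ p, S.Oriented Δ p ∧ d ∈ p := by
  obtain ⟨l, hl, hd | hd⟩ := hd
  · exact ⟨l, Or.inl hl, hd⟩
  · exact ⟨S.revPath l, Or.inr (by rwa [revPath_revPath]), mem_revPath.2 hd⟩

theorem Oriented.mem_arcSides {p : List D} (hp : S.Oriented Δ p) {d : D} (hd : d ∈ p) :
    d ∈ S.arcSides Δ := by
  obtain ⟨l, hl, -, e⟩ := hp.exists_arc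
  exact ⟨l, hl, e ▸ mem_sides_of_mem hd⟩

namespace PathSystem

variable {ends : Set S.Vertex}

theorem oriented_path (h : S.PathSystem ends Δ) {p : List D} (hp : S.Oriented Δ p) :
    S.IsPath ends p := by
  rcases hp with hp | hp
  · exact h.path p hp
  · have := (h.path _ hp).revPath
    rwa [revPath_revPath] at this

theorem oriented_unique (h : S.PathSystem ends Δ) {p p' : List D} (hp : S.Oriented Δ p)
    (hp' : S.Oriented Δ p') {d : D} (hd : d ∈ p) (hd' : d ∈ p') : p = p' := by
  obtain ⟨l, hl, e, hs⟩ := hp.exists_arc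
  obtain ⟨l', hl', e', hs'⟩ := hp'.exists_arc
  have : l = l' := h.eq_of_mem_sides hl hl' (hs ▸ mem_sides_of_mem hd) (hs' ▸ mem_sides_of_mem hd')
  subst this
  have hno := (h.path l hl).no_edge_twice d
  rcases e with rfl | rfl <;> rcases e' with rfl | rfl
  · rfl
  · exact absurd (mem_revPath.1 hd') (hno hd)
  · exact absurd (mem_revPath.1 hd) (hno hd')
  · rfl

theorem eq_head_of_mem (hm : ∀ v ∈ ends, S.IsMarked v) (h : S.PathSystem ends Δ) {p : List D}
    (hp : S.Oriented Δ p) {d : D} (hd : d ∈ p) (he : S.tail d ∈ ends) :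
    d = p.head (h.oriented_path hp).ne_nil := by
  have hP := h.oriented_path hp
  rcases (hP.side_ends_iff hm (mem_sides_of_mem hd)).1 he with e | e
  · exact e
  · exact absurd e.symm (hP.opp_ne (List.getLast_mem _) hd)

theorem oriented_nextSide [Finite D] (hm : ∀ v ∈ ends, S.IsMarked v) (h : S.PathSystem ends Δ)
    {p : List D} (hp : S.Oriented Δ p) {a b : D} (hab : [a, b] <:+: p) :
    S.NextSide (S.arcSides Δ) b (S.opp a) := by
  rcases hp with hp | hp
  · exact (h.nextSide_pair hm hp hab).1
  · have := (h.nextSide_pair hm hp (a := S.opp b) (b := S.opp a)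
      (pair_of_pair_revPath (by rwa [revPath_revPath]))).2
    rwa [S.opp_opp] at this

theorem cut_chain [Finite D] (hm : ∀ v ∈ ends, S.IsMarked v) (h : S.PathSystem ends Δ)
    {p : List D} (hp : S.Oriented Δ p) :
    p.IsChain fun d d' => (S.cut (S.arcSides Δ)).head d = (S.cut (S.arcSides Δ)).tail d' := by
  rw [List.isChain_iff_forall_rel_of_append_cons_cons]
  intro a b u v e
  have := (h.oriented_nextSide hm hp (a := a) (b := b) ⟨u, v, by rw [e]; simp⟩).2
  rwa [S.opp_opp] at this

theorem cut_sameComp [Finite D] (hm : ∀ v ∈ ends, S.IsMarked v) (h : S.PathSystem ends Δ)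
    {p : List D} (hp : S.Oriented Δ p) {a b : D} (ha : a ∈ p) (hb : b ∈ p) :
    (S.cut (S.arcSides Δ)).SameComp a b := by
  refine List.IsChain.forall_of_equivalence (l := p) ⟨fun x => (S.cut _).sameComp_refl x,
    SameComp.symm, SameComp.trans⟩ ?_ ha hb
  exact (h.cut_chain hm hp).imp fun x y hxy => (sameComp_of_tail_eq_head hxy.symm).symm

end PathSystem

end MarkedCells

/-! ### Digons and the homotopy of their sides. -/

namespace MarkedCells

open CellSurface

variable {D : Type*} {S : MarkedCells D} {Δ : Set (List D)}

theorem sameArc_revPath {l : List D} (hi : ∀ d ∈ l, ¬ S.IsBoundarySide d)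
    {a b : S.Vertex ⊕ S.Edge} (h : S.IsCurve a (S.curve l) b) : S.SameArc (S.revPath l) l :=
  ⟨b, a, Or.inr (homotopic_curve_revPath hi h).symm⟩

theorem avoids_red (hd : Disjoint S.white S.red) {v : S.Vertex} (hv : v ∈ S.red) :
    S.Avoids (Sum.inl v) := fun u hu e => by
  rw [Sum.inl.inj e] at hv
  exact Set.disjoint_left.1 hd hu.1 hv

theorem IsPath.isCurve {ends : Set S.Vertex} {l : List D} (h : S.IsPath ends l) :
    S.IsCurve (Sum.inl (S.tail (l.head h.ne_nil))) (S.curve l)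
      (Sum.inl (S.head (l.getLast h.ne_nil))) :=
  isCurve_curve h.ne_nil h.chain fun d hd hp =>
    (h.inner_interior _ ⟨d, hd, rfl⟩).1 (Or.inl hp.1)

/-- A path and the reversed path represent the same arc. -/
theorem IsPath.sameArc_of_or {ends : Set S.Vertex} {l p : List D} (h : S.IsPath ends l)
    (hp : p = l ∨ p = S.revPath l) : S.SameArc p l := by
  rcases hp with rfl | rfl
  · exact sameArc_refl (p.head h.ne_nil) p
  · exact sameArc_revPath h.interior h.isCurve

/-- Homotopic `•`-arcs have equivalent chains. -/
theorem IsPath.chainEquiv_of_sameArc (hd : Disjoint S.white S.red) {l m : List D}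
    (h : S.IsPath S.red l) (hlm : S.SameArc l m) : S.ChainEquiv (S.curve l) (S.curve m) := by
  have hl : ∀ a b, S.IsCurve a (S.curve l) b → S.Avoids a ∧ S.Avoids b := by
    intro a b hab
    obtain ⟨rfl, rfl⟩ := hab.unique h.isCurve (curve_ne_nil h.ne_nil)
    exact ⟨avoids_red hd h.head_mem, avoids_red hd h.last_mem⟩
  obtain ⟨a, b, h' | h'⟩ := hlm
  · exact h'.chainEquiv' hl
  · exact (h'.chainEquiv' hl).trans (chainEquiv_rev _)

/-- The collection cuts the surface into discs, each of which contains at most one `∘`-point, and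
those without a `∘`-point are digons. -/
structure IsDigonSystem (S : MarkedCells D) (Δ : Set (List D)) : Prop where
  sys : S.PathSystem S.red Δ
  euler : ∀ d, (S.cut (S.arcSides Δ)).euler {c | (S.cut (S.arcSides Δ)).SameComp d c} = 1
  white_le : ∀ d, ((S.cut (S.arcSides Δ)).tail ''
    {c | (S.cut (S.arcSides Δ)).SameComp d c ∧ S.tail c ∈ S.white}).ncard ≤ 1
  digon : ∀ d, (∀ c, (S.cut (S.arcSides Δ)).SameComp d c → S.tail c ∉ S.white) →
    {e ∈ S.arcSides Δ | S.tail e ∈ S.red ∧ (S.cut (S.arcSides Δ)).SameComp d e}.ncard = 2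
  count : ({q : (S.cut (S.arcSides Δ)).Comp | ∀ c, S.tail c ∈ S.white →
    (S.cut (S.arcSides Δ)).comp c ≠ q}.ncard : ℤ) + S.white.ncard =
      (S.cut (S.arcSides Δ)).euler Set.univ

/-- The directed paths `p` and `p'` bound a digon on their left. -/
structure IsDigon (S : MarkedCells D) (Δ : Set (List D)) (p p' : List D) : Prop where
  left : S.Oriented Δ p
  right : S.Oriented Δ p'
  white_free : ∀ d ∈ p, ∀ c, (S.cut (S.arcSides Δ)).SameComp d c → S.tail c ∉ S.white
  sameComp : ∀ d ∈ p, ∀ d' ∈ p', (S.cut (S.arcSides Δ)).SameComp d d'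
  ne : p ≠ p'
  mem : ∀ d ∈ p, ∀ e ∈ S.arcSides Δ, (S.cut (S.arcSides Δ)).SameComp d e → e ∈ p ∨ e ∈ p'
  next_left : ∀ d ∈ p.head?, ∀ e ∈ p'.getLast?, S.NextSide (S.arcSides Δ) d (S.opp e)
  next_right : ∀ d ∈ p'.head?, ∀ e ∈ p.getLast?, S.NextSide (S.arcSides Δ) d (S.opp e)

theorem IsDigon.symm (hΔ : S.PathSystem S.red Δ) {p p' : List D} (h : S.IsDigon Δ p p') :
    S.IsDigon Δ p' p where
  left := h.right
  right := h.left
  white_free d hd c hc := h.white_free _ (List.head_mem (hΔ.oriented_path h.left).ne_nil) c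
    ((h.sameComp _ (List.head_mem (hΔ.oriented_path h.left).ne_nil) d hd).trans hc)
  sameComp d hd d' hd' := (h.sameComp d' hd' d hd).symm
  ne := h.ne.symm
  mem d hd e he hc := (h.mem _ (List.head_mem (hΔ.oriented_path h.left).ne_nil) e he
    ((h.sameComp _ (List.head_mem (hΔ.oriented_path h.left).ne_nil) d hd).trans hc)).symm
  next_left := h.next_right
  next_right := h.next_left

/-- In a disc, a closed path formed by one arc is the whole boundary. -/
theorem mem_of_loop [Finite D] (hΔ : S.PathSystem S.red Δ) {p : List D} (hp : S.Oriented Δ p)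
    (hne : p ≠ [])
    (hχ : (S.cut (S.arcSides Δ)).euler {c | (S.cut (S.arcSides Δ)).SameComp (p.head hne) c} = 1)
    (hn : S.NextSide (S.arcSides Δ) (p.head hne) (S.opp (p.getLast hne))) {c : D}
    (hc : c ∈ S.arcSides Δ) (hpc : (S.cut (S.arcSides Δ)).SameComp (p.head hne) c) : c ∈ p := by
  classical
  set A := S.arcSides Δ with hA
  set U := S.cut A with hU
  have hAo : S.OppClosed A := S.oppClosed_arcSides Δ
  have hP := hΔ.oriented_path hp
  have hpA : ∀ d ∈ p, d ∈ A := fun d hd => hp.mem_arcSides hd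
  have hn2 := hn.2
  rw [S.opp_opp] at hn2
  -- The loop is contractible in the disc, so modulo two it is the boundary of a set of polygons of
  -- the disc.
  have h1 := homotopic_nil_of_euler_eq_one (S := U.bare) U.bare_punctures
    (cut_boundary_of_mem (hpA _ (List.head_mem hne))) hχ hne (hΔ.cut_chain red_marked hp) rfl hn2
  have hav : ∀ x, U.bare.Avoids x := fun x v hv => by
    rw [U.bare_punctures] at hv; exact absurd hv id
  have h2 : U.bare.ChainEquiv (U.bare.curve p) (U.bare.curve []) :=
    Homotopic.chainEquiv (hav _) (hav _) h1
  obtain ⟨x, hx1, hx2, hx3⟩ := h2.exists_faces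
  -- The loop consists of boundary sides of the disc, so the coefficient jumps nowhere and is
  -- constant.
  have hxo : ∀ e, x (U.opp e) = x e := by
    intro e
    by_cases he : e ∈ A
    · rw [show U.opp e = e from cut_opp_of_mem he]
    · have h3 := hx2 e
      have h4 : e ∉ p := fun h' => he (hpA e h')
      have h5 : U.opp e ∉ p := fun h' => by
        rw [show U.opp e = S.opp e from cut_opp_of_notMem hAo he] at h'
        exact he (hAo.mem_iff.1 (hpA _ h'))
      rw [List.count_eq_zero_of_not_mem h4,
        List.count_eq_zero_of_not_mem (show U.bare.opp e ∉ p from h5)] at h3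
      simp only [Nat.cast_zero, List.count_nil, add_zero] at h3
      exact h3
  have hxc : x (p.head hne) = x c := EqvGen.eq_of_invariant (f := x) (by
    rintro a b (rfl | rfl)
    · exact (hx1 a).symm
    · exact (hxo a).symm) hpc
  -- On a boundary side the coefficient counts the occurrences in the loop. It is one at the first
  -- side, hence at every boundary side of the disc.
  have h4 := hx3 (p.head hne) (Or.inl (cut_boundary_of_mem (hpA _ (List.head_mem hne))))
  have h5 := hx3 c (Or.inl (cut_boundary_of_mem hc))
  rw [List.count_eq_one_of_mem (hP.nodup red_marked) (List.head_mem hne)] at h4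
  by_contra hcp
  rw [List.count_eq_zero_of_not_mem hcp] at h5
  rw [← hxc, h4] at h5
  simp at h5

theorem arcSides_marked (hΔ : S.PathSystem S.red Δ) :
    ∀ g ∈ S.arcSides Δ, S.IsMarked (S.tail g) ∨ ¬ S.IsBoundaryVertex (S.tail g) := by
  intro g hg
  rcases hΔ.tail_mem hg with h | h
  · exact Or.inl (Or.inr h)
  · exact Or.inr (hΔ.inner_interior h).2

theorem exists_nextSide_of_white_free [Finite D] (hS : S.IsMarkedSurface)
    (hΔ : S.PathSystem S.red Δ) {d : D} (hd : d ∈ S.arcSides Δ)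
    (hw : ∀ c, (S.cut (S.arcSides Δ)).SameComp d c → S.tail c ∉ S.white) :
    ∃ e, S.NextSide (S.arcSides Δ) d e := by
  refine (exists_nextSide_or (S.oppClosed_arcSides Δ) hd).resolve_right ?_
  rintro ⟨b, hb, -, e⟩
  obtain ⟨c, hc, hcw⟩ := exists_white_of_boundary hS (S.oppClosed_arcSides Δ)
    (arcSides_marked hΔ) hb
  exact hw c ((sameComp_of_tail_eq_head e.symm).trans hc) hcw

theorem IsDigonSystem.exists_digon [Finite D] (hS : S.IsMarkedSurface) (h : S.IsDigonSystem Δ)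
    {r : D} (hr : ∀ c, (S.cut (S.arcSides Δ)).SameComp r c → S.tail c ∉ S.white) :
    ∃ p p', S.IsDigon Δ p p' ∧ ∀ d ∈ p, (S.cut (S.arcSides Δ)).SameComp r d := by
  have hAo : S.OppClosed (S.arcSides Δ) := S.oppClosed_arcSides Δ
  have hAb := h.sys.not_boundary
  obtain ⟨d, d', hne, hE⟩ := Set.ncard_eq_two.1 (h.digon r hr)
  have mem : ∀ e, (e ∈ S.arcSides Δ ∧ S.tail e ∈ S.red ∧
      (S.cut (S.arcSides Δ)).SameComp r e) ↔ e = d ∨ e = d' := fun e => by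
    have := Set.ext_iff.1 hE e
    exact this.trans (by simp)
  have hd := (mem d).2 (Or.inl rfl)
  have hd' := (mem d').2 (Or.inr rfl)
  have start : ∀ e, e ∈ S.arcSides Δ → S.tail e ∈ S.red →
      ∃ p, ∃ hp : S.Oriented Δ p, p.head (h.sys.oriented_path hp).ne_nil = e := by
    intro e he her
    obtain ⟨p, hp, hep⟩ := exists_oriented he
    exact ⟨p, hp, (h.sys.eq_head_of_mem red_marked hp hep her).symm⟩
  obtain ⟨p, hp, rfl⟩ := start d hd.1 hd.2.1
  obtain ⟨p', hp', rfl⟩ := start d' hd'.1 hd'.2.1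
  have hpn := (h.sys.oriented_path hp).ne_nil
  have hpn' := (h.sys.oriented_path hp').ne_nil
  -- The side that follows an end is the reverse of the last side of a path along the same region.
  -- This path starts at one of the two ends of the region, so it is `p` or `p'`.
  have step : ∀ x, x ∈ S.arcSides Δ → S.tail x ∈ S.red →
      (S.cut (S.arcSides Δ)).SameComp r x →
      S.NextSide (S.arcSides Δ) x (S.opp (p.getLast hpn)) ∨
        S.NextSide (S.arcSides Δ) x (S.opp (p'.getLast hpn')) := by
    intro x hx hxr hrx
    obtain ⟨e, he⟩ := exists_nextSide_of_white_free hS h.sys hx fun c hc => hr c (hrx.trans hc)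
    obtain ⟨q, hq, rfl⟩ := start e he.1 (by rw [he.tail_eq hAo hAb]; exact hxr)
    have hqn := (h.sys.oriented_path hq).ne_nil
    have hqn' := (h.sys.oriented_path hq.revPath).ne_nil
    have e1 := getLast_revPath hqn hqn'
    have hy := (mem ((S.revPath q).head hqn')).1 ⟨hq.revPath.mem_arcSides (List.head_mem _),
      (h.sys.oriented_path hq.revPath).head_mem, (hrx.trans he.sameComp).trans (by
        rw [← e1]
        exact h.sys.cut_sameComp red_marked hq.revPath (List.getLast_mem _) (List.head_mem _))⟩
    have key : ∀ (u : List D) (hu : S.Oriented Δ u) (hun : u ≠ []),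
        (S.revPath q).head hqn' = u.head hun → S.NextSide (S.arcSides Δ) x (S.opp (u.getLast hun)) := by
      intro u hu hun e2
      have : S.revPath q = u := h.sys.oriented_unique hq.revPath hu (List.head_mem hqn')
        (by rw [e2]; exact List.head_mem _)
      subst this
      rw [e1, S.opp_opp]
      exact he
    exact hy.imp (key p hp hpn) (key p' hp' hpn')
  have hpp : p ≠ p' := by rintro rfl; exact hne rfl
  -- An arc that closes up by itself would be the whole boundary of the disc and leave no room for a
  -- second end.
  have loop : ∀ (u : List D) (hu : S.Oriented Δ u) (hun : u ≠ []) (x : D),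
      S.NextSide (S.arcSides Δ) (u.head hun) (S.opp (u.getLast hun)) →
      (S.cut (S.arcSides Δ)).SameComp r (u.head hun) → x ∈ S.arcSides Δ → S.tail x ∈ S.red →
      (S.cut (S.arcSides Δ)).SameComp r x → x = u.head hun := by
    intro u hu hun x hn hru hx hxr hrx
    exact h.sys.eq_head_of_mem red_marked hu
      (mem_of_loop h.sys hu hun (h.euler _) hn hx (hru.symm.trans hrx)) hxr
  have n1 : S.NextSide (S.arcSides Δ) (p.head hpn) (S.opp (p'.getLast hpn')) :=
    (step _ hd.1 hd.2.1 hd.2.2).resolve_left fun hn =>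
      hne (loop p hp hpn _ hn hd.2.2 hd'.1 hd'.2.1 hd'.2.2).symm
  have n2 : S.NextSide (S.arcSides Δ) (p'.head hpn') (S.opp (p.getLast hpn)) :=
    (step _ hd'.1 hd'.2.1 hd'.2.2).resolve_right fun hn =>
      hne (loop p' hp' hpn' _ hn hd'.2.2 hd.1 hd.2.1 hd.2.2)
  have cp : ∀ x ∈ p, (S.cut (S.arcSides Δ)).SameComp r x := fun x hx =>
    hd.2.2.trans (h.sys.cut_sameComp red_marked hp (List.head_mem _) hx)
  have cp' : ∀ x ∈ p', (S.cut (S.arcSides Δ)).SameComp r x := fun x hx =>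
    hd'.2.2.trans (h.sys.cut_sameComp red_marked hp' (List.head_mem _) hx)
  refine ⟨p, p', ⟨hp, hp', ?_, ?_, hpp, ?_, ?_, ?_⟩, cp⟩
  · exact fun x hx c hc => hr c ((cp x hx).trans hc)
  · exact fun x hx y hy => (cp x hx).symm.trans (cp' y hy)
  · intro x hx e he hxe
    obtain ⟨q, hq, heq⟩ := exists_oriented he
    have hqn := (h.sys.oriented_path hq).ne_nil
    have hy := (mem (q.head hqn)).1 ⟨hq.mem_arcSides (List.head_mem _),
      (h.sys.oriented_path hq).head_mem, ((cp x hx).trans hxe).trans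
        (h.sys.cut_sameComp red_marked hq heq (List.head_mem _))⟩
    rcases hy with e1 | e1
    · left
      rwa [← h.sys.oriented_unique hq hp (List.head_mem hqn) (by rw [e1]; exact List.head_mem _)]
    · right
      rwa [← h.sys.oriented_unique hq hp' (List.head_mem hqn) (by rw [e1]; exact List.head_mem _)]
  · intro x hx e he
    rw [← List.head_of_mem_head? hx, ← List.getLast_of_mem_getLast? he]
    exact n1
  · intro x hx e he
    rw [← List.head_of_mem_head? hx, ← List.getLast_of_mem_getLast? he]
    exact n2

theorem IsDigon.next_left_head (hΔ : S.PathSystem S.red Δ) {p p' : List D}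
    (h : S.IsDigon Δ p p') : S.NextSide (S.arcSides Δ)
      (p.head (hΔ.oriented_path h.left).ne_nil)
      (S.opp (p'.getLast (hΔ.oriented_path h.right).ne_nil)) :=
  h.next_left _ (List.head_mem_head? _) _ (List.getLast_mem_getLast? _)

/-- The two sides of a digon are homotopic. -/
theorem IsDigon.sameArc [Finite D] (hd : Disjoint S.white S.red) (hΔ : S.IsDigonSystem Δ)
    {p p' : List D} (h : S.IsDigon Δ p p') : S.SameArc p p' := by
  have hP := hΔ.sys.oriented_path h.left
  have hP' := hΔ.sys.oriented_path h.right
  have n1 := (h.next_left_head hΔ.sys).2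
  have n2 := ((h.symm hΔ.sys).next_left_head hΔ.sys).2
  rw [S.opp_opp] at n1 n2
  have hAo : S.OppClosed (S.arcSides Δ) := S.oppClosed_arcSides Δ
  have hc : (p ++ p').IsChain fun d d' =>
      (S.cut (S.arcSides Δ)).head d = (S.cut (S.arcSides Δ)).tail d' := by
    refine List.isChain_append.2 ⟨hΔ.sys.cut_chain red_marked h.left,
      hΔ.sys.cut_chain red_marked h.right, fun x hx y hy => ?_⟩
    rw [← List.getLast_of_mem_getLast? hx, ← List.head_of_mem_head? hy]
    exact n2
  have hne : p ++ p' ≠ [] := by simp [hP.ne_nil]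
  have hb := cut_boundary_of_mem (S := S.toCellSurface)
    (h.left.mem_arcSides (List.head_mem hP.ne_nil))
  have h1 := homotopic_nil_of_euler_eq_one (S := (S.cut (S.arcSides Δ)).bare)
    (S.cut (S.arcSides Δ)).bare_punctures hb (hΔ.euler _) hne hc
    (by rw [List.head_append_left hP.ne_nil]) (by
      rw [List.getLast_append_of_ne_nil _ hP'.ne_nil]; exact n1)
  -- The digon has no `∘`-point, in particular no puncture, so the contraction of its boundary takes
  -- place on the marked surface.
  have h2 := homotopic_of_cut (S := S) hAo (b₀ := p.head hP.ne_nil)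
    (fun c hc hp => h.white_free _ (List.head_mem _) c hc hp.1)
    (x := .corner (p.head hP.ne_nil)) (y := .corner (p.head hP.ne_nil))
    ((S.cut (S.arcSides Δ)).sameComp_refl _) h1
  have h3 : S.Homotopic (Sum.inl (S.tail (p.head hP.ne_nil))) (Sum.inl (S.tail (p.head hP.ne_nil)))
      (S.curve p ++ S.curve p') [] := by
    rw [← curve_append]; exact h2
  have e1 : S.head (p.getLast hP.ne_nil) = S.tail (p'.head hP'.ne_nil) :=
    head_eq_of_cut_head_eq_tail hAo n2
  have e2 : S.head (p'.getLast hP'.ne_nil) = S.tail (p.head hP.ne_nil) :=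
    head_eq_of_cut_head_eq_tail hAo n1
  have c1 := hP.isCurve
  have c2 := hP'.isCurve
  rw [← e1, e2] at c2
  exact ⟨_, _, Or.inr (Homotopic.of_append_null c1 c2 (avoids_red hd hP.head_mem)
    (avoids_red hd hP.last_mem) h3)⟩

/-- The two sides of a digon belong to different arcs. -/
theorem IsDigon.ne_revPath [Finite D] (hS : S.IsMarkedSurface) (hΔ : S.PathSystem S.red Δ)
    {p p' : List D} (h : S.IsDigon Δ p p') : p' ≠ S.revPath p := by
  rintro rfl
  have hP := hΔ.oriented_path h.left
  set d := p.head hP.ne_nil with hd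
  have hdp : d ∈ p := List.head_mem _
  have hAo : S.OppClosed (S.arcSides Δ) := S.oppClosed_arcSides Δ
  obtain ⟨b, hdb, hb⟩ := hS.boundary_nonempty d
  -- If both sides belonged to one arc, regluing along it would lead from the digon only to itself,
  -- so the digon would be a whole component of `S`. But a part that contains a boundary side has a
  -- `∘`-point.
  have key : (S.cut (S.arcSides Δ)).SameComp d b := by
    refine (SameComp.of_closed (S := S.toCellSurface)
      (P := fun c => (S.cut (S.arcSides Δ)).SameComp d c)
      (fun c => ⟨fun h => h.trans ((S.cut _).sameComp_next c),
        fun h => h.trans ((S.cut _).sameComp_next c).symm⟩) (fun c hc => ?_) hdb).1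
      ((S.cut _).sameComp_refl d)
    by_cases hcA : c ∈ S.arcSides Δ
    · rcases h.mem d hdp c hcA hc with h' | h'
      · exact h.sameComp d hdp _ (mem_revPath.2 (by rwa [S.opp_opp]))
      · exact hΔ.cut_sameComp red_marked h.left hdp (mem_revPath.1 h')
    · exact hc.trans (cut_sameComp_opp hAo hcA)
  obtain ⟨c, hc, hcw⟩ := exists_white_of_boundary hS hAo (arcSides_marked hΔ) hb
  exact h.white_free d hdp c (key.trans hc) hcw

end MarkedCells

/-! ### Removing one side of a digon. -/

namespace MarkedCells

open CellSurface

variable {D : Type*} {S : MarkedCells D} {Δ : Set (List D)}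

/-- The corners of a collection that lie in a part with a `∘`-point. -/
def whiteCorners (S : MarkedCells D) (Δ : Set (List D)) : Set D :=
  {d | d ∈ S.corners Δ ∧ ∃ c, (S.cut (S.arcSides Δ)).SameComp d c ∧ S.tail c ∈ S.white}

/-- The corner `y` of `Δ'` corresponds to the corner `x` of `Δ`, up to homotopy of the arcs. -/
def CornerRel (S : MarkedCells D) (Δ Δ' : Set (List D)) (x y : D) : Prop :=
  (∀ m ∈ Δ, x ∈ S.sides m → ∃ m' ∈ Δ', y ∈ S.sides m' ∧ S.SameArc m m') ∧
  (∀ e, S.NextSide (S.arcSides Δ) x e → ∀ m ∈ Δ, e ∈ S.sides m →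
    ∃ e', S.NextSide (S.arcSides Δ') y e' ∧ ∃ m' ∈ Δ', e' ∈ S.sides m' ∧ S.SameArc m m') ∧
  (S.cut (S.arcSides Δ')).SameComp x y

theorem arcSides_mono {Δ' : Set (List D)} (h : Δ' ⊆ Δ) : S.arcSides Δ' ⊆ S.arcSides Δ := by
  rintro d ⟨l, hl, hd⟩
  exact ⟨l, h hl, hd⟩

theorem CornerRel.refl (hΔ : S.PathSystem S.red Δ) (x : D) : S.CornerRel Δ Δ x x :=
  ⟨fun m hm hx => ⟨m, hm, hx, sameArc_refl (m.head (hΔ.path m hm).ne_nil) m⟩,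
    fun e he m hm hem => ⟨e, he, m, hm, hem, sameArc_refl (m.head (hΔ.path m hm).ne_nil) m⟩,
    (S.cut _).sameComp_refl x⟩

theorem CornerRel.trans {Δ' Δ'' : Set (List D)} (hΔ' : S.PathSystem S.red Δ') (hs : Δ'' ⊆ Δ')
    {x y z : D} (h : S.CornerRel Δ Δ' x y) (h' : S.CornerRel Δ' Δ'' y z) :
    S.CornerRel Δ Δ'' x z := by
  refine ⟨fun m hm hx => ?_, fun e he m hm hem => ?_, ?_⟩
  · obtain ⟨m', hm', hy, h1⟩ := h.1 m hm hx
    obtain ⟨m'', hm'', hz, h2⟩ := h'.1 m' hm' hy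
    exact ⟨m'', hm'', hz, h1.trans (hΔ'.path m' hm').ne_nil h2⟩
  · obtain ⟨e', he', m', hm', hy, h1⟩ := h.2.1 e he m hm hem
    obtain ⟨e'', he'', m'', hm'', hz, h2⟩ := h'.2.1 e' he' m' hm' hy
    exact ⟨e'', he'', m'', hm'', hz, h1.trans (hΔ'.path m' hm').ne_nil h2⟩
  · exact (SameComp.cut_mono (S.oppClosed_arcSides _) (S.oppClosed_arcSides _)
      (arcSides_mono hs) h.2.2).trans h'.2.2

/-- A digon with sides `p` and `p'`, where `p` is the arc `l`, which is to be removed. -/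
structure DigonRemoval (S : MarkedCells D) (Δ : Set (List D)) (l p p' : List D) : Prop where
  surface : S.IsMarkedSurface
  system : S.IsDigonSystem Δ
  dig : S.IsDigon Δ p p'
  mem : l ∈ Δ
  ori : p = l ∨ p = S.revPath l

namespace DigonRemoval

variable {l p p' : List D}

theorem path (h : DigonRemoval S Δ l p p') : S.IsPath S.red p :=
  h.system.sys.oriented_path h.dig.left

theorem path' (h : DigonRemoval S Δ l p p') : S.IsPath S.red p' :=
  h.system.sys.oriented_path h.dig.right

theorem head_mem (h : DigonRemoval S Δ l p p') : p.head h.path.ne_nil ∈ p := List.head_mem _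

theorem sides_eq (h : DigonRemoval S Δ l p p') : S.sides p = S.sides l := by
  rcases h.ori with rfl | rfl
  · rfl
  · exact sides_revPath l

theorem arcSides_iff (h : DigonRemoval S Δ l p p') {d : D} :
    d ∈ S.arcSides (Δ \ {l}) ↔ d ∈ S.arcSides Δ ∧ d ∉ p ∧ d ∉ S.revPath p := by
  have e : d ∈ S.sides p ↔ d ∈ p ∨ d ∈ S.revPath p := by rw [mem_revPath]; rfl
  rw [← not_or, ← e, h.sides_eq]
  constructor
  · rintro ⟨m, ⟨hm, hml⟩, hd⟩
    exact ⟨⟨m, hm, hd⟩, fun hd' => hml (h.system.sys.eq_of_mem_sides hm h.mem hd hd')⟩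
  · rintro ⟨⟨m, hm, hd⟩, hd'⟩
    exact ⟨m, ⟨hm, fun e => hd' (by rw [Set.mem_singleton_iff] at e; rwa [← e])⟩, hd⟩

theorem sub (_h : DigonRemoval S Δ l p p') : S.arcSides (Δ \ {l}) ⊆ S.arcSides Δ :=
  arcSides_mono Set.sdiff_subset

theorem notMem_of_right (h : DigonRemoval S Δ l p p') [Finite D] {d : D} (hd : d ∈ p') :
    d ∉ p ∧ d ∉ S.revPath p :=
  ⟨fun h' => h.dig.ne (h.system.sys.oriented_unique h.dig.left h.dig.right h' hd),
    fun h' => h.dig.ne_revPath h.surface h.system.sys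
      (h.system.sys.oriented_unique h.dig.right h.dig.left.revPath hd h')⟩

theorem right_mem [Finite D] (h : DigonRemoval S Δ l p p') {d : D} (hd : d ∈ p') :
    d ∈ S.arcSides (Δ \ {l}) :=
  h.arcSides_iff.2 ⟨h.dig.right.mem_arcSides hd, h.notMem_of_right hd⟩

/-- The other side of the removed arc is not in the digon. -/
theorem not_sameComp [Finite D] (h : DigonRemoval S Δ l p p') {c : D} (hc : c ∈ S.revPath p) :
    ¬ (S.cut (S.arcSides Δ)).SameComp (p.head h.path.ne_nil) c := by
  intro hs
  rcases h.dig.mem _ h.head_mem c (h.dig.left.revPath.mem_arcSides hc) hs with h' | h'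
  · exact h.path.no_edge_twice c h' (mem_revPath.1 hc)
  · exact (h.notMem_of_right h').2 hc

/-- The side `c` lies in one of the two parts adjacent to the removed arc. -/
def Near (S : MarkedCells D) (Δ : Set (List D)) (p : List D) (c : D) : Prop :=
  ∃ d, (d ∈ p ∨ d ∈ S.revPath p) ∧ (S.cut (S.arcSides Δ)).SameComp d c

theorem near_trans {c c' : D} (hc : Near S Δ p c) (h : (S.cut (S.arcSides Δ)).SameComp c c') :
    Near S Δ p c' := by
  obtain ⟨d, hd, hdc⟩ := hc
  exact ⟨d, hd, hdc.trans h⟩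

theorem mono (h : DigonRemoval S Δ l p p') {x y : D}
    (hxy : (S.cut (S.arcSides Δ)).SameComp x y) :
    (S.cut (S.arcSides (Δ \ {l}))).SameComp x y :=
  SameComp.cut_mono (S.oppClosed_arcSides _) (S.oppClosed_arcSides _) h.sub hxy

theorem near_sameComp [Finite D] (h : DigonRemoval S Δ l p p') {x : D} (hx : Near S Δ p x) :
    (S.cut (S.arcSides (Δ \ {l}))).SameComp (p.head h.path.ne_nil) x := by
  obtain ⟨d, hd, hdx⟩ := hx
  refine SameComp.trans ?_ (h.mono hdx)
  rcases hd with hd | hd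
  · exact h.mono (h.system.sys.cut_sameComp red_marked h.dig.left h.head_mem hd)
  · have h1 := h.mono (h.system.sys.cut_sameComp red_marked h.dig.left h.head_mem
      (mem_revPath.1 hd))
    refine h1.trans (cut_sameComp_opp (S.oppClosed_arcSides _) fun hd' => ?_).symm
    exact (h.arcSides_iff.1 hd').2.2 hd

/-- Regluing along a single arc joins the two parts along it and changes no other part. -/
theorem merge [Finite D] (h : DigonRemoval S Δ l p p') {x y : D} :
    (S.cut (S.arcSides (Δ \ {l}))).SameComp x y ↔
      (S.cut (S.arcSides Δ)).SameComp x y ∨ (Near S Δ p x ∧ Near S Δ p y) := by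
  have hAo : S.OppClosed (S.arcSides Δ) := S.oppClosed_arcSides Δ
  have hAo1 : S.OppClosed (S.arcSides (Δ \ {l})) := S.oppClosed_arcSides _
  constructor
  · intro hxy
    refine (SameComp.of_closed (P := fun y => (S.cut (S.arcSides Δ)).SameComp x y ∨
      (Near S Δ p x ∧ Near S Δ p y)) (fun d => ?_) (fun d hd => ?_) hxy).1
      (Or.inl ((S.cut _).sameComp_refl x))
    · have hn := (S.cut (S.arcSides Δ)).sameComp_next d
      constructor
      · exact Or.imp (fun h' => h'.trans hn) (fun h' => ⟨h'.1, near_trans h'.2 hn⟩)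
      · exact Or.imp (fun h' => h'.trans hn.symm) (fun h' => ⟨h'.1, near_trans h'.2 hn.symm⟩)
    · by_cases hd1 : d ∈ S.arcSides (Δ \ {l})
      · rw [cut_opp_of_mem hd1]; exact hd
      rw [cut_opp_of_notMem hAo1 hd1]
      by_cases hdA : d ∈ S.arcSides Δ
      · right
        have hdp : d ∈ p ∨ d ∈ S.revPath p := by
          by_contra hcon
          exact hd1 (h.arcSides_iff.2 ⟨hdA, not_or.1 hcon⟩)
        have hod : S.opp d ∈ p ∨ S.opp d ∈ S.revPath p := by
          rw [mem_revPath, S.opp_opp, ← mem_revPath]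
          exact hdp.symm
        refine ⟨?_, _, hod, (S.cut _).sameComp_refl _⟩
        rcases hd with hd | hd
        · exact ⟨d, hdp, hd.symm⟩
        · exact hd.1
      · have hn := cut_sameComp_opp hAo hdA
        exact hd.imp (fun h' => h'.trans hn) (fun h' => ⟨h'.1, near_trans h'.2 hn⟩)
  · rintro (hxy | ⟨hx, hy⟩)
    · exact h.mono hxy
    · exact (h.near_sameComp hx).symm.trans (h.near_sameComp hy)

/-- An end of an arc in one of the two parts adjacent to the removed arc lies in the other part, or
belongs to the digon. -/
theorem near_cases [Finite D] (h : DigonRemoval S Δ l p p') {x : D} (hx : Near S Δ p x) :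
    (S.cut (S.arcSides Δ)).SameComp (p.head h.path.ne_nil) x ∨
      (S.cut (S.arcSides Δ)).SameComp ((S.revPath p).head h.path.revPath_ne_nil) x := by
  obtain ⟨d, hd, hdx⟩ := hx
  rcases hd with hd | hd
  · exact Or.inl ((h.system.sys.cut_sameComp red_marked h.dig.left h.head_mem hd).trans hdx)
  · exact Or.inr ((h.system.sys.cut_sameComp red_marked h.dig.left.revPath (List.head_mem _)
      hd).trans hdx)

theorem near_head (h : DigonRemoval S Δ l p p') : Near S Δ p (p.head h.path.ne_nil) :=
  ⟨_, Or.inl h.head_mem, (S.cut _).sameComp_refl _⟩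

theorem near_rev (h : DigonRemoval S Δ l p p') :
    Near S Δ p ((S.revPath p).head h.path.revPath_ne_nil) :=
  ⟨_, Or.inr (List.head_mem _), (S.cut _).sameComp_refl _⟩

theorem sys' (h : DigonRemoval S Δ l p p') : S.PathSystem S.red (Δ \ {l}) :=
  h.system.sys.mono Set.sdiff_subset

theorem euler_lt [Finite D] (h : DigonRemoval S Δ l p p') :
    (S.cut (S.arcSides (Δ \ {l}))).euler Set.univ + 1 =
      (S.cut (S.arcSides Δ)).euler Set.univ := by
  have h1 := h.system.sys.euler_cut_of_boundary red_marked h.surface.red_boundary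
  have h2 := h.sys'.euler_cut_of_boundary red_marked h.surface.red_boundary
  have hf := h.system.sys.finite
  have h3 : Nat.card (Δ \ {l} : Set (List D)) + 1 = Nat.card Δ := by
    rw [Nat.card_coe_set_eq, Nat.card_coe_set_eq]
    exact Set.ncard_sdiff_singleton_add_one h.mem (Set.toFinite Δ)
  omega

/-- The old parts without `∘`-point other than the digon map onto the new ones, so the digon is
dropped from the count. -/
theorem ncard_white_free_lt [Finite D] (h : DigonRemoval S Δ l p p') :
    {q : (S.cut (S.arcSides (Δ \ {l}))).Comp | ∀ c, S.tail c ∈ S.white →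
      (S.cut (S.arcSides (Δ \ {l}))).comp c ≠ q}.ncard + 1 ≤
    {q : (S.cut (S.arcSides Δ)).Comp | ∀ c, S.tail c ∈ S.white →
      (S.cut (S.arcSides Δ)).comp c ≠ q}.ncard := by
  classical
  set d := p.head h.path.ne_nil
  set Q := {q : (S.cut (S.arcSides Δ)).Comp | ∀ c, S.tail c ∈ S.white →
      (S.cut (S.arcSides Δ)).comp c ≠ q}
  have hdQ : (S.cut (S.arcSides Δ)).comp d ∈ Q := fun c hc e =>
    h.dig.white_free d h.head_mem c (comp_eq_iff.1 e).symm hc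
  rw [← Set.ncard_sdiff_singleton_add_one hdQ (Set.toFinite _)]
  refine Nat.add_le_add_right ?_ 1
  let π : (S.cut (S.arcSides Δ)).Comp → (S.cut (S.arcSides (Δ \ {l}))).Comp := fun q =>
    (S.cut (S.arcSides (Δ \ {l}))).comp (comp_surjective q).choose
  have hπ : ∀ c, π ((S.cut (S.arcSides Δ)).comp c) = (S.cut (S.arcSides (Δ \ {l}))).comp c := by
    intro c
    refine comp_eq_iff.2 (h.mono ?_)
    exact comp_eq_iff.1 (comp_surjective ((S.cut (S.arcSides Δ)).comp c)).choose_spec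
  refine (Set.ncard_le_ncard ?_ (Set.toFinite _)).trans
    (Set.ncard_image_le (f := π) (s := Q \ {(S.cut (S.arcSides Δ)).comp d}) (Set.toFinite _))
  intro q hq
  obtain ⟨c, rfl⟩ := comp_surjective q
  have hmem : ∀ x, (S.cut (S.arcSides (Δ \ {l}))).SameComp c x →
      ¬ (S.cut (S.arcSides Δ)).SameComp d x →
      (S.cut (S.arcSides (Δ \ {l}))).comp c ∈ π '' (Q \ {(S.cut (S.arcSides Δ)).comp d}) := by
    intro x hcx hdx
    refine ⟨(S.cut (S.arcSides Δ)).comp x, ⟨fun y hy e => ?_, fun e => ?_⟩, ?_⟩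
    · exact hq y hy (comp_eq_iff.2 ((h.mono (comp_eq_iff.1 e)).trans hcx.symm))
    · exact hdx (comp_eq_iff.1 (Set.mem_singleton_iff.1 e)).symm
    · rw [hπ]; exact comp_eq_iff.2 hcx.symm
  -- A new part that has absorbed the digon is represented by the old part on the other side of the
  -- removed arc, which is not the digon.
  by_cases hdc : (S.cut (S.arcSides Δ)).SameComp d c
  · exact hmem _ ((h.mono hdc).symm.trans (h.near_sameComp h.near_rev))
      (h.not_sameComp (List.head_mem _))
  · exact hmem c ((S.cut _).sameComp_refl c) hdc

/-- The ends of the removed arc. -/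
theorem end_cases (h : DigonRemoval S Δ l p p') {x : D} (hx : x ∈ S.arcSides Δ)
    (hr : S.tail x ∈ S.red) (hn : x ∉ S.arcSides (Δ \ {l})) :
    x = p.head h.path.ne_nil ∨ x = (S.revPath p).head h.path.revPath_ne_nil := by
  have hxp : x ∈ p ∨ x ∈ S.revPath p := by
    by_contra hcon
    exact hn (h.arcSides_iff.2 ⟨hx, not_or.1 hcon⟩)
  exact hxp.imp (fun h' => h.system.sys.eq_head_of_mem red_marked h.dig.left h' hr)
    (fun h' => h.system.sys.eq_head_of_mem red_marked h.dig.left.revPath h' hr)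

/-- The `•`-arcs pass through no `∘`-point, so the cut does not split any. -/
theorem white_image (hd : Disjoint S.white S.red) [Finite D] (hΔ : S.PathSystem S.red Δ) :
    ((S.cut (S.arcSides Δ)).tail '' {c | S.tail c ∈ S.white}).ncard = S.white.ncard := by
  have h1 := ncard_cut_tail (S := S.toCellSurface) (w := {c | S.tail c ∈ S.white})
    (S.oppClosed_arcSides Δ) hΔ.not_boundary (S.saturated_preimage _)
  have h2 : S.arcSides Δ ∩ {c | S.tail c ∈ S.white} = ∅ := by
    ext c
    refine iff_of_false ?_ id
    rintro ⟨hc, hw⟩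
    rcases hΔ.tail_mem hc with h' | h'
    · exact Set.disjoint_left.1 hd hw h'
    · exact (hΔ.inner_interior h').1 (Or.inl hw)
  rw [h2, tail_image_white] at h1
  simpa using h1

/-- Removal lowers the Euler characteristic of the cut surface by one and the number of parts
without `∘`-point by at least one, so the count stays extremal and forces the new parts to be discs
with at most one `∘`-point. If the neighbour of the digon has no `∘`-point, it is a digon too, and
the union of both is again a digon. -/
theorem isDigonSystem [Finite D] (h : DigonRemoval S Δ l p p') :
    S.IsDigonSystem (Δ \ {l}) := by
  have hlt := h.ncard_white_free_lt
  have heu := h.euler_lt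
  have hcount := h.system.count
  set k := {q : (S.cut (S.arcSides (Δ \ {l}))).Comp | ∀ c, S.tail c ∈ S.white →
      (S.cut (S.arcSides (Δ \ {l}))).comp c ≠ q}.ncard with hk
  have hW := white_image h.surface.disjoint h.sys'
  set K := {q : (S.cut (S.arcSides Δ)).Comp | ∀ c, S.tail c ∈ S.white →
      (S.cut (S.arcSides Δ)).comp c ≠ q}.ncard with hK
  obtain ⟨h1, h2, h3⟩ := euler_eq_one_of_count (S := S.cut (S.arcSides (Δ \ {l})))
    (exists_boundary_cut h.surface.boundary_nonempty (S.oppClosed_arcSides _))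
    {c | S.tail c ∈ S.white} (K - 1) (by
      refine le_trans (le_of_eq ?_) (Nat.le_sub_one_of_lt (Nat.lt_of_succ_le hlt))
      rfl) (by rw [hW]; omega)
  have h3' : k = K - 1 := h3
  refine ⟨h.sys', h1, h2, ?_, ?_⟩
  · intro r hr
    have hwf : ∀ x, (S.cut (S.arcSides (Δ \ {l}))).SameComp r x →
        ∀ c, (S.cut (S.arcSides Δ)).SameComp x c → S.tail c ∉ S.white :=
      fun x hx c hc => hr c (hx.trans (h.mono hc))
    by_cases hnr : Near S Δ p r
    · set d := p.head h.path.ne_nil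
      set rd := (S.revPath p).head h.path.revPath_ne_nil
      set d' := p'.head h.path'.ne_nil
      have hrrd : (S.cut (S.arcSides (Δ \ {l}))).SameComp r rd := h.merge.2 (Or.inr ⟨hnr, h.near_rev⟩)
      have hrdA : rd ∈ S.arcSides Δ := h.dig.left.revPath.mem_arcSides (List.head_mem _)
      have hrdr : S.tail rd ∈ S.red := (h.system.sys.oriented_path h.dig.left.revPath).head_mem
      have hE := h.system.digon rd (hwf rd hrrd)
      set E := {e ∈ S.arcSides Δ | S.tail e ∈ S.red ∧ (S.cut (S.arcSides Δ)).SameComp rd e}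
      have hrdE : rd ∈ E := ⟨hrdA, hrdr, (S.cut _).sameComp_refl _⟩
      have hdd' : (S.cut (S.arcSides Δ)).SameComp d d' :=
        h.dig.sameComp d h.head_mem d' (List.head_mem _)
      have hd'E : d' ∉ E \ {rd} := fun he =>
        h.not_sameComp (List.head_mem h.path.revPath_ne_nil) (hdd'.trans he.1.2.2.symm)
      -- In the union the start `rd` of the removed arc, seen from the neighbour, is replaced by the
      -- start `d'` of the parallel side.
      have e1 : {e ∈ S.arcSides (Δ \ {l}) | S.tail e ∈ S.red ∧
          (S.cut (S.arcSides (Δ \ {l}))).SameComp r e} = insert d' (E \ {rd}) := by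
        ext x
        constructor
        · rintro ⟨hx, hxr, hrx⟩
          have hxn : Near S Δ p x := by
            rcases h.merge.1 hrx with h' | h'
            · exact near_trans hnr h'
            · exact h'.2
          rcases h.near_cases hxn with h' | h'
          · left
            rcases h.dig.mem d h.head_mem x (h.sub hx) h' with h'' | h''
            · exact absurd h'' (h.arcSides_iff.1 hx).2.1
            · exact h.system.sys.eq_head_of_mem red_marked h.dig.right h'' hxr
          · right
            refine ⟨⟨h.sub hx, hxr, h'⟩, fun e => (h.arcSides_iff.1 hx).2.2 ?_⟩
            rw [Set.mem_singleton_iff.1 e]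
            exact List.head_mem _
        · rintro (rfl | ⟨⟨hx, hxr, hrx⟩, hne⟩)
          · refine ⟨h.right_mem (List.head_mem _), h.path'.head_mem, ?_⟩
            exact h.merge.2 (Or.inr ⟨hnr, near_trans h.near_head hdd'⟩)
          · refine ⟨?_, hxr, hrrd.trans (h.mono hrx)⟩
            by_contra hcon
            rcases h.end_cases hx hxr hcon with e | e
            · rw [e] at hrx
              exact h.not_sameComp (List.head_mem h.path.revPath_ne_nil) hrx.symm
            · exact hne e
      rw [e1, Set.ncard_insert_of_notMem hd'E (Set.toFinite _),
        Set.ncard_sdiff_singleton_add_one hrdE (Set.toFinite _), hE]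
    · have hsame : ∀ x, (S.cut (S.arcSides (Δ \ {l}))).SameComp r x ↔
          (S.cut (S.arcSides Δ)).SameComp r x := fun x => by
        rw [h.merge]
        exact or_iff_left fun h' => hnr h'.1
      rw [← h.system.digon r fun c hc => hr c (h.mono hc)]
      congr 1
      ext x
      constructor
      · rintro ⟨hx, hxr, hrx⟩
        exact ⟨h.sub hx, hxr, (hsame x).1 hrx⟩
      · rintro ⟨hx, hxr, hrx⟩
        refine ⟨?_, hxr, (hsame x).2 hrx⟩
        by_contra hcon
        rcases h.end_cases hx hxr hcon with e | e
        · exact hnr (near_trans h.near_head (by rw [← e]; exact hrx.symm))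
        · exact hnr (near_trans h.near_rev (by rw [← e]; exact hrx.symm))
  · rw [← hk]
    omega

end DigonRemoval

end MarkedCells

/-! ### Corners under removal, and reduction to a simple coordinate. -/

namespace MarkedCells

open CellSurface

variable {D : Type*} {S : MarkedCells D} {Δ : Set (List D)}

/-- If no side followed under the finer cut, the fan would end at a boundary side of `S` outside
`E`. Under the coarser cut this fan has a unique end too, and that one belongs to `E'`. -/
theorem exists_nextSide_of_cut_tail_eq [Finite D] {E E' : Set D} (hE : S.OppClosed E)
    (hE' : S.OppClosed E') (hs : E' ⊆ E) {x y e : D} (hx : x ∈ E)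
    (hxy : (S.cut E').tail x = (S.cut E').tail y) (he : S.NextSide E' y e) :
    ∃ e', S.NextSide E x e' := by
  refine (exists_nextSide_or hE hx).resolve_right ?_
  rintro ⟨b, hb, hbE, hbx⟩
  have h1 : (S.cut E').head b = (S.cut E').tail x := by
    refine EqvGen.eq_of_invariant (f := (S.cut E').tail) (fun a b hab => ?_) (tail_eq_iff.1 hbx)
    rw [cut_rot_iff hE] at hab
    exact ((cut_rot_iff hE').2 ⟨hab.1, fun h' => hab.2 (hs h')⟩).tail_eq
  have h2 : b = S.opp e := boundary_head_injective ((cut_isBoundarySide hE').2 (Or.inl hb))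
    (cut_boundary_opp_of_mem hE' he.1) (h1.trans (hxy.trans he.2.symm))
  exact hbE (hs (h2 ▸ hE' e he.1))

theorem cut_tail_eq_mono {E E' : Set D} (hE : S.OppClosed E)
    (hE' : S.OppClosed E') (hs : E' ⊆ E) {x y : D} (h : (S.cut E).tail x = (S.cut E).tail y) :
    (S.cut E').tail x = (S.cut E').tail y := by
  refine EqvGen.eq_of_invariant (f := (S.cut E').tail) (fun a b hab => ?_) (tail_eq_iff.1 h)
  rw [cut_rot_iff hE] at hab
  exact ((cut_rot_iff hE').2 ⟨hab.1, fun h' => hab.2 (hs h')⟩).tail_eq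

namespace DigonRemoval

variable {l p p' : List D}

theorem rev_notMem (h : DigonRemoval S Δ l p p') :
    (S.revPath p).head h.path.revPath_ne_nil ∉ S.arcSides (Δ \ {l}) := fun hd =>
  (h.arcSides_iff.1 hd).2.2 (List.head_mem _)

/-- Rotating across an end of the removed arc. -/
theorem tail_eq_of_nextSide (h : DigonRemoval S Δ l p p') {x e : D}
    (hx : S.NextSide (S.arcSides Δ) x e) :
    (S.cut (S.arcSides (Δ \ {l}))).head (S.opp e) = (S.cut (S.arcSides (Δ \ {l}))).tail x :=
  cut_tail_eq_mono (S.oppClosed_arcSides _) (S.oppClosed_arcSides _) h.sub hx.2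

theorem tail_removed (h : DigonRemoval S Δ l p p') {x e : D}
    (hx : S.NextSide (S.arcSides Δ) x e) (he : e ∉ S.arcSides (Δ \ {l})) :
    (S.cut (S.arcSides (Δ \ {l}))).tail e = (S.cut (S.arcSides (Δ \ {l}))).tail x := by
  rw [← h.tail_eq_of_nextSide hx]
  have hb : ¬ (S.cut (S.arcSides (Δ \ {l}))).IsBoundarySide e := by
    rw [cut_isBoundarySide (S.oppClosed_arcSides _)]
    exact not_or.2 ⟨h.system.sys.not_boundary e hx.1, he⟩
  have := head_opp hb
  rwa [cut_opp_of_notMem (S.oppClosed_arcSides _) he, eq_comm] at this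

theorem nextSide_rev (h : DigonRemoval S Δ l p p') :
    S.NextSide (S.arcSides Δ) (p'.head h.path'.ne_nil)
      ((S.revPath p).head h.path.revPath_ne_nil) := by
  rw [head_revPath h.path.ne_nil]
  exact (h.dig.symm h.system.sys).next_left_head h.system.sys

theorem exists_other (h : DigonRemoval S Δ l p p') [Finite D] :
    ∃ l' ∈ Δ \ {l}, (p' = l' ∨ p' = S.revPath l') ∧ S.SameArc l l' := by
  obtain ⟨l', hl', ho, hs⟩ := h.dig.right.exists_arc
  refine ⟨l', ⟨hl', fun e => ?_⟩, ho, ?_⟩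
  · rw [Set.mem_singleton_iff.1 e] at ho
    rcases h.ori with e1 | e1 <;> rcases ho with e2 | e2
    · exact h.dig.ne (e1.trans e2.symm)
    · exact h.dig.ne_revPath h.surface h.system.sys (by rw [e1, e2])
    · exact h.dig.ne_revPath h.surface h.system.sys (by rw [e1, e2, revPath_revPath])
    · exact h.dig.ne (e1.trans e2.symm)
  · have h1 := (h.system.sys.path l h.mem).sameArc_of_or h.ori
    have h2 := (h.system.sys.path l' hl').sameArc_of_or ho
    have h3 := h.dig.sameArc h.surface.disjoint h.system
    exact h1.symm.trans h.path.ne_nil (h3.trans h.path'.ne_nil h2)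

/-- The side that follows `y` after the removal, if `x` and `y` are at the same vertex then. -/
theorem exists_nextSide [Finite D] (h : DigonRemoval S Δ l p p') {x y e : D}
    (hx : x ≠ p'.head h.path'.ne_nil) (hxA : x ∈ S.arcSides Δ) (hxr : S.tail x ∈ S.red)
    (hxy : (S.cut (S.arcSides (Δ \ {l}))).tail x = (S.cut (S.arcSides (Δ \ {l}))).tail y)
    (he : S.NextSide (S.arcSides Δ) x e) :
    ∃ e', S.NextSide (S.arcSides (Δ \ {l})) y e' ∧ ∀ m ∈ Δ, e ∈ S.sides m →
      ∃ m' ∈ Δ \ {l}, e' ∈ S.sides m' ∧ S.SameArc m m' := by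
  have hAo := S.oppClosed_arcSides Δ
  by_cases he1 : e ∈ S.arcSides (Δ \ {l})
  · refine ⟨e, ⟨he1, (h.tail_eq_of_nextSide he).trans hxy⟩, fun m hm hem => ?_⟩
    refine ⟨m, ⟨hm, fun e1 => ?_⟩, hem, sameArc_refl e m⟩
    have := (h.arcSides_iff.1 he1).2
    rw [Set.mem_singleton_iff.1 e1, ← h.sides_eq] at hem
    rcases hem with hem | hem
    · exact this.1 hem
    · exact this.2 (mem_revPath.2 hem)
  · have her : S.tail e ∈ S.red := by
      rw [he.tail_eq hAo h.system.sys.not_boundary]; exact hxr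
    -- If the following side is the start of `p`, then, after its removal, rotation continues
    -- through the digon to the reverse of the last side of `p'`, on a homotopic arc. The start of
    -- the reversed `p` follows only the start of `p'`, which is excluded.
    rcases h.end_cases he.1 her he1 with rfl | rfl
    · obtain ⟨l', hl', ho, hsame⟩ := h.exists_other
      have hn := h.dig.next_left_head h.system.sys
      refine ⟨S.opp (p'.getLast h.path'.ne_nil), ⟨?_, ?_⟩, fun m hm hem => ?_⟩
      · exact S.oppClosed_arcSides _ _ (h.right_mem (List.getLast_mem _))
      · rw [h.tail_eq_of_nextSide hn, h.tail_removed he he1, hxy]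
      · have : m = l := h.system.sys.eq_of_mem_sides hm h.mem hem
          (h.sides_eq ▸ mem_sides_of_mem h.head_mem)
        subst this
        refine ⟨l', hl', ?_, hsame⟩
        have hs : S.sides p' = S.sides l' := by
          rcases ho with e1 | e1
          · rw [e1]
          · rw [e1, sides_revPath]
        rw [← hs]
        exact opp_mem_sides_of_mem (List.getLast_mem _)
    · exact absurd (he.left_unique hxA (h.dig.right.mem_arcSides (List.head_mem _))
        h.nextSide_rev) hx

open Classical in
/-- The corner that replaces the corner `x` when the arc is removed. -/
noncomputable def move (h : DigonRemoval S Δ l p p') (x : D) : D :=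
  if x = (S.revPath p).head h.path.revPath_ne_nil then p'.head h.path'.ne_nil else x

theorem move_tail (h : DigonRemoval S Δ l p p') (x : D) :
    (S.cut (S.arcSides (Δ \ {l}))).tail x = (S.cut (S.arcSides (Δ \ {l}))).tail (h.move x) := by
  unfold move
  split
  · next e =>
    rw [e]
    exact h.tail_removed h.nextSide_rev h.rev_notMem
  · rfl

theorem notMem_digon (h : DigonRemoval S Δ l p p') {x : D} (hx : x ∈ S.whiteCorners Δ) :
    ¬ (S.cut (S.arcSides Δ)).SameComp (p.head h.path.ne_nil) x := by
  obtain ⟨-, c, hc, hw⟩ := hx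
  exact fun h' => h.dig.white_free _ h.head_mem c (h'.trans hc) hw

theorem head'_sameComp (h : DigonRemoval S Δ l p p') :
    (S.cut (S.arcSides Δ)).SameComp (p.head h.path.ne_nil) (p'.head h.path'.ne_nil) :=
  h.dig.sameComp _ h.head_mem _ (List.head_mem _)

/-- A corner in a part with a `∘`-point is not in the digon. If it lies at the removed arc, it is
based on the outer side of this arc and passes to the parallel arc `p'`, which now bounds the part.
-/
theorem move_mem [Finite D] (h : DigonRemoval S Δ l p p') {x : D} (hx : x ∈ S.whiteCorners Δ) :
    h.move x ∈ S.whiteCorners (Δ \ {l}) ∧ S.CornerRel Δ (Δ \ {l}) x (h.move x) := by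
  have hxd := h.notMem_digon hx
  obtain ⟨⟨hxA, hxr, e, he⟩, c, hc, hw⟩ := hx
  have hxd' : x ≠ p'.head h.path'.ne_nil := fun e' => hxd (e' ▸ h.head'_sameComp)
  have hsc : (S.cut (S.arcSides (Δ \ {l}))).SameComp x (h.move x) :=
    sameComp_of_tail_eq (h.move_tail x)
  obtain ⟨e', he', htgt⟩ := h.exists_nextSide hxd' hxA hxr (h.move_tail x) he
  have hmA : h.move x ∈ S.arcSides (Δ \ {l}) := by
    unfold move
    split
    · exact h.right_mem (List.head_mem _)
    · next hne =>
      by_contra hcon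
      rcases h.end_cases hxA hxr hcon with e1 | e1
      · exact hxd (e1 ▸ (S.cut _).sameComp_refl _)
      · exact hne e1
  have hmr : S.tail (h.move x) ∈ S.red := by
    rw [← tail_eq_of_cut_tail_eq (S.oppClosed_arcSides _) (h.move_tail x)]; exact hxr
  refine ⟨⟨⟨hmA, hmr, e', he'⟩, c, hsc.symm.trans (h.mono hc), hw⟩, ?_, ?_, hsc⟩
  · intro m hm hxm
    unfold move
    split
    · next e1 =>
      have : m = l := h.system.sys.eq_of_mem_sides hm h.mem hxm (by
        rw [e1, ← h.sides_eq, ← sides_revPath]; exact mem_sides_of_mem (List.head_mem _))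
      subst this
      obtain ⟨l', hl', ho, hsame⟩ := h.exists_other
      refine ⟨l', hl', ?_, hsame⟩
      have hs : S.sides p' = S.sides l' := by
        rcases ho with e1 | e1
        · rw [e1]
        · rw [e1, sides_revPath]
      rw [← hs]
      exact mem_sides_of_mem (List.head_mem _)
    · next hne =>
      have e1 : h.move x = x := if_neg hne
      rw [e1] at hmA
      refine ⟨m, ⟨hm, fun e2 => ?_⟩, hxm, sameArc_refl x m⟩
      have := (h.arcSides_iff.1 hmA).2
      rw [Set.mem_singleton_iff.1 e2, ← h.sides_eq] at hxm
      rcases hxm with h' | h'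
      · exact this.1 h'
      · exact this.2 (mem_revPath.2 h')
  · intro e1 he1 m hm hem
    rw [he1.right_unique (S.oppClosed_arcSides Δ) he] at hem
    exact ⟨e', he', htgt m hm hem⟩

/-- The start of `p'` was a corner of the digon before, so it is free to receive the one corner that
moves; all others stay in place. Conversely every new corner comes from outside the digon. -/
theorem exists_equiv [Finite D] (h : DigonRemoval S Δ l p p') :
    ∃ f : S.whiteCorners Δ ≃ S.whiteCorners (Δ \ {l}),
      ∀ x : S.whiteCorners Δ, S.CornerRel Δ (Δ \ {l}) x (f x) := by
  let f : S.whiteCorners Δ → S.whiteCorners (Δ \ {l}) := fun x => ⟨h.move x, (h.move_mem x.2).1⟩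
  have hd' : ∀ x ∈ S.whiteCorners Δ, x ≠ p'.head h.path'.ne_nil := fun x hx e' =>
    h.notMem_digon hx (e' ▸ h.head'_sameComp)
  have hf : Function.Bijective f := by
    constructor
    · intro x y hxy
      have e : h.move x = h.move y := congrArg Subtype.val hxy
      unfold move at e
      refine Subtype.ext ?_
      split at e <;> split at e
      · next e1 e2 => exact e1.trans e2.symm
      · exact absurd e.symm (hd' _ y.2)
      · exact absurd e (hd' _ x.2)
      · exact e
    · rintro ⟨y, ⟨hyA, hyr, e, he⟩, c, hc, hw⟩
      -- the corner before the removal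
      obtain ⟨x, hxA, hxr, hxm, hxd⟩ : ∃ x ∈ S.arcSides Δ, S.tail x ∈ S.red ∧ h.move x = y ∧
          ¬ (S.cut (S.arcSides Δ)).SameComp (p.head h.path.ne_nil) x := by
        by_cases hy : y = p'.head h.path'.ne_nil
        · exact ⟨(S.revPath p).head h.path.revPath_ne_nil,
            h.dig.left.revPath.mem_arcSides (List.head_mem _),
            (h.system.sys.oriented_path h.dig.left.revPath).head_mem, by rw [hy]; exact if_pos rfl,
            h.not_sameComp (List.head_mem _)⟩
        · refine ⟨y, h.sub hyA, hyr, if_neg (fun e1 => h.rev_notMem (by rw [← e1]; exact hyA)), fun hs => ?_⟩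
          rcases h.dig.mem _ h.head_mem y (h.sub hyA) hs with h' | h'
          · exact (h.arcSides_iff.1 hyA).2.1 h'
          · exact hy (h.system.sys.eq_head_of_mem red_marked h.dig.right h' hyr)
      have ht := h.move_tail x
      rw [hxm] at ht
      refine ⟨⟨x, ⟨hxA, hxr, ?_⟩, c, ?_, hw⟩, Subtype.ext hxm⟩
      · exact exists_nextSide_of_cut_tail_eq (S.oppClosed_arcSides _) (S.oppClosed_arcSides _)
          h.sub hxA ht he
      · have h1 : (S.cut (S.arcSides (Δ \ {l}))).SameComp x c := (sameComp_of_tail_eq ht).trans hc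
        rcases h.merge.1 h1 with h' | ⟨hx, hcn⟩
        · exact h'
        · rcases h.near_cases hcn with h' | h'
          · exact absurd hw (h.dig.white_free _ h.head_mem c h')
          · exact ((h.near_cases hx).resolve_left hxd).symm.trans h'
  exact ⟨Equiv.ofBijective f hf, fun x => (h.move_mem x.2).2⟩

end DigonRemoval

theorem exists_white_of_ncard_eq_zero [Finite D]
    (hk : {q : (S.cut (S.arcSides Δ)).Comp | ∀ c, S.tail c ∈ S.white →
      (S.cut (S.arcSides Δ)).comp c ≠ q}.ncard = 0) (d : D) :
    ∃ c, (S.cut (S.arcSides Δ)).SameComp d c ∧ S.tail c ∈ S.white := by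
  rw [Set.ncard_eq_zero] at hk
  by_contra! hcon
  have : (S.cut (S.arcSides Δ)).comp d ∈ {q : (S.cut (S.arcSides Δ)).Comp |
      ∀ c, S.tail c ∈ S.white → (S.cut (S.arcSides Δ)).comp c ≠ q} :=
    fun c hc e => hcon c (comp_eq_iff.1 e).symm hc
  rw [hk] at this
  exact this

theorem not_chainEquiv [Finite D] (hd : Disjoint S.white S.red) (hΔ : S.PathSystem S.red Δ)
    (hw : ∀ d, ∃ c, (S.cut (S.arcSides Δ)).SameComp d c ∧ S.tail c ∈ S.white) {l m : List D}
    (hl : l ∈ Δ) (hm : ∀ d ∈ m, d ∈ S.arcSides Δ) (hlm : ∀ d ∈ S.sides l, d ∉ m) :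
    ¬ S.ChainEquiv (S.curve l) (S.curve m) := by
  have hP := hΔ.path l hl
  refine not_chainEquiv_of_white (S.oppClosed_arcSides Δ) hΔ.not_boundary (fun d hdA hdw => ?_) hw
    hP.ne_nil (fun d hdl => ⟨l, hl, mem_sides_of_mem hdl⟩) hm (hP.nodup red_marked)
    hP.no_edge_twice
    (fun d hdl => ⟨hlm d (mem_sides_of_mem hdl), hlm _ (opp_mem_sides_of_mem hdl)⟩)
  rcases hΔ.tail_mem hdA with h' | h'
  · exact Set.disjoint_left.1 hd hdw h'
  · exact (hΔ.inner_interior h').1 (Or.inl hdw)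

/-- If every part contains a `∘`-point, then different arcs are not homotopic. -/
theorem eq_of_sameArc [Finite D] (hd : Disjoint S.white S.red) (hΔ : S.PathSystem S.red Δ)
    (hw : ∀ d, ∃ c, (S.cut (S.arcSides Δ)).SameComp d c ∧ S.tail c ∈ S.white) {l m : List D}
    (hl : l ∈ Δ) (hm : m ∈ Δ) (hlm : S.SameArc l m) : l = m := by
  by_contra hne
  refine not_chainEquiv hd hΔ hw hl (fun d hdm => ⟨m, hm, mem_sides_of_mem hdm⟩) (fun d hdl hdm => ?_)
    ((hΔ.path l hl).chainEquiv_of_sameArc hd hlm)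
  exact hne (hΔ.eq_of_mem_sides hl hm hdl (mem_sides_of_mem hdm))

theorem IsDigonSystem.isSimpleCoordinate [Finite D] (hd : Disjoint S.white S.red)
    (hΔ : S.IsDigonSystem Δ)
    (hw : ∀ d, ∃ c, (S.cut (S.arcSides Δ)).SameComp d c ∧ S.tail c ∈ S.white) :
    S.IsSimpleCoordinate Δ where
  arc l hl :=
    { ne_nil := (hΔ.sys.path l hl).ne_nil
      chain := (hΔ.sys.path l hl).chain
      interior := (hΔ.sys.path l hl).interior
      no_edge_twice := (hΔ.sys.path l hl).no_edge_twice
      no_vertex_twice := (hΔ.sys.path l hl).no_vertex_twice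
      inner_interior := (hΔ.sys.path l hl).inner_interior
      start_mem := (hΔ.sys.path l hl).start_mem
      end_mem := (hΔ.sys.path l hl).end_mem
      -- A contractible arc would have the same chain modulo two as the empty path, which the
      -- `∘`-points in all parts exclude.
      not_contractible := fun a ha => not_chainEquiv hd hΔ.sys hw hl (m := []) (by simp) (by simp)
        ((hΔ.sys.path l hl).chainEquiv_of_sameArc hd ⟨a, a, Or.inl ha⟩) }
  disjoint_sides := hΔ.sys.disjoint_sides
  disjoint_inner := hΔ.sys.disjoint_inner
  polygon := hΔ.euler
  one_white d := by
    obtain ⟨c, hc, hcw⟩ := hw d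
    refine le_antisymm (hΔ.white_le d) ?_
    exact (Set.ncard_pos (Set.toFinite _)).2 ⟨_, c, ⟨hc, hcw⟩, rfl⟩

/-- Removing the sides of digons one after the other, one arrives at a given set of representatives
of the homotopy classes of arcs. -/
theorem IsDigonSystem.reduce [Finite D] (hS : S.IsMarkedSurface) {Δ' : Set (List D)}
    (hinj : ∀ t ∈ Δ', ∀ t' ∈ Δ', S.SameArc t t' → t = t') (n : ℕ) :
    ∀ Δ : Set (List D), S.IsDigonSystem Δ → Δ' ⊆ Δ → (∀ s ∈ Δ, ∃ t ∈ Δ', S.SameArc s t) →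
      {q : (S.cut (S.arcSides Δ)).Comp | ∀ c, S.tail c ∈ S.white →
        (S.cut (S.arcSides Δ)).comp c ≠ q}.ncard = n →
      S.IsDigonSystem Δ' ∧
      (∀ d, ∃ c, (S.cut (S.arcSides Δ')).SameComp d c ∧ S.tail c ∈ S.white) ∧
      ∃ f : S.whiteCorners Δ ≃ S.whiteCorners Δ', ∀ x : S.whiteCorners Δ, S.CornerRel Δ Δ' x (f x) := by
  induction n using Nat.strong_induction_on with
  | _ n ih =>
    intro Δ hΔ hsub hrep hn
    rcases Nat.eq_zero_or_pos n with rfl | hpos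
    -- Without digons different arcs are not homotopic, so nothing is left to remove.
    · have hw := exists_white_of_ncard_eq_zero hn
      have e : Δ' = Δ := by
        refine hsub.antisymm fun s hs => ?_
        obtain ⟨t, ht, hst⟩ := hrep s hs
        rwa [eq_of_sameArc hS.disjoint hΔ.sys hw hs (hsub ht) hst]
      subst e
      exact ⟨hΔ, hw, Equiv.refl _, fun x => CornerRel.refl hΔ.sys x.1⟩
    · rw [← hn] at hpos
      obtain ⟨q, hq⟩ := Set.nonempty_of_ncard_ne_zero hpos.ne'
      obtain ⟨r, rfl⟩ := comp_surjective q
      obtain ⟨p, p', hdig, -⟩ := hΔ.exists_digon hS (r := r)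
        (fun c hc hcw => hq c hcw (comp_eq_iff.2 hc.symm))
      -- one of the two sides is not in `Δ'`
      have key : ∃ l u u', DigonRemoval S Δ l u u' ∧ l ∉ Δ' := by
        obtain ⟨l, hl, ho, -⟩ := hdig.left.exists_arc
        obtain ⟨l', hl', ho', -⟩ := hdig.right.exists_arc
        have R1 : DigonRemoval S Δ l p p' := ⟨hS, hΔ, hdig, hl, ho⟩
        have R2 : DigonRemoval S Δ l' p' p := ⟨hS, hΔ, hdig.symm hΔ.sys, hl', ho'⟩
        -- The sides belong to different, homotopic arcs, while homotopic members of `Δ'` coincide.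
        by_cases h1 : l ∈ Δ'
        · refine ⟨l', p', p, R2, fun h2 => ?_⟩
          obtain ⟨m, hm, hmo, hsame⟩ := R1.exists_other
          have : m = l' := by
            have hs : ∀ {u v : List D}, (u = v ∨ u = S.revPath v) → S.sides u = S.sides v := by
              rintro u v (rfl | rfl)
              · rfl
              · exact sides_revPath v
            refine hΔ.sys.eq_of_mem_sides hm.1 hl' (d := p'.head R1.path'.ne_nil) ?_ ?_
            · rw [← hs hmo]; exact mem_sides_of_mem (List.head_mem _)
            · rw [← hs ho']; exact mem_sides_of_mem (List.head_mem _)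
          subst this
          exact hm.2 (hinj l h1 m h2 hsame).symm
        · exact ⟨l, p, p', R1, h1⟩
      obtain ⟨l, u, u', R, hlΔ'⟩ := key
      have hlt := R.ncard_white_free_lt
      have hsub' : Δ' ⊆ Δ \ {l} := fun t ht => ⟨hsub ht, fun e => hlΔ' (by
        rwa [Set.mem_singleton_iff.1 e] at ht)⟩
      obtain ⟨h1, h2, g, hg⟩ := ih _ (by omega) (Δ \ {l}) R.isDigonSystem hsub'
        (fun s hs => hrep s hs.1) rfl
      obtain ⟨f, hf⟩ := R.exists_equiv
      exact ⟨h1, h2, f.trans g, fun x => (hf x).trans R.sys' hsub' (hg (f x))⟩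

end MarkedCells

/-! ### Corners of polygons cut off by segments. -/

namespace MarkedCells

open CellSurface

variable {D : Type*} {S : MarkedCells D}

/-- Segments `ε i` of `G`, each of which cuts off a corner of a polygon of `A`. The side `o i` lies
in the region on the inner side of `ε i` (that of the corner), and `c i` in the region on the outer
side. -/
structure CornerSystem (S : MarkedCells D) (A G : Set D) (Y : Set S.Vertex) {ι : Type*}
    (ε : ι → Set D) (o c : ι → D) : Prop where
  opp_A : S.OppClosed A
  opp_G : S.OppClosed G
  opp_ε : ∀ i, S.OppClosed (ε i)
  ε_sub : ∀ i, ε i ⊆ G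
  disjoint : ∀ i j, i ≠ j → Disjoint (ε i) (ε j)
  side : ∀ i, ∃ g ∈ ε i, (S.cut (A ∪ G)).SameComp (o i) g ∧
    (S.cut (A ∪ G)).SameComp (c i) (S.opp g)
  cover : ∀ g ∈ G, (∃ x, (S.cut (A ∪ G)).SameComp g x ∧ S.tail x ∈ S.white) ∨
    ∃ i, g ∈ ε i ∧ (((S.cut (A ∪ G)).SameComp (o i) g ∧
      (S.cut (A ∪ G)).SameComp (c i) (S.opp g)) ∨
        ((S.cut (A ∪ G)).SameComp (c i) g ∧ (S.cut (A ∪ G)).SameComp (o i) (S.opp g)))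
  disjoint_AG : ∀ d ∈ A, d ∉ G
  white_free : ∀ i x, (S.cut (A ∪ ε i)).SameComp (o i) x → S.tail x ∉ S.white
  red : ∀ i, ((S.cut (A ∪ ε i)).tail ''
    {x | (S.cut (A ∪ ε i)).SameComp (o i) x ∧ S.tail x ∈ S.red}).ncard = 1
  polygon : ∀ d, ∃ x, (S.cut A).SameComp d x ∧ S.tail x ∈ S.white
  red_G : ∀ g ∈ G, S.tail g ∉ S.red
  boundary : ∀ b, S.IsBoundarySide b → ∃ x, (S.cut (A ∪ G)).SameComp b x ∧ S.tail x ∈ S.white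
  red_boundary : ∀ v ∈ S.red, S.IsBoundaryVertex v
  inner : ∀ d ∈ A, S.tail d ∈ Y →
    (∃ x, (S.cut (A ∪ G)).SameComp d x ∧ S.tail x ∈ S.white) ∨ ∃ i, d = o i ∨ d = c i

namespace CornerSystem

variable {A G : Set D} {Y : Set S.Vertex} {ι : Type*} {ε : ι → Set D} {o c : ι → D}

theorem opp_AG (h : CornerSystem S A G Y ε o c) : S.OppClosed (A ∪ G) := h.opp_A.union h.opp_G

theorem opp_Aε (h : CornerSystem S A G Y ε o c) (i : ι) : S.OppClosed (A ∪ ε i) :=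
  h.opp_A.union (h.opp_ε i)

theorem mono (h : CornerSystem S A G Y ε o c) (i : ι) {x y : D}
    (hxy : (S.cut (A ∪ G)).SameComp x y) : (S.cut (A ∪ ε i)).SameComp x y :=
  SameComp.cut_mono (h.opp_Aε i) h.opp_AG (Set.union_subset_union_right A (h.ε_sub i)) hxy

theorem mono' (h : CornerSystem S A G Y ε o c) {x y : D}
    (hxy : (S.cut (A ∪ G)).SameComp x y) : (S.cut A).SameComp x y :=
  SameComp.cut_mono h.opp_A h.opp_AG Set.subset_union_left hxy

/-- A closure criterion for the components of a cut surface. -/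
theorem of_closed {E : Set D} (hE : S.OppClosed E) {P : D → Prop}
    (hn : ∀ x, P x ↔ P (S.next x)) (ho : ∀ x, x ∉ E → P x → P (S.opp x)) {a b : D}
    (hab : (S.cut E).SameComp a b) (ha : P a) : P b := by
  refine (SameComp.of_closed (S := S.cut E) hn (fun x hx => ?_) hab).1 ha
  by_cases hxE : x ∈ E
  · rw [cut_opp_of_mem hxE]; exact hx
  · rw [cut_opp_of_notMem hE hxE]; exact ho x hxE hx

theorem next_iff {E : Set D} {a : D} (x : D) :
    (S.cut E).SameComp a x ↔ (S.cut E).SameComp a (S.next x) :=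
  ⟨fun h => h.trans ((S.cut E).sameComp_next x), fun h => h.trans ((S.cut E).sameComp_next x).symm⟩

/-- A segment `ε j` does not separate its two sides when cutting along another segment `ε i`. -/
theorem inner_iff_outer (h : CornerSystem S A G Y ε o c) {i j : ι} (hij : i ≠ j) (z : D) :
    (S.cut (A ∪ ε i)).SameComp z (o j) ↔ (S.cut (A ∪ ε i)).SameComp z (c j) := by
  obtain ⟨g, hg, h1, h2⟩ := h.side j
  have hgn : g ∉ A ∪ ε i := by
    rintro (h' | h')
    · exact h.disjoint_AG g h' (h.ε_sub j hg)
    · exact Set.disjoint_left.1 (h.disjoint i j hij) h' hg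
  have h3 := cut_sameComp_opp (h.opp_Aε i) hgn
  have h4 : (S.cut (A ∪ ε i)).SameComp (o j) (c j) :=
    ((h.mono i h1).trans h3).trans (h.mono i h2).symm
  exact ⟨fun h' => h'.trans h4, fun h' => h'.trans h4.symm⟩

/-- The side of `ε i` on which a side of `ε i` in a white-free region lies. -/
theorem cover_of_white_free (h : CornerSystem S A G Y ε o c) {g : D} (hg : g ∈ G)
    (hw : ∀ x, (S.cut (A ∪ G)).SameComp g x → S.tail x ∉ S.white) :
    ∃ i, g ∈ ε i ∧ (((S.cut (A ∪ G)).SameComp (o i) g ∧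
      (S.cut (A ∪ G)).SameComp (c i) (S.opp g)) ∨
        ((S.cut (A ∪ G)).SameComp (c i) g ∧ (S.cut (A ∪ G)).SameComp (o i) (S.opp g))) :=
  (h.cover g hg).resolve_left fun ⟨x, hx, hxw⟩ => hw x hx hxw

theorem cover_in (h : CornerSystem S A G Y ε o c) {i : ι} {g : D} (hg : g ∈ G)
    (hgi : (S.cut (A ∪ ε i)).SameComp (o i) g) :
    ∃ j, g ∈ ε j ∧ (((S.cut (A ∪ G)).SameComp (o j) g ∧
      (S.cut (A ∪ G)).SameComp (c j) (S.opp g)) ∨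
        ((S.cut (A ∪ G)).SameComp (c j) g ∧ (S.cut (A ∪ G)).SameComp (o j) (S.opp g))) :=
  h.cover_of_white_free hg fun x hx => h.white_free i x (hgi.trans (h.mono i hx))

/-- The outer side of a segment does not belong to the corner that it cuts off. -/
theorem outer_notMem (h : CornerSystem S A G Y ε o c) (i : ι) :
    ¬ (S.cut (A ∪ ε i)).SameComp (o i) (c i) := by
  intro hc
  obtain ⟨x, hx, hxw⟩ := h.polygon (o i)
  refine h.white_free i x ?_ hxw
  -- If crossing `ε i` did not leave the corner, the corner would be closed under everything but
  -- crossing `A`, hence be the whole polygon, including its `∘`-point.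
  refine of_closed h.opp_A (P := fun x => (S.cut (A ∪ ε i)).SameComp (o i) x) next_iff
    (fun x hxA hxi => ?_) hx ((S.cut _).sameComp_refl _)
  by_cases hxε : x ∈ ε i
  · obtain ⟨j, hj, hcase⟩ := h.cover_in (h.ε_sub i hxε) hxi
    have : j = i := by
      by_contra hne
      exact Set.disjoint_left.1 (h.disjoint j i hne) hj hxε
    subst this
    rcases hcase with ⟨-, h2⟩ | ⟨-, h2⟩
    · exact hc.trans (h.mono j h2)
    · exact h.mono j h2
  · exact hxi.trans (cut_sameComp_opp (h.opp_Aε i) (by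
      rintro (h' | h')
      · exact hxA h'
      · exact hxε h'))

/-- Every white-free region lies on the inner side of some segment. -/
theorem exists_inner (h : CornerSystem S A G Y ε o c) {r : D}
    (hr : ∀ x, (S.cut (A ∪ G)).SameComp r x → S.tail x ∉ S.white) :
    ∃ i, (S.cut (A ∪ G)).SameComp (o i) r := by
  by_contra! hcon
  obtain ⟨x, hx, hxw⟩ := h.polygon r
  -- Suppose no inner side borders the region `r`. A walk inside the polygon leaves `r` only by
  -- entering the corner of some `ε i` from its outer side, and it leaves this corner only back into
  -- `r`. So it never reaches the `∘`-point.
  have key : (S.cut (A ∪ G)).SameComp r x ∨ ∃ i, (S.cut (A ∪ G)).SameComp r (c i) ∧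
      (S.cut (A ∪ ε i)).SameComp (o i) x := by
    refine of_closed h.opp_A (P := fun x => (S.cut (A ∪ G)).SameComp r x ∨
      ∃ i, (S.cut (A ∪ G)).SameComp r (c i) ∧ (S.cut (A ∪ ε i)).SameComp (o i) x)
      (fun x => ?_) (fun x hxA hxP => ?_) hx (Or.inl ((S.cut _).sameComp_refl _))
    · exact or_congr (next_iff x) (exists_congr fun i => and_congr_right fun _ => next_iff x)
    · by_cases hxG : x ∈ G
      · rcases hxP with hxr | ⟨i, hi, hxi⟩
        · obtain ⟨j, hj, ⟨h1, -⟩ | ⟨h1, h2⟩⟩ := h.cover_of_white_free hxG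
            (fun y hy => hr y (hxr.trans hy))
          · exact absurd (h1.trans hxr.symm) (hcon j)
          · exact Or.inr ⟨j, hxr.trans h1.symm, h.mono j h2⟩
        · by_cases hxε : x ∈ ε i
          · obtain ⟨j, hj, hcase⟩ := h.cover_in hxG hxi
            have : j = i := by
              by_contra hne
              exact Set.disjoint_left.1 (h.disjoint j i hne) hj hxε
            subst this
            rcases hcase with ⟨-, h2⟩ | ⟨h2, -⟩
            · exact Or.inl (hi.trans h2)
            · exact absurd (hxi.trans (h.mono j h2).symm) (h.outer_notMem j)
          · refine Or.inr ⟨i, hi, hxi.trans (cut_sameComp_opp (h.opp_Aε i) ?_)⟩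
            rintro (h' | h')
            · exact hxA h'
            · exact hxε h'
      · have hxn : x ∉ A ∪ G := by
          rintro (h' | h')
          · exact hxA h'
          · exact hxG h'
        have hxo := cut_sameComp_opp h.opp_AG hxn
        exact hxP.imp (fun h' => h'.trans hxo)
          (fun ⟨i, hi, h'⟩ => ⟨i, hi, h'.trans (h.mono i hxo)⟩)
  rcases key with h' | ⟨i, -, h'⟩
  · exact hr x h' hxw
  · exact h.white_free i x h' hxw

/-- If `ε j` is not met by the corner which `ε i` cuts off, and the corner of `ε j` meets it, then it
contains it. -/
theorem nested (h : CornerSystem S A G Y ε o c) {i j : ι} (hij : i ≠ j)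
    (hn : ¬ (S.cut (A ∪ ε i)).SameComp (o i) (c j)) {z : D}
    (hzi : (S.cut (A ∪ ε i)).SameComp (o i) z) (hzj : (S.cut (A ∪ ε j)).SameComp (o j) z) {x : D}
    (hx : (S.cut (A ∪ ε i)).SameComp (o i) x) : (S.cut (A ∪ ε j)).SameComp (o j) x := by
  have := of_closed (h.opp_Aε i) (P := fun x => (S.cut (A ∪ ε i)).SameComp (o i) x ∧
    (S.cut (A ∪ ε j)).SameComp (o j) x) (fun x => and_congr (next_iff x) (next_iff x))
    (fun x hxn hxP => ?_) (hzi.symm.trans hx) ⟨hzi, hzj⟩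
  · exact this.2
  · refine ⟨hxP.1.trans (cut_sameComp_opp (h.opp_Aε i) hxn), ?_⟩
    refine hxP.2.trans (cut_sameComp_opp (h.opp_Aε j) ?_)
    rintro (h' | h')
    · exact hxn (Or.inl h')
    -- Crossing `ε j` inside the corner of `ε i` would bring the outer side of `ε j` into that
    -- corner.
    · obtain ⟨k, hk, hcase⟩ := h.cover_in (h.ε_sub j h') hxP.1
      have : k = j := by
        by_contra hne
        exact Set.disjoint_left.1 (h.disjoint k j hne) hk h'
      subst this
      rcases hcase with ⟨h1, -⟩ | ⟨h1, -⟩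
      · exact hn ((h.inner_iff_outer hij _).1 (hxP.1.trans (h.mono i h1).symm))
      · exact hn (hxP.1.trans (h.mono i h1).symm)

/-- At a red point, all the cut surfaces have the same corners. -/
theorem tail_eq_of_red (h : CornerSystem S A G Y ε o c) {i : ι} {x y : D}
    (hx : S.tail x ∈ S.red) (hxy : (S.cut (A ∪ ε i)).tail x = (S.cut (A ∪ ε i)).tail y) :
    (S.cut (A ∪ G)).tail x = (S.cut (A ∪ G)).tail y := by
  have key : ∀ x y, EqvGen (S.cut (A ∪ ε i)).Rot x y → S.tail x ∈ S.red →
      (S.cut (A ∪ G)).tail x = (S.cut (A ∪ G)).tail y := by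
    intro x y hxy
    induction hxy with
    | rel a b hab =>
      intro ha
      rw [cut_rot_iff (h.opp_Aε i)] at hab
      refine ((cut_rot_iff h.opp_AG).2 ⟨hab.1, ?_⟩).tail_eq
      rintro (h' | h')
      · exact hab.2 (Or.inl h')
      · exact h.red_G b h' (hab.1.tail_eq ▸ ha)
    | refl a => exact fun _ => rfl
    | symm a b hab ih =>
      intro hb
      refine (ih ?_).symm
      rw [tail_eq_of_cut_tail_eq (h.opp_Aε i) (tail_eq_iff.2 hab)]; exact hb
    | trans a b c' hab _ ih1 ih2 =>
      intro ha
      refine (ih1 ha).trans (ih2 ?_)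
      rw [← tail_eq_of_cut_tail_eq (h.opp_Aε i) (tail_eq_iff.2 hab)]; exact ha
  exact key x y (tail_eq_iff.1 hxy) hx

theorem exists_red (h : CornerSystem S A G Y ε o c) (i : ι) :
    ∃ x, (S.cut (A ∪ ε i)).SameComp (o i) x ∧ S.tail x ∈ S.red := by
  obtain ⟨v, hv⟩ := Set.ncard_eq_one.1 (h.red i)
  have : v ∈ (S.cut (A ∪ ε i)).tail ''
      {x | (S.cut (A ∪ ε i)).SameComp (o i) x ∧ S.tail x ∈ S.red} := by rw [hv]; rfl
  obtain ⟨x, hx, -⟩ := this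
  exact ⟨x, hx⟩

/-- The corner that is cut off contains a single `•`-point, and `G` does not touch it, so further
cuts along `G` do not split it. -/
theorem red_unique (h : CornerSystem S A G Y ε o c) {i : ι} {x y : D}
    (hx : (S.cut (A ∪ ε i)).SameComp (o i) x) (hxr : S.tail x ∈ S.red)
    (hy : (S.cut (A ∪ ε i)).SameComp (o i) y) (hyr : S.tail y ∈ S.red) :
    (S.cut (A ∪ G)).tail x = (S.cut (A ∪ G)).tail y := by
  obtain ⟨v, hv⟩ := Set.ncard_eq_one.1 (h.red i)
  have key : ∀ x, (S.cut (A ∪ ε i)).SameComp (o i) x → S.tail x ∈ S.red →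
      (S.cut (A ∪ ε i)).tail x = v := fun x hx hxr => by
    have : (S.cut (A ∪ ε i)).tail x ∈ (S.cut (A ∪ ε i)).tail ''
      {x | (S.cut (A ∪ ε i)).SameComp (o i) x ∧ S.tail x ∈ S.red} := ⟨x, ⟨hx, hxr⟩, rfl⟩
    rwa [hv] at this
  exact h.tail_eq_of_red hxr ((key x hx hxr).trans (key y hy hyr).symm)

/-- If the outer side of `ε j` is in the region on the inner side of `ε i`, then the corner of `ε j`
is contained in the corner of `ε i`. -/
theorem nested_of_outer (h : CornerSystem S A G Y ε o c) {i j : ι}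
    (hij : (S.cut (A ∪ G)).SameComp (o i) (c j)) {x : D}
    (hx : (S.cut (A ∪ ε j)).SameComp (o j) x) : (S.cut (A ∪ ε i)).SameComp (o i) x := by
  have hne : i ≠ j := by
    rintro rfl
    exact h.outer_notMem i (h.mono i hij)
  have h1 : (S.cut (A ∪ ε i)).SameComp (o i) (o j) := (h.inner_iff_outer hne _).2 (h.mono i hij)
  refine h.nested hne.symm (fun h' => ?_) ((S.cut _).sameComp_refl _) h1 hx
  have h2 := (h.inner_iff_outer hne.symm (o j)).2 h'
  exact h.outer_notMem j (h2.trans (h.mono j hij))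

/-- Besides its inner side, the region on the inner side of a segment has exactly one end. -/
theorem exists_other_end [Finite D] (h : CornerSystem S A G Y ε o c)
    (hinj : ∀ i j, (S.cut (A ∪ G)).SameComp (o i) (o j) → i = j) (i : ι)
    (hc : ∀ j, c j ∈ A ∧ S.tail (c j) ∈ Y)
    (hco : ∀ j k, c j ≠ o k)
    (hoY : ∀ j, S.tail (o j) ∉ S.red)
    (hw : ∀ x, (S.cut (A ∪ G)).SameComp (o i) x → S.tail x ∉ S.white) :
    ∃ d, d ≠ o i ∧ ∀ e, (e ∈ A ∧ (S.tail e ∈ S.red ∨ S.tail e ∈ Y) ∧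
      (S.cut (A ∪ G)).SameComp (o i) e ∧ e ≠ o i) ↔ e = d := by
  -- The inner sides of other segments lie in other regions by `hinj`, so an end on `G` is an outer
  -- side.
  have hcases : ∀ e ∈ A, (S.tail e ∈ S.red ∨ S.tail e ∈ Y) →
      (S.cut (A ∪ G)).SameComp (o i) e → e ≠ o i → S.tail e ∈ S.red ∨ ∃ j, e = c j := by
    rintro e heA (her | hey) hie hne
    · exact Or.inl her
    · rcases h.inner e heA hey with ⟨x, hx, hxw⟩ | ⟨j, rfl | rfl⟩
      · exact absurd hxw (hw x (hie.trans hx))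
      · rw [hinj i j hie] at hne
        exact absurd rfl hne
      · exact Or.inr ⟨j, rfl⟩
  -- Without a further end, the region would be all of the corner cut off by `ε i`, with its
  -- `•`-point. The first side of the fan there cannot be an old boundary side, whose region has a
  -- `∘`-point, nor lie on `G`; so it is a side of `A` and an end after all.
  have hex : ∃ d ∈ A, (S.tail d ∈ S.red ∨ S.tail d ∈ Y) ∧
      (S.cut (A ∪ G)).SameComp (o i) d ∧ d ≠ o i := by
    by_contra! hcon
    obtain ⟨x, hx, hxr⟩ := h.exists_red i
    have hxR : (S.cut (A ∪ G)).SameComp (o i) x := by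
      refine of_closed (h.opp_Aε i) (P := fun x => (S.cut (A ∪ G)).SameComp (o i) x) next_iff
        (fun x hxn hxi => ?_) hx ((S.cut _).sameComp_refl _)
      by_cases hxG : x ∈ G
      · obtain ⟨j, hj, hcase⟩ := h.cover_of_white_free hxG (fun y hy => hw y (hxi.trans hy))
        rcases hcase with ⟨h1, -⟩ | ⟨h1, -⟩
        · rw [← hinj i j (hxi.trans h1.symm)] at hj
          exact absurd (Or.inr hj) hxn
        · exact absurd (hcon (c j) (hc j).1 (Or.inr (hc j).2) (hxi.trans h1.symm)) (hco j i)
      · refine hxi.trans (cut_sameComp_opp h.opp_AG ?_)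
        rintro (h' | h')
        · exact hxn (Or.inl h')
        · exact hxG h'
    obtain ⟨b, hb, e⟩ := h.red_boundary _ hxr
    obtain ⟨d, hd, e'⟩ := exists_cut_boundary_of_tail_eq h.opp_AG (Or.inl hb) e
    have hdR : (S.cut (A ∪ G)).SameComp (o i) d := hxR.trans (sameComp_of_tail_eq e').symm
    have hdr : S.tail d ∈ S.red := by rw [tail_eq_of_cut_tail_eq h.opp_AG e']; exact hxr
    rcases hd with hd | hd | hd
    · obtain ⟨y, hy, hyw⟩ := h.boundary d hd
      exact hw y (hdR.trans hy) hyw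
    · exact hoY i (hcon d hd (Or.inl hdr) hdR ▸ hdr)
    · exact h.red_G d hd hdr
  obtain ⟨d, hdA, hdE, hdR, hdn⟩ := hex
  have red_red : ∀ e e', e ∈ A → e' ∈ A → S.tail e ∈ S.red → S.tail e' ∈ S.red →
      (S.cut (A ∪ G)).SameComp (o i) e → (S.cut (A ∪ G)).SameComp (o i) e' → e = e' := by
    intro e e' he he' her her' hie hie'
    exact boundary_tail_injective (cut_boundary_of_mem (Or.inl he))
      (cut_boundary_of_mem (Or.inl he')) (h.red_unique (h.mono i hie) her (h.mono i hie') her')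
  -- The corner behind an outer side `c j` is contained in that of `ε i`, so both have the same
  -- `•`-point. An end at this point would put the region, and with it `c j`, into the corner of `ε
  -- j`.
  have not_both : ∀ e j, S.tail e ∈ S.red → (S.cut (A ∪ G)).SameComp (o i) e →
      ¬ (S.cut (A ∪ G)).SameComp (o i) (c j) := by
    intro e j her hie hij
    obtain ⟨x, hx, hxr⟩ := h.exists_red j
    have h1 := h.red_unique (h.nested_of_outer hij hx) hxr (h.mono i hie) her
    have h2 : (S.cut (A ∪ ε j)).SameComp (o j) e :=
      hx.trans (h.mono j (sameComp_of_tail_eq h1))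
    exact h.outer_notMem j (h2.trans (h.mono j (hie.symm.trans hij)))
  -- Two such corners would share the `•`-point of the corner of `ε i`. As neither contains the
  -- outer side of the other, one is nested in the other, and then it brings its outer side along: a
  -- contradiction.
  have outer_outer : ∀ j k, (S.cut (A ∪ G)).SameComp (o i) (c j) →
      (S.cut (A ∪ G)).SameComp (o i) (c k) → j = k := by
    intro j k hj hk
    by_contra hjk
    obtain ⟨x, hx, hxr⟩ := h.exists_red j
    obtain ⟨y, hy, hyr⟩ := h.exists_red k
    have h1 := h.red_unique (h.nested_of_outer hj hx) hxr (h.nested_of_outer hk hy) hyr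
    have h2 : (S.cut (A ∪ ε k)).SameComp (o k) x :=
      hy.trans (h.mono k (sameComp_of_tail_eq h1.symm))
    have hn : ∀ {j k : ι}, (S.cut (A ∪ G)).SameComp (o i) (c j) →
        (S.cut (A ∪ G)).SameComp (o i) (c k) → ¬ (S.cut (A ∪ ε j)).SameComp (o j) (c k) := by
      intro j k hj hk h'
      exact h.outer_notMem j (h'.trans (h.mono j (hk.symm.trans hj)))
    have h3 : (S.cut (A ∪ ε k)).SameComp (o k) (o j) :=
      h.nested hjk (hn hj hk) hx h2 ((S.cut _).sameComp_refl _)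
    exact hn hk hj ((h.inner_iff_outer (Ne.symm hjk) (o k)).1 h3)
  refine ⟨d, hdn, fun e => ⟨?_, ?_⟩⟩
  · rintro ⟨heA, heE, heR, hen⟩
    rcases hcases e heA heE heR hen with her | ⟨j, rfl⟩ <;>
      rcases hcases d hdA hdE hdR hdn with hdr | ⟨k, rfl⟩
    · exact red_red e d heA hdA her hdr heR hdR
    · exact absurd hdR (not_both e k her heR)
    · exact absurd heR (not_both d j hdr hdR)
    · rw [outer_outer j k heR hdR]
  · rintro rfl
    exact ⟨hdA, hdE, hdR, hdn⟩

end CornerSystem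

end MarkedCells

/-! ### Pieces of a path, and four sides around a point. -/

theorem List.mem_tail_dropLast_of_ne {α : Type*} {l : List α} {a : α} (h : a ∈ l) (hl : l ≠ [])
    (h1 : a ≠ l.head hl) (h2 : a ≠ l.getLast hl) : a ∈ l.tail.dropLast := by
  have h3 := (List.eq_head_or_mem_tail h hl).resolve_left h1
  have h4 : l.tail ≠ [] := List.ne_nil_of_mem h3
  refine (List.eq_getLast_or_mem_dropLast h3 h4).resolve_left fun h5 => h2 ?_
  rw [h5, List.getLast_tail]

namespace CellSurface

variable {D : Type*} {S : CellSurface D}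

section Pieces

variable {X : Set S.Vertex} {l m : List D}

theorem isInfix_of_mem_pieces (h : m ∈ S.pieces X l) : m <:+: l := by
  obtain ⟨-, -, p, q, e, -⟩ := exists_of_mem_pieces h
  exact ⟨p, q, e.symm⟩

theorem pieces_ne_nil (h : m ∈ S.pieces X l) : m ≠ [] := (exists_of_mem_pieces h).1

theorem pieces_pair (h : m ∈ S.pieces X l) {a b : D} (hab : [a, b] <:+: m) :
    [a, b] <:+: l ∧ S.tail b ∉ X :=
  ⟨hab.trans (isInfix_of_mem_pieces h), (exists_of_mem_pieces h).2.1 b (List.mem_tail_of_pair hab)⟩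

/-- A piece which does not contain the first edge of the path starts in `X`. -/
theorem pieces_exists_prev (h : m ∈ S.pieces X l) (hl : l ≠ []) (hn : l.head hl ∉ m) :
    (∃ a, [a, m.head (pieces_ne_nil h)] <:+: l) ∧ S.tail (m.head (pieces_ne_nil h)) ∈ X := by
  obtain ⟨hm, -, p, q, e, hp, -⟩ := exists_of_mem_pieces h
  rcases p.eq_nil_or_concat with rfl | ⟨p', a, rfl⟩
  · subst e
    exact absurd (by simp [List.head_append_of_ne_nil hm]) hn
  · refine ⟨⟨a, p', m.tail ++ q, ?_⟩, ?_⟩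
    · have : p' ++ [a, m.head hm] ++ (m.tail ++ q) = p' ++ [a] ++ (m.head hm :: m.tail) ++ q := by
        simp only [List.append_assoc, List.cons_append, List.nil_append]
      refine Eq.trans ?_ e.symm
      rw [this, List.cons_head_tail, List.concat_eq_append]
    · exact hp.resolve_left (by simp) _ (List.head?_eq_some_head hm)

/-- A piece which does not contain the last edge of the path ends in `X`. -/
theorem pieces_exists_next (h : m ∈ S.pieces X l) (hl : l ≠ []) (hn : l.getLast hl ∉ m) :
    ∃ b, [m.getLast (pieces_ne_nil h), b] <:+: l ∧ S.tail b ∈ X := by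
  obtain ⟨hm, -, p, q, e, -, hq⟩ := exists_of_mem_pieces h
  cases q with
  | nil =>
    refine absurd ?_ hn
    have : l.getLast hl = m.getLast hm := by simp [e, List.getLast_append_of_ne_nil _ hm]
    rw [this]; exact List.getLast_mem hm
  | cons b q =>
    refine ⟨b, ⟨p ++ m.dropLast, q, ?_⟩, hq b rfl⟩
    conv_rhs => rw [e, ← List.dropLast_concat_getLast hm]
    simp

theorem pieces_eq_head (h : m ∈ S.pieces X l) {b : D} (hb : S.tail b ∈ X) (hbm : b ∈ m) : b = m.head (pieces_ne_nil h) :=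
  (List.eq_head_or_mem_tail hbm _).resolve_right fun h' =>
    (exists_of_mem_pieces h).2.1 b h' hb

theorem pieces_eq_getLast (hl : l.Nodup) (h : m ∈ S.pieces X l) {a b : D} (hab : [a, b] <:+: l)
    (hb : S.tail b ∈ X) (ham : a ∈ m) : a = m.getLast (pieces_ne_nil h) := by
  refine (List.eq_getLast_or_mem_dropLast ham _).resolve_right fun h' => ?_
  obtain ⟨b', hb'⟩ := List.exists_pair_of_mem_dropLast h'
  obtain ⟨h1, h2⟩ := pieces_pair h hb'
  rw [hl.pair_right_unique h1 hab] at h2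
  exact h2 hb

theorem pieces_nodup (hl : l.Nodup) : (S.pieces X l).Nodup := by
  rw [← flatten_pieces X l, List.nodup_flatten] at hl
  refine hl.2.imp_of_mem fun {a b} ha hb hab => ?_
  rintro rfl
  exact hab (List.head_mem (pieces_ne_nil ha)) (List.head_mem (pieces_ne_nil ha))

/-- If there are at least two pieces, then no piece contains both ends. -/
theorem pieces_not_both (hl : l.Nodup) (hne : l ≠ []) (h2 : 2 ≤ (S.pieces X l).length)
    (h : m ∈ S.pieces X l) (h1 : l.head hne ∈ m) : l.getLast hne ∉ m := by
  intro h3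
  have key : ∀ m' ∈ S.pieces X l, m' = m := by
    intro m' hm'
    by_contra hn
    have hd : l.head hne ∉ m' := fun h' => hn (pieces_eq_of_mem hl hm' h h' h1)
    obtain ⟨hm, -, p, q, e, -, -⟩ := exists_of_mem_pieces h
    have hp : p = [] := by
      cases p with
      | nil => rfl
      | cons x p =>
        subst e
        simp only [List.cons_append, List.head_cons] at h1 hl
        have := (List.nodup_cons.1 hl).1
        simp [h1] at this
    have hq : q = [] := by
      rcases q.eq_nil_or_concat with rfl | ⟨q, x, rfl⟩
      · rfl
      · subst e
        have e' : p ++ m ++ q.concat x = p ++ m ++ q ++ [x] := by simp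
        have h4 : (p ++ m ++ q.concat x).getLast hne = x := by simp
        rw [h4] at h3
        rw [e', List.nodup_append] at hl
        exact absurd rfl (hl.2.2 x (by simp [h3]) x (by simp))
    subst hp hq
    simp only [List.nil_append, List.append_nil] at e
    obtain ⟨x, hx⟩ := List.exists_mem_of_ne_nil m' (pieces_ne_nil hm')
    have hx' := (isInfix_of_mem_pieces hm').subset hx
    rw [e] at hx'
    exact hn (pieces_eq_of_mem hl hm' h hx hx')
  have hnd := pieces_nodup (X := X) hl
  rcases hP : S.pieces X l with _ | ⟨x, _ | ⟨y, t⟩⟩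
  · rw [hP] at h2; simp at h2
  · rw [hP] at h2; simp at h2
  · rw [hP] at hnd key
    have e1 := key x (by simp)
    have e2 := key y (by simp)
    rw [e1, e2] at hnd
    simp at hnd

end Pieces

/-- Four sides around an interior point, two of which do not follow each other. -/
theorem nextSide_of_four [Finite D] {E : Set D} (hE : S.OppClosed E)
    (hEb : ∀ d ∈ E, ¬ S.IsBoundarySide d) {g g' b b' : D} (hg : g ∈ E) (hg' : g' ∈ E) (hb : b ∈ E)
    (hb' : b' ∈ E) (hi : ¬ S.IsBoundaryVertex (S.tail g)) (tg : S.tail g' = S.tail g)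
    (tb : S.tail b = S.tail g) (tb' : S.tail b' = S.tail g)
    (ho : ∀ d ∈ E, S.tail d = S.tail g → d = g ∨ d = g' ∨ d = b ∨ d = b')
    (hbg : b ≠ g) (hbg' : b ≠ g') (hbg2 : b' ≠ g) (hbg2' : b' ≠ g') (hgg : g ≠ g') (hbb : b ≠ b')
    (h1 : ¬ S.NextSide E b b') (h2 : ¬ S.NextSide E b' b) :
    (S.NextSide E g b ∧ S.NextSide E b g' ∧ S.NextSide E g' b' ∧ S.NextSide E b' g) ∨
      (S.NextSide E g b' ∧ S.NextSide E b' g' ∧ S.NextSide E g' b ∧ S.NextSide E b g) := by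
  have next : ∀ x ∈ E, S.tail x = S.tail g → ∃ y, S.NextSide E x y ∧
      (y = g ∨ y = g' ∨ y = b ∨ y = b') := by
    intro x hx e
    obtain ⟨y, hy⟩ := exists_nextSide hE hx (by rw [e]; exact hi)
    exact ⟨y, hy, ho y hy.1 ((hy.tail_eq hE hEb).trans e)⟩
  -- The sides at the vertex form one cycle under succession, so there are no smaller closed sets of
  -- one or two sides. As `b` and `b'` are not adjacent in the 4-cycle, they alternate with `g` and
  -- `g'`.
  have closed : ∀ P : Set D, P ⊆ E → (∀ d ∈ P, ∃ e ∈ P, S.NextSide E d e) → ∀ d ∈ P,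
      S.tail d = S.tail g → ∀ e ∈ E, S.tail e = S.tail g → e ∈ P := by
    intro P hPE hP d hd e1 e he e2
    refine mem_of_nextSide_closed hE hPE (fun x hx y hy => ?_) hd (by rw [e1]; exact hi) he
      (e1.trans e2.symm)
    obtain ⟨z, hz, hxz⟩ := hP x hx
    rwa [hy.right_unique hE hxz]
  have self : ∀ x ∈ E, S.tail x = S.tail g → ¬ S.NextSide E x x := by
    intro x hx e hxx
    have := closed {x} (by simpa using hx) (by rintro _ rfl; exact ⟨_, rfl, hxx⟩) x rfl e
    have a1 : g = x := this g hg rfl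
    have a2 : g' = x := this g' hg' tg
    exact hgg (a1.trans a2.symm)
  have two : ∀ x ∈ E, ∀ y ∈ E, S.tail x = S.tail g → S.NextSide E x y →
      S.NextSide E y x → ∀ e ∈ E, S.tail e = S.tail g → e = x ∨ e = y := by
    intro x hx y hy e hxy hyx
    have := closed {x, y} (by rintro _ (rfl | rfl) <;> assumption)
      (by rintro _ (rfl | rfl); exacts [⟨_, Or.inr rfl, hxy⟩, ⟨_, Or.inl rfl, hyx⟩]) x (Or.inl rfl) e
    exact this
  have inj : ∀ {x x' y : D}, x ∈ E → x' ∈ E → S.NextSide E x y → S.NextSide E x' y → x = x' :=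
    fun hx hx' h h' => NextSide.left_unique hx hx' h h'
  obtain ⟨y, hy, hy4⟩ := next b hb tb
  obtain ⟨y', hy', hy4'⟩ := next b' hb' tb'
  obtain ⟨z, hz, hz4⟩ := next g hg rfl
  obtain ⟨z', hz', hz4'⟩ := next g' hg' tg
  rcases hy4 with rfl | rfl | rfl | rfl
  · right
    rcases hy4' with rfl | rfl | rfl | rfl
    · exact absurd (inj hb hb' hy hy') hbb
    · rcases hz4' with rfl | rfl | rfl | rfl
      · exact absurd (inj hg' hb hz' hy).symm hbg'
      · exact absurd hz' (self _ hg' tg)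
      · rcases hz4 with rfl | rfl | rfl | rfl
        · exact absurd hz (self _ hg rfl)
        · exact absurd (inj hg hb' hz hy').symm hbg2
        · exact absurd (inj hg hg' hz hz') hgg
        · exact ⟨hz, hy', hz', hy⟩
      · rcases two _ hg' _ hb' tg hz' hy' _ hb tb with h | h
        · exact absurd h hbg'
        · exact absurd h hbb
    · exact absurd hy' h2
    · exact absurd hy' (self _ hb' tb')
  · left
    rcases hy4' with rfl | rfl | rfl | rfl
    · rcases hz4 with rfl | rfl | rfl | rfl
      · exact absurd hz (self _ hg rfl)
      · exact absurd (inj hg hb hz hy).symm hbg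
      · rcases hz4' with rfl | rfl | rfl | rfl
        · exact absurd (inj hg' hb' hz' hy').symm hbg2'
        · exact absurd hz' (self _ hg' tg)
        · exact absurd (inj hg hg' hz hz') hgg
        · exact ⟨hz, hy, hz', hy'⟩
      · rcases two _ hg _ hb' rfl hz hy' _ hb tb with h | h
        · exact absurd h hbg
        · exact absurd h hbb
    · exact absurd (inj hb hb' hy hy') hbb
    · exact absurd hy' h2
    · exact absurd hy' (self _ hb' tb')
  · exact absurd hy (self _ hb tb)
  · exact absurd hy h1

end CellSurface

namespace CellSurface

variable {D : Type*} {S : CellSurface D}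

theorem cut_cut {E F : Set D} (hE : S.OppClosed E) (hF : S.OppClosed F) :
    (S.cut E).cut F = S.cut (F ∪ E) := by
  have h : ((S.cut E).cut F).opp = (S.cut (F ∪ E)).opp := by
    have hF' : (S.cut E).OppClosed F := fun d hd => by
      by_cases h : d ∈ E
      · rwa [cut_opp_of_mem h]
      · rw [cut_opp_of_notMem hE h]; exact hF d hd
    funext d
    by_cases h1 : d ∈ F
    · rw [cut_opp_of_mem h1, cut_opp_of_mem (E := F ∪ E) (Or.inl h1)]
    · rw [cut_opp_of_notMem hF' h1]
      by_cases h2 : d ∈ E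
      · rw [cut_opp_of_mem h2, cut_opp_of_mem (E := F ∪ E) (Or.inr h2)]
      · rw [cut_opp_of_notMem hE h2, cut_opp_of_notMem (hF.union hE)
          (fun h => h.elim h1 h2)]
  have key : ∀ T T' : CellSurface D, T.next = T'.next → T.opp = T'.opp → T = T' := by
    rintro ⟨n, o, _⟩ ⟨n', o', _⟩ h h'
    cases h; cases h'; rfl
  exact key _ _ rfl h

end CellSurface

/-! ### Crossings of the `∘`-arc with the coordinate. -/

namespace MarkedCells

open CellSurface

variable {D : Type*} {S : MarkedCells D} {γ : List D} {Δ : Set (List D)}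

/-- The surface cut along the arcs of `Δ` and along `γ`. -/
noncomputable abbrev regions (S : MarkedCells D) (Δ : Set (List D)) (γ : List D) : CellSurface D :=
  S.cut (S.arcSides Δ ∪ S.sides γ)

theorem oppClosed_union (Δ : Set (List D)) (γ : List D) :
    S.OppClosed (S.arcSides Δ ∪ S.sides γ) :=
  (S.oppClosed_arcSides Δ).union (S.oppClosed_sides γ)

/-- The two successive edges `a` and `b` of `γ` meet an arc of `Δ`, whose edges at the common point
are `L` on the left of `γ` and `R` on the right. -/
structure IsCrossing (S : MarkedCells D) (Δ : Set (List D)) (γ : List D) (a b L R : D) : Prop where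
  pair : [a, b] <:+: γ
  left_mem : L ∈ S.arcSides Δ
  right_mem : R ∈ S.arcSides Δ
  left_tail : S.tail L = S.tail b
  right_tail : S.tail R = S.tail b
  ne : L ≠ R
  eq_or : ∀ d ∈ S.arcSides Δ, S.tail d = S.tail b → d = L ∨ d = R
  arc : ∀ l ∈ Δ, L ∈ S.sides l → R ∈ S.sides l
  head_opp_left : (S.regions Δ γ).head (S.opp L) = (S.regions Δ γ).tail b
  head_left : (S.regions Δ γ).head a = (S.regions Δ γ).tail L
  head_opp_right : (S.regions Δ γ).head (S.opp R) = (S.regions Δ γ).tail (S.opp a)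
  head_right : (S.regions Δ γ).head (S.opp b) = (S.regions Δ γ).tail R

namespace CrossingData

theorem not_boundary (h : CrossingData S Δ γ) :
    ∀ d ∈ S.arcSides Δ ∪ S.sides γ, ¬ S.IsBoundarySide d := by
  rintro d (hd | hd | hd)
  · exact h.sys.not_boundary d hd
  · exact h.path.interior d hd
  · rw [← isBoundarySide_opp]; exact h.path.interior _ hd

theorem inner_of_pair {a b : D} (hab : [a, b] <:+: γ) : S.tail b ∈ S.inner γ :=
  ⟨b, List.mem_tail_of_pair hab, rfl⟩

/-- Away from the crossings no arc touches the vertex, so consecutive edges of `γ` still meet on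
either side after the cut along `Δ`. -/
theorem cut_pair [Finite D] (h : CrossingData S Δ γ) {a b : D} (hab : [a, b] <:+: γ)
    (hb : S.tail b ∉ S.arcInner Δ) :
    (S.regions Δ γ).head a = (S.regions Δ γ).tail b ∧
      (S.regions Δ γ).head (S.opp b) = (S.regions Δ γ).tail (S.opp a) := by
  obtain ⟨h1, h2⟩ := h.path.cut_pair white_marked hab
  have ha : a ∈ γ := hab.subset (by simp)
  have hb' : b ∈ γ := hab.subset (by simp)
  have hno : ∀ g ∈ S.arcSides Δ, S.tail g ≠ S.tail b := by
    intro g hg e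
    rcases h.sys.tail_mem hg with h' | h'
    · rw [e] at h'
      exact (h.path.inner_interior _ (inner_of_pair hab)).1 (Or.inr h')
    · rw [e] at h'; exact hb h'
  have hA : (S.cut (S.sides γ)).OppClosed (S.arcSides Δ) := fun d hd => by
    rw [cut_opp_of_notMem (S.oppClosed_sides γ) (h.disjoint hd)]
    exact S.oppClosed_arcSides Δ d hd
  have key : ∀ x y, S.tail x = S.tail b → (S.cut (S.sides γ)).tail x = (S.cut (S.sides γ)).tail y →
      (S.regions Δ γ).tail x = (S.regions Δ γ).tail y := by
    intro x y hx hxy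
    have := cut_tail_eq_of_forall (S := S.cut (S.sides γ)) hA (a := x) (b := y) (fun g hg e =>
      hno g hg ((tail_eq_of_cut_tail_eq (S.oppClosed_sides γ) e).trans hx)) hxy
    rwa [cut_cut (S.oppClosed_sides γ) (S.oppClosed_arcSides Δ)] at this
  exact ⟨key _ _ (h.path.pair_head hab) h1, key _ _ (head_opp (h.path.interior b hb')) h2⟩

/-- Around a crossing point there are exactly four sides, two of `γ` and two of one arc.
Transversality puts those of the arc on different sides of `γ`, so the four alternate, and the
cyclic order tells which is on the left. -/
theorem exists_crossing [Finite D] (h : CrossingData S Δ γ) {a b : D} (hab : [a, b] <:+: γ)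
    (hb : S.tail b ∈ S.arcInner Δ) : ∃ L R, S.IsCrossing Δ γ a b L R := by
  obtain ⟨l, hl, a', b', hab', e⟩ := h.sys.exists_pair hb
  have ha : a ∈ γ := hab.subset (by simp)
  have hbγ : b ∈ γ := hab.subset (by simp)
  have ha' : a' ∈ l := hab'.subset (by simp)
  have hb' : b' ∈ l := hab'.subset (by simp)
  have hE := S.oppClosed_union Δ γ
  have haA : a' ∈ S.arcSides Δ := ⟨l, hl, mem_sides_of_mem ha'⟩
  have hoA : S.opp a' ∈ S.arcSides Δ := ⟨l, hl, opp_mem_sides_of_mem ha'⟩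
  have hbA : b' ∈ S.arcSides Δ := ⟨l, hl, mem_sides_of_mem hb'⟩
  have hbG : b ∈ S.sides γ := mem_sides_of_mem hbγ
  have haG : S.opp a ∈ S.sides γ := opp_mem_sides_of_mem ha
  have ta : S.tail (S.opp a) = S.tail b :=
    (tail_opp (h.path.interior a ha)).trans (h.path.pair_head hab)
  have ta' : S.tail (S.opp a') = S.tail b :=
    ((tail_opp ((h.sys.path l hl).interior a' ha')).trans ((h.sys.path l hl).pair_head hab')).trans e
  have ntr := (h.transverse l hl).2 a' b' hab' (by rw [e]; exact inner_of_pair hab)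
  have hA : ∀ d ∈ S.arcSides Δ, S.tail d = S.tail b → d = b' ∨ d = S.opp a' := fun d hd ht =>
    (h.sys.side_inner_iff red_marked hl hab' hd).1 (ht.trans e.symm)
  have mono : ∀ {x y : D}, (S.regions Δ γ).tail x = (S.regions Δ γ).tail y →
      (S.cut (S.sides γ)).tail x = (S.cut (S.sides γ)).tail y := fun hxy =>
    cut_tail_eq_mono hE (S.oppClosed_sides γ) Set.subset_union_right hxy
  have hoppA : ∀ d ∈ S.arcSides Δ, (S.cut (S.sides γ)).head (S.opp d) =
      (S.cut (S.sides γ)).tail d := by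
    intro d hd
    have := head_opp (S := S.cut (S.sides γ)) (d := d) (fun hb => by
      rcases (cut_isBoundarySide (S.oppClosed_sides γ)).1 hb with h' | h'
      · exact h.sys.not_boundary d hd h'
      · exact h.disjoint hd h')
    rwa [cut_opp_of_notMem (S.oppClosed_sides γ) (h.disjoint hd)] at this
  -- A side of an arc that directly follows `x` is on the same side of `γ` as `x`; for the two sides
  -- of the crossing arc this contradicts transversality.
  have notnext : ∀ x y, S.NextSide (S.arcSides Δ ∪ S.sides γ) x y → y ∈ S.arcSides Δ →
      (S.cut (S.sides γ)).tail y = (S.cut (S.sides γ)).tail x := fun x y hxy hy =>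
    (hoppA y hy).symm.trans (mono hxy.2)
  have four := nextSide_of_four hE h.not_boundary (g := b) (g' := S.opp a) (b := b')
    (b' := S.opp a') (Or.inr hbG) (Or.inr haG) (Or.inl hbA) (Or.inl hoA)
    (h.path.inner_interior _ (inner_of_pair hab)).2 ta e ta'
    (by
      rintro d (hd | hd) ht
      · exact Or.inr (Or.inr (hA d hd ht))
      · rcases (h.path.side_inner_iff white_marked hab hd).1 ht with h' | h'
        · exact Or.inl h'
        · exact Or.inr (Or.inl h'))
    (fun e => h.disjoint hbA (e ▸ hbG)) (fun e => h.disjoint hbA (e ▸ haG))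
    (fun e => h.disjoint hoA (e ▸ hbG)) (fun e => h.disjoint hoA (e ▸ haG))
    (h.path.opp_ne ha hbγ).symm (h.sys.pair_opp_ne hl hab')
    (fun hn => ntr (notnext _ _ hn hoA).symm) (fun hn => ntr (notnext _ _ hn hbA))
  have arcs : ∀ {x y : D}, x ∈ S.sides l → y ∈ S.sides l → ∀ l' ∈ Δ, x ∈ S.sides l' →
      y ∈ S.sides l' := fun hx hy l' hl' hx' => h.sys.eq_of_mem_sides hl hl' hx hx' ▸ hy
  rcases four with ⟨h1, h2, h3, h4⟩ | ⟨h1, h2, h3, h4⟩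
  · refine ⟨b', S.opp a', hab, hbA, hoA, e, ta', h.sys.pair_opp_ne hl hab', hA,
      arcs (mem_sides_of_mem hb') (opp_mem_sides_of_mem ha'), h1.2, ?_, h3.2, h4.2⟩
    have := h2.2
    rwa [S.opp_opp] at this
  · refine ⟨S.opp a', b', hab, hoA, hbA, ta', e, (h.sys.pair_opp_ne hl hab').symm,
      fun d hd ht => (hA d hd ht).symm, arcs (opp_mem_sides_of_mem ha') (mem_sides_of_mem hb'),
      h1.2, ?_, h3.2, h4.2⟩
    have := h2.2
    rwa [S.opp_opp] at this

end CrossingData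

end MarkedCells

namespace CellSurface

variable {D : Type*} {S : CellSurface D} {X : Set S.Vertex} {l m : List D}

/-- A piece which contains neither end of the path is neither the first nor the last piece. -/
theorem mem_tail_dropLast_pieces (h : m ∈ S.pieces X l) (h1 : ∀ d ∈ l.head?, d ∉ m)
    (h2 : ∀ d ∈ l.getLast?, d ∉ m) : m ∈ (S.pieces X l).tail.dropLast := by
  have hne : S.pieces X l ≠ [] := List.ne_nil_of_mem h
  have hf := flatten_pieces X l
  refine List.mem_tail_dropLast_of_ne h hne ?_ ?_
  · rintro e
    have hm := pieces_ne_nil h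
    rw [← List.cons_head_tail hne, ← e, List.flatten_cons] at hf
    refine h1 (m.head hm) ?_ (List.head_mem hm)
    rw [← hf, List.head?_append_of_ne_nil _ hm, List.head?_eq_some_head hm]
    rfl
  · rintro e
    have hm := pieces_ne_nil h
    rw [← List.dropLast_concat_getLast hne, ← e, List.flatten_append, List.flatten_singleton] at hf
    refine h2 (m.getLast hm) ?_ (List.getLast_mem hm)
    rw [← hf, List.getLast?_append_of_ne_nil _ hm, List.getLast?_eq_some_getLast hm]
    rfl

end CellSurface

/-! ### Segments of the `∘`-arc between two crossings. -/

namespace MarkedCells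

open CellSurface

variable {D : Type*} {S : MarkedCells D} {γ : List D} {Δ : Set (List D)}

/-- The segments of `γ` between two successive crossings with `Δ`. -/
def middle (S : MarkedCells D) (Δ : Set (List D)) (γ : List D) : Set (List D) :=
  {m | m ∈ S.pieces (S.arcInner Δ) γ ∧ (∀ d ∈ γ.head?, d ∉ m) ∧ ∀ d ∈ γ.getLast?, d ∉ m}

/-- A simple coordinate on a marked surface and a zigzag arc. -/
structure ZigzagData (S : MarkedCells D) (Δ : Set (List D)) (γ : List D) : Prop where
  marked : S.IsMarkedSurface
  coord : S.IsSimpleCoordinate Δ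
  path : S.IsPath S.white γ
  zigzag : S.IsZigzag Δ γ

theorem ZigzagData.crossing (h : ZigzagData S Δ γ) : CrossingData S Δ γ where
  sys := h.coord.pathSystem
  path := h.path
  transverse := h.zigzag.1
  white_red := h.marked.disjoint

namespace IsCrossing

variable {a b L R a' b' L' R' : D}

theorem eq_of_tail_eq (hγ : S.IsPath S.white γ) (h : S.IsCrossing Δ γ a b L R)
    (h' : S.IsCrossing Δ γ a' b' L' R') (e : S.tail b = S.tail b') :
    a = a' ∧ b = b' ∧ L = L' ∧ R = R' := by
  have hb : b = b' := hγ.tail_unique (List.mem_tail_of_pair h.pair) (List.mem_tail_of_pair h'.pair) e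
  subst hb
  have ha := (hγ.nodup white_marked).pair_left_unique h.pair h'.pair
  subst ha
  refine ⟨rfl, rfl, ?_, ?_⟩
  · exact boundary_tail_injective (cut_boundary_of_mem (Or.inl h.left_mem))
      (cut_boundary_of_mem (Or.inl h'.left_mem)) (h.head_left.symm.trans h'.head_left)
  · exact boundary_tail_injective (cut_boundary_of_mem (Or.inl h.right_mem))
      (cut_boundary_of_mem (Or.inl h'.right_mem)) (h.head_right.symm.trans h'.head_right)

/-- A side of an arc determines its crossing by its starting point, and there the left and the right
side differ. -/
theorem left_ne_right (hγ : S.IsPath S.white γ) (h : S.IsCrossing Δ γ a b L R)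
    (h' : S.IsCrossing Δ γ a' b' L' R') : L ≠ R' := by
  rintro e
  have ht : S.tail b = S.tail b' := by rw [← h.left_tail, ← h'.right_tail, e]
  exact h'.ne ((h.eq_of_tail_eq hγ h' ht).2.2.1 ▸ e)

theorem inner_mem (h : S.IsCrossing Δ γ a b L R) : S.tail b ∈ S.inner γ :=
  ⟨b, List.mem_tail_of_pair h.pair, rfl⟩

end IsCrossing

/-- The segment `m` of `γ` between two successive crossings. -/
structure IsSlice (S : MarkedCells D) (Δ : Set (List D)) (γ m : List D)
    (a b L R a' b' L' R' : D) : Prop where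
  piece : m ∈ S.pieces (S.arcInner Δ) γ
  first : S.IsCrossing Δ γ a b L R
  last : S.IsCrossing Δ γ a' b' L' R'
  head_mem : b ∈ m
  last_mem : a' ∈ m

namespace CrossingData

theorem mem_arcInner (h : CrossingData S Δ γ) {a b L R : D} (hc : S.IsCrossing Δ γ a b L R) :
    S.tail b ∈ S.arcInner Δ := by
  have := h.sys.tail_mem hc.left_mem
  rw [hc.left_tail] at this
  exact this.resolve_left fun h' => (h.path.inner_interior _ hc.inner_mem).1 (Or.inr h')

variable [Finite D] {m : List D}

/-- No arc is met inside a piece, so all of its left sides lie in one region and all of its right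
sides in one region. -/
theorem piece_sameComp (h : CrossingData S Δ γ) (hm : m ∈ S.pieces (S.arcInner Δ) γ) {g g' : D}
    (hg : g ∈ m) (hg' : g' ∈ m) :
    (S.regions Δ γ).SameComp g g' ∧ (S.regions Δ γ).SameComp (S.opp g) (S.opp g') := by
  have hchain : m.IsChain fun d d' => (S.regions Δ γ).SameComp d d' ∧
      (S.regions Δ γ).SameComp (S.opp d) (S.opp d') := by
    rw [List.isChain_iff_forall_rel_of_append_cons_cons]
    intro x y l₁ l₂ e
    obtain ⟨h1, h2⟩ := pieces_pair hm (a := x) (b := y) ⟨l₁, l₂, by simp [e]⟩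
    obtain ⟨h3, h4⟩ := h.cut_pair h1 h2
    exact ⟨(sameComp_of_tail_eq_head h3.symm).symm, sameComp_of_tail_eq_head h4.symm⟩
  exact List.IsChain.forall_of_equivalence (r := fun d d' => (S.regions Δ γ).SameComp d d' ∧
      (S.regions Δ γ).SameComp (S.opp d) (S.opp d'))
    ⟨fun x => ⟨sameComp_refl _ _, sameComp_refl _ _⟩, fun h => ⟨h.1.symm, h.2.symm⟩,
      fun h h' => ⟨h.1.trans h'.1, h.2.trans h'.2⟩⟩ hchain hg hg'

/-- A piece that is not between two crossings contains the first or the last edge of `γ`, whose end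
point is a `∘`-point of the regions on both sides. -/
theorem exists_white_of_notMem_middle (h : CrossingData S Δ γ)
    (hm : m ∈ S.pieces (S.arcInner Δ) γ) (hn : m ∉ S.middle Δ γ) {g : D} (hg : g ∈ m) :
    (∃ x, (S.regions Δ γ).SameComp g x ∧ S.tail x ∈ S.white) ∧
      ∃ x, (S.regions Δ γ).SameComp (S.opp g) x ∧ S.tail x ∈ S.white := by
  by_cases h1 : γ.head h.path.ne_nil ∈ m
  · obtain ⟨h3, h4⟩ := h.piece_sameComp hm hg h1
    refine ⟨⟨_, h3, h.path.head_mem⟩, ⟨_, h4.trans ((S.regions Δ γ).sameComp_next _), ?_⟩⟩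
    have := head_opp (h.path.interior _ (List.head_mem h.path.ne_nil))
    change S.head _ ∈ _
    rw [this]
    exact h.path.head_mem
  by_cases h2 : γ.getLast h.path.ne_nil ∈ m
  · obtain ⟨h3, h4⟩ := h.piece_sameComp hm hg h2
    refine ⟨⟨_, h3.trans ((S.regions Δ γ).sameComp_next _), h.path.last_mem⟩, ⟨_, h4, ?_⟩⟩
    rw [tail_opp (h.path.interior _ (List.getLast_mem h.path.ne_nil))]
    exact h.path.last_mem
  · refine absurd ⟨hm, fun d hd => ?_, fun d hd => ?_⟩ hn
    · rw [List.head?_eq_some_head h.path.ne_nil, Option.mem_some_iff] at hd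
      exact hd ▸ h1
    · rw [List.getLast?_eq_some_getLast h.path.ne_nil, Option.mem_some_iff] at hd
      exact hd ▸ h2

theorem exists_slice (h : CrossingData S Δ γ) (hm : m ∈ S.middle Δ γ) :
    ∃ a b L R a' b' L' R', S.IsSlice Δ γ m a b L R a' b' L' R' := by
  obtain ⟨hp, h1, h2⟩ := hm
  obtain ⟨⟨a, ha⟩, hb⟩ := pieces_exists_prev hp h.path.ne_nil
    (h1 _ (List.head?_eq_some_head h.path.ne_nil))
  obtain ⟨b', hb', hbX⟩ := pieces_exists_next hp h.path.ne_nil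
    (h2 _ (List.getLast?_eq_some_getLast h.path.ne_nil))
  obtain ⟨L, R, hc⟩ := h.exists_crossing ha hb
  obtain ⟨L', R', hc'⟩ := h.exists_crossing hb' hbX
  exact ⟨_, _, _, _, _, _, _, _, hp, hc, hc', List.head_mem _, List.getLast_mem _⟩

end CrossingData

namespace IsSlice

variable {m : List D} {a b L R a' b' L' R' : D}

theorem unique (h : CrossingData S Δ γ) (hs : S.IsSlice Δ γ m a b L R a' b' L' R')
    {a₁ b₁ L₁ R₁ a₁' b₁' L₁' R₁' : D} (hs' : S.IsSlice Δ γ m a₁ b₁ L₁ R₁ a₁' b₁' L₁' R₁') :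
    (a = a₁ ∧ b = b₁ ∧ L = L₁ ∧ R = R₁) ∧ a' = a₁' ∧ b' = b₁' ∧ L' = L₁' ∧ R' = R₁' := by
  have hnd := h.path.nodup white_marked
  have e1 : b = b₁ := (pieces_eq_head hs.piece (h.mem_arcInner hs.first) hs.head_mem).trans
    (pieces_eq_head hs'.piece (h.mem_arcInner hs'.first) hs'.head_mem).symm
  have e2 : a' = a₁' := (pieces_eq_getLast hnd hs.piece hs.last.pair (h.mem_arcInner hs.last)
    hs.last_mem).trans (pieces_eq_getLast hnd hs'.piece hs'.last.pair (h.mem_arcInner hs'.last)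
      hs'.last_mem).symm
  have e3 : b' = b₁' := hnd.pair_right_unique hs.last.pair (e2 ▸ hs'.last.pair)
  exact ⟨hs.first.eq_of_tail_eq h.path hs'.first (by rw [e1]),
    hs.last.eq_of_tail_eq h.path hs'.last (by rw [e3])⟩

variable [Finite D]

theorem left_sameComp (h : CrossingData S Δ γ) (hs : S.IsSlice Δ γ m a b L R a' b' L' R') {g : D}
    (hg : g ∈ m) : (S.regions Δ γ).SameComp L' g :=
  (sameComp_of_tail_eq_head hs.last.head_left.symm).trans
    (h.piece_sameComp hs.piece hs.last_mem hg).1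

theorem right_sameComp (h : CrossingData S Δ γ) (hs : S.IsSlice Δ γ m a b L R a' b' L' R') {g : D}
    (hg : g ∈ m) : (S.regions Δ γ).SameComp R (S.opp g) :=
  (sameComp_of_tail_eq_head hs.first.head_right.symm).trans
    (h.piece_sameComp hs.piece hs.head_mem hg).2

end IsSlice

namespace ZigzagData

variable [Finite D]

/-- The sides of a crossing are those of a segment between two crossings, or they lie in the region
of a `∘`-point. -/
theorem crossing_left (h : ZigzagData S Δ γ) {a b L R : D} (hc : S.IsCrossing Δ γ a b L R) :
    (∃ m ∈ S.pieces (S.arcInner Δ) γ, m ∉ S.middle Δ γ ∧ a ∈ m) ∨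
      ∃ m ∈ S.middle Δ γ, ∃ a₁ b₁ L₁ R₁, S.IsSlice Δ γ m a₁ b₁ L₁ R₁ a b L R := by
  obtain ⟨m, hm, ha⟩ := exists_piece_of_mem (X := S.arcInner Δ)
    (hc.pair.subset (show a ∈ [a, b] by simp))
  by_cases hmid : m ∈ S.middle Δ γ
  · obtain ⟨a₁, b₁, L₁, R₁, a₂, b₂, L₂, R₂, hs⟩ := h.crossing.exists_slice hmid
    have hnd := h.path.nodup white_marked
    have e : a = a₂ := (pieces_eq_getLast hnd hm hc.pair (h.crossing.mem_arcInner hc) ha).trans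
      (pieces_eq_getLast hnd hm hs.last.pair (h.crossing.mem_arcInner hs.last) hs.last_mem).symm
    subst e
    have e := hnd.pair_right_unique hc.pair hs.last.pair
    subst e
    obtain ⟨-, -, rfl, rfl⟩ := hc.eq_of_tail_eq h.path hs.last rfl
    exact Or.inr ⟨m, hmid, _, _, _, _, hs⟩
  · exact Or.inl ⟨m, hm, hmid, ha⟩

theorem crossing_right (h : ZigzagData S Δ γ) {a b L R : D} (hc : S.IsCrossing Δ γ a b L R) :
    (∃ m ∈ S.pieces (S.arcInner Δ) γ, m ∉ S.middle Δ γ ∧ b ∈ m) ∨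
      ∃ m ∈ S.middle Δ γ, ∃ a₁ b₁ L₁ R₁, S.IsSlice Δ γ m a b L R a₁ b₁ L₁ R₁ := by
  obtain ⟨m, hm, ha⟩ := exists_piece_of_mem (X := S.arcInner Δ)
    (hc.pair.subset (show b ∈ [a, b] by simp))
  by_cases hmid : m ∈ S.middle Δ γ
  · obtain ⟨a₁, b₁, L₁, R₁, a₂, b₂, L₂, R₂, hs⟩ := h.crossing.exists_slice hmid
    have e : b = b₁ := (pieces_eq_head hm (h.crossing.mem_arcInner hc) ha).trans
      (pieces_eq_head hm (h.crossing.mem_arcInner hs.first) hs.head_mem).symm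
    subst e
    obtain ⟨rfl, -, rfl, rfl⟩ := hc.eq_of_tail_eq h.path hs.first rfl
    exact Or.inr ⟨m, hmid, _, _, _, _, hs⟩
  · exact Or.inl ⟨m, hm, hmid, ha⟩

/-- Along a segment between two crossings, the region on the left has a corner at the left side of
the last crossing, and the region on the right has one at the right side of the first. These two
sides serve as `o` and `c`, in the order determined by the side on which the corner is cut off. -/
theorem exists_cornerSystem (h : ZigzagData S Δ γ) : ∃ o c : S.middle Δ γ → D,
    CornerSystem S (S.arcSides Δ) (S.sides γ) (S.inner γ) (fun m => S.sides m.1) o c ∧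
    ∀ i, ∃ a b L R a' b' L' R', S.IsSlice Δ γ i.1 a b L R a' b' L' R' ∧
      ((o i = L' ∧ c i = R) ∨ (o i = R ∧ c i = L')) := by
  have hc := h.crossing
  have hnd := h.path.nodup white_marked
  have key : ∀ i : S.middle Δ γ, ∃ o c a b L R a' b' L' R',
      S.IsSlice Δ γ i.1 a b L R a' b' L' R' ∧ ((o = L' ∧ c = R) ∨ (o = R ∧ c = L')) ∧
      ∃ d ∈ S.sides i.1, (S.regions Δ γ).SameComp o d ∧
        (∀ c, (S.cut (S.arcSides Δ ∪ S.sides i.1)).SameComp d c → S.tail c ∉ S.white) ∧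
        ((S.cut (S.arcSides Δ ∪ S.sides i.1)).tail ''
          {c | (S.cut (S.arcSides Δ ∪ S.sides i.1)).SameComp d c ∧ S.tail c ∈ S.red}).ncard = 1 := by
    intro i
    obtain ⟨a, b, L, R, a', b', L', R', hs⟩ := hc.exists_slice i.2
    obtain ⟨d, hd, h1, h2⟩ := h.zigzag.2.2 i.1 (mem_tail_dropLast_pieces i.2.1 i.2.2.1 i.2.2.2)
    -- The side given by the zigzag condition is directed like `γ`, or against it; accordingly the
    -- cut-off corner is on the left or on the right.
    rcases hd with hd | hd
    · exact ⟨L', R, _, _, _, _, _, _, _, _, hs, Or.inl ⟨rfl, rfl⟩, d, Or.inl hd,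
        hs.left_sameComp hc hd, h1, h2⟩
    · refine ⟨R, L', _, _, _, _, _, _, _, _, hs, Or.inr ⟨rfl, rfl⟩, d, Or.inr hd, ?_, h1, h2⟩
      have := hs.right_sameComp hc hd
      rwa [S.opp_opp] at this
  choose o c key using key
  have hsub : ∀ m ∈ S.pieces (S.arcInner Δ) γ, S.sides m ⊆ S.sides γ := by
    rintro m hm d (hd | hd)
    · exact Or.inl ((isInfix_of_mem_pieces hm).subset hd)
    · exact Or.inr ((isInfix_of_mem_pieces hm).subset hd)
  have cases : ∀ i : S.middle Δ γ, ∀ g ∈ i.1,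
      ((S.regions Δ γ).SameComp (o i) g ∧ (S.regions Δ γ).SameComp (c i) (S.opp g)) ∨
      ((S.regions Δ γ).SameComp (c i) g ∧ (S.regions Δ γ).SameComp (o i) (S.opp g)) := by
    intro i g hg
    obtain ⟨a, b, L, R, a', b', L', R', hs, ⟨e1, e2⟩ | ⟨e1, e2⟩, -⟩ := key i
    · exact Or.inl ⟨e1 ▸ hs.left_sameComp hc hg, e2 ▸ hs.right_sameComp hc hg⟩
    · exact Or.inr ⟨e2 ▸ hs.left_sameComp hc hg, e1 ▸ hs.right_sameComp hc hg⟩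
  have mono : ∀ i : S.middle Δ γ, ∀ {x y : D}, (S.regions Δ γ).SameComp x y →
      (S.cut (S.arcSides Δ ∪ S.sides i.1)).SameComp x y := fun i x y hxy =>
    SameComp.cut_mono ((S.oppClosed_arcSides Δ).union (S.oppClosed_sides _))
      (S.oppClosed_union Δ γ) (Set.union_subset_union_right _ (hsub i.1 i.2.1)) hxy
  have hGv : ∀ g ∈ S.sides γ, S.tail g ∈ S.white ∨
      (¬ S.IsMarked (S.tail g) ∧ ¬ S.IsBoundaryVertex (S.tail g)) := fun g hg =>
    (h.path.side_mem hg).imp id fun h' => h.path.inner_interior _ h'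
  refine ⟨o, c, ?_, fun i => ?_⟩
  · refine
    { opp_A := S.oppClosed_arcSides Δ
      opp_G := S.oppClosed_sides γ
      opp_ε := fun i => S.oppClosed_sides _
      ε_sub := fun i => hsub i.1 i.2.1
      disjoint := fun i j hij => ?_
      side := fun i => ?_
      cover := fun g hg => ?_
      disjoint_AG := fun d hd => hc.disjoint hd
      white_free := fun i x hx => ?_
      red := fun i => ?_
      polygon := fun d => ?_
      red_G := fun g hg hr => ?_
      boundary := fun b hb => ?_
      red_boundary := h.marked.red_boundary
      inner := fun d hd hi => ?_ }
    · rw [Set.disjoint_left]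
      have hno : ∀ {x y : D}, x ∈ i.1 → y ∈ j.1 → x ≠ y := fun hx hy e =>
        hij (Subtype.ext (pieces_eq_of_mem hnd i.2.1 j.2.1 hx (e ▸ hy)))
      have hin : ∀ {i : S.middle Δ γ} {x : D}, x ∈ i.1 → x ∈ γ := fun {i x} hx =>
        (isInfix_of_mem_pieces i.2.1).subset hx
      rintro d (hd | hd) (hd' | hd')
      · exact hno hd hd' rfl
      · exact h.path.no_edge_twice _ (hin hd) (hin hd')
      · exact h.path.no_edge_twice _ (hin hd') (hin hd)
      · exact hno hd hd' rfl
    · obtain ⟨a, b, L, R, a', b', L', R', hs, -⟩ := key i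
      rcases cases i b hs.head_mem with ⟨h1, h2⟩ | ⟨h1, h2⟩
      · exact ⟨b, Or.inl hs.head_mem, h1, h2⟩
      · exact ⟨S.opp b, opp_mem_sides_of_mem hs.head_mem, h2, by rwa [S.opp_opp]⟩
    · have hor : ∃ g' ∈ γ, g = g' ∨ g = S.opp g' := by
        rcases hg with hg | hg
        · exact ⟨g, hg, Or.inl rfl⟩
        · exact ⟨_, hg, Or.inr (S.opp_opp g).symm⟩
      obtain ⟨g', hg', hgg⟩ := hor
      obtain ⟨m, hm, hgm⟩ := exists_piece_of_mem (X := S.arcInner Δ) hg'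
      by_cases hmid : m ∈ S.middle Δ γ
      · right
        refine ⟨⟨m, hmid⟩, ?_⟩
        have := cases ⟨m, hmid⟩ g' hgm
        rcases hgg with rfl | rfl
        · exact ⟨Or.inl hgm, this⟩
        · exact ⟨opp_mem_sides_of_mem hgm, by rw [S.opp_opp]; exact this.symm.imp And.symm And.symm⟩
      · left
        obtain ⟨h1, h2⟩ := hc.exists_white_of_notMem_middle hm hmid hgm
        rcases hgg with rfl | rfl
        exacts [h1, h2]
    · obtain ⟨a, b, L, R, a', b', L', R', -, -, d, hd, h1, h2, -⟩ := key i
      exact h2 x ((mono i h1).symm.trans hx)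
    · obtain ⟨a, b, L, R, a', b', L', R', -, -, d, hd, h1, -, h2⟩ := key i
      rw [← h2]
      congr 2
      ext x
      exact and_congr_left fun _ => ⟨fun h' => (mono i h1).symm.trans h', fun h' => (mono i h1).trans h'⟩
    · obtain ⟨v, hv⟩ := Set.ncard_eq_one.1 (h.coord.one_white d)
      have : v ∈ (S.cut (S.arcSides Δ)).tail ''
          {c | (S.cut (S.arcSides Δ)).SameComp d c ∧ S.tail c ∈ S.white} := by rw [hv]; rfl
      obtain ⟨x, hx, -⟩ := this
      exact ⟨x, hx⟩
    · rcases hGv g hg with h' | h'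
      · exact Set.disjoint_left.1 h.marked.disjoint h' hr
      · exact h'.1 (Or.inr hr)
    · refine exists_white_of_boundary h.marked (S.oppClosed_union Δ γ) ?_ hb
      rintro g (hg | hg)
      · exact arcSides_marked hc.sys g hg
      · exact (hGv g hg).imp Or.inl And.right
    · obtain ⟨b, hbt, hb⟩ := hi
      obtain ⟨a, hab⟩ := List.exists_pair_of_mem_tail hbt
      have hbX : S.tail b ∈ S.arcInner Δ := by
        rw [hb]
        refine (hc.sys.tail_mem hd).resolve_left fun h' => ?_
        exact (h.path.inner_interior _ ⟨b, hbt, hb⟩).1 (Or.inr h')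
      obtain ⟨L, R, hcr⟩ := hc.exists_crossing hab hbX
      have uniq : ∀ i : S.middle Δ γ, ∀ {a₁ b₁ L₁ R₁ a₂ b₂ L₂ R₂},
          S.IsSlice Δ γ i.1 a₁ b₁ L₁ R₁ a₂ b₂ L₂ R₂ → (L₂ = o i ∨ L₂ = c i) ∧ (R₁ = o i ∨ R₁ = c i) := by
        intro i a₁ b₁ L₁ R₁ a₂ b₂ L₂ R₂ hs
        obtain ⟨a, b, L, R, a', b', L', R', hs', hoc, -⟩ := key i
        obtain ⟨⟨-, -, -, e4⟩, -, -, e5, -⟩ := hs.unique hc hs'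
        rcases hoc with ⟨h1, h2⟩ | ⟨h1, h2⟩
        · exact ⟨Or.inl (e5.trans h1.symm), Or.inr (e4.trans h2.symm)⟩
        · exact ⟨Or.inr (e5.trans h2.symm), Or.inl (e4.trans h1.symm)⟩
      -- A left side belongs to the piece before its crossing, a right side to the piece after it.
      -- The piece is either between two crossings or brings a `∘`-point into the region.
      rcases hcr.eq_or d hd hb.symm with rfl | rfl
      · rcases h.crossing_left hcr with ⟨m, hm, hmid, ha⟩ | ⟨m, hm, a₁, b₁, L₁, R₁, hs⟩
        · obtain ⟨x, hx, hxw⟩ := (hc.exists_white_of_notMem_middle hm hmid ha).1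
          exact Or.inl ⟨x, (sameComp_of_tail_eq_head hcr.head_left.symm).trans hx, hxw⟩
        · exact Or.inr ⟨⟨m, hm⟩, (uniq ⟨m, hm⟩ hs).1⟩
      · rcases h.crossing_right hcr with ⟨m, hm, hmid, ha⟩ | ⟨m, hm, a₁, b₁, L₁, R₁, hs⟩
        · obtain ⟨x, hx, hxw⟩ := (hc.exists_white_of_notMem_middle hm hmid ha).2
          exact Or.inl ⟨x, (sameComp_of_tail_eq_head hcr.head_right.symm).trans hx, hxw⟩
        · exact Or.inr ⟨⟨m, hm⟩, (uniq ⟨m, hm⟩ hs).2⟩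
  · obtain ⟨a, b, L, R, a', b', L', R', hs, hoc, -⟩ := key i
    exact ⟨a, b, L, R, a', b', L', R', hs, hoc⟩

end ZigzagData

end MarkedCells

/-! ### Counting the regions. -/

theorem Set.injective_and_range_eq_of_ncard {α β : Type*} [Finite α] [Finite β] {f : α → β}
    {s : Set β} (hs : s ⊆ Set.range f) (hc : Nat.card α ≤ s.ncard) :
    Function.Injective f ∧ Set.range f = s := by
  have h1 : (Set.range f).ncard ≤ Nat.card α := by
    rw [← Set.image_univ, ← Set.ncard_univ]
    exact Set.ncard_image_le (Set.toFinite _)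
  have h2 := Set.ncard_le_ncard hs (Set.toFinite _)
  have h3 : Set.range f = s := (Set.eq_of_subset_of_ncard_le hs (h1.trans hc)).symm
  refine ⟨fun a b hab => ?_, h3⟩
  have h4 : (f '' Set.univ).ncard = (Set.univ : Set α).ncard := by
    rw [Set.image_univ, Set.ncard_univ]; omega
  exact (Set.ncard_image_iff (Set.toFinite _)).1 h4 (Set.mem_univ a) (Set.mem_univ b) hab

namespace MarkedCells

open CellSurface

variable {D : Type*} {S : MarkedCells D} {γ : List D} {Δ : Set (List D)}

/-- The number of arcs of a simple coordinate is the rank of the surface. -/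
theorem IsSimpleCoordinate.card_eq_rank [Finite D] (hS : S.IsMarkedSurface)
    (hΔ : S.IsSimpleCoordinate Δ) : (Nat.card Δ : ℤ) = S.rank := by
  classical
  have := Fintype.ofFinite (S.cut (S.arcSides Δ)).Comp
  have h1 := hΔ.pathSystem.euler_cut_of_boundary red_marked hS.red_boundary
  have h2 := sum_euler_comp (S := S.cut (S.arcSides Δ))
  have h3 := sum_ncard_image_comp (S := S.cut (S.arcSides Δ)) (g := (S.cut (S.arcSides Δ)).tail)
    {c | S.tail c ∈ S.white} fun _ _ => sameComp_of_tail_eq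
  have e1 : ∀ q : (S.cut (S.arcSides Δ)).Comp, ∃ d, ∀ c, (S.cut (S.arcSides Δ)).comp c = q ↔
      (S.cut (S.arcSides Δ)).SameComp d c := by
    intro q
    obtain ⟨d, rfl⟩ := comp_surjective q
    exact ⟨d, fun c => by rw [comp_eq_iff]; exact ⟨SameComp.symm, SameComp.symm⟩⟩
  have h4 : ∀ q : (S.cut (S.arcSides Δ)).Comp,
      (S.cut (S.arcSides Δ)).euler {c | (S.cut (S.arcSides Δ)).comp c = q} = 1 := by
    intro q
    obtain ⟨d, hd⟩ := e1 q
    simp only [hd]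
    exact hΔ.polygon d
  have h5 : ∀ q : (S.cut (S.arcSides Δ)).Comp, ((S.cut (S.arcSides Δ)).tail ''
      {c | (S.cut (S.arcSides Δ)).comp c = q ∧ c ∈ {c | S.tail c ∈ S.white}}).ncard = 1 := by
    intro q
    obtain ⟨d, hd⟩ := e1 q
    simp only [hd]
    exact hΔ.one_white d
  -- Both sums now count the parts: their number is the Euler characteristic of the cut surface as
  -- well as the number of `∘`-points.
  simp only [h4, h5, Finset.sum_const, smul_eq_mul, mul_one, nsmul_eq_mul] at h2 h3
  rw [DigonRemoval.white_image hS.disjoint hΔ.pathSystem] at h3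
  rw [rank_eq, ← h3]
  linarith

namespace ZigzagData

variable [Finite D]

/-- There is one more crossing than there are segments between crossings. -/
theorem card_middle (h : ZigzagData S Δ γ) :
    (S.middle Δ γ).ncard + 1 ≤ (S.inner γ ∩ S.arcInner Δ).ncard := by
  have hnd := h.path.nodup white_marked
  -- The last piece also begins with a crossing, as there are at least two pieces; it accounts for
  -- the additional one.
  obtain ⟨m₀, hm₀, hl₀⟩ := exists_piece_of_mem (X := S.arcInner Δ)
    (List.getLast_mem h.path.ne_nil)
  have hh₀ : γ.head h.path.ne_nil ∉ m₀ := fun h' =>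
    pieces_not_both hnd h.path.ne_nil h.zigzag.2.1 hm₀ h' hl₀
  have hnot : m₀ ∉ S.middle Δ γ := fun h' =>
    h'.2.2 _ (List.getLast?_eq_some_getLast h.path.ne_nil) hl₀
  have hfin : (S.middle Δ γ).Finite :=
    (List.finite_toSet (S.pieces (S.arcInner Δ) γ)).subset fun m hm => hm.1
  rw [← Set.ncard_insert_of_notMem hnot hfin]
  have key : ∀ m ∈ insert m₀ (S.middle Δ γ), ∃ hm : m ∈ S.pieces (S.arcInner Δ) γ,
      γ.head h.path.ne_nil ∉ m := by
    rintro m (rfl | hm)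
    · exact ⟨hm₀, hh₀⟩
    · exact ⟨hm.1, hm.2.1 _ (List.head?_eq_some_head h.path.ne_nil)⟩
  have hD : ∀ m : List D, ∀ hm : m ≠ [], m.headD (γ.head h.path.ne_nil) = m.head hm := by
    intro m hm
    cases m with
    | nil => exact absurd rfl hm
    | cons x t => rfl
  -- A piece is sent to the crossing at which it begins; the default value of `headD` is never used.
  refine Set.ncard_le_ncard_of_injOn (fun m => S.tail (m.headD (γ.head h.path.ne_nil)))
    (fun m hm => ?_) (fun m hm m' hm' e => ?_) (Set.toFinite _)
  · obtain ⟨hp, hh⟩ := key m hm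
    obtain ⟨⟨a, ha⟩, hX⟩ := pieces_exists_prev hp h.path.ne_nil hh
    simp only [hD m (pieces_ne_nil hp)]
    exact ⟨CrossingData.inner_of_pair ha, hX⟩
  · obtain ⟨hp, hh⟩ := key m hm
    obtain ⟨hp', hh'⟩ := key m' hm'
    obtain ⟨⟨a, ha⟩, -⟩ := pieces_exists_prev hp h.path.ne_nil hh
    obtain ⟨⟨a', ha'⟩, -⟩ := pieces_exists_prev hp' h.path.ne_nil hh'
    simp only [hD m (pieces_ne_nil hp), hD m' (pieces_ne_nil hp')] at e
    have e' := h.path.tail_unique (List.mem_tail_of_pair ha) (List.mem_tail_of_pair ha') e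
    exact pieces_eq_of_mem hnd hp hp' (List.head_mem (pieces_ne_nil hp))
      (e' ▸ List.head_mem (pieces_ne_nil hp'))

theorem two_le_length (h : ZigzagData S Δ γ) : 2 ≤ γ.length := by
  have := h.card_middle
  obtain ⟨v, ⟨d, hd, -⟩, -⟩ := (Set.ncard_pos (Set.toFinite _)).1
    (show 0 < (S.inner γ ∩ S.arcInner Δ).ncard by omega)
  rcases γ with _ | ⟨a, _ | ⟨b, t⟩⟩
  · simp at hd
  · simp at hd
  · simp

theorem cutAlong_marked (h : ZigzagData S Δ γ) : (S.cutAlong γ).IsMarkedSurface :=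
  cutAlong_isMarkedSurface h.marked h.path h.two_le_length

end ZigzagData

/-- The surface cut along `γ`, cut along the segments. -/
noncomputable abbrev segmentRegions [Finite D] (S : MarkedCells D) (Δ : Set (List D)) (γ : List D) :
    CellSurface (S.kept γ) :=
  (S.cutAlong γ).cut ((S.cutAlong γ).arcSides (S.segments Δ γ))

theorem CrossingData.isContraction [Finite D] (h : CrossingData S Δ γ) :
    IsContraction (S.regions Δ γ) (S.segmentRegions Δ γ) := by
  have := (cutAlong_isContraction h.path).cut (E := S.arcSides Δ) fun d hd => by
    rw [cut_opp_of_notMem (S.oppClosed_sides γ) (h.disjoint hd)]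
    exact S.oppClosed_arcSides Δ d hd
  rw [cut_cut (S.oppClosed_sides γ) (S.oppClosed_arcSides Δ)] at this
  unfold segmentRegions
  rw [h.arcSides_segments]
  exact this

theorem mem_kept_of_white (h : S.IsPath S.white γ) {x : D} (hx : S.tail x ∈ S.white) :
    x ∈ S.kept γ := by
  by_contra hn
  exact Set.disjoint_left.1 (disjoint_inner_white h) (tail_contracted h hn).1 hx

/-- A component of the cut surface contains a `∘`-point if and only if the corresponding region
does. -/
theorem CrossingData.exists_white_iff [Finite D] (h : CrossingData S Δ γ) {d : S.kept γ} :
    (∃ c, (S.segmentRegions Δ γ).SameComp d c ∧ (S.cutAlong γ).tail c ∈ (S.cutAlong γ).white) ↔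
      ∃ x, (S.regions Δ γ).SameComp d x ∧ S.tail x ∈ S.white := by
  constructor
  · rintro ⟨c, hc, hw⟩
    exact ⟨c, h.isContraction.sameComp_iff.1 hc, (tail_mem_white_iff h.path).1 hw⟩
  · rintro ⟨x, hx, hw⟩
    have hk := mem_kept_of_white h.path hw
    exact ⟨⟨x, hk⟩, h.isContraction.sameComp_iff.2 hx, (tail_mem_white_iff h.path).2 hw⟩

/-- The corner that is cut off by each of the segments of `γ` between two crossings, with the sides
`o` inside of it and `c` outside. -/
structure ZigzagCorners (S : MarkedCells D) (Δ : Set (List D)) (γ : List D)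
    (o c : S.middle Δ γ → D) : Prop extends ZigzagData S Δ γ where
  system : CornerSystem S (S.arcSides Δ) (S.sides γ) (S.inner γ) (fun m => S.sides m.1) o c
  slice : ∀ i, ∃ a b L R a' b' L' R', S.IsSlice Δ γ i.1 a b L R a' b' L' R' ∧
    ((o i = L' ∧ c i = R) ∨ (o i = R ∧ c i = L'))

theorem ZigzagData.exists_corners [Finite D] (h : ZigzagData S Δ γ) :
    ∃ o c, ZigzagCorners S Δ γ o c := by
  obtain ⟨o, c, h1, h2⟩ := h.exists_cornerSystem
  exact ⟨o, c, h, h1, h2⟩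

namespace ZigzagCorners

variable {o c : S.middle Δ γ → D}

theorem finite_middle (_h : ZigzagCorners S Δ γ o c) : Finite (S.middle Δ γ) :=
  ((List.finite_toSet (S.pieces (S.arcInner Δ) γ)).subset fun _ hm => hm.1).to_subtype

theorem sides_mem (h : ZigzagCorners S Δ γ o c) (i : S.middle Δ γ) :
    (o i ∈ S.arcSides Δ ∧ S.tail (o i) ∈ S.inner γ) ∧
      (c i ∈ S.arcSides Δ ∧ S.tail (c i) ∈ S.inner γ) := by
  obtain ⟨a, b, L, R, a', b', L', R', hs, hoc⟩ := h.slice i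
  have h1 : L' ∈ S.arcSides Δ ∧ S.tail L' ∈ S.inner γ :=
    ⟨hs.last.left_mem, hs.last.left_tail ▸ hs.last.inner_mem⟩
  have h2 : R ∈ S.arcSides Δ ∧ S.tail R ∈ S.inner γ :=
    ⟨hs.first.right_mem, hs.first.right_tail ▸ hs.first.inner_mem⟩
  rcases hoc with ⟨e1, e2⟩ | ⟨e1, e2⟩ <;> rw [e1, e2]
  exacts [⟨h1, h2⟩, ⟨h2, h1⟩]

theorem inner_kept (h : ZigzagCorners S Δ γ o c) (i : S.middle Δ γ) : o i ∈ S.kept γ :=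
  h.crossing.mem_kept (h.sides_mem i).1.1

theorem outer_kept (h : ZigzagCorners S Δ γ o c) (i : S.middle Δ γ) : c i ∈ S.kept γ :=
  h.crossing.mem_kept (h.sides_mem i).2.1

/-- The two sides of a segment of `γ` belong to the same polygon of `Δ`, which the segment crosses.
-/
theorem sameComp_outer (h : ZigzagCorners S Δ γ o c) (i : S.middle Δ γ) :
    (S.cut (S.arcSides Δ)).SameComp (o i) (c i) := by
  obtain ⟨g, hg, h1, h2⟩ := h.system.side i
  exact ((h.system.mono' h1).trans (cut_sameComp_opp (S.oppClosed_arcSides Δ) fun h' =>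
    h.system.disjoint_AG g h' (h.system.ε_sub i hg))).trans (h.system.mono' h2).symm

theorem eq_of_slice_left (h : ZigzagCorners S Δ γ o c) {i j : S.middle Δ γ}
    {a b L R a' b' L' R' a₁ b₁ L₁ R₁ a₁' b₁' L₁' R₁' : D}
    (hs : S.IsSlice Δ γ i.1 a b L R a' b' L' R')
    (hs' : S.IsSlice Δ γ j.1 a₁ b₁ L₁ R₁ a₁' b₁' L₁' R₁') (e : L' = L₁') : i = j := by
  have e' := (hs.last.eq_of_tail_eq h.path hs'.last
    (by rw [← hs.last.left_tail, ← hs'.last.left_tail, e])).1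
  exact Subtype.ext (pieces_eq_of_mem (h.path.nodup white_marked) hs.piece hs'.piece hs.last_mem
    (e' ▸ hs'.last_mem))

theorem eq_of_slice_right (h : ZigzagCorners S Δ γ o c) {i j : S.middle Δ γ}
    {a b L R a' b' L' R' a₁ b₁ L₁ R₁ a₁' b₁' L₁' R₁' : D}
    (hs : S.IsSlice Δ γ i.1 a b L R a' b' L' R')
    (hs' : S.IsSlice Δ γ j.1 a₁ b₁ L₁ R₁ a₁' b₁' L₁' R₁') (e : R = R₁) : i = j := by
  have e' := (hs.first.eq_of_tail_eq h.path hs'.first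
    (by rw [← hs.first.right_tail, ← hs'.first.right_tail, e])).2.1
  exact Subtype.ext (pieces_eq_of_mem (h.path.nodup white_marked) hs.piece hs'.piece hs.head_mem
    (e' ▸ hs'.head_mem))

/-- Each of them is the left side of a last crossing or the right side of a first one. Sides of
different kind differ; equal ones of the same kind come from the same segment, whose two sides are
of different kind. -/
theorem outer_ne_inner (h : ZigzagCorners S Δ γ o c) (i j : S.middle Δ γ) : c i ≠ o j := by
  intro e
  obtain ⟨a, b, L, R, a', b', L', R', hs, hoc⟩ := h.slice i
  obtain ⟨a₁, b₁, L₁, R₁, a₁', b₁', L₁', R₁', hs', hoc'⟩ := h.slice j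
  have same : i = j → False := by
    rintro rfl
    rcases hoc with ⟨e1, e2⟩ | ⟨e1, e2⟩
    · exact hs.last.left_ne_right h.path hs.first (by rw [← e1, ← e2, e])
    · exact hs.last.left_ne_right h.path hs.first (by rw [← e1, ← e2, e])
  rcases hoc with ⟨-, e1⟩ | ⟨-, e1⟩ <;> rcases hoc' with ⟨e2, -⟩ | ⟨e2, -⟩ <;> rw [e1, e2] at e
  · exact hs'.last.left_ne_right h.path hs.first e.symm
  · exact same (h.eq_of_slice_right hs hs' e)
  · exact same (h.eq_of_slice_left hs hs' e)
  · exact hs.last.left_ne_right h.path hs'.first e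

theorem outer_injective (h : ZigzagCorners S Δ γ o c) : Function.Injective c := by
  intro i j e
  obtain ⟨a, b, L, R, a', b', L', R', hs, hoc⟩ := h.slice i
  obtain ⟨a₁, b₁, L₁, R₁, a₁', b₁', L₁', R₁', hs', hoc'⟩ := h.slice j
  rcases hoc with ⟨-, e1⟩ | ⟨-, e1⟩ <;> rcases hoc' with ⟨-, e2⟩ | ⟨-, e2⟩ <;> rw [e1, e2] at e
  · exact h.eq_of_slice_right hs hs' e
  · exact absurd e.symm (hs'.last.left_ne_right h.path hs.first)
  · exact absurd e (hs.last.left_ne_right h.path hs'.first)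
  · exact h.eq_of_slice_left hs hs' e

variable [Finite D]

/-- Each segment raises the Euler characteristic of the cut surface by one, and there are `|Δ| + N`
segments. That of the cut surface is its number of `∘`-points minus its rank, and this rank is `|Δ|
+ 1`. -/
theorem euler_segmentRegions (h : ZigzagCorners S Δ γ o c) :
    (S.segmentRegions Δ γ).euler Set.univ + 1 =
      ((S.cutAlong γ).white.ncard : ℤ) + (S.inner γ ∩ S.arcInner Δ).ncard := by
  have h1 := h.crossing.segments_pathSystem.euler_cut_of_boundary red_marked
    h.cutAlong_marked.red_boundary
  have h2 := h.coord.card_eq_rank h.marked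
  have h3 := cutAlong_rank h.path
  have h4 := rank_eq (S.cutAlong γ)
  rw [h.crossing.card_segments] at h1
  push_cast at h1
  change (S.segmentRegions Δ γ).euler _ = _ at h1
  linarith

/-- The regions without `∘`-point are those on the inner side of the segments between crossings, and
all regions are discs with at most one `∘`-point. -/
theorem regions_count (h : ZigzagCorners S Δ γ o c) :
    (∀ d, (S.segmentRegions Δ γ).euler {c | (S.segmentRegions Δ γ).SameComp d c} = 1) ∧
    (∀ d, ((S.segmentRegions Δ γ).tail '' {c | (S.segmentRegions Δ γ).SameComp d c ∧
      (S.cutAlong γ).tail c ∈ (S.cutAlong γ).white}).ncard ≤ 1) ∧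
    ({q : (S.segmentRegions Δ γ).Comp | ∀ c, (S.cutAlong γ).tail c ∈ (S.cutAlong γ).white →
      (S.segmentRegions Δ γ).comp c ≠ q}.ncard : ℤ) + (S.cutAlong γ).white.ncard =
        (S.segmentRegions Δ γ).euler Set.univ ∧
    (∀ i j, (S.regions Δ γ).SameComp (o i) (o j) → i = j) ∧
    ∀ i x, (S.regions Δ γ).SameComp (o i) x → S.tail x ∉ S.white := by
  have hfin := h.finite_middle
  have hmid := h.card_middle
  have heu := h.euler_segmentRegions
  set U := S.segmentRegions Δ γ with hU
  set N := (S.inner γ ∩ S.arcInner Δ).ncard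
  have hok : ∀ i, o i ∈ S.kept γ := fun i => h.crossing.mem_kept (h.sides_mem i).1.1
  set wf : Set U.Comp := {q | ∀ c, (S.cutAlong γ).tail c ∈ (S.cutAlong γ).white → U.comp c ≠ q}
  have hsub : wf ⊆ Set.range fun i => U.comp ⟨o i, hok i⟩ := by
    intro q hq
    obtain ⟨d, rfl⟩ := comp_surjective q
    obtain ⟨i, hi⟩ := h.system.exists_inner (r := d) (fun x hx hw => by
      obtain ⟨c, hc, hcw⟩ := h.crossing.exists_white_iff.2 ⟨x, hx, hw⟩
      exact hq c hcw (comp_eq_iff.2 hc.symm))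
    exact ⟨i, comp_eq_iff.2 (h.crossing.isContraction.sameComp_iff.2 hi)⟩
  -- The segments between crossings map onto the regions without `∘`-point, and there is at least
  -- one more crossing than such segments.
  have hle : wf.ncard ≤ N - 1 := by
    refine (Set.ncard_le_ncard hsub (Set.toFinite _)).trans ?_
    rw [← Set.image_univ]
    refine (Set.ncard_image_le (Set.toFinite _)).trans ?_
    rw [Set.ncard_univ, Nat.card_coe_set_eq]
    omega
  have hW := DigonRemoval.white_image h.cutAlong_marked.disjoint h.crossing.segments_pathSystem
  obtain ⟨h1, h2, h3⟩ := euler_eq_one_of_count (S := U)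
    (exists_boundary_cut h.cutAlong_marked.boundary_nonempty ((S.cutAlong γ).oppClosed_arcSides _))
    {c | (S.cutAlong γ).tail c ∈ (S.cutAlong γ).white} (N - 1) hle (by
      rw [hU]
      unfold segmentRegions
      rw [hW]
      change _ ≤ U.euler _
      omega)
  have h3' : wf.ncard = N - 1 := h3
  -- Equality in the count leaves no room for two segments with the same inner region, nor for a
  -- `∘`-point in an inner region.
  obtain ⟨hinj, hrange⟩ := Set.injective_and_range_eq_of_ncard hsub (by
    rw [Nat.card_coe_set_eq]; omega)
  refine ⟨h1, h2, by omega, fun i j hij => ?_, fun i x hx hw => ?_⟩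
  · exact hinj (comp_eq_iff.2 (h.crossing.isContraction.sameComp_iff.2 hij))
  · have : U.comp ⟨o i, hok i⟩ ∈ wf := hrange ▸ ⟨i, rfl⟩
    obtain ⟨c, hc, hcw⟩ := (h.crossing.exists_white_iff (d := ⟨o i, hok i⟩)).2 ⟨x, hx, hw⟩
    exact this c hcw (comp_eq_iff.2 hc.symm)

/-- A region without `∘`-point is the inner region of a segment of `γ`; besides the inner side it
has exactly one end. -/
theorem isDigonSystem (h : ZigzagCorners S Δ γ o c) :
    (S.cutAlong γ).IsDigonSystem (S.segments Δ γ) := by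
  obtain ⟨h1, h2, h3, h4, h5⟩ := h.regions_count
  refine ⟨h.crossing.segments_pathSystem, h1, h2, fun d hd => ?_, h3⟩
  have hwf : ∀ x, (S.regions Δ γ).SameComp d x → S.tail x ∉ S.white := fun x hx hw => by
    obtain ⟨c, hc, hcw⟩ := h.crossing.exists_white_iff.2 ⟨x, hx, hw⟩
    exact hd c hc hcw
  obtain ⟨i, hi⟩ := h.system.exists_inner hwf
  obtain ⟨e, he, hall⟩ := h.system.exists_other_end h4 i (fun j => (h.sides_mem j).2)
    h.outer_ne_inner (fun j hr => (h.path.inner_interior _ (h.sides_mem j).1.2).1 (Or.inr hr)) (h5 i)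
  have he' := (hall e).2 rfl
  have hek : e ∈ S.kept γ := h.crossing.mem_kept he'.1
  have hok : o i ∈ S.kept γ := h.crossing.mem_kept (h.sides_mem i).1.1
  have : {e ∈ (S.cutAlong γ).arcSides (S.segments Δ γ) | (S.cutAlong γ).tail e ∈ (S.cutAlong γ).red ∧
      (S.segmentRegions Δ γ).SameComp d e} = {⟨o i, hok⟩, ⟨e, hek⟩} := by
    ext x
    rw [h.crossing.arcSides_segments]
    simp only [Set.mem_ofPred_eq, Set.mem_insert_iff, Set.mem_singleton_iff,
      tail_mem_red_iff h.path, h.crossing.isContraction.sameComp_iff, Subtype.ext_iff]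
    constructor
    · rintro ⟨hx, hxr, hdx⟩
      by_cases hxo : (x : D) = o i
      · exact Or.inl hxo
      · exact Or.inr ((hall x).1 ⟨hx, hxr, hi.trans hdx, hxo⟩)
    · rintro (e' | e')
      · rw [e']
        exact ⟨(h.sides_mem i).1.1, Or.inr (h.sides_mem i).1.2, hi.symm⟩
      · rw [e']
        exact ⟨he'.1, he'.2.1, hi.symm.trans he'.2.2.1⟩
  change Set.ncard _ = 2
  rw [this]
  exact Set.ncard_pair fun e' => he (congrArg Subtype.val e').symm

end ZigzagCorners

end MarkedCells

/-! ### The correspondence between old and new corners. -/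

/-- Two subsets which become equal after adding to each of them a family of points, with the same
values of `f`, correspond to each other. -/
theorem Set.exists_equiv_of_union_range_eq {V ι Z : Type*} [Finite V] {P Q : Set V}
    {c d : ι → V} (f : V → Z) (hc : Function.Injective c) (hd : Function.Injective d)
    (hcP : ∀ i, c i ∉ P) (hdQ : ∀ i, d i ∉ Q) (hu : P ∪ Set.range c = Q ∪ Set.range d)
    (hf : ∀ i, f (c i) = f (d i)) : ∃ F : P ≃ Q, ∀ x : P, f (F x) = f x := by
  have count : ∀ (P : Set V) (c : ι → V), Function.Injective c → (∀ i, c i ∉ P) → ∀ z,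
      {x ∈ P ∪ Set.range c | f x = z}.ncard = {x ∈ P | f x = z}.ncard + {i | f (c i) = z}.ncard := by
    intro P c hc hcP z
    have e : {x ∈ P ∪ Set.range c | f x = z} = {x ∈ P | f x = z} ∪ c '' {i | f (c i) = z} := by
      ext x
      constructor
      · rintro ⟨hx | ⟨i, rfl⟩, hz⟩
        · exact Or.inl ⟨hx, hz⟩
        · exact Or.inr ⟨i, hz, rfl⟩
      · rintro (⟨hx, hz⟩ | ⟨i, hz, rfl⟩)
        · exact ⟨Or.inl hx, hz⟩
        · exact ⟨Or.inr ⟨i, rfl⟩, hz⟩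
    rw [e, Set.ncard_union_eq _ (Set.toFinite _) (Set.toFinite _), hc.injOn.ncard_image]
    rw [Set.disjoint_left]
    rintro _ ⟨hx, -⟩ ⟨i, -, rfl⟩
    exact hcP i hx
  -- Over each value of `f` the two families have equally many members, so removing them from the
  -- common union leaves fibres of equal size.
  have fib : ∀ z, Nat.card {x : P // f x = z} = Nat.card {x : Q // f x = z} := by
    intro z
    have e : ∀ P : Set V, Nat.card {x : P // f x = z} = {x ∈ P | f x = z}.ncard := fun P => by
      rw [← Nat.card_coe_set_eq]
      exact Nat.card_congr (Equiv.subtypeSubtypeEquivSubtypeInter (· ∈ P) (f · = z))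
    rw [e, e]
    have h1 := count P c hc hcP z
    have h2 := count Q d hd hdQ z
    rw [hu] at h1
    simp only [hf] at h1
    omega
  refine ⟨Equiv.ofFiberEquiv (f := fun x : P => f x) (g := fun x : Q => f x)
    fun z => Classical.choice ((Finite.card_eq).1 (fib z)), fun x => ?_⟩
  exact Equiv.ofFiberEquiv_map (f := fun x : P => f x) (g := fun x : Q => f x) _ x

theorem List.Nodup.pair_ne_getLast {α : Type*} {l : List α} (hl : l.Nodup) (hne : l ≠ []) {a b : α}
    (h : [a, b] <:+: l) : a ≠ l.getLast hne := by
  rintro rfl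
  have := List.mem_dropLast_of_pair h
  rw [← List.dropLast_concat_getLast hne, List.nodup_append] at hl
  exact hl.2.2 _ this _ (by simp) rfl

theorem List.Nodup.pair_ne_head {α : Type*} {l : List α} (hl : l.Nodup) (hne : l ≠ []) {a b : α}
    (h : [a, b] <:+: l) : b ≠ l.head hne := by
  rintro rfl
  have := List.mem_tail_of_pair h
  rw [← List.cons_head_tail hne, List.nodup_cons] at hl
  exact hl.1 this

namespace MarkedCells

open CellSurface

variable {D : Type*} {S : MarkedCells D} {γ : List D} {Δ : Set (List D)}

/-- The arc to which a side belongs. -/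
def arcsAt (Δ : Set (List D)) (S : MarkedCells D) (d : D) : Set (List D) := {l ∈ Δ | d ∈ S.sides l}

theorem PathSystem.arcsAt_eq {ends : Set S.Vertex} (h : S.PathSystem ends Δ) {l : List D}
    (hl : l ∈ Δ) {x y : D} (hx : x ∈ S.sides l) (hy : y ∈ S.sides l) :
    arcsAt Δ S x = arcsAt Δ S y := by
  ext m
  constructor
  · rintro ⟨hm, hxm⟩
    exact ⟨hm, h.eq_of_mem_sides hl hm hx hxm ▸ hy⟩
  · rintro ⟨hm, hym⟩
    exact ⟨hm, h.eq_of_mem_sides hl hm hy hym ▸ hx⟩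

theorem IsCrossing.arcsAt_eq {ends : Set S.Vertex} (h : S.PathSystem ends Δ) {a b L R : D}
    (hc : S.IsCrossing Δ γ a b L R) : arcsAt Δ S L = arcsAt Δ S R := by
  obtain ⟨l, hl, hL⟩ := hc.left_mem
  exact h.arcsAt_eq hl hL (hc.arc l hl hL)

theorem notMem_kept (hγ : S.IsPath S.white γ) {g : D} (hg : g ∈ γ) (h1 : g ≠ γ.head hγ.ne_nil)
    (h2 : g ≠ γ.getLast hγ.ne_nil) : g ∉ S.kept γ ∧ S.opp g ∉ S.kept γ := by
  have := List.mem_tail_dropLast_of_ne hg hγ.ne_nil h1 h2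
  exact ⟨fun h => h (Or.inl this), fun h => h (Or.inr (by rwa [S.opp_opp]))⟩

theorem ends_mem_kept (hγ : S.IsPath S.white γ) :
    γ.head hγ.ne_nil ∈ S.kept γ ∧ S.opp (γ.getLast hγ.ne_nil) ∈ S.kept γ := by
  have hnd := hγ.nodup white_marked
  refine ⟨fun h => ?_, fun h => ?_⟩
  · rcases h with h | h
    · obtain ⟨⟨a, ha⟩, -⟩ := List.exists_pairs_of_mem_tail_dropLast h
      exact hnd.pair_ne_head hγ.ne_nil ha rfl
    · exact hγ.no_edge_twice _ (List.head_mem hγ.ne_nil)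
        (List.mem_of_mem_tail (List.mem_of_mem_dropLast h))
  · rcases h with h | h
    · exact hγ.no_edge_twice _ (List.getLast_mem hγ.ne_nil)
        (List.mem_of_mem_tail (List.mem_of_mem_dropLast h))
    · rw [S.opp_opp] at h
      obtain ⟨-, b, hb⟩ := List.exists_pairs_of_mem_tail_dropLast h
      exact hnd.pair_ne_getLast hγ.ne_nil hb rfl

variable [Finite D]

/-- The next segment at an end point of a segment. -/
abbrev NextSegment (S : MarkedCells D) (Δ : Set (List D)) (γ : List D) (d e : S.kept γ) : Prop :=
  (S.cutAlong γ).NextSide ((S.cutAlong γ).arcSides (S.segments Δ γ)) d e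

namespace CrossingData

theorem nextSegment_iff (h : CrossingData S Δ γ) {d e : S.kept γ} :
    S.NextSegment Δ γ d e ↔ (e : D) ∈ S.arcSides Δ ∧
      h.isContraction.vtx (S.next (S.opp e)) = h.isContraction.vtx d := by
  have h1 : (e : D) ∈ S.arcSides Δ → (S.segmentRegions Δ γ).head ((S.cutAlong γ).opp e) =
      h.isContraction.vtx (S.next (S.opp e)) := by
    intro he
    rw [h.isContraction.head_eq_vtx, h.opp_val he]
    rfl
  have h2 : e ∈ (S.cutAlong γ).arcSides (S.segments Δ γ) ↔ (e : D) ∈ S.arcSides Δ := by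
    rw [h.arcSides_segments]; rfl
  constructor
  · rintro ⟨he, hde⟩
    have he' := h2.1 he
    refine ⟨he', ?_⟩
    rw [← h1 he', h.isContraction.vtx_of_mem]
    exact hde
  · rintro ⟨he, hde⟩
    refine ⟨h2.2 he, ?_⟩
    rw [← h1 he, h.isContraction.vtx_of_mem] at hde
    exact hde

theorem vtx_eq (h : CrossingData S Δ γ) {x y : D}
    (hxy : (S.regions Δ γ).head x = (S.regions Δ γ).tail y) :
    h.isContraction.vtx (S.next x) = h.isContraction.vtx y :=
  h.isContraction.vtx_eq_of_tail_eq hxy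

variable {m : List D}

/-- Between two edges of the piece only edges which are neither the first nor the last of `γ` are
traversed, and these are contracted on the left copy. -/
theorem vtx_left (h : CrossingData S Δ γ) (hm : m ∈ S.pieces (S.arcInner Δ) γ)
    (hn : γ.getLast h.path.ne_nil ∉ m) {g g' : D} (hg : g ∈ m) (hg' : g' ∈ m) :
    h.isContraction.vtx (S.next g) = h.isContraction.vtx (S.next g') := by
  refine List.IsChain.forall_of_equivalence
    (r := fun g g' => h.isContraction.vtx (S.next g) = h.isContraction.vtx (S.next g'))
    ⟨fun _ => rfl, Eq.symm, Eq.trans⟩ ?_ hg hg'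
  rw [List.isChain_iff_forall_rel_of_append_cons_cons]
  intro x y l₁ l₂ e
  have hxy : [x, y] <:+: m := ⟨l₁, l₂, by simp [e]⟩
  obtain ⟨h1, h2⟩ := pieces_pair hm hxy
  have hy : y ∉ S.kept γ := (notMem_kept h.path (h1.subset (by simp))
    ((h.path.nodup white_marked).pair_ne_head h.path.ne_nil h1)
    fun e => hn (e ▸ hxy.subset (by simp))).1
  exact (h.vtx_eq (h.cut_pair h1 h2).1).trans (h.isContraction.vtx_next hy).symm

theorem vtx_right (h : CrossingData S Δ γ) (hm : m ∈ S.pieces (S.arcInner Δ) γ)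
    (hn : γ.head h.path.ne_nil ∉ m) {g g' : D} (hg : g ∈ m) (hg' : g' ∈ m) :
    h.isContraction.vtx (S.next (S.opp g)) = h.isContraction.vtx (S.next (S.opp g')) := by
  refine List.IsChain.forall_of_equivalence
    (r := fun g g' => h.isContraction.vtx (S.next (S.opp g)) =
      h.isContraction.vtx (S.next (S.opp g')))
    ⟨fun _ => rfl, Eq.symm, Eq.trans⟩ ?_ hg hg'
  rw [List.isChain_iff_forall_rel_of_append_cons_cons]
  intro x y l₁ l₂ e
  have hxy : [x, y] <:+: m := ⟨l₁, l₂, by simp [e]⟩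
  obtain ⟨h1, h2⟩ := pieces_pair hm hxy
  have hx : S.opp x ∉ S.kept γ := (notMem_kept h.path (h1.subset (by simp))
    (fun e => hn (e ▸ hxy.subset (by simp)))
    ((h.path.nodup white_marked).pair_ne_getLast h.path.ne_nil h1)).2
  exact (h.isContraction.vtx_next hx).trans (h.vtx_eq (h.cut_pair h1 h2).2).symm

/-- When the segment is contracted, its two crossings on either copy of `γ` are moved together, and
the sides of the two arcs become neighbours at the new `•`-point: on the left `L'` is followed by
`L`, on the right `R` by `R'`. -/
theorem nextSegment_slice (h : CrossingData S Δ γ) (hm : m ∈ S.middle Δ γ)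
    {a b L R a' b' L' R' : D} (hs : S.IsSlice Δ γ m a b L R a' b' L' R') :
    S.NextSegment Δ γ ⟨L', h.mem_kept hs.last.left_mem⟩ ⟨L, h.mem_kept hs.first.left_mem⟩ ∧
    S.NextSegment Δ γ ⟨R, h.mem_kept hs.first.right_mem⟩ ⟨R', h.mem_kept hs.last.right_mem⟩ := by
  have h1 : γ.head h.path.ne_nil ∉ m := hm.2.1 _ (List.head?_eq_some_head h.path.ne_nil)
  have h2 : γ.getLast h.path.ne_nil ∉ m := hm.2.2 _ (List.getLast?_eq_some_getLast h.path.ne_nil)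
  have hk : ∀ g ∈ m, g ∉ S.kept γ ∧ S.opp g ∉ S.kept γ := fun g hg =>
    notMem_kept h.path ((isInfix_of_mem_pieces hm.1).subset hg) (fun e => h1 (e ▸ hg)) (fun e => h2 (e ▸ hg))
  constructor
  · refine h.nextSegment_iff.2 ⟨hs.first.left_mem, ?_⟩
    rw [h.vtx_eq hs.first.head_opp_left, ← h.vtx_eq hs.last.head_left,
      ← h.isContraction.vtx_next (hk b hs.head_mem).1]
    exact h.vtx_left hm.1 h2 hs.head_mem hs.last_mem
  · refine h.nextSegment_iff.2 ⟨hs.last.right_mem, ?_⟩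
    rw [h.vtx_eq hs.last.head_opp_right, ← h.vtx_eq hs.first.head_right,
      ← h.isContraction.vtx_next (hk a' hs.last_mem).2]
    exact h.vtx_right hm.1 h1 hs.last_mem hs.head_mem

/-- A side whose starting point is the end of a boundary side of the cut surface has no next
segment. -/
theorem not_nextSegment (h : CrossingData S Δ γ) {d e g : S.kept γ} (hg : (g : D) ∈ S.sides γ)
    (hd : h.isContraction.vtx (S.next g) = h.isContraction.vtx d) :
    ¬ S.NextSegment Δ γ d e := by
  intro hde
  obtain ⟨he, hde⟩ := h.nextSegment_iff.1 hde
  have hoe : S.opp e ∈ S.arcSides Δ := S.oppClosed_arcSides Δ _ he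
  have h1 : (S.segmentRegions Δ γ).head ⟨S.opp e, h.mem_kept hoe⟩ = (S.segmentRegions Δ γ).head g := by
    rw [h.isContraction.head_eq_vtx, h.isContraction.head_eq_vtx]
    exact hde.trans hd.symm
  have h2 := boundary_head_injective
    (h.isContraction.isBoundarySide_iff.2 (cut_boundary_of_mem (Or.inl hoe)))
    (h.isContraction.isBoundarySide_iff.2 (cut_boundary_of_mem (Or.inr hg))) h1
  have h3 : S.opp e = g := congrArg Subtype.val h2
  exact h.disjoint hoe (by rwa [h3])

/-- The arc `γ` does not touch the old `•`-points, so the rotation about them is unchanged. -/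
theorem nextSegment_of_red (h : CrossingData S Δ γ) {d e : S.kept γ} (hd : S.tail d ∈ S.red) :
    S.NextSegment Δ γ d e ↔ S.NextSide (S.arcSides Δ) d e := by
  classical
  have hdi : S.tail d ∉ S.inner γ := fun h' => (h.path.inner_interior _ h').1 (Or.inr hd)
  have hE := S.oppClosed_union Δ γ
  rw [h.nextSegment_iff]
  refine and_congr_right fun he => ⟨fun hv => ?_, fun hv => ?_⟩
  · have := h.isContraction.eq_of_vtx_eq
      (g := fun c => if S.tail c ∈ S.inner γ then none else some ((S.regions Δ γ).tail c))
      (fun x y e => by rw [tail_eq_of_cut_tail_eq hE e, e])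
      (fun d hd => by
        obtain ⟨h1, h2⟩ := tail_contracted h.path hd
        change (if S.tail (S.next d) ∈ S.inner γ then none else _) = _
        rw [if_pos h1, if_pos h2]) hv
    simp only [hdi, if_false] at this
    split_ifs at this with hi
    exact cut_tail_eq_mono hE (S.oppClosed_arcSides Δ) Set.subset_union_left (Option.some.inj this)
  · have hG : (S.cut (S.arcSides Δ)).OppClosed (S.sides γ) := fun g hg => by
      rw [cut_opp_of_notMem (S.oppClosed_arcSides Δ) fun h' => h.disjoint h' hg]
      exact S.oppClosed_sides γ g hg
    have := cut_tail_eq_of_forall (S := S.cut (S.arcSides Δ)) hG (a := d)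
      (b := S.next (S.opp e)) (fun g hg e' => by
        have e' := tail_eq_of_cut_tail_eq (S.oppClosed_arcSides Δ) e'
        rcases h.path.side_mem hg with h' | h'
        · exact Set.disjoint_left.1 h.white_red h' (e' ▸ hd)
        · exact hdi (e' ▸ h')) hv.symm
    rw [cut_cut (S.oppClosed_arcSides Δ) (S.oppClosed_sides γ), Set.union_comm] at this
    exact h.isContraction.vtx_eq_of_tail_eq this.symm

theorem arcsAt_eq_of_oriented (h : CrossingData S Δ γ) {p : List (S.kept γ)}
    (hp : (S.cutAlong γ).Oriented (S.segments Δ γ) p) {x y : S.kept γ}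
    (hx : x ∈ p ∨ (S.cutAlong γ).opp x ∈ p) (hy : y ∈ p ∨ (S.cutAlong γ).opp y ∈ p) :
    arcsAt Δ S x = arcsAt Δ S y := by
  obtain ⟨t, ht, -, hst⟩ := hp.exists_arc
  obtain ⟨l, hl, -, -, -, hinf⟩ := exists_of_mem_segments ht
  have key : ∀ x : S.kept γ, x ∈ (S.cutAlong γ).sides p → (x : D) ∈ S.sides l := by
    intro x hx
    rw [hst] at hx
    have hA : (x : D) ∈ S.arcSides Δ := by
      have : x ∈ (S.cutAlong γ).arcSides (S.segments Δ γ) := ⟨t, ht, hx⟩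
      rwa [h.arcSides_segments] at this
    rcases hx with hx | hx
    · exact Or.inl (hinf.subset (List.mem_map.2 ⟨x, hx, rfl⟩))
    · exact Or.inr (hinf.subset (List.mem_map.2 ⟨_, hx, h.opp_val hA⟩))
  exact h.sys.arcsAt_eq hl (key x hx) (key y hy)

end CrossingData

end MarkedCells

namespace MarkedCells

open CellSurface

variable {D : Type*} {S : MarkedCells D} {γ : List D} {Δ : Set (List D)} [Finite D]

namespace CrossingData

/-- The two ends of a digon. -/
theorem exists_other_of_digon (h : CrossingData S Δ γ) {p p' : List (S.kept γ)}
    (hp : (S.cutAlong γ).IsDigon (S.segments Δ γ) p p') {r : S.kept γ} (hr : r ∈ p)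
    (hrr : (S.cutAlong γ).tail r ∈ (S.cutAlong γ).red) :
    ∃ d, d ≠ r ∧ d ∈ (S.cutAlong γ).arcSides (S.segments Δ γ) ∧
      (S.cutAlong γ).tail d ∈ (S.cutAlong γ).red ∧ (S.segmentRegions Δ γ).SameComp r d ∧
      (∀ x ∈ (S.cutAlong γ).arcSides (S.segments Δ γ), (S.cutAlong γ).tail x ∈ (S.cutAlong γ).red →
        (S.segmentRegions Δ γ).SameComp r x → x = r ∨ x = d) ∧
      (∃ e, S.NextSegment Δ γ d e ∧ arcsAt Δ S e = arcsAt Δ S r) ∧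
      ∃ e, S.NextSegment Δ γ r e ∧ arcsAt Δ S e = arcsAt Δ S d := by
  have hsys := h.segments_pathSystem
  have hne := (hsys.oriented_path hp.left).ne_nil
  have hne' := (hsys.oriented_path hp.right).ne_nil
  have hrh := hsys.eq_head_of_mem red_marked hp.left hr hrr
  refine ⟨p'.head hne', fun e => ?_, hp.right.mem_arcSides (List.head_mem _),
    (hsys.oriented_path hp.right).head_mem, hp.sameComp r hr _ (List.head_mem _),
    fun x hx hxr hrx => ?_, ⟨_, (hp.symm hsys).next_left_head hsys, ?_⟩,
    ⟨(S.cutAlong γ).opp (p'.getLast hne'), ?_, ?_⟩⟩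
  · exact hp.ne (hsys.oriented_unique hp.left hp.right hr (e ▸ List.head_mem hne'))
  · rcases hp.mem r hr x hx hrx with h' | h'
    · exact Or.inl ((hsys.eq_head_of_mem red_marked hp.left h' hxr).trans hrh.symm)
    · exact Or.inr (hsys.eq_head_of_mem red_marked hp.right h' hxr)
  · exact h.arcsAt_eq_of_oriented hp.left
      (Or.inr (by rw [(S.cutAlong γ).opp_opp]; exact List.getLast_mem hne)) (Or.inl hr)
  · rw [hrh]; exact hp.next_left_head hsys
  · exact h.arcsAt_eq_of_oriented hp.right
      (Or.inr (by rw [(S.cutAlong γ).opp_opp]; exact List.getLast_mem hne'))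
      (Or.inl (List.head_mem hne'))

end CrossingData

/-- The arc of a corner, the arc of the next side, and the polygon. -/
noncomputable def cornerType (S : MarkedCells D) (Δ : Set (List D)) (γ : List D) (d : S.kept γ) :
    Set (List D) × Set (List D) × (S.cut (S.arcSides Δ)).Comp :=
  (arcsAt Δ S d, {l | ∃ e, S.NextSegment Δ γ d e ∧ l ∈ arcsAt Δ S e},
    (S.cut (S.arcSides Δ)).comp d)

theorem cornerType_eq {d e : S.kept γ} (hde : S.NextSegment Δ γ d e) :
    S.cornerType Δ γ d = (arcsAt Δ S d, arcsAt Δ S e, (S.cut (S.arcSides Δ)).comp d) := by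
  unfold cornerType
  congr 2
  ext l
  constructor
  · rintro ⟨e', he', hl⟩
    rwa [hde.right_unique ((S.cutAlong γ).oppClosed_arcSides _) he']
  · exact fun hl => ⟨e, hde, hl⟩

namespace ZigzagCorners

variable {o c : S.middle Δ γ → D}

/-- At a crossing the left and the right side belong to the same arc. So the two new corners at a
segment of `γ` lead from one of the two crossed arcs to the other, in opposite directions. -/
theorem nextSegment (h : ZigzagCorners S Δ γ o c) (i : S.middle Δ γ) :
    ∃ e e' : S.kept γ, S.NextSegment Δ γ ⟨o i, h.inner_kept i⟩ e ∧
      S.NextSegment Δ γ ⟨c i, h.outer_kept i⟩ e' ∧ arcsAt Δ S e = arcsAt Δ S (c i) ∧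
      arcsAt Δ S e' = arcsAt Δ S (o i) := by
  obtain ⟨a, b, L, R, a', b', L', R', hs, hoc⟩ := h.slice i
  obtain ⟨h1, h2⟩ := h.crossing.nextSegment_slice i.2 hs
  have e1 := hs.first.arcsAt_eq h.crossing.sys
  have e2 := hs.last.arcsAt_eq h.crossing.sys
  rcases hoc with ⟨e3, e4⟩ | ⟨e3, e4⟩ <;> simp only [e3, e4]
  · exact ⟨_, _, h1, h2, e1, e2.symm⟩
  · exact ⟨_, _, h2, h1, e2.symm, e1⟩

/-- The ends of the segments which have a next segment. -/
theorem mem_corners_iff (h : ZigzagCorners S Δ γ o c) (x : S.kept γ) :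
    x ∈ (S.cutAlong γ).corners (S.segments Δ γ) ↔
      (x : D) ∈ S.corners Δ ∨ ∃ i, (x : D) = o i ∨ (x : D) = c i := by
  have hc := h.crossing
  have hA : x ∈ (S.cutAlong γ).arcSides (S.segments Δ γ) ↔ (x : D) ∈ S.arcSides Δ := by
    rw [hc.arcSides_segments]; rfl
  constructor
  · rintro ⟨hx, hxr, e, he⟩
    have hx' := hA.1 hx
    rcases (tail_mem_red_iff h.path).1 hxr with hr | hi
    · exact Or.inl ⟨hx', hr, e, (hc.nextSegment_of_red hr).1 he⟩
    · right
      -- Suppose an end at a crossing is not a side of a segment between crossings. A left one then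
      -- lies at the first piece of `γ`, a right one at the last. After the contraction its fan ends
      -- at a kept first or last edge of `γ`, so no segment follows it.
      by_contra! hn
      have hi' := hi
      obtain ⟨b, hbt, hb⟩ := hi
      obtain ⟨a, hab⟩ := List.exists_pair_of_mem_tail hbt
      have hbX : S.tail b ∈ S.arcInner Δ := by
        rw [hb]
        exact (hc.sys.tail_mem hx').resolve_left fun h' =>
          (h.path.inner_interior _ hi').1 (Or.inr h')
      have hnd := h.path.nodup white_marked
      have hslice : ∀ m (hm : m ∈ S.middle Δ γ) {a b L R a' b' L' R' : D},
          S.IsSlice Δ γ m a b L R a' b' L' R' → (x : D) ≠ L' ∧ (x : D) ≠ R := by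
        intro m hm a b L R a' b' L' R' hs
        obtain ⟨a₁, b₁, L₁, R₁, a₁', b₁', L₁', R₁', hs', hoc⟩ := h.slice ⟨m, hm⟩
        obtain ⟨⟨-, -, -, e4⟩, -, -, e5, -⟩ := hs.unique hc hs'
        rw [e4, e5]
        rcases hoc with ⟨h1, h2⟩ | ⟨h1, h2⟩ <;> rw [← h1, ← h2]
        exacts [hn _, (hn _).symm]
      obtain ⟨L, R, hcr⟩ := hc.exists_crossing hab hbX
      obtain ⟨hk1, hk2⟩ := ends_mem_kept h.path
      rcases hcr.eq_or x hx' hb.symm with e' | e'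
      · rcases h.crossing_left hcr with ⟨m, hm, hmid, ha⟩ | ⟨m, hm, a₁, b₁, L₁, R₁, hs⟩
        · have hlast : γ.getLast h.path.ne_nil ∉ m := by
            intro hl
            rcases List.eq_getLast_or_mem_dropLast hl (pieces_ne_nil hm) with h' | h'
            · rw [← pieces_eq_getLast hnd hm hab hbX ha] at h'
              exact hnd.pair_ne_getLast h.path.ne_nil hab h'.symm
            · obtain ⟨y, hy⟩ := List.exists_pair_of_mem_dropLast h'
              exact hnd.pair_ne_getLast h.path.ne_nil (pieces_pair hm hy).1 rfl
          have hhead : γ.head h.path.ne_nil ∈ m := by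
            by_contra hh
            refine hmid ⟨hm, fun d hd => ?_, fun d hd => ?_⟩
            · rw [List.head?_eq_some_head h.path.ne_nil, Option.mem_some_iff] at hd
              exact hd ▸ hh
            · rw [List.getLast?_eq_some_getLast h.path.ne_nil, Option.mem_some_iff] at hd
              exact hd ▸ hlast
          refine hc.not_nextSegment (g := ⟨_, hk1⟩) (mem_sides_of_mem (List.head_mem _)) ?_ he
          rw [e', ← hc.vtx_eq hcr.head_left]
          exact hc.vtx_left hm hlast hhead ha
        · exact (hslice m hm hs).1 e'
      · rcases h.crossing_right hcr with ⟨m, hm, hmid, hbm⟩ | ⟨m, hm, a₁, b₁, L₁, R₁, hs⟩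
        · have hhead : γ.head h.path.ne_nil ∉ m := by
            intro hl
            rcases List.eq_head_or_mem_tail hl (pieces_ne_nil hm) with h' | h'
            · rw [← pieces_eq_head hm hbX hbm] at h'
              exact hnd.pair_ne_head h.path.ne_nil hab h'.symm
            · obtain ⟨y, hy⟩ := List.exists_pair_of_mem_tail h'
              exact hnd.pair_ne_head h.path.ne_nil (pieces_pair hm hy).1 rfl
          have hlast : γ.getLast h.path.ne_nil ∈ m := by
            by_contra hh
            refine hmid ⟨hm, fun d hd => ?_, fun d hd => ?_⟩
            · rw [List.head?_eq_some_head h.path.ne_nil, Option.mem_some_iff] at hd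
              exact hd ▸ hhead
            · rw [List.getLast?_eq_some_getLast h.path.ne_nil, Option.mem_some_iff] at hd
              exact hd ▸ hh
          refine hc.not_nextSegment (g := ⟨_, hk2⟩) (opp_mem_sides_of_mem (List.getLast_mem _)) ?_ he
          rw [e', ← hc.vtx_eq hcr.head_right]
          exact hc.vtx_right hm hhead hlast hbm
        · exact (hslice m hm hs).2 e'
  · rintro (⟨hx, hr, e, he⟩ | ⟨i, hi⟩)
    · exact ⟨hA.2 hx, (tail_mem_red_iff h.path).2 (Or.inl hr), ⟨e, hc.mem_kept he.1⟩,
        (hc.nextSegment_of_red hr).2 he⟩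
    · obtain ⟨e, e', h1, h2, -, -⟩ := h.nextSegment i
      rcases hi with hi | hi
      · have : x = ⟨o i, h.inner_kept i⟩ := Subtype.ext hi
        rw [this] at hA ⊢
        exact ⟨hA.2 (h.sides_mem i).1.1, (tail_mem_red_iff h.path).2 (Or.inr (h.sides_mem i).1.2),
          e, h1⟩
      · have : x = ⟨c i, h.outer_kept i⟩ := Subtype.ext hi
        rw [this] at hA ⊢
        exact ⟨hA.2 (h.sides_mem i).2.1, (tail_mem_red_iff h.path).2 (Or.inr (h.sides_mem i).2.2),
          e', h2⟩

/-- The region of `o i` is a digon; let `d` be its other end. What follows `o i` belongs to the arc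
of `d` by going around the digon, and to the arc of `c i` by the crossing. What follows `d` and what
follows `c i` both belong to the arc of `o i`. All this happens in one polygon, so `c i` and `d`
have the same type. -/
theorem exists_partner (h : ZigzagCorners S Δ γ o c) (i : S.middle Δ γ) :
    ∃ d : S.kept γ, (d : D) ≠ o i ∧ d ∈ (S.cutAlong γ).corners (S.segments Δ γ) ∧
      (S.regions Δ γ).SameComp (o i) d ∧
      (∀ x ∈ (S.cutAlong γ).corners (S.segments Δ γ), (S.regions Δ γ).SameComp (o i) x →
        (x : D) = o i ∨ x = d) ∧
      S.cornerType Δ γ ⟨c i, h.outer_kept i⟩ = S.cornerType Δ γ d := by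
  obtain ⟨-, -, -, -, hwf⟩ := h.regions_count
  set r : S.kept γ := ⟨o i, h.inner_kept i⟩ with hr
  have hrc := (h.mem_corners_iff r).2 (Or.inr ⟨i, Or.inl rfl⟩)
  obtain ⟨p, p', hp, hpr⟩ := h.isDigonSystem.exists_digon h.cutAlong_marked (r := r)
    fun x hx hw => hwf i x (h.crossing.isContraction.sameComp_iff.1 hx)
      ((tail_mem_white_iff h.path).1 hw)
  have hsys := h.crossing.segments_pathSystem
  have hhead := List.head_mem (hsys.oriented_path hp.left).ne_nil
  have key : ∃ q q', (S.cutAlong γ).IsDigon (S.segments Δ γ) q q' ∧ r ∈ q := by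
    rcases hp.mem _ hhead r hrc.1 (hpr _ hhead).symm with h' | h'
    · exact ⟨p, p', hp, h'⟩
    · exact ⟨p', p, hp.symm hsys, h'⟩
  obtain ⟨q, q', hq, hrq⟩ := key
  obtain ⟨d, hne, hdA, hdr, hrd, hall, ⟨e, hde, e1⟩, e', hre, e2⟩ :=
    h.crossing.exists_other_of_digon hq hrq hrc.2.1
  obtain ⟨e₁, e₂, hn1, hn2, e3, e4⟩ := h.nextSegment i
  have hreg : (S.regions Δ γ).SameComp (o i) d := h.crossing.isContraction.sameComp_iff.1 hrd
  refine ⟨d, fun e => hne (Subtype.ext e), ⟨hdA, hdr, e, hde⟩, hreg, fun x hx hox => ?_, ?_⟩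
  · exact (hall x hx.1 hx.2.1 (h.crossing.isContraction.sameComp_iff.2 hox)).imp
      (congrArg Subtype.val) id
  · have e5 : e₁ = e' := hn1.right_unique ((S.cutAlong γ).oppClosed_arcSides _) hre
    rw [cornerType_eq hn2, cornerType_eq hde, e4, e1, ← e3, e5, e2]
    congr 2
    exact comp_eq_iff.2 ((h.sameComp_outer i).symm.trans (h.system.mono' hreg))

/-- The corners of `Δ` correspond to the corners of the segments in the regions of the
`∘`-points. -/
theorem exists_whiteCorners_equiv (h : ZigzagCorners S Δ γ o c) :
    ∃ F : S.corners Δ ≃ (S.cutAlong γ).whiteCorners (S.segments Δ γ), ∀ x : S.corners Δ,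
      S.cornerType Δ γ (F x) = S.cornerType Δ γ ⟨x, h.crossing.mem_kept x.2.1⟩ := by
  obtain ⟨-, -, -, hinj, hwf⟩ := h.regions_count
  choose d hne hdc hdo hall htype using h.exists_partner
  have inner_ne : ∀ {x : D}, x ∈ S.corners Δ → S.tail x ∉ S.inner γ := fun hx h' =>
    (h.path.inner_interior _ h').1 (Or.inr hx.2.1)
  -- The corners of the segments other than the `o i` are, on the one hand, the corners of `Δ` and
  -- the `c i`, and, on the other hand, those in regions with a `∘`-point and the partners `d i`.
  obtain ⟨F, hF⟩ := Set.exists_equiv_of_union_range_eq (P := {x : S.kept γ | (x : D) ∈ S.corners Δ})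
    (Q := (S.cutAlong γ).whiteCorners (S.segments Δ γ)) (c := fun i => ⟨c i, h.outer_kept i⟩) (d := d)
    (S.cornerType Δ γ) (fun i j e => h.outer_injective (congrArg Subtype.val e))
    (fun i j e => hinj i j ((hdo i).trans (e ▸ (hdo j).symm)))
    (fun i hi => inner_ne hi (h.sides_mem i).2.2)
    (fun i hi => by
      obtain ⟨x, hx, hxw⟩ := h.crossing.exists_white_iff.1 hi.2
      exact hwf i x ((hdo i).trans hx) hxw)
    (by
      have key : ∀ x ∈ (S.cutAlong γ).corners (S.segments Δ γ), (∀ i, (x : D) ≠ o i) →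
          x ∈ (S.cutAlong γ).whiteCorners (S.segments Δ γ) ∪ Set.range d := by
        intro x hx hxo
        by_cases hw : ∃ y, (S.regions Δ γ).SameComp x y ∧ S.tail y ∈ S.white
        · exact Or.inl ⟨hx, h.crossing.exists_white_iff.2 hw⟩
        · push Not at hw
          obtain ⟨i, hi⟩ := h.system.exists_inner hw
          exact Or.inr ⟨i, ((hall i x hx hi).resolve_left (hxo i)).symm⟩
      ext x
      constructor
      · rintro (hx | ⟨i, rfl⟩)
        · exact key x ((h.mem_corners_iff x).2 (Or.inl hx)) fun i e =>
            inner_ne hx (e ▸ (h.sides_mem i).1.2)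
        · exact key _ ((h.mem_corners_iff _).2 (Or.inr ⟨i, Or.inr rfl⟩)) (h.outer_ne_inner i)
      · intro hx
        have hx' : x ∈ (S.cutAlong γ).corners (S.segments Δ γ) ∧ ∀ i, (x : D) ≠ o i := by
          rcases hx with hx | ⟨i, rfl⟩
          · refine ⟨hx.1, fun i e => ?_⟩
            obtain ⟨y, hy, hyw⟩ := h.crossing.exists_white_iff.1 hx.2
            exact hwf i y (e ▸ hy) hyw
          · refine ⟨hdc i, fun j e => ?_⟩
            have := hinj i j (e ▸ hdo i)
            subst this
            exact hne i e
        rcases (h.mem_corners_iff x).1 hx'.1 with h' | ⟨i, h' | h'⟩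
        · exact Or.inl h'
        · exact absurd h' (hx'.2 i)
        · exact Or.inr ⟨i, Subtype.ext h'.symm⟩)
    htype
  let G : S.corners Δ ≃ {x : S.kept γ | (x : D) ∈ S.corners Δ} :=
    { toFun := fun x => ⟨⟨x, h.crossing.mem_kept x.2.1⟩, x.2⟩
      invFun := fun x => ⟨x.1, x.2⟩
      left_inv := fun _ => rfl
      right_inv := fun _ => rfl }
  exact ⟨G.trans F, fun x => hF (G x)⟩

end ZigzagCorners

end MarkedCells

/-! ### Conclusion. -/

namespace MarkedCells

open CellSurface

variable {D : Type*} {S : MarkedCells D} {γ : List D} {Δ : Set (List D)}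

theorem IsSimpleCoordinate.tail_eq_of_white [Finite D] (hΔ : S.IsSimpleCoordinate Δ) {x y z : D}
    (hy : (S.cut (S.arcSides Δ)).SameComp x y) (hyw : S.tail y ∈ S.white)
    (hz : (S.cut (S.arcSides Δ)).SameComp x z) (hzw : S.tail z ∈ S.white) : S.tail y = S.tail z := by
  obtain ⟨v, hv⟩ := Set.ncard_eq_one.1 (hΔ.one_white x)
  have key : ∀ y, (S.cut (S.arcSides Δ)).SameComp x y → S.tail y ∈ S.white →
      (S.cut (S.arcSides Δ)).tail y = v := fun y hy hw => by
    have : (S.cut (S.arcSides Δ)).tail y ∈ (S.cut (S.arcSides Δ)).tail ''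
      {c | (S.cut (S.arcSides Δ)).SameComp x c ∧ S.tail c ∈ S.white} := ⟨y, ⟨hy, hw⟩, rfl⟩
    rwa [hv] at this
  exact tail_eq_of_cut_tail_eq (S.oppClosed_arcSides Δ)
    ((key y hy hyw).trans (key z hz hzw).symm)

namespace CrossingData

variable [Finite D]

/-- One segment is chosen from each homotopy class; non-emptiness of the segments is needed for
transitivity. -/
theorem exists_isCutCoordinate (h : CrossingData S Δ γ) : ∃ Δ', S.IsCutCoordinate Δ γ Δ' := by
  have hne : ∀ t ∈ S.segments Δ γ, t ≠ [] := fun t ht => (h.segment_path ht).ne_nil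
  let st : Setoid (S.segments Δ γ) :=
    ⟨fun s t => (S.cutAlong γ).SameArc s t,
      fun s => sameArc_refl (s.1.head (hne s s.2)) _, fun h => h.symm,
      fun {_ t _} h h' => h.trans (hne t t.2) h'⟩
  refine ⟨{t | ∃ q : Quotient st, t = (q.out : List (S.kept γ))}, ?_, ?_⟩
  · rintro t ⟨q, rfl⟩
    exact q.out.2
  · intro l hl s hs
    let s' : S.segments Δ γ := ⟨s, l, hl, hs⟩
    refine ⟨(Quotient.mk st s').out, ⟨⟨_, rfl⟩, ?_⟩, ?_⟩
    · exact SameArc.symm (Quotient.exact (Quotient.out_eq (Quotient.mk st s')))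
    · rintro _ ⟨⟨q, rfl⟩, hq⟩
      have : Quotient.mk st s' = Quotient.mk st q.out := Quotient.sound hq
      rw [Quotient.out_eq] at this
      rw [this]

theorem exists_smoothedOf (h : CrossingData S Δ γ) {l : List D} {y : S.kept γ}
    (hl : l ∈ arcsAt Δ S y) : ∃ t ∈ S.smoothedOf γ l, y ∈ (S.cutAlong γ).sides t := by
  rcases hl with ⟨hl, hy | hy⟩
  · obtain ⟨t, ht, hk, hyt⟩ := h.exists_segment hl hy
    exact ⟨t, ht, Or.inl hyt⟩
  · obtain ⟨t, ht, hk, hyt⟩ := h.exists_segment hl hy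
    refine ⟨t, ht, Or.inr ?_⟩
    have : (S.cutAlong γ).opp y = ⟨S.opp y, hk⟩ :=
      Subtype.ext (h.opp_val ⟨l, hl, Or.inr hy⟩)
    rwa [this]

end CrossingData

variable [Finite D]

/-- The segments form a digon system, which reduces to the given representatives. Corners of `Δ`
correspond to segment corners in regions with a `∘`-point, these to corners of the representatives,
and the type of a corner together with `CornerRel` records source, target and polygon. -/
theorem ZigzagData.exists_equiv (h : ZigzagData S Δ γ) {Δ' : Set (List (S.kept γ))}
    (hΔ' : S.IsCutCoordinate Δ γ Δ') :
    (S.cutAlong γ).IsSimpleCoordinate Δ' ∧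
      ∃ f : S.MinimalIntersection Δ ≃ (S.cutAlong γ).MinimalIntersection Δ',
        ∀ a, S.Induces Δ γ Δ' a (f a) := by
  obtain ⟨o, c, hz⟩ := h.exists_corners
  have hc := h.crossing
  have hT := h.cutAlong_marked
  have hsub : Δ' ⊆ S.segments Δ γ := hΔ'.1
  have hinj : ∀ t ∈ Δ', ∀ t' ∈ Δ', (S.cutAlong γ).SameArc t t' → t = t' := by
    intro t ht t' ht' htt'
    obtain ⟨l, hl, htl⟩ := hΔ'.1 t ht
    exact (hΔ'.2 l hl t htl).unique
      ⟨ht, sameArc_refl (t.head (hc.segment_path (hsub ht)).ne_nil) t⟩ ⟨ht', htt'⟩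
  obtain ⟨hdig, hwhite, f, hf⟩ := IsDigonSystem.reduce hT hinj _ (S.segments Δ γ) hz.isDigonSystem
    hsub (fun s ⟨l, hl, hs⟩ => (hΔ'.2 l hl s hs).exists) rfl
  have hcoord := hdig.isSimpleCoordinate hT.disjoint hwhite
  have hsys := hcoord.pathSystem
  refine ⟨hcoord, ?_⟩
  obtain ⟨e₁, he₁⟩ := exists_minimalIntersection_equiv hc.sys h.marked.red_boundary
  obtain ⟨e₂, he₂⟩ := exists_minimalIntersection_equiv hsys hT.red_boundary
  obtain ⟨F, hF⟩ := hz.exists_whiteCorners_equiv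
  have hcw : (S.cutAlong γ).whiteCorners Δ' = (S.cutAlong γ).corners Δ' :=
    Set.ext fun d => ⟨fun hd => hd.1, fun hd => ⟨hd, hwhite d⟩⟩
  -- After the reduction every part has a `∘`-point, so all corners of `Δ'` are among those that are
  -- transported.
  refine ⟨((e₁.trans F).trans f).trans ((Equiv.setCongr hcw).trans e₂.symm), fun a => ?_⟩
  set a' := (((e₁.trans F).trans f).trans ((Equiv.setCongr hcw).trans e₂.symm)) a with ha'
  have hx := he₁ a
  have hfy := hf (F (e₁ a))
  have hFx := hF (e₁ a)
  set y := F (e₁ a) with hy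
  have hz' : e₂ a' = Equiv.setCongr hcw (f y) := by simp [ha', hy]
  have hz₁ : (f y : S.kept γ) = a'.1.fst := by
    rw [← (he₂ a').1, hz']; rfl
  have hz₂ := (he₂ a').2
  rw [hz₁] at hfy
  obtain ⟨hsrc, htgt, hcomp⟩ := hfy
  have hxA : a.1.fst ∈ S.arcSides Δ := ⟨_, a.1.src.2, a.1.fst_mem⟩
  have hxF : S.cornerType Δ γ y = S.cornerType Δ γ ⟨a.1.fst, hc.mem_kept hxA⟩ := by
    rw [hFx]
    congr 1
    exact Subtype.ext hx.1
  obtain ⟨t1, t23⟩ := Prod.ext_iff.1 hxF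
  obtain ⟨t2, t3⟩ := Prod.ext_iff.1 t23
  simp only [cornerType] at t1 t2 t3
  refine ⟨?_, ?_, fun c c' hac hcw hac' hcw' => ?_⟩
  · have hl : a.1.src.1 ∈ arcsAt Δ S (y : S.kept γ) := by
      rw [t1]; exact ⟨a.1.src.2, a.1.fst_mem⟩
    obtain ⟨t, ht, hyt⟩ := hc.exists_smoothedOf hl
    obtain ⟨m, hm, hzm, htm⟩ := hsrc t ⟨_, a.1.src.2, ht⟩ hyt
    rw [hsys.eq_of_mem_sides hm a'.1.src.2 hzm a'.1.fst_mem] at htm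
    exact ⟨t, ht, htm⟩
  · have htA : a.1.snd ∈ S.arcSides Δ := ⟨_, a.1.tgt.2, a.1.snd_mem⟩
    have hl : a.1.tgt.1 ∈ {l | ∃ e, S.NextSegment Δ γ y e ∧ l ∈ arcsAt Δ S e} := by
      rw [t2]
      exact ⟨⟨a.1.snd, hc.mem_kept htA⟩, (hc.nextSegment_of_red a.1.base).2 hx.2,
        a.1.tgt.2, a.1.snd_mem⟩
    obtain ⟨e, hye, hl⟩ := hl
    obtain ⟨t, ht, het⟩ := hc.exists_smoothedOf hl
    obtain ⟨e', he', m, hm, hem, htm⟩ := htgt e hye t ⟨_, a.1.tgt.2, ht⟩ het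
    rw [he'.right_unique ((S.cutAlong γ).oppClosed_arcSides _) hz₂] at hem
    rw [hsys.eq_of_mem_sides hm a'.1.tgt.2 hem a'.1.snd_mem] at htm
    exact ⟨t, ht, htm⟩
  -- A `∘`-point `w` of the region of the intermediate corner serves for comparison: it lies in the
  -- new polygon, which contains this region, and over the `∘`-point of the old polygon by the last
  -- component of the type.
  · obtain ⟨w, hw, hww⟩ := y.2.2
    have hw' : ((S.cutAlong γ).cut ((S.cutAlong γ).arcSides Δ')).SameComp y w :=
      SameComp.cut_mono ((S.cutAlong γ).oppClosed_arcSides _) ((S.cutAlong γ).oppClosed_arcSides _)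
        (arcSides_mono hsub) hw
    have e1 := hcoord.tail_eq_of_white (hcomp.trans hac') hcw' hw' hww
    have hcw'' := (tail_mem_white_iff h.path).1 hcw'
    have hww' := (tail_mem_white_iff h.path).1 hww
    have e2 := tail_eq_of_cutAlong h.path
      (fun h' => Set.disjoint_left.1 (disjoint_inner_white h.path) h' hcw'') e1
    have e3 : (S.cut (S.arcSides Δ)).SameComp a.1.fst w :=
      (comp_eq_iff.1 t3).symm.trans (SameComp.cut_mono (S.oppClosed_arcSides Δ)
        (S.oppClosed_union Δ γ) Set.subset_union_left (hc.isContraction.sameComp_iff.1 hw))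
    exact e2.trans (h.coord.tail_eq_of_white e3 hww' hac hcw)

end MarkedCells

theorem mainTheorem5 {D : Type*} [Finite D] (S : MarkedCells D) (hS : S.IsMarkedSurface)
    (Δ : Set (List D)) (hΔ : S.IsSimpleCoordinate Δ)
    (γ : List D) (hγ : S.IsSimpleArc S.white γ) (hz : S.IsZigzag Δ γ) :
    (S.cutAlong γ).IsMarkedSurface ∧
    (S.cutAlong γ).rank = S.rank + 1 ∧
    (∃ Δ', S.IsCutCoordinate Δ γ Δ') ∧
    ∀ Δ', S.IsCutCoordinate Δ γ Δ' →
      (S.cutAlong γ).IsSimpleCoordinate Δ' ∧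
      (∃ f : S.MinimalIntersection Δ ≃ (S.cutAlong γ).MinimalIntersection Δ',
        ∀ a, S.Induces Δ γ Δ' a (f a)) ∧
      Nat.card Δ' = Nat.card Δ + 1 ∧
      Nat.card ((S.cutAlong γ).MinimalIntersection Δ') = Nat.card (S.MinimalIntersection Δ) := by
  have h : MarkedCells.ZigzagData S Δ γ := ⟨hS, hΔ, hγ.isPath, hz⟩
  have hrank := MarkedCells.cutAlong_rank h.path
  refine ⟨h.cutAlong_marked, hrank, h.crossing.exists_isCutCoordinate, fun Δ' hΔ' => ?_⟩
  obtain ⟨hcoord, f, hf⟩ := h.exists_equiv hΔ'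
  refine ⟨hcoord, ⟨f, hf⟩, ?_, (Nat.card_congr f).symm⟩
  -- The numbers of arcs are the ranks, which differ by one.
  have h1 := hcoord.card_eq_rank h.cutAlong_marked
  have h2 := hΔ.card_eq_rank hS
  omega
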